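/- **Setting.** A signature of length $N$ is a tuple of integers $\lambda=(\lambda_1\ge\dots\ge\lambda_N)$; $\mathbb{GT}_N$ is the set of all of them, and $s_\lambda(x_1,\dots,x_N)=\det[x_i^{\lambda_j+N-j}]_{i,j=1}^N/\prod_{i<j}(x_i-x_j)$ is the Schur function, a symmetric Laurent polynomial. Write $1^N=(1,\dots,1)$. The Schur generating function of a probability measure $\rho$ on $\mathbb{GT}_N$ is $$S_\rho(x_1,\dots,x_N)=\sum_{\lambda\in\mathbb{GT}_N}\rho(\lambda)\frac{s_\lambda(x_1,\dots,x_N)}{s_\lambda(1^N)};$$ all measures considered are such that this series converges uniformly in a neighborhood of $1^N$. A sequence of symmetric functions $F_N(x_1,\dots,x_N)$, $N\ge1$, is *appropriate* if there are reals $\mathbf c_k$, $\mathbf d_{k,l}$ ($k,l\ge1$) such that: $\log F_N$ is holomorphic near $1^N$ for every $N$; for every fixed index $i$ and every $k\ge1$, $\frac1N\partial_i^k\log F_N(1^N)\to\mathbf c_k$ as $N\to\infty$; for all fixed $i\ne j$ and $k,l\ge1$, $\partial_i^k\partial_j^l\log F_N(1^N)\to\mathbf d_{k,l}$; for all fixed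 $i_1,\dots,i_s$ containing at least three distinct indices, $\partial_{i_1}\cdots\partial_{i_s}\log F_N(1^N)\to0$; and the series $$F(x)=\sum_{k\ge1}\frac{\mathbf c_k}{(k-1)!}(x-1)^{k-1},\qquad G(x,y)=\sum_{k,l\ge1}\frac{\mathbf d_{k,l}}{(k-1)!\,(l-1)!}(x-1)^{k-1}(y-1)^{l-1}$$ converge in neighborhoods of $1$ and $(1,1)$. In this case put $Q(z,w)=G(1+z,1+w)+(z-w)^{-2}$. A sequence of probability measures on $\mathbb{GT}_N$, $N\ge1$, is appropriate if the sequence of its Schur generating functions is. Let $n\ge1$, and let $\{\rho_N\}$, $\{\varrho^{(1)}_N\},\dots,\{\varrho^{(n-1)}_N\}$ be appropriate sequences of probability measures on $\mathbb{GT}_N$. Let $g_r^{(N)}$ be the Schur generating function of $\varrho^{(r)}_N$ and define $\mathrm{st}^{(N)}_{g_r}(\lambda\to\mu)$ by the absolutely convergent expansion $$g_r^{(N)}(\vec x)\,\frac{s_\lambda(\vec x)}{s_\lambda(1^N)}=\sum_{\mu\in\mathbb{GT}_N}\mathrm{st}^{(N)}_{g_r}(\lambda\to\mu)\,\frac{s_\mu(\vec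 x)}{s_\mu(1^N)}$$ (on the torus $|x_1|=\dots=|x_N|=1$). Let $(\lambda^{(1)},\dots,\lambda^{(n)})\in(\mathbb{GT}_N)^n$ be random with $$\mathrm{Prob}(\lambda^{(1)},\dots,\lambda^{(n)})=\rho_N(\lambda^{(n)})\prod_{i=1}^{n-1}\mathrm{st}^{(N)}_{g_i}(\lambda^{(i+1)}\to\lambda^{(i)}),$$ and put $p^{(N)}_{k;s}=\sum_{i=1}^N(\lambda^{(s)}_i+N-i)^k$. Let $H^{(N)}_n=S_{\rho_N}$ and $H^{(N)}_s=H^{(N)}_{s+1}\,g^{(N)}_s$ for $1\le s\le n-1$. **Theorem.** For every $N\ge 1$ the coefficients $\mathrm{st}^{(N)}_{g_r}(\lambda\to\mu)$ exist and are nonnegative, the weights above define a probability measure, and all moments of the $p^{(N)}_{k;s}$ are finite. For every $s$ the sequence $\{H_s^{(N)}\}_{N\ge1}$ is appropriate; let $F_{\rho,(s)}$ and $Q_{\rho,(s)}$ be its limit functions $F$ and $Q$. As $N\to\infty$, the collection $$\Bigl\{N^{-k}\bigl(p^{(N)}_{k;s}-\mathbf E\,p^{(N)}_{k;s}\bigr)\Bigr\}_{k\ge1,\;s=1,\dots,n}$$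 converges in the sense of moments (all joint moments of finitely many of its members converge to those of the limit) to a Gaussian vector with mean zero and covariance $$\lim_{N\to\infty}\frac{\mathrm{cov}\bigl(p^{(N)}_{k_1;s_1},p^{(N)}_{k_2;s_2}\bigr)}{N^{k_1+k_2}}=\frac1{(2\pi\mathbf i)^2}\oint_{|z|=\epsilon}\oint_{|w|=2\epsilon}\Bigl(\frac1z+1+(1+z)F_{\rho,(s_1)}(1+z)\Bigr)^{k_1}\Bigl(\frac1w+1+(1+w)F_{\rho,(s_2)}(1+w)\Bigr)^{k_2}Q_{\rho,(s_2)}(z,w)\,dz\,dw$$ for all $k_1,k_2\ge1$ and $1\le s_1\le s_2\le n$, where the contours are counter-clockwise and $\epsilon>0$ is any sufficiently small number. -/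

import Mathlib

open Filter Topology MeasureTheory ProbabilityTheory

namespace SchurCLT

/-! ### Signatures and Schur functions -/

/-- `Signature N` is the set of non-increasing `N`-tuples of integers. -/
abbrev Signature (N : ℕ) : Type := {l : Fin N → ℤ // Antitone l}

open MvPolynomial in
/-- The Vandermonde polynomial `∏_{i<j} (X_i - X_j)`. -/
noncomputable def vandermondePoly (N : ℕ) : MvPolynomial (Fin N) ℂ :=
  ∏ p ∈ (Finset.univ : Finset (Fin N × Fin N)).filter (fun p => p.1 < p.2), (X p.1 - X p.2)

open MvPolynomial in
/-- The alternating polynomial `det [X_i ^ {a_j}]`. -/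
noncomputable def alternantPoly {N : ℕ} (a : Fin N → ℕ) : MvPolynomial (Fin N) ℂ :=
  (Matrix.of fun i j : Fin N => (X i : MvPolynomial (Fin N) ℂ) ^ a j).det

open MvPolynomial in
theorem irreducible_X_sub_X {N : ℕ} {i j : Fin N} (h : i ≠ j) :
    Irreducible (X i - X j : MvPolynomial (Fin N) ℂ) := by
  have hc : coeff (Finsupp.single i 1) (X i - X j : MvPolynomial (Fin N) ℂ) = 1 := by
    rw [coeff_sub, coeff_X, coeff_X, if_pos rfl, if_neg, sub_zero]
    intro h'
    exact h (Finsupp.single_left_injective one_ne_zero h').symm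
  apply irreducible_of_totalDegree_eq_one
  · apply le_antisymm
    · refine (totalDegree_sub _ _).trans ?_
      simp
    · have : Finsupp.single i 1 ∈ (X i - X j : MvPolynomial (Fin N) ℂ).support := by
        rw [mem_support_iff, hc]; exact one_ne_zero
      have h2 := le_totalDegree this
      simpa using h2
  · intro x hx
    have h2 := hx (Finsupp.single i 1)
    rw [hc] at h2
    exact isUnit_of_dvd_one h2

open MvPolynomial in
theorem vandermondePoly_dvd_alternantPoly {N : ℕ} (a : Fin N → ℕ) :
    vandermondePoly N ∣ alternantPoly a := by
  apply Finset.prod_dvd_of_isRelPrime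
  · rintro ⟨i, j⟩ hij ⟨k, l⟩ hkl hne
    simp only [Finset.coe_filter, Finset.mem_univ, true_and, Set.mem_ofPred_eq] at hij hkl
    refine ((irreducible_X_sub_X hij.ne).isRelPrime_iff_not_dvd).2 ?_
    rintro ⟨q, hq⟩
    have h := congrArg
      (MvPolynomial.eval (fun t : Fin N => if t = i ∨ t = j then (0 : ℂ) else (t : ℕ) + 1)) hq
    simp only [map_sub, map_mul, eval_X, true_or, or_true, if_true, sub_self, zero_mul] at h
    have hpos : ∀ t : Fin N, ((t : ℕ) : ℂ) + 1 ≠ 0 := fun t => Nat.cast_add_one_ne_zero _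
    apply hne
    by_cases hk : k = i ∨ k = j <;> by_cases hl : l = i ∨ l = j
    · rcases hk with rfl | rfl <;> rcases hl with rfl | rfl
      · exact absurd hkl (lt_irrefl _)
      · rfl
      · exact absurd hkl (lt_asymm hij)
      · exact absurd hkl (lt_irrefl _)
    · rw [if_pos hk, if_neg hl, zero_sub, neg_eq_zero] at h
      exact absurd h (hpos l)
    · rw [if_pos hl, if_neg hk, sub_zero] at h
      exact absurd h (hpos k)
    · rw [if_neg hk, if_neg hl, sub_eq_zero, add_left_inj, Nat.cast_inj] at h
      exact absurd (Fin.ext h) hkl.ne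
  · rintro ⟨i, j⟩ hij
    simp only [Finset.mem_filter, Finset.mem_univ, true_and] at hij
    rw [← Ideal.mem_span_singleton, ← Ideal.Quotient.eq_zero_iff_mem, alternantPoly, RingHom.map_det]
    refine Matrix.det_zero_of_row_eq hij.ne ?_
    have hX : Ideal.Quotient.mk (Ideal.span {(X i - X j : MvPolynomial (Fin N) ℂ)}) (X i)
        = Ideal.Quotient.mk _ (X j) :=
      Ideal.Quotient.eq.2 (Ideal.subset_span rfl)
    funext t
    simp [RingHom.mapMatrix_apply, Matrix.map_apply, hX]

/-- The quotient of the alternating polynomial by the Vandermonde polynomial. -/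
noncomputable def schurPoly {N : ℕ} (a : Fin N → ℕ) : MvPolynomial (Fin N) ℂ :=
  (vandermondePoly_dvd_alternantPoly a).choose

theorem vandermondePoly_mul_schurPoly {N : ℕ} (a : Fin N → ℕ) :
    vandermondePoly N * schurPoly a = alternantPoly a :=
  (vandermondePoly_dvd_alternantPoly a).choose_spec.symm

/-- A natural number making all `l_j + shift` nonnegative. -/
def shift {N : ℕ} (l : Signature N) : ℕ := ∑ j, (l.1 j).natAbs

/-- The Schur function `s_l(x_1, …, x_N) = det [x_i ^ (l_j + N - j)] / ∏_{i<j} (x_i - x_j)`,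
a symmetric Laurent polynomial (also defined where some of the `x_i` coincide).
The exponents are first made nonnegative by multiplying with a power of `x_1 ⋯ x_N`;
see `schur_mul_vandermonde` for the defining identity. -/
noncomputable def schur {N : ℕ} (l : Signature N) (x : Fin N → ℂ) : ℂ :=
  (∏ i, x i)⁻¹ ^ shift l *
    MvPolynomial.eval x (schurPoly fun j => (l.1 j + shift l).toNat + (N - 1 - (j : ℕ)))

theorem schur_mul_vandermonde {N : ℕ} (l : Signature N) (x : Fin N → ℂ) (hx : ∀ i, x i ≠ 0) :
    schur l x * ∏ p ∈ (Finset.univ : Finset (Fin N × Fin N)).filter (fun p => p.1 < p.2),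
        (x p.1 - x p.2)
      = (Matrix.of fun i j : Fin N => x i ^ (l.1 j + N - ((j : ℕ) + 1))).det := by
  have h := congrArg (MvPolynomial.eval x) (vandermondePoly_mul_schurPoly
    fun j => (l.1 j + shift l).toNat + (N - 1 - (j : ℕ)))
  simp only [map_mul, vandermondePoly, map_prod, map_sub, MvPolynomial.eval_X, alternantPoly] at h
  rw [schur, mul_assoc, mul_comm (MvPolynomial.eval x _), h, RingHom.map_det, inv_pow,
    ← Finset.prod_pow, ← Finset.prod_inv_distrib, ← Matrix.det_mul_column]
  congr 1
  ext i j
  simp only [Matrix.of_apply, RingHom.mapMatrix_apply, Matrix.map_apply, map_pow,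
    MvPolynomial.eval_X]
  have hle : (l.1 j).natAbs ≤ shift l :=
    Finset.single_le_sum (f := fun j => (l.1 j).natAbs) (fun _ _ => Nat.zero_le _)
      (Finset.mem_univ j)
  have hj := j.2
  rw [← zpow_natCast, ← zpow_natCast, ← zpow_neg, ← zpow_add₀ (hx i)]
  congr 1
  omega

/-- The normalized Schur function `s_l(x) / s_l(1, …, 1)`. -/
noncomputable def normSchur {N : ℕ} (l : Signature N) (x : Fin N → ℂ) : ℂ :=
  schur l x / schur l 1

/-- The Schur generating function `∑_l ρ(l) s_l(x) / s_l(1, …, 1)`. -/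
noncomputable def schurGF {N : ℕ} (ρ : PMF (Signature N)) (x : Fin N → ℂ) : ℂ :=
  ∑' l : Signature N, ((ρ l).toReal : ℂ) * normSchur l x

/-! ### Appropriate sequences -/

/-- The `i`-th coordinate vector of `ℂ^N`, with `i` counted from `0` (zero if `N ≤ i`). -/
def coordVec (N i : ℕ) : Fin N → ℂ := fun j => if (j : ℕ) = i then 1 else 0

/-- The partial derivative `∂_i f`. -/
noncomputable def partialDeriv {N : ℕ} (i : ℕ) (f : (Fin N → ℂ) → ℂ) : (Fin N → ℂ) → ℂ :=
  fun x => fderiv ℂ f x (coordVec N i)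

/-- The iterated partial derivative `∂_{i_1} ⋯ ∂_{i_s} f` for the list `[i_1, …, i_s]`. -/
noncomputable def mixedPartial {N : ℕ} (I : List ℕ) (f : (Fin N → ℂ) → ℂ) :
    (Fin N → ℂ) → ℂ :=
  I.foldr partialDeriv f

/-- The derivative `∂_{i_1} ⋯ ∂_{i_s} log F_N` at `(1, …, 1)`. -/
noncomputable def logCoeff (F : ∀ N : ℕ, (Fin N → ℂ) → ℂ) (I : List ℕ) (N : ℕ) : ℂ :=
  mixedPartial I (fun x => Complex.log (F N x)) 1

/-- The sequence of symmetric functions `F_N` is (CLT-)appropriate, with limiting coefficients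
`c_k` and `d_{k,l}` (`k, l ≥ 1`; the values of `c` and `d` at `0` play no role). The indices of
the variables are fixed while `N → ∞`. -/
structure IsAppropriateWith (F : ∀ N : ℕ, (Fin N → ℂ) → ℂ) (c : ℕ → ℝ) (d : ℕ → ℕ → ℝ) :
    Prop where
  symmetric : ∀ N : ℕ, 1 ≤ N → ∀ (τ : Equiv.Perm (Fin N)) (x : Fin N → ℂ), F N (x ∘ τ) = F N x
  log_holomorphic : ∀ N : ℕ, 1 ≤ N → AnalyticAt ℂ (fun x => Complex.log (F N x)) 1
  tendsto_one : ∀ i k : ℕ, 1 ≤ k →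
    Tendsto (fun N : ℕ => logCoeff F (List.replicate k i) N / (N : ℂ)) atTop (𝓝 (c k : ℂ))
  tendsto_two : ∀ i j k l : ℕ, i ≠ j → 1 ≤ k → 1 ≤ l →
    Tendsto (fun N : ℕ => logCoeff F (List.replicate k i ++ List.replicate l j) N) atTop
      (𝓝 (d k l : ℂ))
  tendsto_three : ∀ I : List ℕ, 3 ≤ I.toFinset.card →
    Tendsto (fun N : ℕ => logCoeff F I N) atTop (𝓝 0)
  summable_one : ∀ᶠ x in 𝓝 (1 : ℂ),
    Summable fun k : ℕ => (c (k + 1) : ℂ) / (k.factorial : ℂ) * (x - 1) ^ k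
  summable_two : ∀ᶠ p in 𝓝 ((1, 1) : ℂ × ℂ), Summable fun q : ℕ × ℕ =>
    (d (q.1 + 1) (q.2 + 1) : ℂ) / ((q.1.factorial : ℂ) * (q.2.factorial : ℂ)) *
      (p.1 - 1) ^ q.1 * (p.2 - 1) ^ q.2

/-- The sequence of probability measures `ρ_N` on signatures of length `N` is
(CLT-)appropriate: the series defining the Schur generating function of each `ρ_N` converges
uniformly in a neighborhood of `(1, …, 1)`, and these functions form an appropriate sequence. -/
def IsAppropriate (ρ : ∀ N : ℕ, PMF (Signature N)) : Prop :=
  (∀ N : ℕ, 1 ≤ N → ∃ U ∈ 𝓝 (1 : Fin N → ℂ),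
    SummableUniformlyOn (fun (l : Signature N) x => ((ρ N l).toReal : ℂ) * normSchur l x) U) ∧
  ∃ c d, IsAppropriateWith (fun N => schurGF (ρ N)) c d

/-- `F(x) = ∑_{k ≥ 1} c_k / (k-1)! (x - 1)^(k-1)`. -/
noncomputable def limitF (c : ℕ → ℝ) (x : ℂ) : ℂ :=
  ∑' k : ℕ, (c (k + 1) : ℂ) / (k.factorial : ℂ) * (x - 1) ^ k

/-- `G(x, y) = ∑_{k, l ≥ 1} d_{k,l} / ((k-1)! (l-1)!) (x - 1)^(k-1) (y - 1)^(l-1)`. -/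
noncomputable def limitG (d : ℕ → ℕ → ℝ) (x y : ℂ) : ℂ :=
  ∑' q : ℕ × ℕ, (d (q.1 + 1) (q.2 + 1) : ℂ) / ((q.1.factorial : ℂ) * (q.2.factorial : ℂ)) *
    (x - 1) ^ q.1 * (y - 1) ^ q.2

/-- `Q(z, w) = G(1 + z, 1 + w) + 1 / (z - w)^2`. -/
noncomputable def limitQ (d : ℕ → ℕ → ℝ) (z w : ℂ) : ℂ :=
  limitG d (1 + z) (1 + w) + 1 / (z - w) ^ 2

/-- The double contour integral over `|z| = ε`, `|w| = 2ε`, with the functions `F₁`, `F₂`, `Q`. -/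
noncomputable def contourCov (F₁ F₂ : ℂ → ℂ) (Q : ℂ → ℂ → ℂ) (k₁ k₂ : ℕ) (ε : ℝ) : ℂ :=
  1 / (2 * Real.pi * Complex.I) ^ 2 *
    ∮ z in C(0, ε), ∮ w in C(0, 2 * ε),
      (1 / z + 1 + (1 + z) * F₁ (1 + z)) ^ k₁ * (1 / w + 1 + (1 + w) * F₂ (1 + w)) ^ k₂ * Q z w

/-! ### The Markov chain -/

/-- `st` is the family of coefficients of the absolutely convergent expansion of
`g(x) s_l(x) / s_l(1, …, 1)` in normalized Schur functions, `g` being the Schur generating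
function of `σ`. The expansion is required on the torus, which determines `st` uniquely. -/
def IsTransition {N : ℕ} (σ : PMF (Signature N)) (l : Signature N) (st : Signature N → ℝ) :
    Prop :=
  ∀ x : Fin N → ℂ, (∀ i, ‖x i‖ = 1) →
    HasSum (fun u : Signature N => (st u : ℂ) * normSchur u x) (schurGF σ x * normSchur l x)

/-- The transition probability `st_g(l → u)`: the `u`-th coefficient in the expansion of
`g(x) s_l(x) / s_l(1, …, 1)` in normalized Schur functions. -/
noncomputable def transition {N : ℕ} (σ : PMF (Signature N)) (l : Signature N) :
    Signature N → ℝ :=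
  Classical.epsilon (IsTransition σ l)

/-- The weight `ρ(λ^(n)) ∏_{i=1}^{n-1} st_{g_i}(λ^(i+1) → λ^(i))` of a trajectory, where
`n = m + 1` and the levels `1, …, n` are numbered `0, …, m`. -/
noncomputable def chainWeight {N m : ℕ} (ρ : PMF (Signature N)) (σ : Fin m → PMF (Signature N))
    (l : Fin (m + 1) → Signature N) : ℝ :=
  (ρ (l (Fin.last m))).toReal * ∏ r : Fin m, transition (σ r) (l r.succ) (l r.castSucc)

/-- The joint law of the signatures on all levels. -/
noncomputable def chainMeasure {N m : ℕ} (ρ : PMF (Signature N)) (σ : Fin m → PMF (Signature N)) :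
    Measure (Fin (m + 1) → Signature N) :=
  Measure.sum fun l => ENNReal.ofReal (chainWeight ρ σ l) • Measure.dirac l

/-- `H_s = S_ρ ∏_{r ≥ s} g_r`, that is, `H_n = S_ρ` and `H_s = H_{s+1} g_s`. -/
noncomputable def levelGF {m : ℕ} (ρ : ∀ N : ℕ, PMF (Signature N))
    (σ : Fin m → ∀ N : ℕ, PMF (Signature N)) (s : Fin (m + 1)) (N : ℕ) (x : Fin N → ℂ) : ℂ :=
  schurGF (ρ N) x * ∏ r : Fin m with s ≤ r.castSucc, schurGF (σ r N) x

/-- The shifted power sum `p_{k;s} = ∑_{i=1}^N (λ_i^(s) + N - i)^k`. -/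
def powerSum {N m : ℕ} (k : ℕ) (s : Fin (m + 1)) (l : Fin (m + 1) → Signature N) : ℝ :=
  ∑ i : Fin N, (((l s).1 i : ℝ) + N - ((i : ℕ) + 1)) ^ k

/-- The random variable `N^(-k) (p_{k;s} - E p_{k;s})`, for `a = (k, s)`. -/
noncomputable def fluctuation {N m : ℕ} (P : Measure (Fin (m + 1) → Signature N))
    (a : ℕ+ × Fin (m + 1)) (l : Fin (m + 1) → Signature N) : ℝ :=
  (powerSum a.1 a.2 l - ∫ l', powerSum a.1 a.2 l' ∂P) / (N : ℝ) ^ (a.1 : ℕ)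

/-! ### Convergence in the sense of moments -/

/-- The random variables `ξ_N(a)`, `a ∈ T`, defined on the probability spaces `(Ω_N, P_N)`,
converge as `N → ∞`, in the sense of moments, to the centered Gaussian vector
indexed by `T` with covariance `C`: for every finite `J ⊆ T` there is a centered Gaussian measure
on `ℝ^J` with covariance `C`, and all joint moments of `ξ_N(a)`, `a ∈ J`, converge to its
moments. -/
def TendstoGaussianInMoments {T : Type*} {Ω : ℕ → Type*} [∀ N, MeasurableSpace (Ω N)]
    (P : ∀ N, Measure (Ω N)) (ξ : ∀ N, T → Ω N → ℝ) (C : T → T → ℝ) : Prop :=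
  ∀ J : Finset T, ∃ γ : Measure (J → ℝ), IsGaussian γ ∧
    (∀ a : J, ∫ y, y a ∂γ = 0) ∧
    (∀ a b : J, cov[fun y => y a, fun y => y b; γ] = C a b) ∧
    ∀ α : J → ℕ, Tendsto (fun N => ∫ ω, ∏ a : J, ξ N a ω ^ α a ∂(P N)) atTop
      (𝓝 (∫ y, ∏ a : J, y a ^ α a ∂γ))

end SchurCLT

open SchurCLT

/-! Let V be the Vandermonde product. The numerator V·s_λ is an alternating sum of monomials whose
exponents are the permutations of (λ_i + N − i), so V·s_λ is an eigenfunction of D_k = Σ_i (x_i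
∂_i)^k with eigenvalue Σ_i (λ_i + N − i)^k. Passing from level s+1 to level s multiplies the
generating function of a weight by g_s (`genFn_pushWeight`). Hence a joint moment of the p_{k;s} is
the value at 1^N of the function obtained from the top generating function by applying V⁻¹ D_k V
once for every factor p_{k;s} and multiplying by g_s between the levels.

Two preparations make this rigorous. A product of two Schur functions is a nonnegative combination
of Schur functions; this follows from Bender–Knuth toggles and a sign-reversing involution
(`alternantPoly_mul_gtSum_eq_sum_good`) and yields nonnegative transition coefficients, which
`expansion_unique` shows to be the only ones. Convergence near 1^N forces exponential moments
(`expSummable_of_summable`), which justify every interchange of sums and derivatives.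

As V vanishes at 1^N, values are read off from jets: the jet of V·f of order deg V + 1 determines
f(1^N) (`eq_of_jetEq_vander_mul`). Up to such jets, each symmetric function involved is h·exp(L)
with h and L polynomials in the power sums of y_i = x_i − 1 (`jetEq_jetSym`). The sums Σ_i y_i^b
∂_i^s V / V are polynomials in the power sums as well (`sum_recipElem`), so V⁻¹ D_k V becomes an
explicit operator `powOp` acting on h (`jetEq_powOp`). The outcome is an exact formula for fixed N:
a moment is the constant coefficient of a product of such operators applied to 1
(`integral_chainMeasure_levelFn`).

Now let N grow. The derivatives of L in the power sums have constant terms of order N, while their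
nonconstant parts converge to linear forms (`logAsymp_jetSym`). Therefore `powOp` equals N^(k+1)
(y_N + Ξ_N / N) with scalars y_N and convergent operators Ξ_N (`dualTendsto_powOp`). Centring
removes the scalar and division by N^k leaves the limit Ξ, which is multiplication by a linear form
plus a derivation with constant coefficients. Commutators of such derivations with multiplications
by linear forms are scalars, so the constant coefficient of a product of operators Ξ applied to 1 is
a sum over pairings (`constantCoeff_foldr_limOp`). Operators of lower levels stand further to the
left; this is why the covariance formula is for s₁ ≤ s₂ and involves Q of level s₂.

Sums over pairings are the moments of a Gaussian vector (`exists_gaussian_wick`), positive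
semidefiniteness being inherited from the covariances before the limit. The commutator is a finite
sum of products of power series coefficients (`covCoeff`). It is the double residue in the theorem:
1/(z − w)² = Σ_j (j + 1) z^j w^(−j−2) for |z| < |w| accounts for one part and G for the other
(`covCoeff_eq_contourCov`). -/

namespace SchurCLT

/-! ### Gelfand–Tsetlin patterns -/

/-- Gelfand–Tsetlin patterns with `N` letters and top row `ν`. -/
structure IsGT (N : ℕ) (ν : ℕ → ℕ) (T : ℕ → ℕ → ℕ) : Prop where
  zero : ∀ i, T 0 i = 0
  top : ∀ k, N ≤ k → ∀ i, T k i = ν i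
  up : ∀ k i, T k i ≤ T (k + 1) i
  down : ∀ k i, T (k + 1) (i + 1) ≤ T k i

namespace IsGT

variable {N : ℕ} {ν : ℕ → ℕ} {T : ℕ → ℕ → ℕ}

theorem eq_zero (h : IsGT N ν T) : ∀ k i, k ≤ i → T k i = 0
  | 0, i, _ => h.zero i
  | k + 1, 0, hk => by omega
  | k + 1, i + 1, hk => by
    have h1 := h.down k i
    have h2 := h.eq_zero k i (by omega)
    omega

theorem le_top (h : IsGT N ν T) (k i : ℕ) : T k i ≤ ν i := by
  rcases le_total N k with hk | hk
  · exact (h.top k hk i).le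
  · rw [← h.top N le_rfl i]
    exact monotone_nat_of_le_succ (f := fun k => T k i) (fun k => h.up k i) hk

theorem nu_anti (h : IsGT N ν T) : Antitone ν := by
  apply antitone_nat_of_succ_le
  intro i
  have := h.down N i
  rwa [h.top N le_rfl, h.top (N + 1) (by omega)] at this

end IsGT

theorem finite_isGT (N : ℕ) (ν : ℕ → ℕ) : {T | IsGT N ν T}.Finite := by
  refine Set.Finite.of_injOn (f := fun T (p : Fin N × Fin N) => T p.1 p.2)
    (t := Set.Iic fun p : Fin N × Fin N => ν p.2) ?_ ?_ (Set.finite_Iic _)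
  · intro T hT p
    exact IsGT.le_top hT _ _
  · intro T hT T' hT' heq
    funext k i
    by_cases hk : N ≤ k
    · rw [hT.top k hk, hT'.top k hk]
    by_cases hi : k ≤ i
    · rw [hT.eq_zero k i hi, hT'.eq_zero k i hi]
    · exact congrFun heq (⟨k, by omega⟩, ⟨i, by omega⟩)

/-- The finite set of Gelfand–Tsetlin patterns. -/
noncomputable def gtSet (N : ℕ) (ν : ℕ → ℕ) : Finset (ℕ → ℕ → ℕ) := (finite_isGT N ν).toFinset

theorem mem_gtSet {N : ℕ} {ν : ℕ → ℕ} {T : ℕ → ℕ → ℕ} : T ∈ gtSet N ν ↔ IsGT N ν T := by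
  simp [gtSet]

/-- Rows from N on are forced by ν and the entries on or right of the diagonal vanish, so N² entries
between 0 and ν 0 determine a pattern. A polynomial bound of the dimension is enough, since it will
be absorbed by exponential factors. -/
theorem card_gtSet_le (N : ℕ) {ν : ℕ → ℕ} (hν : Antitone ν) :
    (gtSet N ν).card ≤ (ν 0 + 1) ^ (N * N) := by
  have h : (gtSet N ν).card ≤ (Finset.univ : Finset (Fin N × Fin N → Fin (ν 0 + 1))).card := by
    refine Finset.card_le_card_of_injOn
      (fun T (p : Fin N × Fin N) => Fin.ofNat (ν 0 + 1) (T p.1 p.2)) (fun _ _ => by simp) ?_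
    intro T hT T' hT' heq
    rw [Finset.mem_coe, mem_gtSet] at hT hT'
    funext k i
    by_cases hk : N ≤ k
    · rw [hT.top k hk, hT'.top k hk]
    by_cases hi : k ≤ i
    · rw [hT.eq_zero k i hi, hT'.eq_zero k i hi]
    · have h1 := congrArg Fin.val (congrFun heq (⟨k, by omega⟩, ⟨i, by omega⟩))
      have h2 := (hT.le_top k i).trans (hν (Nat.zero_le i))
      have h3 := (hT'.le_top k i).trans (hν (Nat.zero_le i))
      simp only [Fin.ofNat] at h1
      rwa [Nat.mod_eq_of_lt (by omega), Nat.mod_eq_of_lt (by omega)] at h1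
  simpa using h

/-- The number of letters `k` (with letters counted from `0`). -/
def gtWeight (N : ℕ) (T : ℕ → ℕ → ℕ) (k : ℕ) : ℕ :=
  ∑ i ∈ Finset.range N, (T (k + 1) i - T k i)

/-- The number of letters `k` in the columns with index `> c`. -/
def gtOver (N c : ℕ) (T : ℕ → ℕ → ℕ) (k : ℕ) : ℤ :=
  ∑ i ∈ Finset.range N, ((T (k + 1) i - c : ℕ) : ℤ) - ∑ i ∈ Finset.range N, ((T k i - c : ℕ) : ℤ)

/-- The number of letters `k` in the columns with index `≤ c`. -/
def gtUnder (N c : ℕ) (T : ℕ → ℕ → ℕ) (k : ℕ) : ℤ :=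
  ∑ i ∈ Finset.range N, ((min (T (k + 1) i) c : ℕ) : ℤ) -
    ∑ i ∈ Finset.range N, ((min (T k i) c : ℕ) : ℤ)

theorem gtWeight_eq {N : ℕ} {ν : ℕ → ℕ} {T : ℕ → ℕ → ℕ} (h : IsGT N ν T) (c k : ℕ) :
    (gtWeight N T k : ℤ) = gtUnder N c T k + gtOver N c T k := by
  simp only [gtWeight, gtUnder, gtOver, Nat.cast_sum]
  rw [← Finset.sum_sub_distrib, ← Finset.sum_sub_distrib, ← Finset.sum_add_distrib]
  refine Finset.sum_congr rfl fun i _ => ?_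
  have := h.up k i
  omega

/-! ### Bender–Knuth toggles restricted to the first columns -/

/-- The Bender–Knuth involution on the row `k + 1`, acting on the columns with index `≤ c`. -/
def gtToggle (k c : ℕ) (T : ℕ → ℕ → ℕ) : ℕ → ℕ → ℕ :=
  Function.update T (k + 1) fun i =>
    if c < T (k + 1) i then T (k + 1) i else
      min (min (T (k + 2) i) (if i = 0 then T (k + 2) 0 else T k (i - 1))) c +
        max (T (k + 2) (i + 1)) (T k i) - T (k + 1) i

section toggle

variable {N : ℕ} {ν : ℕ → ℕ} {T : ℕ → ℕ → ℕ} (k c : ℕ)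

theorem gtToggle_of_ne {j : ℕ} (hj : j ≠ k + 1) : gtToggle k c T j = T j :=
  Function.update_of_ne hj _ _

theorem gtToggle_apply (i : ℕ) : gtToggle k c T (k + 1) i =
    if c < T (k + 1) i then T (k + 1) i else
      min (min (T (k + 2) i) (if i = 0 then T (k + 2) 0 else T k (i - 1))) c +
        max (T (k + 2) (i + 1)) (T k i) - T (k + 1) i := by
  rw [gtToggle, Function.update_self]

/-- Together with `IsGT.upper`: once the rows k and k + 2 are fixed, interlacing confines each entry
of row k + 1 to an interval, and the toggle reflects the entry in this interval, cut off at c. For i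
= 0 there is no left neighbour, so T (k + 2) 0 stands in for it. -/
theorem IsGT.lower (h : IsGT N ν T) (i : ℕ) :
    max (T (k + 2) (i + 1)) (T k i) ≤ T (k + 1) i :=
  max_le (h.down _ _) (h.up _ _)

theorem IsGT.upper (h : IsGT N ν T) (i : ℕ) :
    T (k + 1) i ≤ min (T (k + 2) i) (if i = 0 then T (k + 2) 0 else T k (i - 1)) := by
  rcases i with _ | i
  · simpa using h.up (k + 1) 0
  · simpa using ⟨h.up (k + 1) (i + 1), h.down k i⟩

theorem gtToggle_lower (h : IsGT N ν T) (i : ℕ) :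
    max (T (k + 2) (i + 1)) (T k i) ≤ gtToggle k c T (k + 1) i := by
  have h1 := h.lower k i
  have h2 := h.upper k i
  rw [gtToggle_apply]
  split_ifs at * <;> omega

theorem gtToggle_upper (h : IsGT N ν T) (i : ℕ) :
    gtToggle k c T (k + 1) i ≤
      min (T (k + 2) i) (if i = 0 then T (k + 2) 0 else T k (i - 1)) := by
  have h1 := h.lower k i
  have h2 := h.upper k i
  rw [gtToggle_apply]
  split_ifs at * <;> omega

theorem IsGT.toggle (h : IsGT N ν T) (hk : k + 1 < N) : IsGT N ν (gtToggle k c T) where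
  zero i := by rw [gtToggle_of_ne _ _ (by omega)]; exact h.zero i
  top j hj i := by rw [gtToggle_of_ne _ _ (by omega)]; exact h.top j hj i
  up j i := by
    by_cases h1 : j = k + 1
    · subst h1
      rw [gtToggle_of_ne k c (show k + 1 + 1 ≠ k + 1 by omega)]
      exact (gtToggle_upper k c h i).trans (min_le_left _ _)
    by_cases h2 : j = k
    · subst h2
      rw [gtToggle_of_ne j c (show j ≠ j + 1 by omega)]
      exact (le_max_right _ _).trans (gtToggle_lower j c h i)
    · rw [gtToggle_of_ne k c h1, gtToggle_of_ne k c (by omega)]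
      exact h.up j i
  down j i := by
    by_cases h1 : j = k + 1
    · subst h1
      rw [gtToggle_of_ne k c (show k + 1 + 1 ≠ k + 1 by omega)]
      exact (le_max_left _ _).trans (gtToggle_lower k c h i)
    by_cases h2 : j = k
    · subst h2
      rw [gtToggle_of_ne j c (show j ≠ j + 1 by omega)]
      exact (gtToggle_upper j c h (i + 1)).trans (by simp)
    · rw [gtToggle_of_ne k c h1, gtToggle_of_ne k c (by omega)]
      exact h.down j i

theorem gtToggle_gtToggle (h : IsGT N ν T) : gtToggle k c (gtToggle k c T) = T := by
  funext j i
  by_cases hj : j = k + 1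
  · subst hj
    have h1 := h.lower k i
    have h2 := h.upper k i
    rw [gtToggle_apply, gtToggle_of_ne k c (show k + 2 ≠ k + 1 by omega),
      gtToggle_of_ne k c (show k ≠ k + 1 by omega), gtToggle_apply]
    split_ifs at * <;> omega
  · rw [gtToggle_of_ne k c hj, gtToggle_of_ne k c hj]

/-- Entries above c are left alone and the other entries stay at most c, so nothing happens in the
columns beyond c. -/
theorem gtToggle_sub (h : IsGT N ν T) {c' : ℕ} (hc : c ≤ c') (j i : ℕ) :
    gtToggle k c T j i - c' = T j i - c' := by
  by_cases hj : j = k + 1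
  · subst hj
    have h1 := h.lower k i
    have h2 := h.upper k i
    rw [gtToggle_apply]
    split_ifs at * <;> omega
  · rw [gtToggle_of_ne k c hj]

theorem gtOver_gtToggle (h : IsGT N ν T) {c' : ℕ} (hc : c ≤ c') :
    gtOver N c' (gtToggle k c T) = gtOver N c' T := by
  funext j
  simp only [gtOver, gtToggle_sub k c h hc]

/-- Pair the maximum of a (i + 1) and b i with their minimum, which is the next term of the second
sum. -/
theorem sum_min_max (a b : ℕ → ℕ) (n : ℕ) :
    ∑ i ∈ Finset.range n, max (a (i + 1)) (b i) +
      ∑ i ∈ Finset.range (n + 1), min (a i) (if i = 0 then a 0 else b (i - 1)) =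
    ∑ i ∈ Finset.range (n + 1), a i + ∑ i ∈ Finset.range n, b i := by
  induction n with
  | zero => simp
  | succ n ih =>
    rw [Finset.sum_range_succ _ n, Finset.sum_range_succ _ (n + 1), Finset.sum_range_succ a,
      Finset.sum_range_succ b]
    simp only [Nat.add_eq_zero_iff, one_ne_zero, and_false, if_false, Nat.add_sub_cancel]
    omega

/-- The hypothesis `hc` says that column c + 1 contains no letter k. If an entry of row k + 1
exceeds c, then so do T k i and all the upper bounds, and both sides equal 2c; otherwise the entry
is reflected. Without `hc` an entry above c could stand over a shorter row, and its truncation would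
not be reflected. -/
theorem min_gtToggle_add (h : IsGT N ν T) (hc : ∀ i, c < T (k + 1) i → c < T k i) (i : ℕ) :
    min (gtToggle k c T (k + 1) i) c + min (T (k + 1) i) c =
      max (min (T (k + 2) (i + 1)) c) (min (T k i) c) +
        min (min (T (k + 2) i) c) (if i = 0 then min (T (k + 2) 0) c else min (T k (i - 1)) c) := by
  have h1 := h.lower k i
  have h2 := h.upper k i
  have h3 := hc i
  rw [gtToggle_apply]
  have h4 : (if i = 0 then min (T (k + 2) 0) c else min (T k (i - 1)) c) =
      min (if i = 0 then T (k + 2) 0 else T k (i - 1)) c := by split_ifs <;> rfl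
  rw [h4]
  generalize (if i = 0 then T (k + 2) 0 else T k (i - 1)) = w at *
  generalize T (k + 2) (i + 1) = u at *
  generalize T (k + 2) i = u' at *
  generalize T (k + 1) i = t at *
  generalize T k i = v at *
  clear h4
  by_cases hct : c < t
  · rw [if_pos hct]; omega
  · rw [if_neg hct]; omega

theorem sum_gtToggle (h : IsGT N ν T) (hk : k + 1 < N)
    (hc : ∀ i, c < T (k + 1) i → c < T k i) :
    ∑ i ∈ Finset.range N, min (gtToggle k c T (k + 1) i) c +
        ∑ i ∈ Finset.range N, min (T (k + 1) i) c =
      ∑ i ∈ Finset.range N, min (T (k + 2) i) c + ∑ i ∈ Finset.range N, min (T k i) c := by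
  have key := sum_min_max (fun i => min (T (k + 2) i) c) (fun i => min (T k i) c) N
  rw [Finset.sum_range_succ, Finset.sum_range_succ (fun i => min (T (k + 2) i) c)] at key
  simp only [h.eq_zero (k + 2) N (by omega)] at key
  rw [← Finset.sum_add_distrib,
    Finset.sum_congr rfl fun i _ => min_gtToggle_add k c h hc i, Finset.sum_add_distrib]
  simp only [zero_min, add_zero] at key ⊢
  omega

/-- The truncated sum of row k + 1 is reflected in the mean of the truncated sums of the rows k and
k + 2, which interchanges the two successive differences. -/
theorem gtUnder_gtToggle (h : IsGT N ν T) (hk : k + 1 < N)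
    (hc : ∀ i, c < T (k + 1) i → c < T k i) :
    gtUnder N c (gtToggle k c T) k = gtUnder N c T (k + 1) ∧
    gtUnder N c (gtToggle k c T) (k + 1) = gtUnder N c T k := by
  have key := congrArg (Nat.cast (R := ℤ)) (sum_gtToggle k c h hk hc)
  push_cast at key
  simp only [gtUnder, gtToggle_of_ne k c (show k + 1 + 1 ≠ k + 1 by omega),
    gtToggle_of_ne k c (show k ≠ k + 1 by omega)]
  push_cast
  constructor <;> linarith

theorem gtUnder_gtToggle_of_ne {j : ℕ} (h1 : j ≠ k) (h2 : j ≠ k + 1) :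
    gtUnder N c (gtToggle k c T) j = gtUnder N c T j := by
  simp only [gtUnder, gtToggle_of_ne k c h2, gtToggle_of_ne k c (show j + 1 ≠ k + 1 by omega)]

end toggle

/-! ### Schur polynomials as sums over patterns -/

/-- The monomial of a pattern. -/
noncomputable def gtMonomial {N : ℕ} (T : ℕ → ℕ → ℕ) : MvPolynomial (Fin N) ℂ :=
  ∏ i : Fin N, MvPolynomial.X i ^ gtWeight N T i

/-- The generating function of patterns with top row `ν`. -/
noncomputable def gtSum (N : ℕ) (ν : ℕ → ℕ) : MvPolynomial (Fin N) ℂ :=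
  ∑ T ∈ gtSet N ν, gtMonomial T

/-- A cutoff beyond all columns gives the classical involution, which interchanges the full contents
of the letters k and k + 1. -/
theorem gtWeight_toggle_full {N : ℕ} {ν : ℕ → ℕ} {T : ℕ → ℕ → ℕ} (h : IsGT N ν T) {k c : ℕ}
    (hk : k + 1 < N) (hc : ν 0 ≤ c) (i : Fin N) :
    gtWeight N (gtToggle k c T) i =
      gtWeight N T (Equiv.swap (⟨k, by omega⟩ : Fin N) ⟨k + 1, hk⟩ i : Fin N) := by
  have hle : ∀ k i, T k i ≤ c := fun k i =>
    (h.le_top k i).trans ((h.nu_anti (Nat.zero_le i)).trans hc)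
  obtain ⟨h1, h2⟩ := gtUnder_gtToggle k c h hk (fun i hi => absurd hi (not_lt.2 (hle _ _)))
  have hov : ∀ j, gtOver N c T j = 0 := by
    intro j
    simp [gtOver, Nat.sub_eq_zero_of_le (hle _ _)]
  have e1 := fun j => gtWeight_eq (h.toggle k c hk) c j
  have e2 := fun j => gtWeight_eq h c j
  simp only [gtOver_gtToggle k c h le_rfl, hov, add_zero] at e1 e2
  have : ∀ j, (gtWeight N (gtToggle k c T) i : ℤ) = gtWeight N T j →
    gtWeight N (gtToggle k c T) i = gtWeight N T j := fun j hj => by exact_mod_cast hj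
  apply this
  rw [e1, e2, Equiv.swap_apply_def]
  split_ifs with ha hb
  · rw [ha]; exact h1
  · rw [hb]; exact h2
  · exact gtUnder_gtToggle_of_ne k c (fun h => ha (Fin.ext h)) (fun h => hb (Fin.ext h))

theorem rename_swap_gtSum {N : ℕ} (ν : ℕ → ℕ) {k : ℕ} (hk : k + 1 < N) :
    MvPolynomial.rename (Equiv.swap (⟨k, by omega⟩ : Fin N) ⟨k + 1, hk⟩) (gtSum N ν) =
      gtSum N ν := by
  rw [gtSum, map_sum]
  refine Finset.sum_nbij' (gtToggle k (ν 0)) (gtToggle k (ν 0)) ?_ ?_ ?_ ?_ ?_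
  · intro T hT; rw [mem_gtSet] at *; exact hT.toggle _ _ hk
  · intro T hT; rw [mem_gtSet] at *; exact hT.toggle _ _ hk
  · intro T hT; rw [mem_gtSet] at *; exact gtToggle_gtToggle _ _ hT
  · intro T hT; rw [mem_gtSet] at *; exact gtToggle_gtToggle _ _ hT
  · intro T hT
    rw [mem_gtSet] at hT
    simp only [gtMonomial, map_prod, map_pow, MvPolynomial.rename_X]
    simp only [gtWeight_toggle_full hT hk le_rfl]
    exact Fintype.prod_equiv (Equiv.swap (⟨k, by omega⟩ : Fin N) ⟨k + 1, hk⟩) _ _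
      (fun i => by rw [Equiv.swap_apply_self])

/-- Adjacent transpositions generate the symmetric group, and each of them is realised by a toggle.
-/
theorem rename_gtSum {N : ℕ} (ν : ℕ → ℕ) (σ : Equiv.Perm (Fin N)) :
    MvPolynomial.rename σ (gtSum N ν) = gtSum N ν := by
  rcases N with _ | n
  · have : (σ : Fin 0 → Fin 0) = id := by ext i; exact i.elim0
    rw [this, MvPolynomial.rename_id_apply]
  have hσ : σ ∈ Submonoid.closure
      (Set.range fun i : Fin n => Equiv.swap i.castSucc i.succ) := by
    rw [Equiv.Perm.mclosure_swap_castSucc_succ]; trivial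
  induction hσ using Submonoid.closure_induction with
  | mem x hx =>
    obtain ⟨i, rfl⟩ := hx
    exact rename_swap_gtSum ν (k := i) (by omega)
  | one => exact MvPolynomial.rename_id_apply _
  | mul x y _ _ hx hy =>
    rw [Equiv.Perm.coe_mul, ← MvPolynomial.rename_rename, hy, hx]

theorem alternantPoly_eq_sum {N : ℕ} (a : Fin N → ℕ) :
    alternantPoly a = ∑ σ : Equiv.Perm (Fin N), ((Equiv.Perm.sign σ : ℤ) : MvPolynomial (Fin N) ℂ) *
      ∏ i, MvPolynomial.X (σ i) ^ a i := by
  simp [alternantPoly, Matrix.det_apply']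

/-- Since the generating function is symmetric, the term of the determinant belonging to σ may be
multiplied by its copy permuted by σ; each pattern then just shifts the exponents of the alternant
by its weight. -/
theorem alternantPoly_mul_gtSum {N : ℕ} (a : Fin N → ℕ) (ν : ℕ → ℕ) :
    alternantPoly a * gtSum N ν =
      ∑ T ∈ gtSet N ν, alternantPoly (fun i => a i + gtWeight N T i) := by
  simp only [alternantPoly_eq_sum, Finset.sum_mul]
  rw [Finset.sum_comm]
  refine Finset.sum_congr rfl fun σ _ => ?_
  rw [← rename_gtSum ν σ, gtSum, map_sum, Finset.mul_sum]
  refine Finset.sum_congr rfl fun T _ => ?_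
  simp only [gtMonomial, map_prod, map_pow, MvPolynomial.rename_X, mul_assoc, pow_add,
    Finset.prod_mul_distrib]

theorem alternantPoly_swap {N : ℕ} (a : Fin N → ℕ) {i j : Fin N} (hij : i ≠ j) :
    alternantPoly (a ∘ Equiv.swap i j) = - alternantPoly a := by
  have h := Matrix.det_permute' (Equiv.swap i j)
    (Matrix.of fun i j : Fin N => (MvPolynomial.X i : MvPolynomial (Fin N) ℂ) ^ a j)
  rw [Equiv.Perm.sign_swap hij] at h
  simpa [alternantPoly, Matrix.submatrix] using h

end SchurCLT

namespace SchurCLT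

/-! ### The Littlewood–Richardson expansion -/

/-- Patterns such that `l` plus the content of the columns with index `> c` is non-increasing for
every `c`. -/
def IsGood (N : ℕ) (l : ℕ → ℕ) (T : ℕ → ℕ → ℕ) : Prop :=
  ∀ c k, k + 1 < N → (l (k + 1) : ℤ) + gtOver N c T (k + 1) ≤ l k + gtOver N c T k

/-- The letters `k` and `k + 1` violate `IsGood` at `c`. -/
def IsBadAt (N : ℕ) (l : ℕ → ℕ) (T : ℕ → ℕ → ℕ) (c k : ℕ) : Prop :=
  k + 1 < N ∧ (l k : ℤ) + gtOver N c T k < l (k + 1) + gtOver N c T (k + 1)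

open Classical in
/-- The last column where `IsGood` fails. -/
noncomputable def badCol (N : ℕ) (ν l : ℕ → ℕ) (T : ℕ → ℕ → ℕ) : ℕ :=
  Nat.findGreatest (fun c => ∃ k, IsBadAt N l T c k) (ν 0)

open Classical in
/-- A letter for which `IsGood` fails at `badCol`. -/
noncomputable def badRow (N : ℕ) (ν l : ℕ → ℕ) (T : ℕ → ℕ → ℕ) : ℕ :=
  Nat.findGreatest (fun k => IsBadAt N l T (badCol N ν l T) k) N

/-- The sign-reversing involution on the patterns that are not good. -/
noncomputable def badFlip (N : ℕ) (ν l : ℕ → ℕ) (T : ℕ → ℕ → ℕ) : ℕ → ℕ → ℕ :=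
  gtToggle (badRow N ν l T) (badCol N ν l T) T

/-- The exponents of the alternant attached to a pattern. -/
def gtExp {N : ℕ} (l : ℕ → ℕ) (T : ℕ → ℕ → ℕ) (i : Fin N) : ℕ :=
  l i + (N - 1 - (i : ℕ)) + gtWeight N T i

section bad

variable {N : ℕ} {ν l : ℕ → ℕ} {T : ℕ → ℕ → ℕ}

theorem gtOver_eq_zero (h : IsGT N ν T) {c : ℕ} (hc : ν 0 ≤ c) (k : ℕ) : gtOver N c T k = 0 := by
  have hle : ∀ k i, T k i - c = 0 := fun k i =>
    Nat.sub_eq_zero_of_le ((h.le_top k i).trans ((h.nu_anti (Nat.zero_le i)).trans hc))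
  simp [gtOver, hle]

theorem not_isBadAt (h : IsGT N ν T) (hl : ∀ k, k + 1 < N → l (k + 1) ≤ l k) {c : ℕ}
    (hc : ν 0 ≤ c) (k : ℕ) : ¬ IsBadAt N l T c k := by
  rintro ⟨hk, h1⟩
  rw [gtOver_eq_zero h hc, gtOver_eq_zero h hc] at h1
  have := hl k hk
  omega

/-- Beyond column ν 0 nothing is left and `IsGood` reduces to the monotonicity of l, so the search
for the last failing column is bounded by ν 0. -/
theorem badCol_spec (h : IsGT N ν T) (hl : ∀ k, k + 1 < N → l (k + 1) ≤ l k)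
    (hb : ¬ IsGood N l T) :
    IsBadAt N l T (badCol N ν l T) (badRow N ν l T) ∧
      ∀ c, badCol N ν l T < c → ∀ k, ¬ IsBadAt N l T c k := by
  classical
  have hex : ∃ c k, IsBadAt N l T c k := by
    by_contra! hcon
    exact hb fun c k hk => not_lt.1 fun hlt => hcon c k ⟨hk, hlt⟩
  obtain ⟨c, k, hck⟩ := hex
  have hc : c ≤ ν 0 := by
    by_contra! hlt
    exact not_isBadAt h hl hlt.le k hck
  obtain ⟨k', hk'⟩ : ∃ k, IsBadAt N l T (badCol N ν l T) k :=
    Nat.findGreatest_spec (P := fun c => ∃ k, IsBadAt N l T c k) hc ⟨k, hck⟩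
  refine ⟨Nat.findGreatest_spec (P := fun k => IsBadAt N l T (badCol N ν l T) k)
    (m := k') (by have := hk'.1; omega) hk', ?_⟩
  intro c' hc' k'' hbad
  rcases le_total c' (ν 0) with h1 | h1
  · exact Nat.findGreatest_is_greatest (P := fun c => ∃ k, IsBadAt N l T c k) hc' h1 ⟨k'', hbad⟩
  · exact not_isBadAt h hl h1 k'' hbad

theorem gtOver_succ (c k : ℕ) : gtOver N c T k = gtOver N (c + 1) T k +
    (∑ i ∈ Finset.range N, (if c < T (k + 1) i then 1 else 0 : ℤ) -
      ∑ i ∈ Finset.range N, (if c < T k i then 1 else 0 : ℤ)) := by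
  have key : ∀ j, ∑ i ∈ Finset.range N, ((T j i - c : ℕ) : ℤ) =
      ∑ i ∈ Finset.range N, ((T j i - (c + 1) : ℕ) : ℤ) +
        ∑ i ∈ Finset.range N, (if c < T j i then 1 else 0 : ℤ) := by
    intro j
    rw [← Finset.sum_add_distrib]
    refine Finset.sum_congr rfl fun i _ => ?_
    split_ifs <;> omega
  simp only [gtOver, key]
  ring

/-- Each letter occurs at most once in a column, because consecutive rows interlace. -/
theorem height_step (h : IsGT N ν T) (c k : ℕ) :
    ∑ i ∈ Finset.range N, (if c < T (k + 1) i then 1 else 0 : ℤ) ≤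
      ∑ i ∈ Finset.range N, (if c < T k i then 1 else 0 : ℤ) + 1 := by
  rcases N with _ | n
  · simp
  rw [Finset.sum_range_succ', Finset.sum_range_succ _ n]
  have h1 : ∑ i ∈ Finset.range n, (if c < T (k + 1) (i + 1) then 1 else 0 : ℤ) ≤
      ∑ i ∈ Finset.range n, (if c < T k i then 1 else 0 : ℤ) := by
    refine Finset.sum_le_sum fun i _ => ?_
    have := h.down k i
    split_ifs <;> omega
  split_ifs <;> linarith

theorem height_mono (h : IsGT N ν T) (c k i : ℕ) :
    (if c < T k i then 1 else 0 : ℤ) ≤ (if c < T (k + 1) i then 1 else 0 : ℤ) := by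
  have := h.up k i
  split_ifs <;> omega

/-- From c + 1 to c the count of k + 1 rises by at most one and that of k does not fall. Since the
inequality holds at c + 1 and fails at c, it fails by exactly one, and column c + 1 contains no
letter k. This is the condition under which the toggle with cutoff c interchanges contents. -/
theorem bad_facts (h : IsGT N ν T) {c k : ℕ} (hb : IsBadAt N l T c k)
    (hn : ¬ IsBadAt N l T (c + 1) k) :
    (l k : ℤ) + gtOver N c T k + 1 = l (k + 1) + gtOver N c T (k + 1) ∧
      ∀ i, c < T (k + 1) i → c < T k i := by
  have h1 := hb.2
  have h2 : (l (k + 1) : ℤ) + gtOver N (c + 1) T (k + 1) ≤ l k + gtOver N (c + 1) T k := by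
    by_contra! hlt
    exact hn ⟨hb.1, hlt⟩
  have h3 := height_step h c (k + 1)
  have h4 := Finset.sum_le_sum fun i (_ : i ∈ Finset.range N) => height_mono h c k i
  rw [gtOver_succ c k, gtOver_succ c (k + 1)] at *
  have h5 : ∑ i ∈ Finset.range N, (if c < T k i then 1 else 0 : ℤ) =
      ∑ i ∈ Finset.range N, (if c < T (k + 1) i then 1 else 0 : ℤ) := by linarith
  refine ⟨by linarith, fun i hi => ?_⟩
  by_cases hiN : i < N
  · have := (Finset.sum_eq_sum_iff_of_le fun i (_ : i ∈ Finset.range N) =>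
      height_mono h c k i).1 h5 i (Finset.mem_range.2 hiN)
    rw [if_pos hi] at this
    by_contra hcon
    rw [if_neg hcon] at this
    omega
  · have := h.eq_zero (k + 1) i (by have := hb.1; omega)
    omega

theorem isBadAt_toggle (h : IsGT N ν T) {c c' k : ℕ} (hc : c ≤ c') (j : ℕ) :
    IsBadAt N l (gtToggle k c T) c' j ↔ IsBadAt N l T c' j := by
  simp only [IsBadAt, gtOver_gtToggle k c h hc]

/-- The toggle does not touch the columns beyond the last bad column c. All the conditions at
cutoffs c' ≥ c are therefore unchanged, the same column and letter are selected again, and the map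
is an involution. On alternants it acts by a transposition of exponents, hence by a sign. -/
theorem badFlip_spec (h : IsGT N ν T) (hl : ∀ k, k + 1 < N → l (k + 1) ≤ l k)
    (hb : ¬ IsGood N l T) :
    IsGT N ν (badFlip N ν l T) ∧ ¬ IsGood N l (badFlip N ν l T) ∧
      badFlip N ν l (badFlip N ν l T) = T ∧
      alternantPoly (gtExp (N := N) l T) + alternantPoly (gtExp l (badFlip N ν l T)) = 0 := by
  classical
  obtain ⟨h1, h2⟩ := badCol_spec h hl hb
  have hG : IsGT N ν (badFlip N ν l T) := h.toggle _ _ h1.1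
  have hbad : IsBadAt N l (badFlip N ν l T) (badCol N ν l T) (badRow N ν l T) :=
    (isBadAt_toggle h le_rfl _).2 h1
  have hnG : ¬ IsGood N l (badFlip N ν l T) := fun hg =>
    absurd hbad.2 (not_lt.2 (hg _ _ hbad.1))
  have hcol : badCol N ν l (badFlip N ν l T) = badCol N ν l T := by
    have h3 := badCol_spec hG hl hnG
    apply le_antisymm
    · by_contra! hlt
      exact h2 _ hlt _ ((isBadAt_toggle h hlt.le _).1 h3.1)
    · by_contra! hlt
      exact h3.2 _ hlt _ hbad
  have hrow : badRow N ν l (badFlip N ν l T) = badRow N ν l T := by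
    unfold badRow
    rw [hcol]
    congr 1
    funext j
    exact propext (isBadAt_toggle h le_rfl j)
  refine ⟨hG, hnG, ?_, ?_⟩
  · have : badFlip N ν l (badFlip N ν l T) =
        gtToggle (badRow N ν l T) (badCol N ν l T) (badFlip N ν l T) := by
      conv_lhs => rw [badFlip, hcol, hrow]
    rw [this]
    exact gtToggle_gtToggle _ _ h
  · have hnb := h2 _ (Nat.lt_succ_self _) (badRow N ν l T)
    obtain ⟨h5, h6⟩ := bad_facts h h1 hnb
    obtain ⟨h7, h8⟩ := gtUnder_gtToggle _ _ h h1.1 h6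
    have hk := h1.1
    unfold badFlip
    generalize hkk : badRow N ν l T = k at *
    generalize badCol N ν l T = c at *
    have hne : (⟨k, by omega⟩ : Fin N) ≠ ⟨k + 1, hk⟩ := by simp
    -- Below the cutoff the contents of k and k + 1 are interchanged. Beyond it they, together with
    -- l, differ by exactly one, which is compensated by the step of the staircase N − 1 − i.
    have hexp : gtExp l (gtToggle k c T) = gtExp (N := N) l T ∘
        Equiv.swap (⟨k, by omega⟩ : Fin N) ⟨k + 1, hk⟩ := by
      funext i
      have e1 := fun j => gtWeight_eq (h.toggle k c hk) c j
      have e2 := fun j => gtWeight_eq h c j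
      simp only [gtOver_gtToggle k c h le_rfl] at e1
      simp only [gtExp, Function.comp_apply, Equiv.swap_apply_def]
      split_ifs with ha hb
      · have e3 := e1 k
        have e4 := e2 (k + 1)
        simp only [ha]
        omega
      · have e3 := e1 (k + 1)
        have e4 := e2 k
        simp only [hb]
        omega
      · have e3 := e1 i
        have e4 := e2 i
        rw [gtUnder_gtToggle_of_ne k c (fun h => ha (Fin.ext h)) (fun h => hb (Fin.ext h))] at e3
        omega
    rw [hexp, alternantPoly_swap _ hne, add_neg_cancel]

-- Patterns that are not good cancel in pairs under the sign-reversing involution; a fixed pattern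
-- would have an alternant equal to its own negative, that is, zero.
open Classical in
theorem alternantPoly_mul_gtSum_eq_sum_good (ν : ℕ → ℕ)
    (hl : ∀ k, k + 1 < N → l (k + 1) ≤ l k) :
    alternantPoly (fun i : Fin N => l i + (N - 1 - (i : ℕ))) * gtSum N ν =
      ∑ T ∈ gtSet N ν with IsGood N l T, alternantPoly (gtExp l T) := by
  rw [alternantPoly_mul_gtSum]
  change ∑ T ∈ gtSet N ν, alternantPoly (gtExp l T) = _
  rw [← Finset.sum_filter_add_sum_filter_not (gtSet N ν) (IsGood N l), add_eq_left]
  have key : ∀ T ∈ (gtSet N ν).filter fun T => ¬ IsGood N l T, IsGT N ν T ∧ ¬ IsGood N l T := by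
    intro T hT
    rwa [Finset.mem_filter, mem_gtSet] at hT
  refine Finset.sum_involution (fun T _ => badFlip N ν l T) ?_ ?_ ?_ ?_
  · intro T hT
    exact (badFlip_spec (key T hT).1 hl (key T hT).2).2.2.2
  · intro T hT hne heq
    have h1 := (badFlip_spec (key T hT).1 hl (key T hT).2).2.2.2
    rw [heq, ← two_mul] at h1
    exact hne ((mul_eq_zero.1 h1).resolve_left two_ne_zero)
  · intro T hT
    rw [Finset.mem_filter, mem_gtSet]
    have h1 := badFlip_spec (key T hT).1 hl (key T hT).2
    exact ⟨h1.1, h1.2.1⟩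
  · intro T hT
    exact (badFlip_spec (key T hT).1 hl (key T hT).2).2.2.1

end bad

/-! ### Identification of the Schur polynomials -/

/-- The pattern all of whose letters in the row `i` are equal to `i`. -/
def gtHighest (ν : ℕ → ℕ) (k i : ℕ) : ℕ := if i < k then ν i else 0

theorem isGT_gtHighest {N : ℕ} {ν : ℕ → ℕ} (hν : Antitone ν) (h0 : ν N = 0) :
    IsGT N ν (gtHighest ν) where
  zero i := by simp [gtHighest]
  top k hk i := by
    have h1 : N ≤ i → ν i = 0 := fun hi => Nat.eq_zero_of_le_zero (h0 ▸ hν hi)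
    unfold gtHighest
    split_ifs with h
    · rfl
    · exact (h1 (by omega)).symm
  up k i := by
    unfold gtHighest
    split_ifs <;> omega
  down k i := by
    have := hν (Nat.le_succ i)
    unfold gtHighest
    split_ifs <;> omega

theorem gtOver_gtHighest {N : ℕ} (ν : ℕ → ℕ) (c : ℕ) {k : ℕ} (hk : k < N) :
    gtOver N c (gtHighest ν) k = ((ν k - c : ℕ) : ℤ) := by
  rw [gtOver, ← Finset.sum_sub_distrib, Finset.sum_eq_single k]
  · simp [gtHighest]
  · intro i _ hik
    have : gtHighest ν (k + 1) i = gtHighest ν k i := by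
      unfold gtHighest
      split_ifs <;> omega
    rw [this, sub_self]
  · intro h
    exact absurd (Finset.mem_range.2 hk) h

theorem gtWeight_gtHighest {N : ℕ} {ν : ℕ → ℕ} (hν : Antitone ν) (h0 : ν N = 0) {k : ℕ}
    (hk : k < N) : gtWeight N (gtHighest ν) k = ν k := by
  have h1 := gtWeight_eq (isGT_gtHighest hν h0) 0 k
  rw [gtOver_gtHighest ν 0 hk] at h1
  have h2 : gtUnder N 0 (gtHighest ν) k = 0 := by simp [gtUnder]
  rw [h2] at h1
  simp only [Nat.sub_zero, zero_add] at h1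
  exact_mod_cast h1

theorem isGood_gtHighest {N : ℕ} {ν : ℕ → ℕ} (hν : Antitone ν) :
    IsGood N 0 (gtHighest ν) := by
  intro c k hk
  rw [gtOver_gtHighest ν c hk, gtOver_gtHighest ν c (by omega)]
  have := hν (Nat.le_succ k)
  simp only [Pi.zero_apply, Nat.succ_eq_add_one] at *
  omega

/-- If row k first received v < ν k boxes at its own letter k, then letter k would have no box
beyond column v. Goodness at cutoff v with l = 0 says that later letters have no more of them than
earlier ones, so the number of boxes beyond column v could never increase again. But row k must
still grow from v to ν k. -/
theorem eq_gtHighest {N : ℕ} {ν : ℕ → ℕ} {T : ℕ → ℕ → ℕ} (h : IsGT N ν T)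
    (hg : IsGood N 0 T) : T = gtHighest ν := by
  have key : ∀ k, k ≤ N → ∀ i, i < k → T k i = ν i := by
    intro k
    induction k with
    | zero => intro _ i hi; omega
    | succ k ih =>
      intro hk
      have hlow : ∀ i, i < k → T (k + 1) i = ν i := fun i hi =>
        le_antisymm (h.le_top _ _) ((ih (by omega) i hi).symm.le.trans (h.up k i))
      have hlast : T (k + 1) k = ν k := by
        by_contra hne
        have hlt : T (k + 1) k < ν k := lt_of_le_of_ne (h.le_top _ _) hne
        set v := T (k + 1) k with hv
        have hover : ∀ j, gtOver N v T j = ∑ i ∈ Finset.range N,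
            (((T (j + 1) i - v : ℕ) : ℤ) - ((T j i - v : ℕ) : ℤ)) := fun j => by
          rw [gtOver, Finset.sum_sub_distrib]
        have hz : gtOver N v T k = 0 := by
          rw [hover]
          refine Finset.sum_eq_zero fun i hi => ?_
          rcases lt_trichotomy i k with hik | hik | hik
          · rw [hlow i hik, ih (by omega) i hik, sub_self]
          · subst hik
            rw [h.eq_zero i i le_rfl, ← hv]; simp
          · rw [h.eq_zero (k + 1) i (by omega), h.eq_zero k i (by omega), sub_self]
        have hle : ∀ j, k + j < N → gtOver N v T (k + j) ≤ 0 := by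
          intro j
          induction j with
          | zero => intro _; exact hz.le
          | succ j ihj =>
            intro hj
            have h1 := hg v (k + j) (by omega)
            have h2 := ihj (by omega)
            simp only [Pi.zero_apply, Nat.cast_zero, zero_add] at h1
            exact h1.trans h2
        have hsum : ∀ j, k + j ≤ N → ∑ i ∈ Finset.range N, ((T (k + j) i - v : ℕ) : ℤ) ≤
            ∑ i ∈ Finset.range N, ((T k i - v : ℕ) : ℤ) := by
          intro j
          induction j with
          | zero => intro _; exact le_rfl
          | succ j ihj =>
            intro hj
            have h1 := hle j (by omega)
            have h2 := ihj (by omega)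
            rw [gtOver] at h1
            rw [← add_assoc]
            linarith
        have h3 := hsum (N - k) (by omega)
        rw [show k + (N - k) = N by omega] at h3
        have h4 : ∑ i ∈ Finset.range N, ((T k i - v : ℕ) : ℤ) <
            ∑ i ∈ Finset.range N, ((T N i - v : ℕ) : ℤ) := by
          refine Finset.sum_lt_sum (fun i _ => ?_) ⟨k, Finset.mem_range.2 (by omega), ?_⟩
          · have h5 := h.le_top k i
            rw [h.top N le_rfl]
            omega
          · rw [h.top N le_rfl, h.eq_zero k k le_rfl]
            omega
        linarith
      intro i hi
      rcases Nat.lt_succ_iff_lt_or_eq.1 hi with h1 | rfl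
      · exact hlow i h1
      · exact hlast
  funext k i
  unfold gtHighest
  split_ifs with hi
  · rcases le_total k N with hk | hk
    · exact key k hk i hi
    · exact h.top k hk i
  · exact h.eq_zero k i (by omega)

theorem vandermondePoly_ne_zero (N : ℕ) : vandermondePoly N ≠ 0 := by
  refine Finset.prod_ne_zero_iff.2 fun p hp => ?_
  simp only [Finset.mem_filter, Finset.mem_univ, true_and] at hp
  exact (irreducible_X_sub_X hp.ne).ne_zero

theorem alternantPoly_rho (N : ℕ) :
    alternantPoly (fun i : Fin N => N - 1 - (i : ℕ)) = vandermondePoly N := by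
  have h1 := Matrix.det_vandermonde
    (fun i : Fin N => (MvPolynomial.X i.rev : MvPolynomial (Fin N) ℂ))
  have h2 : (Matrix.vandermonde fun i : Fin N =>
      (MvPolynomial.X i.rev : MvPolynomial (Fin N) ℂ)) =
      (Matrix.of fun i j : Fin N =>
        (MvPolynomial.X i : MvPolynomial (Fin N) ℂ) ^ (N - 1 - (j : ℕ))).submatrix
        Fin.revPerm Fin.revPerm := by
    ext1 i j
    simp only [Matrix.vandermonde_apply, Matrix.submatrix_apply, Fin.revPerm_apply, Matrix.of_apply,
      Fin.val_rev]
    congr 1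
    omega
  rw [h2, Matrix.det_submatrix_equiv_self] at h1
  rw [alternantPoly, h1, vandermondePoly]
  rw [Finset.prod_sigma']
  refine Finset.prod_nbij' (fun p => (p.2.rev, p.1.rev)) (fun p => ⟨p.2.rev, p.1.rev⟩)
    ?_ ?_ ?_ ?_ ?_
  · rintro ⟨i, j⟩ hp
    simpa using hp
  · rintro ⟨i, j⟩ hp
    simpa using hp
  · rintro ⟨i, j⟩ _; simp
  · rintro ⟨i, j⟩ _; simp
  · rintro ⟨i, j⟩ _; simp

/-- Case l = 0 of the expansion: the alternant is then V itself and only the highest pattern is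
good. -/
theorem schurPoly_eq_gtSum {N : ℕ} {ν : ℕ → ℕ} (hν : Antitone ν) (h0 : ν N = 0) :
    schurPoly (fun i : Fin N => ν i + (N - 1 - (i : ℕ))) = gtSum N ν := by
  classical
  have h1 := alternantPoly_mul_gtSum_eq_sum_good (N := N) (l := 0) ν (fun _ _ => le_rfl)
  have h2 : (gtSet N ν).filter (IsGood N 0) = {gtHighest ν} := by
    ext T
    rw [Finset.mem_filter, mem_gtSet, Finset.mem_singleton]
    constructor
    · rintro ⟨h3, h4⟩
      exact eq_gtHighest h3 h4
    · rintro rfl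
      exact ⟨isGT_gtHighest hν h0, isGood_gtHighest hν⟩
  rw [h2, Finset.sum_singleton] at h1
  simp only [Pi.zero_apply, zero_add, alternantPoly_rho] at h1
  apply mul_left_cancel₀ (vandermondePoly_ne_zero N)
  rw [vandermondePoly_mul_schurPoly, h1]
  congr 1
  funext i
  rw [gtExp, gtWeight_gtHighest hν h0 i.2]
  simp [add_comm]

-- The Littlewood–Richardson rule: cancel V once in the alternant expansion. What matters later is
-- only that every coefficient is a number of patterns, hence nonnegative, and that the exponents
-- are controlled.
open Classical in
theorem schurPoly_mul_schurPoly {N : ℕ} {l ν : ℕ → ℕ} (hl : ∀ k, k + 1 < N → l (k + 1) ≤ l k)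
    (hν : Antitone ν) (h0 : ν N = 0) :
    schurPoly (fun i : Fin N => l i + (N - 1 - (i : ℕ))) *
        schurPoly (fun i : Fin N => ν i + (N - 1 - (i : ℕ))) =
      ∑ T ∈ gtSet N ν with IsGood N l T, schurPoly (gtExp l T) := by
  apply mul_left_cancel₀ (vandermondePoly_ne_zero N)
  rw [← mul_assoc, vandermondePoly_mul_schurPoly, schurPoly_eq_gtSum hν h0,
    alternantPoly_mul_gtSum_eq_sum_good ν hl, Finset.mul_sum]
  simp only [vandermondePoly_mul_schurPoly]

theorem IsGood.antitone {N : ℕ} {l ν : ℕ → ℕ} {T : ℕ → ℕ → ℕ} (h : IsGT N ν T)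
    (hg : IsGood N l T) {k : ℕ} (hk : k + 1 < N) :
    l (k + 1) + gtWeight N T (k + 1) ≤ l k + gtWeight N T k := by
  have h1 := hg 0 k hk
  have h2 := gtWeight_eq h 0 k
  have h3 := gtWeight_eq h 0 (k + 1)
  have h4 : ∀ j, gtUnder N 0 T j = 0 := by simp [gtUnder]
  rw [h4] at h2 h3
  omega

theorem gtWeight_le {N : ℕ} {ν : ℕ → ℕ} {T : ℕ → ℕ → ℕ} (h : IsGT N ν T) (k : ℕ) :
    gtWeight N T k ≤ N * ν 0 := by
  calc gtWeight N T k ≤ ∑ _i ∈ Finset.range N, ν 0 := Finset.sum_le_sum fun i _ =>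
        (Nat.sub_le _ _).trans ((h.le_top _ _).trans (h.nu_anti (Nat.zero_le i)))
    _ = N * ν 0 := by simp

end SchurCLT

namespace SchurCLT

/-! ### Schur functions: monomial expansion and estimates -/

variable {N : ℕ}

/-- The partition `l_i + shift l` attached to a signature. -/
def sigPart (l : Signature N) (i : ℕ) : ℕ := if h : i < N then (l.1 ⟨i, h⟩ + shift l).toNat else 0

theorem natAbs_le_shift (l : Signature N) (j : Fin N) : (l.1 j).natAbs ≤ shift l :=
  Finset.single_le_sum (f := fun j => (l.1 j).natAbs) (fun _ _ => Nat.zero_le _)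
    (Finset.mem_univ j)

theorem sigPart_coe (l : Signature N) (j : Fin N) : sigPart l j = (l.1 j + shift l).toNat := by
  simp [sigPart]

theorem sigPart_cast (l : Signature N) (j : Fin N) : (sigPart l j : ℤ) = l.1 j + shift l := by
  have := natAbs_le_shift l j
  rw [sigPart_coe]
  omega

theorem sigPart_antitone (l : Signature N) : Antitone (sigPart l) := by
  intro i j hij
  unfold sigPart
  split_ifs with h1 h2
  · have := l.2 (show (⟨i, h2⟩ : Fin N) ≤ ⟨j, h1⟩ from hij)
    omega
  · omega
  · omega
  · omega

theorem sigPart_self (l : Signature N) : sigPart l N = 0 := by simp [sigPart]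

theorem sigPart_zero_le (l : Signature N) : sigPart l 0 ≤ 2 * shift l := by
  unfold sigPart
  split_ifs with h
  · have := natAbs_le_shift l ⟨0, h⟩
    omega
  · omega

/-- The set of patterns of a signature. -/
noncomputable def sigSet (l : Signature N) : Finset (ℕ → ℕ → ℕ) := gtSet N (sigPart l)

/-- The weights of the Schur function of a signature. -/
def sigWeight (l : Signature N) (T : ℕ → ℕ → ℕ) (i : Fin N) : ℤ := gtWeight N T i - shift l

/-- The dimension `s_l(1, …, 1)`. -/
noncomputable def sigDim (l : Signature N) : ℕ := (sigSet l).card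

theorem schur_eq (l : Signature N) (x : Fin N → ℂ) :
    schur l x = (∏ i, x i)⁻¹ ^ shift l * MvPolynomial.eval x (gtSum N (sigPart l)) := by
  rw [schur, ← schurPoly_eq_gtSum (sigPart_antitone l) (sigPart_self l)]
  simp only [sigPart_coe]

theorem schur_eq_sum (l : Signature N) (x : Fin N → ℂ) (hx : ∀ i, x i ≠ 0) :
    schur l x = ∑ T ∈ sigSet l, ∏ i, x i ^ sigWeight l T i := by
  rw [schur_eq, gtSum, map_sum, Finset.mul_sum]
  refine Finset.sum_congr rfl fun T _ => ?_
  simp only [gtMonomial, map_prod, map_pow, MvPolynomial.eval_X]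
  rw [inv_pow, ← Finset.prod_pow, ← Finset.prod_inv_distrib, ← Finset.prod_mul_distrib]
  refine Finset.prod_congr rfl fun i _ => ?_
  rw [sigWeight, zpow_sub₀ (hx i), zpow_natCast, zpow_natCast, div_eq_mul_inv, mul_comm]

theorem schur_one (l : Signature N) : schur l 1 = sigDim l := by
  rw [schur_eq_sum l 1 (fun _ => one_ne_zero)]
  simp [sigDim]

theorem highest_mem (l : Signature N) : gtHighest (sigPart l) ∈ sigSet l :=
  mem_gtSet.2 (isGT_gtHighest (sigPart_antitone l) (sigPart_self l))

theorem sigDim_pos (l : Signature N) : 0 < sigDim l := Finset.card_pos.2 ⟨_, highest_mem l⟩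

theorem sigDim_ne_zero (l : Signature N) : (sigDim l : ℂ) ≠ 0 :=
  Nat.cast_ne_zero.2 (sigDim_pos l).ne'

theorem normSchur_one (l : Signature N) : normSchur l 1 = 1 := by
  rw [normSchur, schur_one, div_self (sigDim_ne_zero l)]

theorem sigDim_le (l : Signature N) : sigDim l ≤ (2 * shift l + 1) ^ (N * N) :=
  (card_gtSet_le N (sigPart_antitone l)).trans
    (Nat.pow_le_pow_left (Nat.succ_le_succ (sigPart_zero_le l)) _)

theorem sigWeight_highest (l : Signature N) (i : Fin N) :
    sigWeight l (gtHighest (sigPart l)) i = l.1 i := by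
  rw [sigWeight, gtWeight_gtHighest (sigPart_antitone l) (sigPart_self l) i.2, sigPart_cast]
  ring

theorem natAbs_weight_le {l : Signature N} {T : ℕ → ℕ → ℕ} (hT : IsGT N (sigPart l) T)
    (i : Fin N) : ((gtWeight N T i : ℤ) - shift l).natAbs ≤ 2 * N * shift l := by
  have h1 := gtWeight_le hT i
  have h2 : N * sigPart l 0 ≤ 2 * N * shift l := by
    calc N * sigPart l 0 ≤ N * (2 * shift l) := Nat.mul_le_mul_left _ (sigPart_zero_le l)
      _ = 2 * N * shift l := by ring
  have h3 : shift l ≤ 2 * N * shift l := Nat.le_mul_of_pos_left _ (by have := i.2; omega)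
  omega

theorem norm_zpow_le {R : ℝ} (hR : 1 ≤ R) {z : ℂ} (h1 : R⁻¹ ≤ ‖z‖) (h2 : ‖z‖ ≤ R) (n : ℤ)
    {k : ℕ} (hk : n.natAbs ≤ k) : ‖z ^ n‖ ≤ R ^ k := by
  have h0 : 0 < R⁻¹ := by positivity
  refine le_trans ?_ (pow_le_pow_right₀ hR hk)
  rw [norm_zpow]
  rcases Int.natAbs_eq n with h | h
  · rw [h, zpow_natCast, Int.natAbs_natCast]
    exact pow_le_pow_left₀ (norm_nonneg _) h2 _
  · rw [h, zpow_neg, zpow_natCast, Int.natAbs_neg, Int.natAbs_natCast, ← inv_pow]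
    exact pow_le_pow_left₀ (inv_nonneg.2 (norm_nonneg _)) (inv_le_of_inv_le₀ (by positivity) h1) _

/-- A normalized Schur function is an average of Laurent monomials, with N exponents each of size at
most 2 N shift. -/
theorem norm_normSchur_le {R : ℝ} (hR : 1 ≤ R) (l : Signature N) {x : Fin N → ℂ}
    (hx : ∀ i, R⁻¹ ≤ ‖x i‖ ∧ ‖x i‖ ≤ R) : ‖normSchur l x‖ ≤ R ^ (2 * N * N * shift l) := by
  have hR0 : 0 < R⁻¹ := by positivity
  have hx0 : ∀ i, x i ≠ 0 := fun i => norm_pos_iff.1 (hR0.trans_le (hx i).1)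
  have hd : (0 : ℝ) < sigDim l := Nat.cast_pos.2 (sigDim_pos l)
  rw [normSchur, schur_one, norm_div, Complex.norm_natCast, div_le_iff₀ hd, schur_eq_sum l x hx0]
  calc ‖∑ T ∈ sigSet l, ∏ i, x i ^ sigWeight l T i‖
      ≤ ∑ T ∈ sigSet l, ‖∏ i, x i ^ sigWeight l T i‖ := norm_sum_le _ _
    _ ≤ ∑ T ∈ sigSet l, R ^ (2 * N * N * shift l) := by
      refine Finset.sum_le_sum fun T hT => ?_
      rw [norm_prod]
      calc ∏ i, ‖x i ^ sigWeight l T i‖ ≤ ∏ _i : Fin N, R ^ (2 * N * shift l) :=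
            Finset.prod_le_prod (fun _ _ => norm_nonneg _) fun i _ =>
              norm_zpow_le hR (hx i).1 (hx i).2 _ (natAbs_weight_le (mem_gtSet.1 hT) i)
        _ = R ^ (2 * N * N * shift l) := by
          rw [Finset.prod_const, Finset.card_univ, Fintype.card_fin, ← pow_mul]
          congr 1; ring
    _ = R ^ (2 * N * N * shift l) * sigDim l := by
      rw [Finset.sum_const, nsmul_eq_mul, mul_comm]; rfl

theorem norm_normSchur_le_one (l : Signature N) {x : Fin N → ℂ} (hx : ∀ i, ‖x i‖ = 1) :
    ‖normSchur l x‖ ≤ 1 := by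
  have := norm_normSchur_le le_rfl l (x := x) (fun i => by simp [hx i])
  simpa using this

theorem normSchur_ofReal (l : Signature N) {x : Fin N → ℝ} (hx : ∀ i, 0 < x i) :
    normSchur l (fun i => (x i : ℂ)) =
      (((∑ T ∈ sigSet l, ∏ i, x i ^ sigWeight l T i) / sigDim l : ℝ) : ℂ) := by
  rw [normSchur, schur_one, schur_eq_sum l _ (fun i => by exact_mod_cast (hx i).ne')]
  push_cast
  rfl

/-- At positive arguments all terms are positive and the highest weight is one of them. This bounds
Schur functions from below. -/
theorem prod_zpow_le_sum (l : Signature N) {x : Fin N → ℝ} (hx : ∀ i, 0 < x i) :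
    ∏ i, x i ^ l.1 i ≤ ∑ T ∈ sigSet l, ∏ i, x i ^ sigWeight l T i := by
  have h := Finset.single_le_sum (f := fun T => ∏ i, x i ^ sigWeight l T i)
    (fun T _ => Finset.prod_nonneg fun i _ => (zpow_pos (hx i) _).le) (highest_mem l)
  simpa only [sigWeight_highest] using h

/-! ### Products of Schur functions -/

theorem alternantPoly_add (a : Fin N → ℕ) (m : ℕ) :
    alternantPoly (fun i => a i + m) = (∏ i, MvPolynomial.X i) ^ m * alternantPoly a := by
  rw [← Finset.prod_pow, alternantPoly, alternantPoly, ← Matrix.det_mul_column]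
  congr 1
  ext1 i j
  simp only [Matrix.of_apply, pow_add]
  rw [mul_comm]

theorem schurPoly_add (a : Fin N → ℕ) (m : ℕ) :
    schurPoly (fun i => a i + m) = (∏ i, MvPolynomial.X i) ^ m * schurPoly a := by
  apply mul_left_cancel₀ (vandermondePoly_ne_zero N)
  rw [vandermondePoly_mul_schurPoly, alternantPoly_add, ← vandermondePoly_mul_schurPoly a]
  ring

/-- The power of x_1 ⋯ x_N used to clear denominators is immaterial; products of Schur functions
come with a power different from the one in the definition. -/
theorem schur_eq_of_exponents (l : Signature N) (s : ℕ) (a : Fin N → ℕ)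
    (ha : ∀ i, (a i : ℤ) = l.1 i + s + ((N - 1 - (i : ℕ) : ℕ) : ℤ)) (x : Fin N → ℂ)
    (hx : ∀ i, x i ≠ 0) :
    (∏ i, x i)⁻¹ ^ s * MvPolynomial.eval x (schurPoly a) = schur l x := by
  set b : Fin N → ℕ := fun j => (l.1 j + shift l).toNat + (N - 1 - (j : ℕ)) with hb
  have h1 : (fun i => a i + shift l) = fun i => b i + s := by
    funext i
    have := natAbs_le_shift l i
    have := ha i
    simp only [hb]
    omega
  have h2 := congrArg (MvPolynomial.eval x) (congrArg schurPoly h1)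
  rw [schurPoly_add, schurPoly_add] at h2
  simp only [map_mul, map_pow, map_prod, MvPolynomial.eval_X] at h2
  have hp : ∏ i, x i ≠ 0 := Finset.prod_ne_zero_iff.2 fun i _ => hx i
  rw [schur, ← hb, inv_pow, inv_pow]
  have hp1 := pow_ne_zero s hp
  have hp2 := pow_ne_zero (shift l) hp
  field_simp
  linear_combination h2

/-- Multiplicities are encoded by letting good patterns index the sum. The signature of a pattern is
l plus its weight, which bounds its shift linearly in the shifts of the factors. -/
theorem exists_schur_mul (l n : Signature N) :
    ∃ (S : Finset (ℕ → ℕ → ℕ)) (μ : (ℕ → ℕ → ℕ) → Signature N),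
      (∀ T ∈ S, shift (μ T) ≤ shift l + 2 * N * N * shift n) ∧
      ∀ x : Fin N → ℂ, (∀ i, x i ≠ 0) →
        schur l x * schur n x = ∑ T ∈ S, schur (μ T) x := by
  classical
  have hex : ∀ T ∈ (gtSet N (sigPart n)).filter (IsGood N (sigPart l)),
      ∃ u : Signature N, ∀ i, u.1 i = l.1 i + ((gtWeight N T i : ℤ) - shift n) := by
    intro T hT
    rw [Finset.mem_filter, mem_gtSet] at hT
    refine ⟨⟨fun i => l.1 i + ((gtWeight N T i : ℤ) - shift n), ?_⟩, fun i => rfl⟩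
    rcases N with _ | N
    · intro i; exact i.elim0
    refine Fin.antitone_iff_succ_le.2 fun i => ?_
    have h1 := hT.2.antitone hT.1 (k := i) (by omega)
    have h2 := sigPart_cast l i.castSucc
    have h3 := sigPart_cast l i.succ
    simp only [Fin.val_castSucc, Fin.val_succ] at *
    omega
  have : Nonempty (Signature N) := ⟨l⟩
  choose! μ hμ using hex
  refine ⟨(gtSet N (sigPart n)).filter (IsGood N (sigPart l)), μ, ?_, ?_⟩
  · intro T hT
    have hT' := (Finset.mem_filter.1 hT).1
    rw [mem_gtSet] at hT'
    calc shift (μ T) ≤ ∑ j, ((l.1 j).natAbs + 2 * N * shift n) := by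
          refine Finset.sum_le_sum fun j _ => ?_
          rw [hμ T hT j]
          exact (Int.natAbs_add_le _ _).trans
            (Nat.add_le_add_left (natAbs_weight_le hT' j) _)
      _ = shift l + 2 * N * N * shift n := by
          rw [Finset.sum_add_distrib, Finset.sum_const, Finset.card_univ, Fintype.card_fin,
            smul_eq_mul]
          simp only [shift]
          ring
  · intro x hx
    have h1 := schurPoly_mul_schurPoly (N := N) (l := sigPart l) (ν := sigPart n)
      (fun k _ => sigPart_antitone l (Nat.le_succ k)) (sigPart_antitone n) (sigPart_self n)
    have h2 := congrArg (MvPolynomial.eval x) h1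
    rw [map_mul, map_sum] at h2
    have h3 : schur l x * schur n x = (∏ i, x i)⁻¹ ^ (shift l + shift n) *
        (MvPolynomial.eval x (schurPoly fun i : Fin N => sigPart l i + (N - 1 - (i : ℕ))) *
          MvPolynomial.eval x (schurPoly fun i : Fin N => sigPart n i + (N - 1 - (i : ℕ)))) := by
      simp only [schur, sigPart_coe, pow_add]
      ring
    rw [h3, h2, Finset.mul_sum]
    refine Finset.sum_congr rfl fun T hT => schur_eq_of_exponents _ _ _ (fun i => ?_) x hx
    have := sigPart_cast l i
    rw [hμ T hT i, gtExp]
    push_cast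
    omega

/-- The coefficients of products of normalized Schur functions. -/
theorem exists_normSchur_mul (l n : Signature N) :
    ∃ (F : Finset (Signature N)) (K : Signature N → ℝ), (∀ u, 0 ≤ K u) ∧ (∀ u ∉ F, K u = 0) ∧
      (∀ u ∈ F, shift u ≤ shift l + 2 * N * N * shift n) ∧
      ∀ x : Fin N → ℂ, (∀ i, x i ≠ 0) →
        normSchur l x * normSchur n x = ∑ u ∈ F, (K u : ℂ) * normSchur u x := by
  classical
  obtain ⟨S, μ, h1, h2⟩ := exists_schur_mul l n
  refine ⟨S.image μ, fun u => ∑ T ∈ S with μ T = u, (sigDim u : ℝ) / (sigDim l * sigDim n),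
    fun u => Finset.sum_nonneg fun T _ => by positivity, ?_, ?_, ?_⟩
  · intro u hu
    refine Finset.sum_eq_zero fun T hT => ?_
    rw [Finset.mem_filter] at hT
    exact absurd (Finset.mem_image.2 ⟨T, hT⟩) hu
  · intro u hu
    obtain ⟨T, hT, rfl⟩ := Finset.mem_image.1 hu
    exact h1 T hT
  · intro x hx
    have h3 : ∀ u ∈ S.image μ, (((∑ T ∈ S with μ T = u,
        (sigDim u : ℝ) / (sigDim l * sigDim n) : ℝ) : ℂ)) * normSchur u x =
        ∑ T ∈ S with μ T = u, schur (μ T) x / (sigDim l * sigDim n) := by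
      intro u _
      push_cast
      rw [Finset.sum_mul]
      refine Finset.sum_congr rfl fun T hT => ?_
      rw [(Finset.mem_filter.1 hT).2, normSchur, schur_one]
      have := sigDim_ne_zero u
      have := sigDim_ne_zero l
      have := sigDim_ne_zero n
      field_simp
    rw [Finset.sum_congr rfl h3,
      Finset.sum_fiberwise_of_maps_to (fun T hT => Finset.mem_image_of_mem μ hT),
      ← Finset.sum_div, ← h2 x hx, normSchur, normSchur, schur_one, schur_one, div_mul_div_comm]

/-! ### Uniqueness of Schur expansions on the torus -/

/-- The exponents of the alternant in the numerator of `s_u`. -/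
def sigExp (u : Signature N) (j : Fin N) : ℤ := u.1 j + N - ((j : ℕ) + 1)

theorem sigExp_strictAnti (u : Signature N) : StrictAnti (sigExp u) := by
  intro i j hij
  have h1 := u.2 hij.le
  have h2 : (i : ℕ) < j := hij
  simp only [sigExp]
  omega

theorem sigExp_injective : Function.Injective (sigExp (N := N)) := by
  intro u v h
  apply Subtype.ext
  funext j
  have := congrFun h j
  simp only [sigExp] at this
  omega

/-- A strictly decreasing sequence is determined by its range, so the monomials in the numerators of
different Schur functions never coincide. -/
theorem sigExp_comp_perm {u v : Signature N} {σ : Equiv.Perm (Fin N)}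
    (h : sigExp u ∘ σ = sigExp v) : σ = 1 ∧ u = v := by
  have h1 : sigExp u = sigExp v := by
    have h2 : (fun j => - sigExp u j) = fun j => - sigExp v j := by
      refine (StrictMono.range_inj ?_ ?_).1 ?_
      · exact fun i j hij => neg_lt_neg (sigExp_strictAnti u hij)
      · exact fun i j hij => neg_lt_neg (sigExp_strictAnti v hij)
      · rw [← h]
        exact (EquivLike.range_comp (fun j => - sigExp u j) σ).symm
    funext j
    exact neg_injective (congrFun h2 j)
  refine ⟨?_, sigExp_injective h1⟩
  rw [← h1] at h
  ext i
  exact congrArg Fin.val ((sigExp_strictAnti u).injective (congrFun h i))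

/-- The product `∏_{i<j} (x_i - x_j)`. -/
noncomputable def vander (x : Fin N → ℂ) : ℂ :=
  ∏ p ∈ (Finset.univ : Finset (Fin N × Fin N)).filter (fun p => p.1 < p.2), (x p.1 - x p.2)

theorem vander_mul_normSchur (u : Signature N) {x : Fin N → ℂ} (hx : ∀ i, x i ≠ 0) :
    vander x * normSchur u x = ∑ σ : Equiv.Perm (Fin N), ((Equiv.Perm.sign σ : ℤ) : ℂ) /
      sigDim u * ∏ i, x i ^ sigExp u (σ i) := by
  have h := schur_mul_vandermonde u x hx
  rw [normSchur, schur_one, mul_div_assoc', mul_comm, vander, h, ← Matrix.det_transpose,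
    Matrix.det_apply', Finset.sum_div]
  refine Finset.sum_congr rfl fun σ _ => ?_
  simp only [Matrix.transpose_apply, Matrix.of_apply, sigExp]
  rw [mul_div_right_comm]

theorem exists_fourier_functional (m : Fin N → ℤ) :
    ∃ φ : C(UnitAddTorus (Fin N), ℂ) →L[ℂ] ℂ,
      ∀ n, φ (UnitAddTorus.mFourier n) = if m = n then 1 else 0 := by
  -- The multivariate Fourier monomials are orthonormal with respect to the product of the Haar
  -- probability measures.
  let _ : MeasureSpace UnitAddCircle := ⟨AddCircle.haarAddCircle⟩
  have : IsProbabilityMeasure (volume : Measure UnitAddCircle) :=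
    inferInstanceAs (IsProbabilityMeasure AddCircle.haarAddCircle)
  exact ⟨(innerSL ℂ (UnitAddTorus.mFourierLp 2 m)).comp (ContinuousMap.toLp 2 volume ℂ),
    fun n => orthonormal_iff_ite.1 (UnitAddTorus.orthonormal_mFourier (d := Fin N)) m n⟩

/-- After multiplication by V the expansion becomes an absolutely convergent Fourier series on the
torus, in which the monomial with exponents `sigExp κ` comes only from κ and the identity
permutation. The Fourier coefficient there is a nonzero multiple of a κ. Zeros of V on the torus do
no harm. -/
theorem expansion_unique {a : Signature N → ℂ} (ha : Summable fun u => ‖a u‖)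
    (h : ∀ x : Fin N → ℂ, (∀ i, ‖x i‖ = 1) → HasSum (fun u => a u * normSchur u x) 0) :
    a = 0 := by
  classical
  open UnitAddTorus in
  let b : Signature N → C(UnitAddTorus (Fin N), ℂ) := fun u =>
    ∑ σ : Equiv.Perm (Fin N), (a u * (((Equiv.Perm.sign σ : ℤ) : ℂ) / sigDim u)) •
      mFourier (sigExp u ∘ σ)
  have hbn : ∀ u, ‖b u‖ ≤ ‖a u‖ * Fintype.card (Equiv.Perm (Fin N)) := by
    intro u
    refine (norm_sum_le _ _).trans ?_
    refine (Finset.sum_le_sum (g := fun _ => ‖a u‖) fun σ _ => ?_).trans ?_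
    · rw [norm_smul, UnitAddTorus.mFourier_norm, mul_one, norm_mul]
      refine mul_le_of_le_one_right (norm_nonneg _) ?_
      rw [norm_div, Complex.norm_natCast]
      have h1 : ‖((Equiv.Perm.sign σ : ℤ) : ℂ)‖ = 1 := by
        rcases Int.units_eq_one_or (Equiv.Perm.sign σ) with h | h <;> simp [h]
      rw [h1]
      exact div_le_one_of_le₀ (by exact_mod_cast sigDim_pos u) (Nat.cast_nonneg _)
    · simp [mul_comm]
  have hbs : Summable b := Summable.of_norm_bounded (ha.mul_right _) hbn
  have hb0 : HasSum b 0 := by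
    have h1 := hbs.hasSum
    suffices h2 : ∑' u, b u = 0 by rwa [h2] at h1
    ext t
    have h2 : HasSum (fun u => b u t) ((∑' u, b u) t) :=
      h1.map (ContinuousMap.evalCLM ℂ t) (ContinuousMap.evalCLM ℂ t).continuous
    let x : Fin N → ℂ := fun i => (fourier 1 (t i) : ℂ)
    have hx1 : ∀ i, ‖x i‖ = 1 := fun i => by
      simp only [x, fourier_one]; exact Circle.norm_coe _
    have hx0 : ∀ i, x i ≠ 0 := fun i => norm_pos_iff.1 (by rw [hx1 i]; exact one_pos)
    have h3 := (h x hx1).mul_left (vander x)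
    rw [mul_zero] at h3
    have h4 : (fun u => b u t) = fun u => vander x * (a u * normSchur u x) := by
      funext u
      rw [mul_left_comm, vander_mul_normSchur u hx0, Finset.mul_sum]
      simp only [b, ContinuousMap.coe_sum, Finset.sum_apply, ContinuousMap.coe_smul, Pi.smul_apply,
        smul_eq_mul]
      refine Finset.sum_congr rfl fun σ _ => ?_
      rw [mul_assoc]
      congr 2
      simp only [UnitAddTorus.mFourier, ContinuousMap.coe_mk, Function.comp_apply]
      refine Finset.prod_congr rfl fun i _ => ?_
      simp only [x, fourier_apply, one_smul, AddCircle.toCircle_zsmul, Circle.coe_zpow]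
    rw [h4] at h2
    exact h2.unique h3
  funext κ
  obtain ⟨φ, hφ⟩ := exists_fourier_functional (sigExp κ)
  have h1 := hb0.mapL φ
  rw [map_zero] at h1
  have h2 : ∀ u, φ (b u) = if u = κ then a κ / sigDim κ else 0 := by
    intro u
    simp only [b, map_sum, map_smul, hφ, smul_eq_mul, mul_ite, mul_one, mul_zero]
    rw [Finset.sum_eq_single 1]
    · by_cases hu : u = κ
      · subst hu
        simp [div_eq_mul_inv]
      · rw [if_neg hu, if_neg]
        exact fun h => hu (sigExp_comp_perm h.symm).2
    · intro σ _ hσ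
      rw [if_neg]
      exact fun h => hσ (sigExp_comp_perm h.symm).1
    · intro h; exact absurd (Finset.mem_univ _) h
  simp only [h2] at h1
  have h3 := h1.unique (hasSum_ite_eq κ _)
  exact ((div_eq_zero_iff.1 h3.symm).resolve_right (sigDim_ne_zero κ))

/-! ### Weights with exponential moments -/

/-- Weights on signatures with some finite exponential moment. -/
def ExpSummable (w : Signature N → ℂ) : Prop :=
  ∃ q : ℝ, 1 < q ∧ Summable fun l => ‖w l‖ * q ^ shift l

/-- Functions on signatures of at most polynomial growth. -/
def PolyBdd (φ : Signature N → ℂ) : Prop :=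
  ∃ (A : ℝ) (K : ℕ), 0 ≤ A ∧ ∀ l, ‖φ l‖ ≤ A * (shift l + 1 : ℝ) ^ K

theorem exists_pow_le_mul_pow (K : ℕ) {r : ℝ} (hr : 1 < r) :
    ∃ C : ℝ, 0 < C ∧ ∀ n : ℕ, (n + 1 : ℝ) ^ K ≤ C * r ^ n := by
  have h1 := (tendsto_pow_const_div_const_pow_of_one_lt K hr).comp (tendsto_add_atTop_nat 1)
  obtain ⟨B, hB⟩ := h1.bddAbove_range
  refine ⟨max 1 (B * r), by positivity, fun n => ?_⟩
  have h2 := hB ⟨n, rfl⟩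
  have hr0 : 0 < r := by linarith
  simp only [Function.comp_apply] at h2
  rw [div_le_iff₀ (by positivity)] at h2
  push_cast at h2
  calc (n + 1 : ℝ) ^ K ≤ B * r ^ (n + 1) := h2
    _ = B * r * r ^ n := by ring
    _ ≤ _ := by gcongr; exact le_max_right _ _

theorem summable_mul_pow_mono {ι : Type*} {w : ι → ℂ} {s : ι → ℕ} {q q' : ℝ} (h0 : 0 ≤ q')
    (h1 : q' ≤ q)
    (h : Summable fun l => ‖w l‖ * q ^ s l) : Summable fun l => ‖w l‖ * q' ^ s l :=
  Summable.of_nonneg_of_le (fun l => by positivity) (fun l => by gcongr) h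

/-- Polynomial growth is absorbed by replacing q with √q. -/
theorem ExpSummable.mul {w φ : Signature N → ℂ} (hw : ExpSummable w) (hφ : PolyBdd φ) :
    ExpSummable fun l => φ l * w l := by
  obtain ⟨q, hq, hs⟩ := hw
  obtain ⟨A, K, hA, hK⟩ := hφ
  have hr : 1 < √q := by rw [Real.lt_sqrt zero_le_one]; simpa using hq
  obtain ⟨C, hC, hC'⟩ := exists_pow_le_mul_pow K hr
  refine ⟨√q, hr, Summable.of_nonneg_of_le (fun l => by positivity) (fun l => ?_)
    (hs.mul_left (A * C))⟩
  have h1 : √q ^ shift l * √q ^ shift l = q ^ shift l := by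
    rw [← mul_pow, Real.mul_self_sqrt (by linarith)]
  rw [norm_mul]
  calc ‖φ l‖ * ‖w l‖ * √q ^ shift l
      ≤ (A * (C * √q ^ shift l)) * ‖w l‖ * √q ^ shift l := by
        gcongr
        exact (hK l).trans (by gcongr; exact hC' _)
    _ = A * C * (‖w l‖ * q ^ shift l) := by rw [← h1]; ring

/-- Convergence is used only at the 2^N points whose coordinates are q or q⁻¹, for one q > 1 near 1.
For each signature one of these points makes the highest monomial equal to q^shift. The normalized
Schur function there is at least q^shift divided by the dimension, and the dimension is polynomial
in the shift, so √q^shift remains. -/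
theorem expSummable_of_summable {w : Signature N → ℝ} (hw : ∀ l, 0 ≤ w l)
    (h : ∀ᶠ x in 𝓝 (1 : Fin N → ℂ), Summable fun l => (w l : ℂ) * normSchur l x) :
    ExpSummable fun l => (w l : ℂ) := by
  classical
  let X : ℝ → (Fin N → Bool) → Fin N → ℝ := fun q ε i => if ε i then q else q⁻¹
  have hX : ∀ ε, Tendsto (fun q : ℝ => fun i => (X q ε i : ℂ)) (𝓝 1) (𝓝 1) := by
    intro ε
    have : ContinuousAt (fun q : ℝ => fun i => (X q ε i : ℂ)) 1 := by
      refine continuousAt_pi.2 fun i => ?_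
      by_cases hi : ε i
      · simp only [X, hi, if_true]; fun_prop
      · simp only [X, hi, if_false, Bool.false_eq_true]
        exact Complex.continuous_ofReal.continuousAt.comp (continuousAt_inv₀ one_ne_zero)
    have h2 : (fun i => (X 1 ε i : ℂ)) = 1 := by
      funext i; simp [X]
    simpa [ContinuousAt, h2] using this
  have h1 : ∀ᶠ q : ℝ in 𝓝 1, ∀ ε, Summable fun l => (w l : ℂ) * normSchur l fun i => (X q ε i : ℂ) :=
    eventually_all.2 fun ε => (hX ε).eventually h
  obtain ⟨q, hq1, hq⟩ : ∃ q : ℝ, 1 < q ∧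
      ∀ ε, Summable fun l => (w l : ℂ) * normSchur l fun i => (X q ε i : ℂ) := by
    have h2 := (h1.filter_mono nhdsWithin_le_nhds).and (self_mem_nhdsWithin (a := (1 : ℝ)) (s := Set.Ioi 1))
    obtain ⟨q, h3, h4⟩ := h2.exists
    exact ⟨q, h4, h3⟩
  have hXpos : ∀ ε i, 0 < X q ε i := fun ε i => by
    simp only [X]; split_ifs <;> positivity
  have hr : 1 < √q := by rw [Real.lt_sqrt zero_le_one]; simpa using hq1
  obtain ⟨C, hC, hC'⟩ := exists_pow_le_mul_pow (N * N) hr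
  have hq2 : ∀ ε, Summable fun l => w l *
      ((∑ T ∈ sigSet l, ∏ i, X q ε i ^ sigWeight l T i) / sigDim l) := by
    intro ε
    have h2 := hq ε
    simp only [normSchur_ofReal _ (hXpos ε)] at h2
    exact_mod_cast h2
  refine ⟨√q, hr, Summable.of_nonneg_of_le (fun l => by positivity) (fun l => ?_)
    ((summable_sum fun ε (_ : ε ∈ Finset.univ) => hq2 ε).mul_left (2 ^ (N * N) * C))⟩
  rw [Complex.norm_real, Real.norm_of_nonneg (hw l), ← Finset.mul_sum, ← mul_assoc,
    mul_comm _ (w l), mul_assoc]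
  refine mul_le_mul_of_nonneg_left ?_ (hw l)
  have hd : (0 : ℝ) < sigDim l := Nat.cast_pos.2 (sigDim_pos l)
  -- The choice of signs matching those of the coordinates of l.
  let ε0 : Fin N → Bool := fun i => decide (0 ≤ l.1 i)
  have h3 : q ^ shift l = ∏ i, X q ε0 i ^ l.1 i := by
    rw [shift, ← Finset.prod_pow_eq_pow_sum]
    refine Finset.prod_congr rfl fun i _ => ?_
    by_cases hi : 0 ≤ l.1 i
    · simp only [X, ε0, hi, decide_true, if_true]
      rw [← zpow_natCast, Int.natCast_natAbs, abs_of_nonneg hi]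
    · simp only [X, ε0, hi, decide_false, Bool.false_eq_true, if_false]
      rw [← zpow_natCast, Int.natCast_natAbs, abs_of_neg (not_le.1 hi), inv_zpow, zpow_neg]
  have h4 := prod_zpow_le_sum l (hXpos ε0)
  have h5 : q ^ shift l / sigDim l ≤
      ∑ ε, (∑ T ∈ sigSet l, ∏ i, X q ε i ^ sigWeight l T i) / sigDim l := by
    refine le_trans ?_ (Finset.single_le_sum (f := fun ε =>
      (∑ T ∈ sigSet l, ∏ i, X q ε i ^ sigWeight l T i) / (sigDim l : ℝ))
      (fun ε _ => ?_) (Finset.mem_univ ε0))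
    · rw [h3]; gcongr
    · exact div_nonneg (Finset.sum_nonneg fun T _ => Finset.prod_nonneg fun i _ =>
        (zpow_pos (hXpos ε i) _).le) hd.le
  refine le_trans ?_ (mul_le_mul_of_nonneg_left h5 (by positivity))
  have h6 : (sigDim l : ℝ) ≤ 2 ^ (N * N) * C * √q ^ shift l := by
    calc (sigDim l : ℝ) ≤ (2 * shift l + 1 : ℝ) ^ (N * N) := by exact_mod_cast sigDim_le l
      _ ≤ (2 * (shift l + 1)) ^ (N * N) := by gcongr; linarith
      _ = 2 ^ (N * N) * (shift l + 1) ^ (N * N) := by rw [mul_pow]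
      _ ≤ 2 ^ (N * N) * (C * √q ^ shift l) := by gcongr; exact hC' _
      _ = _ := by ring
  have h1 : √q ^ shift l * √q ^ shift l = q ^ shift l := by
    rw [← mul_pow, Real.mul_self_sqrt (by linarith)]
  rw [mul_div_assoc', le_div_iff₀ hd, ← h1]
  calc √q ^ shift l * sigDim l ≤ √q ^ shift l * (2 ^ (N * N) * C * √q ^ shift l) := by gcongr
    _ = _ := by ring

/-- The point masses of a probability measure. -/
noncomputable def massFn (σ : PMF (Signature N)) (l : Signature N) : ℂ := ((σ l).toReal : ℂ)

theorem IsAppropriate.expSummable {ρ : ∀ N : ℕ, PMF (Signature N)} (h : IsAppropriate ρ)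
    (hN : 1 ≤ N) : ExpSummable (massFn (ρ N)) := by
  obtain ⟨U, hU, hs⟩ := h.1 N hN
  exact expSummable_of_summable (fun l => ENNReal.toReal_nonneg)
    (eventually_of_mem hU fun x hx => hs.summable hx)

theorem hasSum_toReal (σ : PMF (Signature N)) : HasSum (fun l => (σ l).toReal) 1 := by
  have h := ENNReal.hasSum_toReal (f := σ) (by rw [σ.tsum_coe]; exact ENNReal.one_ne_top)
  rwa [← ENNReal.tsum_toReal_eq (fun l => σ.apply_ne_top l), σ.tsum_coe, ENNReal.toReal_one] at h

/-- Take coordinates between R⁻¹ and R with R^(2N²) < q. -/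
theorem eventually_normSchur_le (N : ℕ) {q : ℝ} (hq : 1 < q) :
    ∀ᶠ x in 𝓝 (1 : Fin N → ℂ), (∀ i, x i ≠ 0) ∧ ∀ l, ‖normSchur l x‖ ≤ q ^ shift l := by
  obtain ⟨R, hR1, hR⟩ : ∃ R : ℝ, 1 < R ∧ R ^ (2 * N * N) < q := by
    have h1 : ∀ᶠ R : ℝ in 𝓝 1, R ^ (2 * N * N) < q := by
      have h2 : ContinuousAt (fun R : ℝ => R ^ (2 * N * N)) 1 := by fun_prop
      exact h2.eventually (gt_mem_nhds (by simpa using hq))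
    obtain ⟨R, h3, h4⟩ := ((h1.filter_mono nhdsWithin_le_nhds).and
      (self_mem_nhdsWithin (a := (1 : ℝ)) (s := Set.Ioi 1))).exists
    exact ⟨R, h4, h3⟩
  have h1 : ∀ i : Fin N, ∀ᶠ x in 𝓝 (1 : Fin N → ℂ), R⁻¹ < ‖x i‖ ∧ ‖x i‖ < R := by
    intro i
    have h2 : ContinuousAt (fun x : Fin N → ℂ => ‖x i‖) 1 :=
      (continuous_apply i).norm.continuousAt
    exact h2.eventually ((lt_mem_nhds (by simpa using inv_lt_one_of_one_lt₀ hR1)).and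
      (gt_mem_nhds (by simpa using hR1)))
  filter_upwards [eventually_all.2 h1] with x hx
  refine ⟨fun i => norm_pos_iff.1 (lt_trans (by positivity) (hx i).1), fun l => ?_⟩
  refine (norm_normSchur_le hR1.le l fun i => ⟨(hx i).1.le, (hx i).2.le⟩).trans ?_
  rw [pow_mul]
  exact pow_le_pow_left₀ (by positivity) hR.le _

/-! ### Transition coefficients -/

/-- The coefficients of the product of two normalized Schur functions. -/
noncomputable def lrCoeff (l n : Signature N) : Signature N → ℝ :=
  (exists_normSchur_mul l n).choose_spec.choose

theorem lrCoeff_spec (l n : Signature N) : ∃ F : Finset (Signature N),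
    (∀ u, 0 ≤ lrCoeff l n u) ∧ (∀ u ∉ F, lrCoeff l n u = 0) ∧
      (∀ u ∈ F, shift u ≤ shift l + 2 * N * N * shift n) ∧
      ∀ x : Fin N → ℂ, (∀ i, x i ≠ 0) →
        normSchur l x * normSchur n x = ∑ u ∈ F, (lrCoeff l n u : ℂ) * normSchur u x :=
  ⟨_, (exists_normSchur_mul l n).choose_spec.choose_spec⟩

theorem lrCoeff_nonneg (l n u : Signature N) : 0 ≤ lrCoeff l n u :=
  (lrCoeff_spec l n).choose_spec.1 u

theorem hasSum_lrCoeff_mul (l n : Signature N) {x : Fin N → ℂ} (hx : ∀ i, x i ≠ 0) :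
    HasSum (fun u => (lrCoeff l n u : ℂ) * normSchur u x) (normSchur l x * normSchur n x) := by
  obtain ⟨F, -, h2, -, h4⟩ := lrCoeff_spec l n
  rw [h4 x hx]
  exact hasSum_sum_of_ne_finset_zero fun u hu => by simp [h2 u hu]

theorem hasSum_lrCoeff (l n : Signature N) : HasSum (lrCoeff l n) 1 := by
  have h := hasSum_lrCoeff_mul l n (x := 1) (fun _ => one_ne_zero)
  simp only [normSchur_one, mul_one] at h
  exact Complex.hasSum_ofReal.1 (by simpa using h)

/-- The shift of a signature occurring in a product is at most shift l + 2N² shift n. This is the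
origin of the power q^(2N²) in the summability hypotheses on σ below. -/
theorem lrCoeff_mul_pow_le {q : ℝ} (hq : 1 ≤ q) (l n u : Signature N) :
    lrCoeff l n u * q ^ shift u ≤ lrCoeff l n u * (q ^ shift l * (q ^ (2 * N * N)) ^ shift n) := by
  obtain ⟨F, -, h2, h3, -⟩ := lrCoeff_spec l n
  by_cases hu : u ∈ F
  · refine mul_le_mul_of_nonneg_left ?_ (lrCoeff_nonneg _ _ _)
    rw [← pow_mul, ← pow_add]
    exact pow_le_pow_right₀ hq (h3 u hu)
  · rw [h2 u hu, zero_mul, zero_mul]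

/-- The transition coefficients as averages of Littlewood–Richardson coefficients. -/
noncomputable def lrTransition (σ : PMF (Signature N)) (l u : Signature N) : ℝ :=
  ∑' n, (σ n).toReal * lrCoeff l n u

theorem lrTransition_nonneg (σ : PMF (Signature N)) (l u : Signature N) :
    0 ≤ lrTransition σ l u :=
  tsum_nonneg fun _ => mul_nonneg ENNReal.toReal_nonneg (lrCoeff_nonneg _ _ _)

theorem summable_lr {σ : PMF (Signature N)} {q : ℝ} (hq : 1 ≤ q)
    (hσ : Summable fun n => ‖massFn σ n‖ * (q ^ (2 * N * N)) ^ shift n) (l : Signature N) :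
    Summable fun p : Signature N × Signature N =>
      (σ p.1).toReal * lrCoeff l p.1 p.2 * q ^ shift p.2 := by
  have hnn : ∀ p : Signature N × Signature N,
      0 ≤ (σ p.1).toReal * (lrCoeff l p.1 p.2 * (q ^ shift l * (q ^ (2 * N * N)) ^ shift p.1)) := by
    intro p
    have := lrCoeff_nonneg l p.1 p.2
    positivity
  refine Summable.of_nonneg_of_le (fun p => ?_) (fun p => ?_)
    (f := fun p => (σ p.1).toReal *
      (lrCoeff l p.1 p.2 * (q ^ shift l * (q ^ (2 * N * N)) ^ shift p.1))) ?_
  · have := lrCoeff_nonneg l p.1 p.2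
    positivity
  · rw [mul_assoc]
    exact mul_le_mul_of_nonneg_left (lrCoeff_mul_pow_le hq _ _ _) ENNReal.toReal_nonneg
  · rw [summable_prod_of_nonneg hnn]
    refine ⟨fun n => ((hasSum_lrCoeff l n).summable.mul_right
      (q ^ shift l * (q ^ (2 * N * N)) ^ shift n)).mul_left (σ n).toReal, ?_⟩
    simp only [tsum_mul_left, tsum_mul_right, (hasSum_lrCoeff _ _).tsum_eq, one_mul]
    refine (hσ.mul_left (q ^ shift l)).congr fun n => ?_
    rw [massFn, Complex.norm_real, Real.norm_of_nonneg ENNReal.toReal_nonneg]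
    ring

theorem tsum_lr_le {σ : PMF (Signature N)} {q : ℝ} (hq : 1 ≤ q)
    (hσ : Summable fun n => ‖massFn σ n‖ * (q ^ (2 * N * N)) ^ shift n) (l n : Signature N) :
    ∑' u, (σ n).toReal * lrCoeff l n u * q ^ shift u ≤
      q ^ shift l * (‖massFn σ n‖ * (q ^ (2 * N * N)) ^ shift n) := by
  have h1 : ∀ u, (σ n).toReal * lrCoeff l n u * q ^ shift u ≤
      (σ n).toReal * (lrCoeff l n u * (q ^ shift l * (q ^ (2 * N * N)) ^ shift n)) := fun u => by
    rw [mul_assoc]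
    exact mul_le_mul_of_nonneg_left (lrCoeff_mul_pow_le hq _ _ _) ENNReal.toReal_nonneg
  have h2 := ((hasSum_lrCoeff l n).mul_right
    (q ^ shift l * (q ^ (2 * N * N)) ^ shift n)).mul_left (σ n).toReal
  refine (Summable.tsum_le_tsum h1 ((summable_lr hq hσ l).prod_factor n) h2.summable).trans ?_
  rw [h2.tsum_eq, massFn, Complex.norm_real, Real.norm_of_nonneg ENNReal.toReal_nonneg]
  apply le_of_eq
  ring

theorem hasSum_lrTransition_pow {σ : PMF (Signature N)} {q : ℝ} (hq : 1 ≤ q)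
    (hσ : Summable fun n => ‖massFn σ n‖ * (q ^ (2 * N * N)) ^ shift n) (l : Signature N) :
    Summable (fun u => lrTransition σ l u * q ^ shift u) ∧
      ∑' u, lrTransition σ l u * q ^ shift u ≤
        q ^ shift l * ∑' n, ‖massFn σ n‖ * (q ^ (2 * N * N)) ^ shift n := by
  have h1 := summable_lr hq hσ l
  have h2 : ∀ u, ∑' n, (σ n).toReal * lrCoeff l n u * q ^ shift u =
      lrTransition σ l u * q ^ shift u := fun u => by rw [tsum_mul_right, lrTransition]
  have h3 := h1.prod_symm.prod
  simp only [Prod.swap_prod_mk, h2] at h3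
  refine ⟨h3, ?_⟩
  have h4 := Summable.tsum_comm' (f := fun n u => (σ n).toReal * lrCoeff l n u * q ^ shift u)
    h1 (fun n => h1.prod_factor n) (fun u => h1.prod_symm.prod_factor u)
  simp only [h2] at h4
  have h5 : Summable fun n => ∑' u, (σ n).toReal * lrCoeff l n u * q ^ shift u := h1.prod
  have h6 := Summable.tsum_le_tsum (fun n => tsum_lr_le hq hσ l n) h5 (hσ.mul_left (q ^ shift l))
  rw [tsum_mul_left, ← h4] at h6
  exact h6

/-- Expand g over n and each product over u; the double series converges absolutely, so it may be
summed over n first. The hypothesis on x covers both uses: the torus with q = 1, and a neighbourhood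
of 1^N with q slightly larger than 1. -/
theorem hasSum_lrTransition_normSchur {σ : PMF (Signature N)} {q : ℝ} (hq : 1 ≤ q)
    (hσ : Summable fun n => ‖massFn σ n‖ * (q ^ (2 * N * N)) ^ shift n) (l : Signature N)
    {x : Fin N → ℂ} (hx : ∀ i, x i ≠ 0) (hxq : ∀ u, ‖normSchur u x‖ ≤ q ^ shift u) :
    HasSum (fun u => (lrTransition σ l u : ℂ) * normSchur u x)
      (schurGF σ x * normSchur l x) := by
  have h1 : Summable fun p : Signature N × Signature N =>
      ((σ p.1).toReal : ℂ) * lrCoeff l p.1 p.2 * normSchur p.2 x := by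
    refine Summable.of_norm_bounded (summable_lr hq hσ l) fun p => ?_
    rw [norm_mul, norm_mul, Complex.norm_real, Complex.norm_real,
      Real.norm_of_nonneg ENNReal.toReal_nonneg, Real.norm_of_nonneg (lrCoeff_nonneg _ _ _)]
    have := lrCoeff_nonneg l p.1 p.2
    gcongr
    exact hxq _
  have h2 : ∀ u, ∑' n, ((σ n).toReal : ℂ) * lrCoeff l n u * normSchur u x =
      (lrTransition σ l u : ℂ) * normSchur u x := fun u => by
    rw [tsum_mul_right, lrTransition, Complex.ofReal_tsum]
    simp
  have h3 := h1.prod_symm.prod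
  simp only [Prod.swap_prod_mk, h2] at h3
  have h4 := h1.tsum_comm' (fun n => h1.prod_factor n) (fun u => h1.prod_symm.prod_factor u)
  simp only [h2] at h4
  have h5 : ∑' u, (lrTransition σ l u : ℂ) * normSchur u x = schurGF σ x * normSchur l x := by
    rw [h4, schurGF, ← tsum_mul_right]
    refine tsum_congr fun n => ?_
    simp only [mul_assoc]
    rw [tsum_mul_left, (hasSum_lrCoeff_mul l n hx).tsum_eq]
    ring
  rw [← h5]
  exact h3.hasSum

theorem isTransition_lrTransition (σ : PMF (Signature N)) (l : Signature N) :
    IsTransition σ l (lrTransition σ l) := by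
  intro x hx
  refine hasSum_lrTransition_normSchur (q := 1) le_rfl ?_ l
    (fun i => norm_pos_iff.1 (by rw [hx i]; exact one_pos))
    (fun u => by rw [one_pow]; exact norm_normSchur_le_one u hx)
  simp only [one_pow, mul_one]
  refine (hasSum_toReal σ).summable.congr fun n => ?_
  rw [massFn, Complex.norm_real, Real.norm_of_nonneg ENNReal.toReal_nonneg]

theorem IsTransition.summable {σ : PMF (Signature N)} {l : Signature N} {st : Signature N → ℝ}
    (h : IsTransition σ l st) : Summable fun u => ‖(st u : ℂ)‖ := by
  have h1 := (h 1 (by simp)).summable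
  simp only [normSchur_one, mul_one] at h1
  exact summable_norm_iff.2 h1

theorem IsTransition.unique {σ : PMF (Signature N)} {l : Signature N} {st st' : Signature N → ℝ}
    (h : IsTransition σ l st) (h' : IsTransition σ l st') : st = st' := by
  have h1 := expansion_unique (a := fun u => (st u : ℂ) - st' u)
    (Summable.of_nonneg_of_le (fun _ => norm_nonneg _) (fun u => norm_sub_le _ _)
      (h.summable.add h'.summable)) (fun x hx => by
        simpa [sub_mul] using (h x hx).sub (h' x hx))
  funext u
  exact_mod_cast sub_eq_zero.1 (congrFun h1 u)

theorem isTransition_transition (σ : PMF (Signature N)) (l : Signature N) :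
    IsTransition σ l (transition σ l) :=
  Classical.epsilon_spec ⟨_, isTransition_lrTransition σ l⟩

/-- The coefficients defined by choice are the averaged Littlewood–Richardson coefficients, by
uniqueness on the torus. Nonnegativity and decay are visible only for the latter. -/
theorem transition_eq (σ : PMF (Signature N)) (l : Signature N) :
    transition σ l = lrTransition σ l :=
  (isTransition_transition σ l).unique (isTransition_lrTransition σ l)

theorem transition_nonneg (σ : PMF (Signature N)) (l u : Signature N) : 0 ≤ transition σ l u := by
  rw [transition_eq]
  exact lrTransition_nonneg σ l u

/-- The point 1^N lies on the torus, and the expansion there says that the coefficients add up to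
one. -/
theorem hasSum_transition (σ : PMF (Signature N)) (l : Signature N) :
    HasSum (transition σ l) 1 := by
  have h := isTransition_transition σ l 1 (by simp)
  simp only [normSchur_one, mul_one, schurGF] at h
  rw [← Complex.ofReal_tsum, (hasSum_toReal σ).tsum_eq] at h
  exact_mod_cast h

instance : Countable (Signature N) := Subtype.countable

instance : Nonempty (Signature N) := ⟨⟨0, fun _ _ _ => le_rfl⟩⟩

theorem _root_.HasSum.congr_aux {ι : Type*} {f g : ι → ℂ} {a : ℂ} (h : HasSum f a)
    (hfg : ∀ i, g i = f i) : HasSum g a := by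
  rwa [show g = f from funext hfg]

/-! ### Push-forward of weights -/

/-- The image of a weight under the transition coefficients of `σ`. -/
noncomputable def pushWeight (σ : PMF (Signature N)) (w : Signature N → ℂ) (u : Signature N) : ℂ :=
  ∑' l, w l * transition σ l u

section push

variable {σ : PMF (Signature N)} {w : Signature N → ℂ} {q : ℝ}

theorem summable_push_pow (hq : 1 ≤ q) (hw : Summable fun l => ‖w l‖ * q ^ shift l)
    (hσ : Summable fun n => ‖massFn σ n‖ * (q ^ (2 * N * N)) ^ shift n) :
    Summable fun p : Signature N × Signature N => ‖w p.1‖ * (transition σ p.1 p.2 * q ^ shift p.2) := by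
  have hnn : ∀ p : Signature N × Signature N,
      0 ≤ ‖w p.1‖ * (transition σ p.1 p.2 * q ^ shift p.2) := by
    intro p
    have := transition_nonneg σ p.1 p.2
    positivity
  rw [summable_prod_of_nonneg hnn]
  have h1 := fun l => hasSum_lrTransition_pow hq hσ l
  simp only [transition_eq]
  refine ⟨fun l => (h1 l).1.mul_left ‖w l‖, ?_⟩
  simp only [tsum_mul_left]
  refine Summable.of_nonneg_of_le (fun l => ?_) (fun l => ?_)
    (hw.mul_right (∑' n, ‖massFn σ n‖ * (q ^ (2 * N * N)) ^ shift n))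
  · refine mul_nonneg (norm_nonneg _) (tsum_nonneg fun u => ?_)
    have := lrTransition_nonneg σ l u
    positivity
  · rw [mul_assoc]
    exact mul_le_mul_of_nonneg_left (h1 l).2 (norm_nonneg _)

theorem summable_push (hq : 1 ≤ q) (hw : Summable fun l => ‖w l‖ * q ^ shift l)
    (hσ : Summable fun n => ‖massFn σ n‖ * (q ^ (2 * N * N)) ^ shift n) {g : Signature N → ℂ}
    {A : ℝ} (hg : ∀ u, ‖g u‖ ≤ A * q ^ shift u) :
    Summable fun p : Signature N × Signature N => w p.1 * (transition σ p.1 p.2 * g p.2) := by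
  refine Summable.of_norm_bounded ((summable_push_pow hq hw hσ).mul_left A) fun p => ?_
  rw [norm_mul, norm_mul, Complex.norm_real, Real.norm_of_nonneg (transition_nonneg σ _ _)]
  have := transition_nonneg σ p.1 p.2
  calc ‖w p.1‖ * (transition σ p.1 p.2 * ‖g p.2‖)
      ≤ ‖w p.1‖ * (transition σ p.1 p.2 * (A * q ^ shift p.2)) := by gcongr; exact hg _
    _ = _ := by ring

/-- Duality between pushing a weight forward and averaging a test function, by exchanging two
absolutely convergent sums. -/
theorem hasSum_pushWeight (hq : 1 ≤ q) (hw : Summable fun l => ‖w l‖ * q ^ shift l)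
    (hσ : Summable fun n => ‖massFn σ n‖ * (q ^ (2 * N * N)) ^ shift n) {g : Signature N → ℂ}
    {A : ℝ} (hg : ∀ u, ‖g u‖ ≤ A * q ^ shift u) :
    HasSum (fun u => pushWeight σ w u * g u) (∑' l, w l * ∑' u, transition σ l u * g u) := by
  have h1 := summable_push hq hw hσ hg
  have h2 : ∀ u, ∑' l, w l * (transition σ l u * g u) = pushWeight σ w u * g u := fun u => by
    simp only [← mul_assoc]
    rw [tsum_mul_right, pushWeight]
  have h3 : Summable fun u => ∑' l, w l * (transition σ l u * g u) := h1.prod_symm.prod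
  have h4 := Summable.tsum_comm' (f := fun l u => w l * ((transition σ l u : ℂ) * g u))
    h1 (fun n => h1.prod_factor n) (fun u => h1.prod_symm.prod_factor u)
  simp only [h2, tsum_mul_left] at h3 h4
  rw [← h4]
  exact h3.hasSum

theorem summable_pushWeight_pow (hq : 1 ≤ q) (hw : Summable fun l => ‖w l‖ * q ^ shift l)
    (hσ : Summable fun n => ‖massFn σ n‖ * (q ^ (2 * N * N)) ^ shift n) :
    Summable fun u => ‖pushWeight σ w u‖ * q ^ shift u := by
  have h1 := summable_push_pow hq hw hσ
  have h3 : Summable fun u => ∑' l, ‖w l‖ * (transition σ l u * q ^ shift u) := h1.prod_symm.prod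
  refine Summable.of_nonneg_of_le (fun u => by positivity) (fun u => ?_) h3
  have h5 : Summable fun l => ‖w l‖ * (transition σ l u * q ^ shift u) := h1.prod_symm.prod_factor u
  have hq0 : 0 < q ^ shift u := by positivity
  have h6 : Summable fun l => ‖w l * (transition σ l u : ℂ)‖ := by
    refine (h5.mul_right (q ^ shift u)⁻¹).congr fun l => ?_
    rw [norm_mul, Complex.norm_real, Real.norm_of_nonneg (transition_nonneg σ _ _)]
    field_simp
  calc ‖pushWeight σ w u‖ * q ^ shift u
      ≤ (∑' l, ‖w l * (transition σ l u : ℂ)‖) * q ^ shift u := by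
        gcongr
        exact norm_tsum_le_tsum_norm h6
    _ = ∑' l, ‖w l‖ * (transition σ l u * q ^ shift u) := by
        rw [← tsum_mul_right]
        refine tsum_congr fun l => ?_
        rw [norm_mul, Complex.norm_real, Real.norm_of_nonneg (transition_nonneg σ _ _)]
        ring

end push

theorem ExpSummable.eventually {w : Signature N → ℂ} (hw : ExpSummable w) (k : ℕ) :
    ∀ᶠ q in 𝓝[>] (1 : ℝ), Summable fun l => ‖w l‖ * (q ^ k) ^ shift l := by
  obtain ⟨q₀, hq₀, hs⟩ := hw
  have h2 : ContinuousAt (fun R : ℝ => R ^ k) 1 := by fun_prop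
  have h1 : ∀ᶠ q : ℝ in 𝓝[>] 1, q ^ k < q₀ :=
    (h2.eventually (gt_mem_nhds (by simpa using hq₀))).filter_mono nhdsWithin_le_nhds
  filter_upwards [h1, self_mem_nhdsWithin] with q h3 h4
  have : (0 : ℝ) < q := zero_lt_one.trans h4
  exact summable_mul_pow_mono (by positivity) h3.le hs

theorem ExpSummable.eventually' {w : Signature N → ℂ} (hw : ExpSummable w) :
    ∀ᶠ q in 𝓝[>] (1 : ℝ), Summable fun l => ‖w l‖ * q ^ shift l := by
  simpa using hw.eventually 1

theorem ExpSummable.push {σ : PMF (Signature N)} {w : Signature N → ℂ} (hw : ExpSummable w)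
    (hσ : ExpSummable (massFn σ)) : ExpSummable (pushWeight σ w) := by
  obtain ⟨q, ⟨h1, h2⟩, h3⟩ :=
    ((hw.eventually'.and (hσ.eventually (2 * N * N))).and self_mem_nhdsWithin).exists
  exact ⟨q, h3, summable_pushWeight_pow (le_of_lt h3) h1 h2⟩

/-- The generating function of a weight. -/
noncomputable def genFn (w : Signature N → ℂ) (x : Fin N → ℂ) : ℂ := ∑' l, w l * normSchur l x

theorem schurGF_eq_genFn (ρ : PMF (Signature N)) : schurGF ρ = genFn (massFn ρ) := rfl

/-- The structural fact behind the chain: one step multiplies the generating function by g, whatever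
the weight is. It need not be a probability, so products with power sums are allowed. -/
theorem genFn_pushWeight {σ : PMF (Signature N)} {w : Signature N → ℂ} (hw : ExpSummable w)
    (hσ : ExpSummable (massFn σ)) :
    ∀ᶠ x in 𝓝 (1 : Fin N → ℂ), genFn (pushWeight σ w) x = schurGF σ x * genFn w x := by
  obtain ⟨q, ⟨h1, h2⟩, h3⟩ :=
    ((hw.eventually'.and (hσ.eventually (2 * N * N))).and self_mem_nhdsWithin).exists
  have h3' : 1 ≤ q := le_of_lt h3
  filter_upwards [eventually_normSchur_le N h3] with x hx
  rw [genFn, (hasSum_pushWeight h3' h1 h2 (A := 1) (g := fun u => normSchur u x)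
    (fun u => by rw [one_mul]; exact hx.2 u)).tsum_eq, genFn, ← tsum_mul_left]
  refine tsum_congr fun l => ?_
  simp only [transition_eq]
  rw [(hasSum_lrTransition_normSchur h3' h2 l hx.1 hx.2).tsum_eq]
  ring

theorem genFn_one (w : Signature N → ℂ) : genFn w 1 = ∑' l, w l := by
  simp [genFn, normSchur_one]

/-! ### Sums over trajectories -/

/-- The push-forward to the lowest level of the weight of a trajectory times the functions `φ s`. -/
noncomputable def chainMarg : ∀ {m : ℕ}, PMF (Signature N) → (Fin m → PMF (Signature N)) →
    (Fin (m + 1) → Signature N → ℂ) → Signature N → ℂ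
  | 0, ρ, _, φ => fun u => φ 0 u * massFn ρ u
  | _ + 1, ρ, σ, φ => fun u =>
      φ 0 u * pushWeight (σ 0) (chainMarg ρ (fun r => σ r.succ) (fun s => φ s.succ)) u

theorem expSummable_chainMarg : ∀ {m : ℕ} {ρ : PMF (Signature N)} {σ : Fin m → PMF (Signature N)}
    {φ : Fin (m + 1) → Signature N → ℂ}, ExpSummable (massFn ρ) →
    (∀ r, ExpSummable (massFn (σ r))) → (∀ s, PolyBdd (φ s)) → ExpSummable (chainMarg ρ σ φ)
  | 0, _, _, _, hρ, _, hφ => hρ.mul (hφ 0)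
  | _ + 1, _, _, _, hρ, hσ, hφ =>
    ((expSummable_chainMarg hρ (fun r => hσ r.succ) (fun s => hφ s.succ)).push (hσ 0)).mul (hφ 0)

theorem chainWeight_cons {m : ℕ} (ρ : PMF (Signature N)) (σ : Fin (m + 1) → PMF (Signature N))
    (u : Signature N) (l : Fin (m + 1) → Signature N) :
    chainWeight ρ σ (Fin.cons u l : Fin (m + 2) → Signature N) =
      chainWeight ρ (fun r => σ r.succ) l * transition (σ 0) (l 0) u := by
  rw [chainWeight, chainWeight, Fin.prod_univ_succ]
  have h1 : (Fin.cons u l : Fin (m + 2) → Signature N) (Fin.last (m + 1)) = l (Fin.last m) := by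
    rw [← Fin.succ_last, Fin.cons_succ]
  rw [h1]
  simp only [Fin.cons_succ, Fin.castSucc_zero, Fin.cons_zero, ← Fin.succ_castSucc]
  ring

theorem chainWeight_nonneg {m : ℕ} (ρ : PMF (Signature N)) (σ : Fin m → PMF (Signature N))
    (l : Fin (m + 1) → Signature N) : 0 ≤ chainWeight ρ σ l :=
  mul_nonneg ENNReal.toReal_nonneg (Finset.prod_nonneg fun _ _ => transition_nonneg _ _ _)

theorem tendsto_sq_one : Tendsto (fun q : ℝ => q ^ 2) (𝓝[>] 1) (𝓝[>] 1) := by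
  refine tendsto_nhdsWithin_iff.2 ⟨?_, ?_⟩
  · have h2 : ContinuousAt (fun R : ℝ => R ^ 2) 1 := by fun_prop
    simpa using h2.tendsto.mono_left nhdsWithin_le_nhds
  · filter_upwards [self_mem_nhdsWithin] with q hq
    exact one_lt_pow₀ (Set.mem_Ioi.1 hq) two_ne_zero

/-- The test function g on the lowest level is there for the induction: summing out that level
replaces g by the average of φ 0 · g over the transition. If g grows like q^shift, then φ 0 · g, and
hence its average, grows at most like (q²)^shift. This is why the statement is for all q
sufficiently close to 1, a condition stable under squaring. -/
theorem hasSum_chain : ∀ {m : ℕ} {ρ : PMF (Signature N)} {σ : Fin m → PMF (Signature N)}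
    {φ : Fin (m + 1) → Signature N → ℂ}, ExpSummable (massFn ρ) →
    (∀ r, ExpSummable (massFn (σ r))) → (∀ s, PolyBdd (φ s)) →
    ∀ᶠ q in 𝓝[>] (1 : ℝ), ∀ (g : Signature N → ℂ) (A : ℝ), (∀ u, ‖g u‖ ≤ A * q ^ shift u) →
      HasSum (fun l : Fin (m + 1) → Signature N =>
        (chainWeight ρ σ l : ℂ) * (∏ s, φ s (l s)) * g (l 0)) (∑' u, chainMarg ρ σ φ u * g u)
  | 0, ρ, σ, φ, hρ, hσ, hφ => by
    filter_upwards [(hρ.mul (hφ 0)).eventually', self_mem_nhdsWithin] with q hq hq1 g A hg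
    have h1 : Summable fun u => chainMarg ρ σ φ u * g u := by
      refine Summable.of_norm_bounded (hq.mul_left A) fun u => ?_
      rw [norm_mul, chainMarg]
      calc _ ≤ ‖φ 0 u * massFn ρ u‖ * (A * q ^ shift u) := by gcongr; exact hg u
        _ = _ := by ring
    have h2 := (Equiv.funUnique (Fin 1) (Signature N)).hasSum_iff.2 h1.hasSum
    refine h2.congr_aux fun l => ?_
    simp only [Function.comp_apply, Equiv.funUnique_apply, chainMarg, chainWeight, massFn]
    simp
    left
    ring
  | m + 1, ρ, σ, φ, hρ, hσ, hφ => by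
    have ih := hasSum_chain (φ := fun s => φ s.succ) hρ (fun r => hσ r.succ) (fun s => hφ s.succ)
    have hW := expSummable_chainMarg hρ (fun r => hσ r.succ) (fun s => hφ s.succ)
    obtain ⟨A₀, K, hA₀, hK⟩ := hφ 0
    filter_upwards [tendsto_sq_one.eventually ih, hW.eventually 2,
      tendsto_sq_one.eventually ((hσ 0).eventually (2 * N * N)), self_mem_nhdsWithin]
      with q hq hqW hqσ hq1 g A hg
    have hq1 : 1 < q := hq1
    have hq2 : 1 ≤ q ^ 2 := one_le_pow₀ hq1.le
    have hA : 0 ≤ A := by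
      have h := (norm_nonneg _).trans (hg (Classical.arbitrary (Signature N)))
      exact nonneg_of_mul_nonneg_left h (by positivity)
    obtain ⟨C, hC, hC'⟩ := exists_pow_le_mul_pow K hq1
    set W := chainMarg ρ (fun r => σ r.succ) (fun s => φ s.succ) with hWdef
    have hg2 : ∀ u, ‖φ 0 u * g u‖ ≤ (A₀ * C * A) * (q ^ 2) ^ shift u := by
      intro u
      rw [norm_mul]
      calc ‖φ 0 u‖ * ‖g u‖ ≤ (A₀ * (C * q ^ shift u)) * (A * q ^ shift u) := by
            gcongr
            · exact (hK u).trans (by gcongr; exact hC' _)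
            · exact hg u
        _ = _ := by rw [← pow_mul, mul_comm 2, pow_mul]; ring
    have hst := fun l => hasSum_lrTransition_pow hq2 hqσ l
    simp only [← transition_eq] at hst
    set M := ∑' n, ‖massFn (σ 0) n‖ * ((q ^ 2) ^ (2 * N * N)) ^ shift n with hM
    have hM0 : 0 ≤ M := tsum_nonneg fun n => by positivity
    have hG : ∀ l, Summable (fun u => ‖(transition (σ 0) l u : ℂ) * (φ 0 u * g u)‖) ∧
        ∑' u, ‖(transition (σ 0) l u : ℂ) * (φ 0 u * g u)‖ ≤ (A₀ * C * A * M) * (q ^ 2) ^ shift l := by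
      intro l
      have hle : ∀ u, ‖(transition (σ 0) l u : ℂ) * (φ 0 u * g u)‖ ≤
          (A₀ * C * A) * (transition (σ 0) l u * (q ^ 2) ^ shift u) := by
        intro u
        rw [norm_mul, Complex.norm_real, Real.norm_of_nonneg (transition_nonneg _ _ _)]
        calc _ ≤ transition (σ 0) l u * ((A₀ * C * A) * (q ^ 2) ^ shift u) :=
              mul_le_mul_of_nonneg_left (hg2 u) (transition_nonneg _ _ _)
          _ = _ := by ring
      have h1 : Summable (fun u => ‖(transition (σ 0) l u : ℂ) * (φ 0 u * g u)‖) :=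
        Summable.of_nonneg_of_le (fun u => norm_nonneg _) hle ((hst l).1.mul_left _)
      refine ⟨h1, (Summable.tsum_le_tsum hle h1 ((hst l).1.mul_left _)).trans ?_⟩
      rw [tsum_mul_left]
      calc _ ≤ (A₀ * C * A) * ((q ^ 2) ^ shift l * M) := by
            gcongr
            exact (hst l).2
        _ = _ := by ring
    let F : (Fin (m + 1) → Signature N) × Signature N → ℂ := fun p =>
      (chainWeight ρ (fun r => σ r.succ) p.1 * ∏ s : Fin (m + 1), φ s.succ (p.1 s)) *
        (transition (σ 0) (p.1 0) p.2 * (φ 0 p.2 * g p.2))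
    have hF : Summable F := by
      rw [← summable_norm_iff, summable_prod_of_nonneg (fun p => norm_nonneg _)]
      refine ⟨fun l => ?_, ?_⟩
      · simp only [F]
        exact ((hG (l 0)).1.mul_left _).congr fun u => (norm_mul _ _).symm
      · have h1 := (hq (fun u => (((A₀ * C * A * M) * (q ^ 2) ^ shift u : ℝ) : ℂ))
          (A₀ * C * A * M) (fun u => by
            rw [Complex.norm_real, Real.norm_of_nonneg (by positivity)])).summable.norm
        refine Summable.of_nonneg_of_le (fun l => tsum_nonneg fun u => norm_nonneg _)
          (fun l => ?_) h1
        simp only [F]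
        rw [norm_mul _ (((A₀ * C * A * M) * (q ^ 2) ^ shift (l 0) : ℝ) : ℂ), Complex.norm_real,
          Real.norm_of_nonneg (by positivity)]
        simp only [norm_mul (_ * _) (_ * (_ * _))]
        rw [tsum_mul_left]
        exact mul_le_mul_of_nonneg_left (hG (l 0)).2 (norm_nonneg _)
    have hval : ∑' p, F p = ∑' u, chainMarg ρ σ φ u * g u := by
      rw [hF.tsum_prod' fun l => hF.prod_factor l]
      simp only [F, tsum_mul_left]
      rw [(hq (fun l => ∑' u, (transition (σ 0) l u : ℂ) * (φ 0 u * g u)) (A₀ * C * A * M)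
        (fun l => (norm_tsum_le_tsum_norm (hG l).1).trans (hG l).2)).tsum_eq]
      have h2 := (hasSum_pushWeight hq2 hqW hqσ hg2).tsum_eq
      rw [← h2]
      refine tsum_congr fun u => ?_
      rw [chainMarg]
      ring
    let e : (Fin (m + 1) → Signature N) × Signature N ≃ (Fin (m + 2) → Signature N) :=
      (Equiv.prodComm _ _).trans (Fin.consEquiv fun _ => Signature N)
    rw [← e.hasSum_iff, ← hval]
    refine hF.hasSum.congr_aux fun p => ?_
    obtain ⟨l, u⟩ := p
    change (chainWeight ρ σ (Fin.cons u l : Fin (m + 2) → Signature N) : ℂ) *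
      (∏ s, φ s ((Fin.cons u l : Fin (m + 2) → Signature N) s)) *
      g ((Fin.cons u l : Fin (m + 2) → Signature N) 0) = F (l, u)
    rw [chainWeight_cons, Fin.prod_univ_succ]
    simp only [Fin.cons_zero, Fin.cons_succ, F]
    push_cast
    ring

/-! ### The chain measure -/

theorem integral_chainMeasure {m : ℕ} (ρ : PMF (Signature N)) (σ : Fin m → PMF (Signature N))
    {E : Type*} [NormedAddCommGroup E] [NormedSpace ℝ E] [FiniteDimensional ℝ E]
    (f : (Fin (m + 1) → Signature N) → E) :
    ∫ l, f l ∂(chainMeasure ρ σ) = ∑' l, chainWeight ρ σ l • f l := by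
  rw [chainMeasure, integral_sum_dirac (fun _ => ENNReal.ofReal_ne_top)]
  simp only [ENNReal.toReal_ofReal (chainWeight_nonneg ρ σ _)]

theorem integrable_chainMeasure_iff {m : ℕ} (ρ : PMF (Signature N))
    (σ : Fin m → PMF (Signature N)) {E : Type*} [NormedAddCommGroup E]
    (f : (Fin (m + 1) → Signature N) → E) :
    Integrable f (chainMeasure ρ σ) ↔ Summable fun l => chainWeight ρ σ l * ‖f l‖ := by
  rw [chainMeasure, integrable_sum_dirac_iff (fun _ => ENNReal.ofReal_ne_top)]
  simp only [ENNReal.toReal_ofReal (chainWeight_nonneg ρ σ _)]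

theorem hasSum_chain_prod
    {m : ℕ} {ρ : PMF (Signature N)} {σ : Fin m → PMF (Signature N)}
    (hρ : ExpSummable (massFn ρ)) (hσ : ∀ r, ExpSummable (massFn (σ r)))
    {φ : Fin (m + 1) → Signature N → ℂ} (hφ : ∀ s, PolyBdd (φ s)) :
    HasSum (fun l : Fin (m + 1) → Signature N => (chainWeight ρ σ l : ℂ) * ∏ s, φ s (l s))
      (∑' u, chainMarg ρ σ φ u) := by
  obtain ⟨q, h1, h2⟩ := ((hasSum_chain hρ hσ hφ).and self_mem_nhdsWithin).exists
  have h2 : 1 < q := h2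
  simpa using h1 (fun _ => 1) 1 (fun u => by
    rw [norm_one, one_mul]; exact one_le_pow₀ h2.le)

theorem integrable_chain_prod
    {m : ℕ} {ρ : PMF (Signature N)} {σ : Fin m → PMF (Signature N)}
    (hρ : ExpSummable (massFn ρ)) (hσ : ∀ r, ExpSummable (massFn (σ r)))
    {φ : Fin (m + 1) → Signature N → ℂ} (hφ : ∀ s, PolyBdd (φ s)) :
    Integrable (fun l => ∏ s, φ s (l s)) (chainMeasure ρ σ) := by
  rw [integrable_chainMeasure_iff]
  refine (hasSum_chain_prod hρ hσ hφ).summable.norm.congr fun l => ?_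
  rw [norm_mul, Complex.norm_real, Real.norm_of_nonneg (chainWeight_nonneg _ _ _)]

/-- An expectation along the whole trajectory is the total mass of the weight pushed down to the
lowest level, and total mass is the value of the generating function at 1^N. -/
theorem integral_chain_prod
    {m : ℕ} {ρ : PMF (Signature N)} {σ : Fin m → PMF (Signature N)}
    (hρ : ExpSummable (massFn ρ)) (hσ : ∀ r, ExpSummable (massFn (σ r)))
    {φ : Fin (m + 1) → Signature N → ℂ} (hφ : ∀ s, PolyBdd (φ s)) :
    ∫ l, ∏ s, φ s (l s) ∂(chainMeasure ρ σ) = genFn (chainMarg ρ σ φ) 1 := by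
  rw [integral_chainMeasure, genFn_one, ← (hasSum_chain_prod hρ hσ hφ).tsum_eq]
  simp only [Complex.real_smul]

theorem polyBdd_const (c : ℂ) : PolyBdd (N := N) fun _ => c :=
  ⟨‖c‖, 0, norm_nonneg _, fun l => by simp⟩

theorem PolyBdd.mul {φ ψ : Signature N → ℂ} (h : PolyBdd φ) (h' : PolyBdd ψ) :
    PolyBdd fun l => φ l * ψ l := by
  obtain ⟨A, K, hA, hK⟩ := h
  obtain ⟨A', K', hA', hK'⟩ := h'
  refine ⟨A * A', K + K', by positivity, fun l => ?_⟩
  rw [norm_mul, pow_add]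
  calc ‖φ l‖ * ‖ψ l‖ ≤ (A * (shift l + 1 : ℝ) ^ K) * (A' * (shift l + 1 : ℝ) ^ K') :=
        mul_le_mul (hK l) (hK' l) (norm_nonneg _) (by positivity)
    _ = _ := by ring

theorem PolyBdd.sub {φ ψ : Signature N → ℂ} (h : PolyBdd φ) (h' : PolyBdd ψ) :
    PolyBdd fun l => φ l - ψ l := by
  obtain ⟨A, K, hA, hK⟩ := h
  obtain ⟨A', K', hA', hK'⟩ := h'
  refine ⟨A + A', max K K', by positivity, fun l => ?_⟩
  have h1 : (1 : ℝ) ≤ shift l + 1 := by simp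
  calc ‖φ l - ψ l‖ ≤ ‖φ l‖ + ‖ψ l‖ := norm_sub_le _ _
    _ ≤ A * (shift l + 1 : ℝ) ^ max K K' + A' * (shift l + 1 : ℝ) ^ max K K' := by
        refine add_le_add ((hK l).trans ?_) ((hK' l).trans ?_)
        · gcongr
          exact le_max_left _ _
        · gcongr
          exact le_max_right _ _
    _ = _ := by ring

/-- The shifted power sums of one signature. -/
noncomputable def sigPower (k : ℕ) (l : Signature N) : ℝ :=
  ∑ i : Fin N, ((l.1 i : ℝ) + N - ((i : ℕ) + 1)) ^ k

theorem powerSum_eq {m : ℕ} (k : ℕ) (s : Fin (m + 1)) (l : Fin (m + 1) → Signature N) :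
    powerSum k s l = sigPower k (l s) := rfl

theorem polyBdd_sigPower (k : ℕ) : PolyBdd (N := N) fun l => (sigPower k l : ℂ) := by
  refine ⟨N * (N + 1 : ℝ) ^ k, k, by positivity, fun l => ?_⟩
  rw [Complex.norm_real, sigPower]
  refine (norm_sum_le _ _).trans ((Finset.sum_le_sum (g := fun _ =>
    ((N + 1 : ℝ) * (shift l + 1)) ^ k) fun i _ => ?_).trans ?_)
  · rw [norm_pow]
    refine pow_le_pow_left₀ (norm_nonneg _) ?_ k
    have h1 : |((l.1 i : ℤ) : ℝ)| ≤ shift l := by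
      have := natAbs_le_shift l i
      rw [← Int.cast_abs, Int.abs_eq_natAbs]
      exact_mod_cast this
    have h2 := abs_le.1 h1
    have h3 : ((i : ℕ) : ℝ) + 1 ≤ N := by exact_mod_cast i.2
    have h4 : (0 : ℝ) ≤ (i : ℕ) := Nat.cast_nonneg _
    have h5 : (0 : ℝ) ≤ shift l := Nat.cast_nonneg _
    have h6 : (0 : ℝ) ≤ N * shift l := by positivity
    rw [Real.norm_eq_abs, abs_le]
    constructor <;> nlinarith
  · rw [Finset.sum_const, Finset.card_univ, Fintype.card_fin, nsmul_eq_mul, mul_pow]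
    apply le_of_eq
    ring

/-- Pushing forward preserves total mass, since the transition coefficients out of every signature
add up to one. -/
theorem isProbabilityMeasure_chainMeasure
    {m : ℕ} {ρ : PMF (Signature N)} {σ : Fin m → PMF (Signature N)}
    (hρ : ExpSummable (massFn ρ)) (hσ : ∀ r, ExpSummable (massFn (σ r))) :
    IsProbabilityMeasure (chainMeasure ρ σ) := by
  have key : ∀ {m : ℕ} {σ : Fin m → PMF (Signature N)}, (∀ r, ExpSummable (massFn (σ r))) →
      ∑' u, chainMarg ρ σ (fun _ _ => 1) u = 1 := by
    intro m
    induction m with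
    | zero =>
      intro σ _
      simp only [chainMarg, one_mul, massFn]
      rw [← Complex.ofReal_tsum, (hasSum_toReal ρ).tsum_eq, Complex.ofReal_one]
    | succ m ih =>
      intro σ hσ
      have hW := expSummable_chainMarg (φ := fun _ _ => 1) hρ (fun r => hσ r.succ)
        (fun s => polyBdd_const 1)
      obtain ⟨q, ⟨h1, h2⟩, h3⟩ := ((hW.eventually'.and
        ((hσ 0).eventually (2 * N * N))).and self_mem_nhdsWithin).exists
      have h3 : 1 < q := h3
      have h4 := hasSum_pushWeight (g := fun _ => 1) h3.le h1 h2 (A := 1)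
        (fun u => by rw [norm_one, one_mul]; exact one_le_pow₀ h3.le)
      simp only [mul_one, ← Complex.ofReal_tsum, (hasSum_transition _ _).tsum_eq,
        Complex.ofReal_one] at h4
      simp only [chainMarg, one_mul]
      rw [h4.tsum_eq]
      exact ih fun r => hσ r.succ
  have h1 := hasSum_chain_prod (φ := fun _ _ => 1) hρ hσ (fun s => polyBdd_const 1)
  simp only [Finset.prod_const_one, mul_one, key hσ] at h1
  have h2 : HasSum (chainWeight ρ σ) 1 := Complex.hasSum_ofReal.1 (by simpa using h1)
  constructor
  rw [chainMeasure, Measure.sum_apply _ MeasurableSet.univ]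
  simp only [Measure.smul_apply, measure_univ, smul_eq_mul, mul_one]
  rw [← ENNReal.ofReal_tsum_of_nonneg (chainWeight_nonneg ρ σ) h2.summable, h2.tsum_eq,
    ENNReal.ofReal_one]

theorem polyBdd_pow {φ : Signature N → ℂ} (h : PolyBdd φ) (n : ℕ) : PolyBdd fun l => φ l ^ n := by
  induction n with
  | zero => simpa using polyBdd_const 1
  | succ n ih => simpa only [pow_succ] using ih.mul h

theorem memLp_powerSum
    {m : ℕ} {ρ : PMF (Signature N)} {σ : Fin m → PMF (Signature N)}
    (hρ : ExpSummable (massFn ρ)) (hσ : ∀ r, ExpSummable (massFn (σ r)))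
    (k : ℕ) (s : Fin (m + 1)) (q : ℕ) :
    MemLp (powerSum k s) q (chainMeasure ρ σ) := by
  have hae : AEStronglyMeasurable (powerSum (N := N) k s) (chainMeasure ρ σ) :=
    (measurable_of_countable _).aestronglyMeasurable
  rcases eq_or_ne q 0 with rfl | hq
  · simpa using memLp_zero_iff_aestronglyMeasurable.2 hae
  rw [← integrable_norm_rpow_iff hae (by exact_mod_cast hq) (ENNReal.natCast_ne_top q)]
  have h1 := integrable_chain_prod (φ := fun s' l => if s' = s then (sigPower k l : ℂ) ^ q else 1)
    hρ hσ (fun s' => by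
      by_cases h : s' = s
      · simpa only [h, if_true] using polyBdd_pow (polyBdd_sigPower k) q
      · simpa only [h, if_false] using polyBdd_const 1)
  refine h1.norm.congr (Eventually.of_forall fun l => ?_)
  simp only [Finset.prod_ite_eq', Finset.mem_univ, if_true, norm_pow, Complex.norm_real,
    powerSum_eq, ENNReal.toReal_natCast, Real.rpow_natCast]

/-! ### Laurent series near `(1, …, 1)` -/

/-- The Laurent monomial with exponent `n`. -/
noncomputable def laurentMonomial (n : Fin N → ℤ) (x : Fin N → ℂ) : ℂ := ∏ i, x i ^ n i

/-- The differential at `x` of a function with logarithmic derivatives `g i / x i`. -/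
noncomputable def logDifferential (g : Fin N → ℂ) (x : Fin N → ℂ) : (Fin N → ℂ) →L[ℂ] ℂ :=
  ∑ i, ((x i)⁻¹ * g i) • ContinuousLinearMap.proj (R := ℂ) (φ := fun _ : Fin N => ℂ) i

theorem hasFDerivAt_laurentMonomial (n : Fin N → ℤ) {x : Fin N → ℂ} (hx : ∀ i, x i ≠ 0) :
    HasFDerivAt (laurentMonomial n) (logDifferential (fun i => n i * laurentMonomial n x) x) x := by
  have h1 : ∀ i : Fin N, HasFDerivAt (fun x : Fin N → ℂ => x i ^ n i)
      (((n i : ℂ) * x i ^ (n i - 1)) •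
        ContinuousLinearMap.proj (R := ℂ) (φ := fun _ : Fin N => ℂ) i) x := fun i =>
    HasDerivAt.comp_hasFDerivAt (f := fun y : Fin N → ℂ => y i) x
      (hasDerivAt_zpow (n i) (x i) (Or.inl (hx i))) (hasFDerivAt_apply i x)
  have h2 := HasFDerivAt.finsetProd (u := Finset.univ) (fun i _ => h1 i)
  refine h2.congr_fderiv ?_
  rw [logDifferential]
  refine Finset.sum_congr rfl fun i _ => ?_
  rw [smul_smul]
  congr 1
  rw [laurentMonomial, ← Finset.mul_prod_erase Finset.univ (fun i => x i ^ n i) (Finset.mem_univ i),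
    zpow_sub_one₀ (hx i)]
  ring

section laurent

variable {ι : Type*} {b : ι → ℂ} {n : ι → Fin N → ℤ}

/-- The coefficients `b` decay exponentially in terms of the exponents `n`. -/
def LaurentBdd (b : ι → ℂ) (n : ι → Fin N → ℤ) : Prop :=
  ∃ (s : ι → ℕ) (q : ℝ), 1 < q ∧ (∀ j i, (n j i).natAbs ≤ s j) ∧ Summable fun j => ‖b j‖ * q ^ s j

/-- The sum of the Laurent series with coefficients `b` and exponents `n`. -/
noncomputable def laurentSum (b : ι → ℂ) (n : ι → Fin N → ℤ) (x : Fin N → ℂ) : ℂ :=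
  ∑' j, b j * laurentMonomial (n j) x

theorem LaurentBdd.mul_exp (h : LaurentBdd b n) (i : Fin N) :
    LaurentBdd (fun j => b j * n j i) n := by
  obtain ⟨s, q, hq, hs, hsum⟩ := h
  have hr : 1 < √q := by rw [Real.lt_sqrt (by norm_num)]; simpa using hq
  obtain ⟨C, hC, hC'⟩ := exists_pow_le_mul_pow 1 hr
  refine ⟨s, √q, hr, hs, Summable.of_nonneg_of_le (fun l => by positivity) (fun j => ?_)
    (hsum.mul_left C)⟩
  have h1 : √q ^ s j * √q ^ s j = q ^ s j := by
    rw [← mul_pow, Real.mul_self_sqrt (by linarith)]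
  have h2 : ‖((n j i : ℤ) : ℂ)‖ ≤ (s j + 1 : ℝ) ^ 1 := by
    rw [Complex.norm_intCast, pow_one, ← Int.cast_abs, Int.abs_eq_natAbs]
    exact_mod_cast (hs j i).trans (Nat.le_succ _)
  calc ‖b j * n j i‖ * √q ^ s j ≤ (‖b j‖ * (C * √q ^ s j)) * √q ^ s j := by
        rw [norm_mul]
        gcongr
        exact h2.trans (hC' _)
    _ = C * (‖b j‖ * (√q ^ s j * √q ^ s j)) := by ring
    _ = _ := by rw [h1]

/-- On R⁻¹ ≤ |x_i| ≤ R with R^N smaller than the decay rates, the series and its termwise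
derivatives have summable majorants. -/
theorem LaurentBdd.exists_hasFDerivAt (h : LaurentBdd b n) :
    ∀ᶠ x in 𝓝 (1 : Fin N → ℂ), (∀ i, x i ≠ 0) ∧ Summable (fun j => b j * laurentMonomial (n j) x) ∧
      HasFDerivAt (laurentSum b n)
        (logDifferential (fun i => laurentSum (fun j => b j * n j i) n x) x) x := by
  have hd : ∀ i, LaurentBdd (fun j => b j * n j i) n := fun i => h.mul_exp i
  obtain ⟨s, q, hq, hs, hsum⟩ := h
  choose s' q' hq' hs' hsum' using hd
  have e1 : ∀ q : ℝ, 1 < q → ∀ᶠ R : ℝ in 𝓝[>] 1, R ^ N < q := fun q hq => by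
    have h2 : ContinuousAt (fun R : ℝ => R ^ N) 1 := by fun_prop
    exact (h2.eventually (gt_mem_nhds (by simpa using hq))).filter_mono nhdsWithin_le_nhds
  obtain ⟨R, ⟨hRq, hRq'⟩, hR1⟩ := (((e1 q hq).and
    (eventually_all.2 fun i => e1 (q' i) (hq' i))).and self_mem_nhdsWithin).exists
  have hR1 : 1 < R := hR1
  have hR0 : 0 < R := by linarith
  have hRi : R⁻¹ < 1 := inv_lt_one_of_one_lt₀ hR1
  -- The ball of this radius lies in the region R⁻¹ ≤ |x_i| ≤ R, because R + R⁻¹ ≥ 2.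
  set δ : ℝ := 1 - R⁻¹ with hδ
  have hδ0 : 0 < δ := by simp only [hδ]; linarith
  have hδ1 : 1 + δ ≤ R := by
    have : R * R⁻¹ = 1 := mul_inv_cancel₀ hR0.ne'
    have h3 : 0 < R⁻¹ := by positivity
    nlinarith [sq_nonneg (R - 1)]
  have hball : ∀ x ∈ Metric.ball (1 : Fin N → ℂ) δ, ∀ i, R⁻¹ ≤ ‖x i‖ ∧ ‖x i‖ ≤ R := by
    intro x hx i
    have h1 : ‖x i - 1‖ < δ := by
      have := (norm_le_pi_norm (x - 1) i).trans_lt (mem_ball_iff_norm.1 hx)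
      simpa using this
    have h2 : ‖x i‖ ≤ ‖x i - 1‖ + 1 := by
      simpa using norm_add_le (x i - 1) 1
    have h3 : 1 ≤ ‖x i - 1‖ + ‖x i‖ := by
      have := norm_sub_le (x i) (x i - 1)
      simp only [sub_sub_cancel, norm_one] at this
      linarith
    constructor <;> linarith
  have hne : ∀ x ∈ Metric.ball (1 : Fin N → ℂ) δ, ∀ i, x i ≠ 0 := fun x hx i =>
    norm_pos_iff.1 ((inv_pos.2 hR0).trans_le (hball x hx i).1)
  have hmon : ∀ x ∈ Metric.ball (1 : Fin N → ℂ) δ, ∀ (m : Fin N → ℤ) (k : ℕ),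
      (∀ i, (m i).natAbs ≤ k) → ∀ q, R ^ N < q → ‖laurentMonomial m x‖ ≤ q ^ k := by
    intro x hx m k hm q hq
    rw [laurentMonomial, norm_prod]
    calc _ ≤ ∏ _i : Fin N, R ^ k := Finset.prod_le_prod (fun _ _ => norm_nonneg _) fun i _ =>
          norm_zpow_le hR1.le (hball x hx i).1 (hball x hx i).2 _ (hm i)
      _ = (R ^ N) ^ k := by
          rw [Finset.prod_const, Finset.card_univ, Fintype.card_fin, ← pow_mul, ← pow_mul, mul_comm]
      _ ≤ q ^ k := by gcongr
  have hS : ∀ x ∈ Metric.ball (1 : Fin N → ℂ) δ,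
      Summable fun j => b j * laurentMonomial (n j) x := fun x hx => by
    refine Summable.of_norm_bounded hsum fun j => ?_
    rw [norm_mul]
    gcongr
    exact hmon x hx _ _ (hs j) q hRq
  have hS' : ∀ i, ∀ x ∈ Metric.ball (1 : Fin N → ℂ) δ,
      Summable fun j => (b j * n j i) * laurentMonomial (n j) x := fun i x hx => by
    refine Summable.of_norm_bounded (hsum' i) fun j => ?_
    rw [norm_mul]
    gcongr
    exact hmon x hx _ _ (hs' i j) _ (hRq' i)
  have hproj : ∀ i : Fin N,
      ‖ContinuousLinearMap.proj (R := ℂ) (φ := fun _ : Fin N => ℂ) i‖ ≤ 1 := fun i =>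
    ContinuousLinearMap.opNorm_le_bound _ zero_le_one fun v => by
      simpa using norm_le_pi_norm v i
  filter_upwards [Metric.ball_mem_nhds _ hδ0] with x hx
  refine ⟨hne x hx, hS x hx, ?_⟩
  have key := hasFDerivAt_tsum_of_isPreconnected
    (u := fun j => ∑ i, R * (‖b j * n j i‖ * q' i ^ s' i j))
    (f := fun j x => b j * laurentMonomial (n j) x)
    (f' := fun j x => b j • logDifferential (fun i => n j i * laurentMonomial (n j) x) x)
    (s := Metric.ball (1 : Fin N → ℂ) δ) (x₀ := 1) (x := x)
    (summable_sum fun i _ => (hsum' i).mul_left R) Metric.isOpen_ball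
    (convex_ball _ _).isPreconnected
    (fun j x hx => (hasFDerivAt_laurentMonomial (n j) (hne x hx)).const_mul (b j))
    (fun j x hx => by
      rw [logDifferential, Finset.smul_sum]
      refine (norm_sum_le _ _).trans (Finset.sum_le_sum fun i _ => ?_)
      rw [smul_smul, norm_smul]
      have h1 : ‖(x i)⁻¹‖ ≤ R := by
        rw [norm_inv]
        exact inv_le_of_inv_le₀ hR0 (hball x hx i).1
      calc _ ≤ ‖b j * ((x i)⁻¹ * (n j i * laurentMonomial (n j) x))‖ * 1 := by
            gcongr
            exact hproj i
        _ = ‖(x i)⁻¹‖ * (‖b j * n j i‖ * ‖laurentMonomial (n j) x‖) := by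
            simp only [norm_mul]; ring
        _ ≤ _ := by
            gcongr
            exact hmon x hx _ _ (hs' i j) _ (hRq' i))
    (Metric.mem_ball_self hδ0) (hS 1 (Metric.mem_ball_self hδ0)) hx
  refine key.congr_fderiv ?_
  have h1 : ∀ j, b j • logDifferential (fun i => n j i * laurentMonomial (n j) x) x =
      ∑ i, ((x i)⁻¹ * ((b j * n j i) * laurentMonomial (n j) x)) •
        ContinuousLinearMap.proj (R := ℂ) (φ := fun _ : Fin N => ℂ) i := fun j => by
    rw [logDifferential, Finset.smul_sum]
    refine Finset.sum_congr rfl fun i _ => ?_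
    rw [smul_smul]
    congr 1
    ring
  simp only [h1]
  rw [Summable.tsum_finsetSum fun i _ => ((hS' i x hx).mul_left (x i)⁻¹).smul_const _,
    logDifferential]
  refine Finset.sum_congr rfl fun i _ => ?_
  rw [((hS' i x hx).mul_left (x i)⁻¹).tsum_smul_const, tsum_mul_left]
  rfl

/-- The components of the derivative are x_i⁻¹ times Laurent series of the same kind, so smoothness
follows by induction on the order. -/
theorem LaurentBdd.contDiffAt (k : ℕ) : ∀ {b : ι → ℂ}, LaurentBdd b n →
    ContDiffAt ℂ k (laurentSum b n) 1 := by
  induction k with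
  | zero =>
    intro b h
    obtain ⟨u, hu, hu', h1⟩ := eventually_nhds_iff.1 h.exists_hasFDerivAt
    rw [Nat.cast_zero, contDiffAt_zero]
    exact ⟨u, hu'.mem_nhds h1, fun x hx =>
      (hu x hx).2.2.continuousAt.continuousWithinAt⟩
  | succ k ih =>
    intro b h
    rw [Nat.cast_succ, contDiffAt_succ_iff_hasFDerivAt]
    refine ⟨_, ⟨_, h.exists_hasFDerivAt, fun x hx => hx.2.2⟩, ?_⟩
    unfold logDifferential
    refine ContDiffAt.sum fun i _ => ContDiffAt.smul (ContDiffAt.mul ?_ (ih (h.mul_exp i)))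
      contDiffAt_const
    exact ContDiffAt.inv (contDiff_apply ℂ ℂ i).contDiffAt (by simp)

/-- The Euler operator `x_i ∂_i`. -/
noncomputable def eulerOp (i : Fin N) (f : (Fin N → ℂ) → ℂ) (x : Fin N → ℂ) : ℂ :=
  x i * partialDeriv (i : ℕ) f x

theorem coordVec_apply (i j : Fin N) : coordVec N i j = if j = i then 1 else 0 := by
  simp [coordVec, Fin.ext_iff]

theorem partialDeriv_congr {f g : (Fin N → ℂ) → ℂ} {x : Fin N → ℂ} (h : f =ᶠ[𝓝 x] g) (i : ℕ) :
    partialDeriv i f =ᶠ[𝓝 x] partialDeriv i g := by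
  filter_upwards [h.fderiv (𝕜 := ℂ)] with y hy
  rw [partialDeriv, partialDeriv, hy]

theorem eulerOp_congr {f g : (Fin N → ℂ) → ℂ} {x : Fin N → ℂ} (h : f =ᶠ[𝓝 x] g) (i : Fin N) :
    eulerOp i f =ᶠ[𝓝 x] eulerOp i g := by
  filter_upwards [partialDeriv_congr h i] with y hy
  rw [eulerOp, eulerOp, hy]

theorem iterate_eulerOp_congr {f g : (Fin N → ℂ) → ℂ} {x : Fin N → ℂ} (h : f =ᶠ[𝓝 x] g)
    (i : Fin N) (k : ℕ) : (eulerOp i)^[k] f =ᶠ[𝓝 x] (eulerOp i)^[k] g := by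
  induction k with
  | zero => exact h
  | succ k ih =>
    rw [Function.iterate_succ_apply', Function.iterate_succ_apply']
    exact eulerOp_congr ih i

theorem LaurentBdd.eulerOp_eq (h : LaurentBdd b n) (i : Fin N) :
    eulerOp i (laurentSum b n) =ᶠ[𝓝 1] laurentSum (fun j => b j * n j i) n := by
  filter_upwards [h.exists_hasFDerivAt] with x hx
  rw [eulerOp, partialDeriv, hx.2.2.fderiv, logDifferential]
  simp only [sum_apply, smul_apply,
    ContinuousLinearMap.proj_apply, coordVec_apply, smul_eq_mul, mul_ite, mul_one, mul_zero,
    Finset.sum_ite_eq', Finset.mem_univ, if_true]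
  rw [mul_inv_cancel_left₀ (hx.1 i)]

theorem LaurentBdd.mul_exp_pow (h : LaurentBdd b n) (i : Fin N) (k : ℕ) :
    LaurentBdd (fun j => b j * (n j i : ℂ) ^ k) n := by
  induction k with
  | zero => simpa using h
  | succ k ih => simpa only [pow_succ, ← mul_assoc] using ih.mul_exp i

theorem LaurentBdd.iterate_eulerOp_eq (h : LaurentBdd b n) (i : Fin N) (k : ℕ) :
    (eulerOp i)^[k] (laurentSum b n) =ᶠ[𝓝 1] laurentSum (fun j => b j * (n j i : ℂ) ^ k) n := by
  induction k with
  | zero => simp only [pow_zero, mul_one]; rfl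
  | succ k ih =>
    rw [Function.iterate_succ_apply']
    refine (eulerOp_congr ih i).trans (((h.mul_exp_pow i k).eulerOp_eq i).trans (.of_eq ?_))
    congr 1
    funext j
    ring

end laurent

/-! ### Generating functions as Laurent series -/

/-- The coefficients of the Laurent expansion of the Vandermonde factor times `genFn w`. -/
noncomputable def genCoeff (w : Signature N → ℂ) (p : Signature N × Equiv.Perm (Fin N)) : ℂ :=
  w p.1 * (((Equiv.Perm.sign p.2 : ℤ) : ℂ) / sigDim p.1)

/-- The exponents of the Laurent expansion of the Vandermonde factor times a generating
function. -/
def genExp (p : Signature N × Equiv.Perm (Fin N)) (i : Fin N) : ℤ := sigExp p.1 (p.2 i)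

theorem laurentBdd_genCoeff {w : Signature N → ℂ} (hw : ExpSummable w) :
    LaurentBdd (genCoeff w) (genExp (N := N)) := by
  obtain ⟨q, hq, hs⟩ := hw
  refine ⟨fun p => shift p.1 + N, q, hq, fun p i => ?_, ?_⟩
  · have h1 := natAbs_le_shift p.1 (p.2 i)
    have h2 := (p.2 i).2
    simp only [genExp, sigExp]
    omega
  · refine (summable_prod_of_nonneg fun p => by positivity).2
      ⟨fun u => Summable.of_finite, ?_⟩
    refine Summable.of_nonneg_of_le (fun u => tsum_nonneg fun _ => by positivity) (fun u => ?_)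
      (hs.mul_left ((Fintype.card (Equiv.Perm (Fin N)) : ℝ) * q ^ N))
    rw [tsum_fintype]
    calc _ ≤ ∑ _p : Equiv.Perm (Fin N), ‖w u‖ * q ^ (shift u + N) := by
          refine Finset.sum_le_sum fun p _ => ?_
          gcongr
          rw [genCoeff, norm_mul, norm_div]
          have h1 : ‖(((Equiv.Perm.sign p : ℤ)) : ℂ)‖ = 1 := by
            rcases Int.units_eq_one_or (Equiv.Perm.sign p) with h | h <;> simp [h]
          have h2 : (1 : ℝ) ≤ ‖(sigDim u : ℂ)‖ := by
            rw [Complex.norm_natCast]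
            exact_mod_cast sigDim_pos u
          simp only [h1]
          exact mul_le_of_le_one_right (norm_nonneg _) (div_le_one_of_le₀ h2 (norm_nonneg _))
      _ = _ := by
          rw [Finset.sum_const, Finset.card_univ, nsmul_eq_mul, pow_add]
          ring

/-- Multiplication by V replaces each normalized Schur function, whose number of monomials grows
with the signature, by N! monomials with coefficients ±1 divided by the dimension. -/
theorem vander_mul_genFn {w : Signature N → ℂ} (hw : ExpSummable w) :
    (fun x => vander x * genFn w x) =ᶠ[𝓝 1] laurentSum (genCoeff w) genExp := by
  filter_upwards [(laurentBdd_genCoeff hw).exists_hasFDerivAt] with x hx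
  rw [laurentSum, hx.2.1.tsum_prod' fun l => Summable.of_finite, genFn, ← tsum_mul_left]
  refine tsum_congr fun u => ?_
  rw [tsum_fintype, mul_left_comm, vander_mul_normSchur u hx.1, Finset.mul_sum]
  refine Finset.sum_congr rfl fun p _ => ?_
  rw [← mul_assoc]
  rfl

theorem contDiffAt_vander_mul_genFn {w : Signature N → ℂ} (hw : ExpSummable w) (k : ℕ) :
    ContDiffAt ℂ k (fun x => vander x * genFn w x) 1 :=
  ((laurentBdd_genCoeff hw).contDiffAt k).congr_of_eventuallyEq (vander_mul_genFn hw)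

theorem continuousAt_genFn {w : Signature N → ℂ} (hw : ExpSummable w) :
    ContinuousAt (genFn w) 1 := by
  obtain ⟨q, hq, hs⟩ := hw
  obtain ⟨u, hu, hu', h1⟩ := eventually_nhds_iff.1 (eventually_normSchur_le N hq)
  have h2 : ContinuousOn (genFn w) u := by
    refine continuousOn_tsum (fun l => ?_) hs (fun l x hx => ?_)
    · refine continuousOn_const.mul (ContinuousOn.div_const ?_ _)
      unfold schur
      refine ContinuousOn.mul (ContinuousOn.pow (ContinuousOn.inv₀ (by fun_prop) fun x hx =>
        Finset.prod_ne_zero_iff.2 fun i _ => (hu x hx).1 i) _) ?_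
      exact (MvPolynomial.continuous_eval _).continuousOn
    · rw [norm_mul]
      gcongr
      exact (hu x hx).2 l
  exact h2.continuousAt (hu'.mem_nhds h1)

/-- The exponents attached to u are the permutations of u_i + N − i, so Σ_i (x_i ∂_i)^k multiplies
all monomials coming from u by the same number, the shifted power sum of u. -/
theorem vander_mul_genFn_sigPower {w : Signature N → ℂ} (hw : ExpSummable w) (k : ℕ) (e : ℂ) :
    (fun x => vander x * genFn (fun u => ((sigPower k u : ℂ) - e) * w u) x) =ᶠ[𝓝 1]
      fun x => ∑ i, (eulerOp i)^[k] (fun x => vander x * genFn w x) x -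
        e * (vander x * genFn w x) := by
  have hb := laurentBdd_genCoeff hw
  have hw' : ExpSummable fun u => ((sigPower k u : ℂ) - e) * w u :=
    hw.mul ((polyBdd_sigPower k).sub (polyBdd_const e))
  have h1 : ∀ᶠ x in 𝓝 (1 : Fin N → ℂ), ∀ i, (eulerOp i)^[k] (fun x => vander x * genFn w x) x =
      laurentSum (fun j => genCoeff w j * (genExp j i : ℂ) ^ k) genExp x := by
    rw [eventually_all]
    exact fun i => (iterate_eulerOp_congr (vander_mul_genFn hw) i k).trans
      (hb.iterate_eulerOp_eq i k)
  have h2 : ∀ᶠ x in 𝓝 (1 : Fin N → ℂ), ∀ i, Summable fun j =>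
      genCoeff w j * (genExp j i : ℂ) ^ k * laurentMonomial (genExp j) x := by
    rw [eventually_all]
    exact fun i => (hb.mul_exp_pow i k).exists_hasFDerivAt.mono fun x hx => hx.2.1
  filter_upwards [vander_mul_genFn hw', vander_mul_genFn hw, h1, h2, hb.exists_hasFDerivAt]
    with x e1 e2 e3 e4 e5
  rw [e1, e2]
  simp only [e3]
  simp only [laurentSum]
  rw [← Summable.tsum_finsetSum fun i _ => e4 i, ← tsum_mul_left,
    ← (summable_sum fun i _ => e4 i).tsum_sub (e5.2.1.mul_left e)]
  refine tsum_congr fun p => ?_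
  have h3 : (sigPower k p.1 : ℂ) = ∑ i, (genExp p i : ℂ) ^ k := by
    rw [sigPower, show ∑ i, (genExp p i : ℂ) ^ k = ∑ i, ((sigExp p.1 i : ℤ) : ℂ) ^ k from
      Equiv.sum_comp p.2 fun i => ((sigExp p.1 i : ℤ) : ℂ) ^ k]
    push_cast
    refine Finset.sum_congr rfl fun i _ => ?_
    simp [sigExp]
  rw [genCoeff, genCoeff, h3, ← Finset.sum_mul, ← Finset.mul_sum]
  ring

/-! ### Jets at `(1, …, 1)` -/

open scoped ContDiff in
/-- `f` is smooth at `(1, …, 1)`. -/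
abbrev Smooth (f : (Fin N → ℂ) → ℂ) : Prop := ContDiffAt ℂ ∞ f 1

section smooth

variable {f g : (Fin N → ℂ) → ℂ}

theorem Smooth.eventually_differentiableAt (hf : Smooth f) :
    ∀ᶠ x in 𝓝 (1 : Fin N → ℂ), DifferentiableAt ℂ f x := by
  have h1 : ContDiffAt ℂ 1 f 1 := hf.of_le (by exact_mod_cast le_top)
  filter_upwards [h1.eventually (by simp)] with x hx
  exact hx.differentiableAt one_ne_zero

theorem Smooth.partialDeriv (hf : Smooth f) (i : ℕ) : Smooth (partialDeriv i f) :=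
  (hf.fderiv_right (by simp)).clm_apply contDiffAt_const

theorem partialDeriv_add (hf : Smooth f) (hg : Smooth g) (i : ℕ) :
    partialDeriv i (fun x => f x + g x) =ᶠ[𝓝 1]
      fun x => partialDeriv i f x + partialDeriv i g x := by
  filter_upwards [hf.eventually_differentiableAt, hg.eventually_differentiableAt] with x h1 h2
  rw [partialDeriv, fderiv_fun_add h1 h2]
  rfl

theorem partialDeriv_sub (hf : Smooth f) (hg : Smooth g) (i : ℕ) :
    partialDeriv i (fun x => f x - g x) =ᶠ[𝓝 1]
      fun x => partialDeriv i f x - partialDeriv i g x := by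
  filter_upwards [hf.eventually_differentiableAt, hg.eventually_differentiableAt] with x h1 h2
  rw [partialDeriv, fderiv_fun_sub h1 h2]
  rfl

theorem partialDeriv_mul (hf : Smooth f) (hg : Smooth g) (i : ℕ) :
    partialDeriv i (fun x => f x * g x) =ᶠ[𝓝 1]
      fun x => f x * partialDeriv i g x + g x * partialDeriv i f x := by
  filter_upwards [hf.eventually_differentiableAt, hg.eventually_differentiableAt] with x h1 h2
  rw [partialDeriv, fderiv_fun_mul h1 h2]
  simp [partialDeriv]

theorem partialDeriv_exp (hf : Smooth f) (i : ℕ) :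
    partialDeriv i (fun x => Complex.exp (f x)) =ᶠ[𝓝 1]
      fun x => Complex.exp (f x) * partialDeriv i f x := by
  filter_upwards [hf.eventually_differentiableAt] with x h1
  rw [partialDeriv, h1.hasFDerivAt.cexp.fderiv]
  simp [partialDeriv]

end smooth

/-- The partial derivatives of `f` of order less than `K` vanish at `(1, …, 1)`. -/
def VanishTo : ℕ → ((Fin N → ℂ) → ℂ) → Prop
  | 0, _ => True
  | K + 1, f => f 1 = 0 ∧ ∀ i : Fin N, VanishTo K (partialDeriv i f)

theorem VanishTo.congr {K : ℕ} : ∀ {f g : (Fin N → ℂ) → ℂ}, VanishTo K f → f =ᶠ[𝓝 1] g →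
    VanishTo K g := by
  induction K with
  | zero => exact fun _ _ => trivial
  | succ K ih => exact fun h hfg => ⟨hfg.self_of_nhds ▸ h.1, fun i =>
      ih (h.2 i) (partialDeriv_congr hfg i)⟩

theorem VanishTo.of_succ {K : ℕ} : ∀ {f : (Fin N → ℂ) → ℂ}, VanishTo (K + 1) f → VanishTo K f := by
  induction K with
  | zero => exact fun _ => trivial
  | succ K ih => exact fun h => ⟨h.1, fun i => ih (h.2 i)⟩

theorem VanishTo.mono {K L : ℕ} (hLK : L ≤ K) {f : (Fin N → ℂ) → ℂ} (h : VanishTo K f) :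
    VanishTo L f := by
  induction K with
  | zero => rwa [Nat.le_zero.1 hLK]
  | succ K ih =>
    rcases hLK.eq_or_lt with rfl | hlt
    · exact h
    · exact ih (Nat.lt_succ_iff.1 hlt) h.of_succ

theorem VanishTo.add {K : ℕ} : ∀ {f g : (Fin N → ℂ) → ℂ}, Smooth f → Smooth g → VanishTo K f →
    VanishTo K g → VanishTo K (fun x => f x + g x) := by
  induction K with
  | zero => exact fun _ _ _ _ => trivial
  | succ K ih =>
    intro f g hf hg h1 h2
    refine ⟨by simp [h1.1, h2.1], fun i => ?_⟩
    exact (ih (hf.partialDeriv i) (hg.partialDeriv i) (h1.2 i) (h2.2 i)).congr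
      (partialDeriv_add hf hg i).symm

theorem VanishTo.mul_right {K : ℕ} : ∀ {f g : (Fin N → ℂ) → ℂ}, Smooth f → Smooth g →
    VanishTo K f → VanishTo K (fun x => f x * g x) := by
  induction K with
  | zero => exact fun _ _ _ => trivial
  | succ K ih =>
    intro f g hf hg h1
    refine ⟨by simp [h1.1], fun i => ?_⟩
    refine VanishTo.congr (VanishTo.add (hf.mul (hg.partialDeriv i)) (hg.mul (hf.partialDeriv i))
      (ih hf (hg.partialDeriv i) h1.of_succ) ?_) (partialDeriv_mul hf hg i).symm
    exact (ih (hf.partialDeriv i) hg (h1.2 i)).congr (.of_eq (by funext x; ring))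

/-- Orders of vanishing add. By the product rule each partial derivative is a sum of two products
whose orders add up to one less. -/
theorem VanishTo.mul {a b : ℕ} : ∀ {f g : (Fin N → ℂ) → ℂ}, Smooth f → Smooth g →
    VanishTo a f → VanishTo b g → VanishTo (a + b) (fun x => f x * g x) := by
  induction h : a + b generalizing a b with
  | zero => exact fun _ _ _ _ => trivial
  | succ K ih =>
    intro f g hf hg h1 h2
    rcases a with _ | a
    · obtain rfl : b = K + 1 := by omega
      exact (h2.mul_right hg hf).congr (.of_eq (by funext x; ring))
    rcases b with _ | b
    · obtain rfl : a = K := by omega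
      exact h1.mul_right hf hg
    refine ⟨by simp [h1.1], fun i => ?_⟩
    refine VanishTo.congr (VanishTo.add (hf.mul (hg.partialDeriv i)) (hg.mul (hf.partialDeriv i))
      (ih (by omega) hf (hg.partialDeriv i) h1 (h2.2 i)) (ih (a := b + 1) (b := a) (by omega) hg
      (hf.partialDeriv i) h2 (h1.2 i))) (partialDeriv_mul hf hg i).symm

theorem VanishTo.of_mixedPartial {K : ℕ} : ∀ {f : (Fin N → ℂ) → ℂ},
    (∀ I : List (Fin N), I.length < K → mixedPartial (I.map Fin.val) f 1 = 0) → VanishTo K f := by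
  induction K with
  | zero => exact fun _ => trivial
  | succ K ih =>
    refine fun h => ⟨by simpa [mixedPartial] using h [] (by simp), fun i => ih fun I hI => ?_⟩
    simpa [mixedPartial] using h (I ++ [i]) (by simpa using hI)

/-- Two smooth functions have the same partial derivatives of order less than `K` at
`(1, …, 1)`. -/
structure JetEq (K : ℕ) (f g : (Fin N → ℂ) → ℂ) : Prop where
  left : Smooth f
  right : Smooth g
  vanish : VanishTo K fun x => f x - g x

section jets

variable {K : ℕ} {f g h f' g' : (Fin N → ℂ) → ℂ}

theorem JetEq.refl (hf : Smooth f) : JetEq K f f := by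
  refine ⟨hf, hf, ?_⟩
  have : VanishTo K fun _ : Fin N → ℂ => (0 : ℂ) := by
    induction K with
    | zero => trivial
    | succ K ih =>
      refine ⟨rfl, fun i => ih.congr (.of_eq ?_)⟩
      funext x
      simp [partialDeriv]
  simpa using this

theorem JetEq.of_eventuallyEq (hf : Smooth f) (hfg : f =ᶠ[𝓝 1] g) : JetEq K f g := by
  have hg : Smooth g := hf.congr_of_eventuallyEq hfg.symm
  exact ⟨hf, hg, (JetEq.refl (K := K) hf).vanish.congr (by filter_upwards [hfg] with x hx; rw [hx])⟩

theorem JetEq.mul (h1 : JetEq K f g) (h2 : JetEq K f' g') :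
    JetEq K (fun x => f x * f' x) fun x => g x * g' x := by
  refine ⟨h1.left.mul h2.left, h1.right.mul h2.right, ?_⟩
  exact (VanishTo.add ((h1.left.sub h1.right).mul h2.left) ((h2.left.sub h2.right).mul h1.right)
    (h1.vanish.mul_right (h1.left.sub h1.right) h2.left)
    (h2.vanish.mul_right (h2.left.sub h2.right) h1.right)).congr (.of_eq (by funext x; ring))

theorem JetEq.add (h1 : JetEq K f g) (h2 : JetEq K f' g') :
    JetEq K (fun x => f x + f' x) fun x => g x + g' x := by
  refine ⟨h1.left.add h2.left, h1.right.add h2.right, ?_⟩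
  exact (h1.vanish.add (h1.left.sub h1.right) (h2.left.sub h2.right) h2.vanish).congr
    (.of_eq (by funext x; ring))

theorem JetEq.sub (h1 : JetEq K f g) (h2 : JetEq K f' g') :
    JetEq K (fun x => f x - f' x) fun x => g x - g' x := by
  have := h1.add ((JetEq.refl (f := fun _ => (-1 : ℂ)) contDiffAt_const).mul h2)
  simpa [← sub_eq_add_neg] using this

theorem JetEq.symm (h : JetEq K f g) : JetEq K g f := by
  refine ⟨h.right, h.left, ?_⟩
  exact (VanishTo.mul_right (g := fun _ => -1) (h.left.sub h.right) contDiffAt_const h.vanish).congr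
    (.of_eq (by funext x; ring))

theorem JetEq.trans (h1 : JetEq K f g) (h2 : JetEq K g h) : JetEq K f h := by
  refine ⟨h1.left, h2.right, ?_⟩
  exact (h1.vanish.add (h1.left.sub h1.right) (h2.left.sub h2.right) h2.vanish).congr
    (.of_eq (by funext x; ring))

theorem JetEq.mono {L : ℕ} (h : JetEq K f g) (hLK : L ≤ K) : JetEq L f g :=
  ⟨h.left, h.right, h.vanish.mono hLK⟩

theorem JetEq.sum {ι : Type*} (s : Finset ι) {f g : ι → (Fin N → ℂ) → ℂ}
    (h : ∀ i ∈ s, JetEq K (f i) (g i)) :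
    JetEq K (fun x => ∑ i ∈ s, f i x) fun x => ∑ i ∈ s, g i x := by
  classical
  induction s using Finset.induction_on with
  | empty => simpa using JetEq.refl (contDiffAt_const (c := (0 : ℂ)))
  | insert a s ha ih =>
    simp only [Finset.sum_insert ha]
    exact (h a (Finset.mem_insert_self _ _)).add (ih fun i hi => h i (Finset.mem_insert_of_mem hi))

theorem JetEq.partialDeriv (h : JetEq (K + 1) f g) (i : Fin N) :
    JetEq K (partialDeriv i f) (partialDeriv i g) :=
  ⟨h.left.partialDeriv i, h.right.partialDeriv i,
    (h.vanish.2 i).congr (partialDeriv_sub h.left h.right i)⟩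

theorem smooth_coord (i : Fin N) : Smooth fun x : Fin N → ℂ => x i :=
  (contDiff_apply ℂ ℂ i).contDiffAt

theorem JetEq.eulerOp (h : JetEq (K + 1) f g) (i : Fin N) : JetEq K (eulerOp i f) (eulerOp i g) :=
  (JetEq.refl (smooth_coord i)).mul (h.partialDeriv i)

theorem JetEq.iterate_eulerOp {n : ℕ} (i : Fin N) : ∀ {K : ℕ}, JetEq (K + n) f g →
    JetEq K ((SchurCLT.eulerOp i)^[n] f) ((SchurCLT.eulerOp i)^[n] g) := by
  induction n with
  | zero => exact fun h => h
  | succ n ih =>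
    intro K h
    rw [Function.iterate_succ_apply', Function.iterate_succ_apply']
    exact (ih (h.mono (by omega) : JetEq (K + 1 + n) f g)).eulerOp i

/-- Multiplying by a function that vanishes to order a improves the agreement of jets by a. With f'
= V this supplies the deg V extra orders needed for evaluation at 1^N. -/
theorem JetEq.vanish_mul {a : ℕ} (h : JetEq K f g) (hf' : Smooth f') (hv : VanishTo a f') :
    JetEq (a + K) (fun x => f' x * f x) fun x => f' x * g x :=
  ⟨hf'.mul h.left, hf'.mul h.right, (hv.mul hf' (h.left.sub h.right) h.vanish).congr
    (.of_eq (by funext x; ring))⟩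

theorem JetEq.exp (h : JetEq K f g) :
    JetEq K (fun x => Complex.exp (f x)) fun x => Complex.exp (g x) := by
  refine ⟨h.left.cexp, h.right.cexp, ?_⟩
  induction K with
  | zero => trivial
  | succ K ih =>
    refine ⟨?_, fun i => ?_⟩
    · have h0 : f 1 = g 1 := sub_eq_zero.1 h.vanish.1
      simp only [h0, sub_self]
    · have h0 : JetEq K (fun x => Complex.exp (f x)) fun x => Complex.exp (g x) :=
        ⟨h.left.cexp, h.right.cexp, ih (h.mono (Nat.le_succ K))⟩
      refine ((h0.mul (h.partialDeriv i)).vanish).congr ?_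
      filter_upwards [partialDeriv_sub h.left.cexp h.right.cexp i, partialDeriv_exp h.left i,
        partialDeriv_exp h.right i] with x h1 h2 h3
      rw [h1, h2, h3]

end jets

theorem norm_fderiv_le (f : (Fin N → ℂ) → ℂ) (x : Fin N → ℂ) :
    ‖fderiv ℂ f x‖ ≤ ∑ i : Fin N, ‖partialDeriv i f x‖ := by
  refine ContinuousLinearMap.opNorm_le_bound _ (Finset.sum_nonneg fun _ _ => norm_nonneg _)
    fun v => ?_
  have h1 : v = ∑ i : Fin N, v i • coordVec N i := by
    funext j
    simp [coordVec_apply]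
  conv_lhs => rw [h1]
  rw [map_sum, Finset.sum_mul]
  refine (norm_sum_le _ _).trans (Finset.sum_le_sum fun i _ => ?_)
  rw [map_smul, norm_smul, mul_comm]
  exact mul_le_mul_of_nonneg_left (norm_le_pi_norm v i) (norm_nonneg _)

/-- Apply the mean value inequality once per order, integrating the bounds for the partial
derivatives. -/
theorem VanishTo.bound {K : ℕ} : ∀ {f : (Fin N → ℂ) → ℂ}, Smooth f → VanishTo K f →
    ∃ C, ∀ᶠ x in 𝓝 (1 : Fin N → ℂ), ‖f x‖ ≤ C * ‖x - 1‖ ^ K := by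
  induction K with
  | zero =>
    intro f hf _
    refine ⟨‖f 1‖ + 1, ?_⟩
    filter_upwards [hf.continuousAt.norm.eventually (gt_mem_nhds (lt_add_one ‖f 1‖))] with x hx
    simpa using hx.le
  | succ K ih =>
    intro f hf h
    choose C hC using fun i : Fin N => ih (hf.partialDeriv i) (h.2 i)
    refine ⟨∑ i, C i, ?_⟩
    obtain ⟨δ, hδ, hball⟩ := Metric.eventually_nhds_iff_ball.1
      (hf.eventually_differentiableAt.and (eventually_all.2 hC))
    filter_upwards [Metric.ball_mem_nhds _ hδ] with x hx
    have hsub : ∀ z ∈ Metric.closedBall (1 : Fin N → ℂ) ‖x - 1‖, z ∈ Metric.ball 1 δ := fun z hz =>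
      (Metric.mem_closedBall.1 hz).trans_lt (by rw [← dist_eq_norm]; exact hx)
    have h1 := Convex.norm_image_sub_le_of_norm_fderiv_le (𝕜 := ℂ) (f := f)
      (s := Metric.closedBall (1 : Fin N → ℂ) ‖x - 1‖) (C := (∑ i, C i) * ‖x - 1‖ ^ K) (x := 1)
      (y := x) (fun z hz => (hball z (hsub z hz)).1) (fun z hz => ?_) (convex_closedBall _ _)
      (Metric.mem_closedBall_self (norm_nonneg _)) (by rw [mem_closedBall_iff_norm])
    · rw [h.1, sub_zero] at h1
      rw [pow_succ, ← mul_assoc]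
      exact h1
    · refine (norm_fderiv_le f z).trans ?_
      rw [Finset.sum_mul]
      refine Finset.sum_le_sum fun i _ => ((hball z (hsub z hz)).2 i).trans ?_
      have h2 : ‖z - 1‖ ^ K ≤ ‖x - 1‖ ^ K := by
        have := mem_closedBall_iff_norm.1 hz
        gcongr
      -- The constants are not assumed nonnegative; a negative one forces ‖x − 1‖^K = 0, and then
      -- both powers vanish.
      rcases le_or_gt 0 (C i) with h3 | h3
      · exact mul_le_mul_of_nonneg_left h2 h3
      · have h4 := (norm_nonneg _).trans ((hball x hx).2 i)
        have h5 : ‖x - 1‖ ^ K = 0 := by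
          have h6 : 0 ≤ ‖x - 1‖ ^ K := by positivity
          nlinarith
        have h6 : ‖z - 1‖ ^ K = 0 := le_antisymm (h2.trans h5.le) (by positivity)
        rw [h5, h6]

/-! ### The Vandermonde product at `(1, …, 1)` -/

/-- The degree of the Vandermonde product. -/
def vanderDeg (N : ℕ) : ℕ :=
  ((Finset.univ : Finset (Fin N × Fin N)).filter (fun p => p.1 < p.2)).card

theorem smooth_vander : Smooth (vander (N := N)) := by
  unfold vander
  exact contDiffAt_prod fun p _ => (smooth_coord _).sub (smooth_coord _)

theorem vanishTo_vander : VanishTo (vanderDeg N) (vander (N := N)) := by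
  unfold vander vanderDeg
  generalize (Finset.univ : Finset (Fin N × Fin N)).filter (fun p => p.1 < p.2) = s
  classical
  induction s using Finset.induction_on with
  | empty => trivial
  | insert a s ha ih =>
    simp only [Finset.prod_insert ha, Finset.card_insert_of_notMem ha]
    rw [add_comm]
    refine VanishTo.mul (a := 1) ((smooth_coord a.1).sub (smooth_coord a.2))
      (contDiffAt_prod fun p _ => (smooth_coord _).sub (smooth_coord _)) ⟨by simp, fun i => trivial⟩ ih

theorem vander_line (t : ℂ) :
    vander (fun i : Fin N => 1 + t * (i : ℕ)) = t ^ vanderDeg N * vander fun i : Fin N => ((i : ℕ) : ℂ) := by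
  rw [vander, vander, vanderDeg, ← Finset.prod_const, ← Finset.prod_mul_distrib]
  exact Finset.prod_congr rfl fun p _ => by ring

theorem vander_natCast_ne_zero : vander (fun i : Fin N => ((i : ℕ) : ℂ)) ≠ 0 := by
  refine Finset.prod_ne_zero_iff.2 fun p hp => ?_
  rw [sub_ne_zero, Ne, Nat.cast_inj]
  exact fun h => (Finset.mem_filter.1 hp).2.ne (Fin.ext h)

theorem eq_of_jetEq_vander_mul {f g : (Fin N → ℂ) → ℂ} (hf : ContinuousAt f 1)
    (hg : ContinuousAt g 1)
    (h : JetEq (vanderDeg N + 1) (fun x => vander x * f x) fun x => vander x * g x) :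
    f 1 = g 1 := by
  obtain ⟨C, hC⟩ := h.vanish.bound (h.left.sub h.right)
  set γ : ℂ → Fin N → ℂ := fun t i => 1 + t * (i : ℕ) with hγ
  have hγc : Continuous γ := by fun_prop
  have hγ0 : γ 0 = 1 := by funext i; simp [hγ]
  have hγt : Tendsto γ (𝓝[≠] 0) (𝓝 1) := by
    have := hγc.tendsto 0
    rw [hγ0] at this
    exact this.mono_left nhdsWithin_le_nhds
  have h1 : Tendsto (fun t => f (γ t) - g (γ t)) (𝓝[≠] 0) (𝓝 (f 1 - g 1)) :=
    (hf.tendsto.comp hγt).sub (hg.tendsto.comp hγt)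
  have h2 : Tendsto (fun t => f (γ t) - g (γ t)) (𝓝[≠] 0) (𝓝 0) := by
    set V : ℂ := vander fun i : Fin N => ((i : ℕ) : ℂ) with hV
    have hV0 : 0 < ‖V‖ := norm_pos_iff.2 vander_natCast_ne_zero
    set M : ℝ := ‖fun i : Fin N => ((i : ℕ) : ℂ)‖ with hM
    refine squeeze_zero_norm' (a := fun t : ℂ => |C| * M ^ (vanderDeg N + 1) / ‖V‖ * ‖t‖) ?_ ?_
    · filter_upwards [hγt.eventually hC, self_mem_nhdsWithin] with t ht ht0
      have ht0 : t ≠ 0 := ht0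
      have e1 : γ t - 1 = t • fun i : Fin N => ((i : ℕ) : ℂ) := by
        funext i
        simp [hγ]
      have e2 : vander (γ t) = t ^ vanderDeg N * V := vander_line t
      rw [← mul_sub, e1, norm_smul, ← hM, e2, norm_mul, norm_mul, norm_pow] at ht
      have ht1 : 0 < ‖t‖ := norm_pos_iff.2 ht0
      have h3 : C * (‖t‖ * M) ^ (vanderDeg N + 1) ≤ |C| * (‖t‖ * M) ^ (vanderDeg N + 1) := by
        gcongr
        exact le_abs_self C
      have h4 : ‖t‖ ^ vanderDeg N * (‖V‖ * ‖f (γ t) - g (γ t)‖) ≤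
          ‖t‖ ^ vanderDeg N * (|C| * M ^ (vanderDeg N + 1) * ‖t‖) := by
        calc _ = ‖t‖ ^ vanderDeg N * ‖V‖ * ‖f (γ t) - g (γ t)‖ := by ring
          _ ≤ _ := ht.trans h3
          _ = _ := by rw [mul_pow]; ring
      have h5 := le_of_mul_le_mul_left h4 (by positivity)
      rw [div_mul_eq_mul_div, le_div_iff₀ hV0, mul_comm]
      exact h5
    · have : Tendsto (fun t : ℂ => |C| * M ^ (vanderDeg N + 1) / ‖V‖ * ‖t‖) (𝓝 0) (𝓝 0) := by
        have h := (continuous_norm.tendsto (0 : ℂ)).const_mul (|C| * M ^ (vanderDeg N + 1) / ‖V‖)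
        simpa using h
      exact this.mono_left nhdsWithin_le_nhds
  exact sub_eq_zero.1 (tendsto_nhds_unique h1 h2)

/-! ### Derivatives of the Vandermonde product -/

open Polynomial in
/-- The polynomial `∏_{l ≠ i} (T - x_l)`. -/
noncomputable def skipPoly (i : Fin N) (x : Fin N → ℂ) : ℂ[X] :=
  ∏ l ∈ Finset.univ.erase i, (X - C (x l))

theorem eval_skipPoly (i : Fin N) (x : Fin N → ℂ) (z : ℂ) :
    (skipPoly i x).eval z = ∏ l ∈ Finset.univ.erase i, (z - x l) := by
  simp [skipPoly, Polynomial.eval_prod]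

/-- As a function of the variable x_i alone, V is a constant times the product of z − x_l over l ≠
i, so derivatives of V in x_i reduce to derivatives of a polynomial in one variable. -/
theorem exists_vander_update (i : Fin N) (x : Fin N → ℂ) :
    ∃ w : ℂ, ∀ z, vander (Function.update x i z) = w * (skipPoly i x).eval z := by
  refine ⟨∏ p ∈ (Finset.univ : Finset (Fin N × Fin N)).filter (fun p => p.1 < p.2),
    (if p.1 = i then 1 else if p.2 = i then -1 else x p.1 - x p.2), fun z => ?_⟩
  have h1 : ∏ p ∈ (Finset.univ : Finset (Fin N × Fin N)).filter (fun p => p.1 < p.2),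
      (if p.1 = i ∨ p.2 = i then (z - x (if p.1 = i then p.2 else p.1)) else 1) =
        (skipPoly i x).eval z := by
    rw [eval_skipPoly, ← Finset.prod_filter]
    refine (Finset.prod_nbij' (fun l => if l < i then (l, i) else (i, l))
      (fun p => if p.1 = i then p.2 else p.1) ?_ ?_ ?_ ?_ ?_).symm
    · intro l hl
      have hl' := (Finset.mem_erase.1 hl).1
      by_cases h : l < i
      · simp [h]
      · simp [h, lt_of_le_of_ne (not_lt.1 h) (Ne.symm hl')]
    · intro p hp
      simp only [Finset.mem_filter, Finset.mem_univ, true_and] at hp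
      simp only [Finset.mem_erase, Finset.mem_univ, and_true]
      by_cases h : p.1 = i
      · rw [if_pos h, ← h]
        exact hp.1.ne'
      · rwa [if_neg h]
    · intro l hl
      have hl' := (Finset.mem_erase.1 hl).1
      by_cases h : l < i
      · simp [h, hl']
      · simp [h]
    · intro p hp
      simp only [Finset.mem_filter, Finset.mem_univ, true_and] at hp
      by_cases h : p.1 = i
      · have : ¬ p.2 < i := by rw [← h]; exact not_lt.2 hp.1.le
        simp only [h, if_true, this, if_false]
        exact Prod.ext h.symm rfl
      · have h2 : p.2 = i := hp.2.resolve_left h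
        have : p.1 < i := by rw [← h2]; exact hp.1
        simp only [h, if_false, this, if_true]
        exact Prod.ext rfl h2.symm
    · intro l hl
      have hl' := (Finset.mem_erase.1 hl).1
      by_cases h : l < i
      · simp [h, hl']
      · simp [h]
  rw [← h1, ← Finset.prod_mul_distrib, vander]
  refine Finset.prod_congr rfl fun p hp => ?_
  have hp := (Finset.mem_filter.1 hp).2
  by_cases h : p.1 = i
  · have h2 : p.2 ≠ i := by rw [← h]; exact hp.ne'
    simp [h, h2]
  · by_cases h2 : p.2 = i
    · simp [h, h2]
    · simp [h, h2]

open scoped ContDiff in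
theorem contDiff_iterate_partialDeriv_vander (i s : ℕ) :
    ContDiff ℂ ∞ ((partialDeriv i)^[s] (vander (N := N))) := by
  induction s with
  | zero =>
    simp only [Function.iterate_zero, id]
    unfold vander
    exact contDiff_prod fun p _ => (contDiff_apply ℂ ℂ _).sub (contDiff_apply ℂ ℂ _)
  | succ s ih =>
    rw [Function.iterate_succ_apply']
    exact (ih.fderiv_right (by simp)).clm_apply contDiff_const

theorem partialDeriv_update {f : (Fin N → ℂ) → ℂ} (hf : Differentiable ℂ f) (i : Fin N)
    (x : Fin N → ℂ) (z : ℂ) :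
    partialDeriv i f (Function.update x i z) = deriv (fun z => f (Function.update x i z)) z := by
  have h1 : HasDerivAt (fun z => Function.update x i z) (coordVec N i) z := by
    have := hasDerivAt_update x i z
    convert this using 1
    funext j
    simp [coordVec_apply, Pi.single_apply]
  exact ((hf _).hasFDerivAt.comp_hasDerivAt z h1).deriv.symm

theorem iterate_partialDeriv_vander (i : Fin N) (x : Fin N → ℂ) {w : ℂ}
    (hw : ∀ z, vander (Function.update x i z) = w * (skipPoly i x).eval z) (s : ℕ) :
    ∀ z, (partialDeriv i)^[s] vander (Function.update x i z) =
      w * (s.factorial * (Polynomial.hasseDeriv s (skipPoly i x)).eval z) := by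
  have key : ∀ z, (partialDeriv i)^[s] vander (Function.update x i z) =
      w * (Polynomial.derivative^[s] (skipPoly i x)).eval z := by
    induction s with
    | zero => exact hw
    | succ s ih =>
      intro z
      rw [Function.iterate_succ_apply', Function.iterate_succ_apply', partialDeriv_update
        ((contDiff_iterate_partialDeriv_vander _ s).differentiable (by simp))]
      simp only [ih]
      rw [deriv_const_mul _ (Polynomial.differentiable _).differentiableAt, Polynomial.deriv]
  intro z
  rw [key, ← Polynomial.factorial_smul_hasseDeriv]
  simp

/-- The elementary symmetric polynomial of degree `s` in the `1 / (x_i - x_l)`, `l ≠ i`. -/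
noncomputable def recipElem (s : ℕ) (i : Fin N) (x : Fin N → ℂ) : ℂ :=
  (Polynomial.hasseDeriv s (skipPoly i x)).eval (x i) / (skipPoly i x).eval (x i)

theorem eval_skipPoly_ne_zero {x : Fin N → ℂ} (hx : Function.Injective x) (i : Fin N) :
    (skipPoly i x).eval (x i) ≠ 0 := by
  rw [eval_skipPoly]
  refine Finset.prod_ne_zero_iff.2 fun l hl => sub_ne_zero.2 fun h => ?_
  exact (Finset.mem_erase.1 hl).1 (hx h).symm

theorem iterate_partialDeriv_vander_eq {x : Fin N → ℂ} (hx : Function.Injective x) (i : Fin N)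
    (s : ℕ) : (partialDeriv i)^[s] vander x = s.factorial * vander x * recipElem s i x := by
  obtain ⟨w, hw⟩ := exists_vander_update i x
  have h1 := iterate_partialDeriv_vander i x hw s (x i)
  have h2 := hw (x i)
  rw [Function.update_eq_self] at h1 h2
  rw [h1, h2, recipElem]
  field_simp [eval_skipPoly_ne_zero hx i]

theorem recipElem_zero {x : Fin N → ℂ} (hx : Function.Injective x) (i : Fin N) :
    recipElem 0 i x = 1 := by
  rw [recipElem, Polynomial.hasseDeriv_zero', div_self (eval_skipPoly_ne_zero hx i)]

open Polynomial in
theorem natDegree_skipPoly (i : Fin N) (x : Fin N → ℂ) : (skipPoly i x).natDegree = N - 1 := by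
  rw [skipPoly, natDegree_prod _ _ fun l _ => X_sub_C_ne_zero _]
  simp

open Polynomial in
theorem X_sub_C_mul_skipPoly (i : Fin N) (x : Fin N → ℂ) :
    (X - C (x i)) * skipPoly i x = ∏ l, (X - C (x l)) :=
  Finset.mul_prod_erase Finset.univ (fun l => X - C (x l)) (Finset.mem_univ i)

open Polynomial in
theorem eval_hasseDeriv_succ_prod (s : ℕ) (i : Fin N) (x : Fin N → ℂ) :
    (hasseDeriv (s + 1) (∏ l, (X - C (x l)))).eval (x i) =
      (hasseDeriv s (skipPoly i x)).eval (x i) := by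
  rw [← X_sub_C_mul_skipPoly i x, hasseDeriv_mul, eval_finsetSum,
    Finset.Nat.sum_antidiagonal_succ, Finset.sum_eq_single (0, s)]
  · simp
  · intro p hp hne
    have h1 : p.1 ≠ 0 := fun h => hne (Prod.ext h (by
      have := Finset.HasAntidiagonal.mem_antidiagonal.1 hp
      simp only at this ⊢
      omega))
    rw [map_sub, show (p.1 + 1, p.2).1 = p.1 + 1 from rfl,
      hasseDeriv_X (k := p.1 + 1) (by omega), hasseDeriv_C (k := p.1 + 1) _ (Nat.succ_pos _)]
    simp
  · intro h
    exact absurd (Finset.HasAntidiagonal.mem_antidiagonal.2 (zero_add s)) h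

open Polynomial in
-- Lagrange interpolation: both sides have degree less than N, and at the node x_i only the i-th
-- summand on the right survives.
theorem hasseDeriv_prod_eq_sum {x : Fin N → ℂ} (hx : Function.Injective x) (s : ℕ) :
    hasseDeriv (s + 1) (∏ l, (X - C (x l))) = ∑ l, C (recipElem s l x) * skipPoly l x := by
  rcases Nat.eq_zero_or_pos N with rfl | hN
  · simp [hasseDeriv_apply_one]
  have hdeg : ∀ p : ℂ[X], p.natDegree ≤ N - 1 → p.degree < (Finset.univ : Finset (Fin N)).card := by
    intro p hp
    refine degree_le_natDegree.trans_lt ?_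
    rw [Finset.card_univ, Fintype.card_fin]
    exact_mod_cast (show p.natDegree < N by omega)
  refine eq_of_degrees_lt_of_eval_index_eq (v := x) Finset.univ hx.injOn (hdeg _ ?_) (hdeg _ ?_)
    fun i _ => ?_
  · refine (natDegree_hasseDeriv_le _ _).trans ?_
    rw [natDegree_prod _ _ fun l _ => X_sub_C_ne_zero _]
    simp only [natDegree_X_sub_C, Finset.sum_const, Finset.card_univ, Fintype.card_fin]
    simp only [smul_eq_mul, mul_one, tsub_le_iff_right]
    omega
  · refine natDegree_sum_le_of_forall_le _ _ fun l _ => ?_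
    exact (natDegree_C_mul_le _ _).trans (natDegree_skipPoly l x).le
  · rw [eval_hasseDeriv_succ_prod, eval_finsetSum, Finset.sum_eq_single i]
    · rw [eval_mul, eval_C, recipElem, div_mul_cancel₀ _ (eval_skipPoly_ne_zero hx i)]
    · intro l _ hl
      rw [eval_mul, eval_skipPoly, Finset.prod_eq_zero (i := i), mul_zero]
      · simp [hl.symm]
      · simp
    · simp

open Polynomial in
theorem eval_derivative_skipPoly_self {x : Fin N → ℂ} (hx : Function.Injective x) (i : Fin N) :
    (derivative (skipPoly i x)).eval (x i) =
      (skipPoly i x).eval (x i) * ∑ l ∈ Finset.univ.erase i, (x i - x l)⁻¹ := by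
  rw [skipPoly, derivative_prod_finset, eval_finsetSum, eval_prod, Finset.mul_sum]
  refine Finset.sum_congr rfl fun l hl => ?_
  have h : x i - x l ≠ 0 := sub_ne_zero.2 fun h => (Finset.mem_erase.1 hl).1 (hx h).symm
  rw [← Finset.mul_prod_erase _ _ hl, derivative_X_sub_C, mul_one, eval_prod]
  simp only [eval_sub, eval_X, eval_C]
  field_simp

open Polynomial in
theorem eval_derivative_skipPoly_of_ne {x : Fin N → ℂ} (hx : Function.Injective x) {i l : Fin N}
    (hl : l ≠ i) :
    (derivative (skipPoly l x)).eval (x i) = (skipPoly i x).eval (x i) * (x i - x l)⁻¹ := by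
  have h : x i - x l ≠ 0 := sub_ne_zero.2 fun h => hl (hx h).symm
  have h1 : i ∈ Finset.univ.erase l := by simp [hl.symm]
  have h2 : l ∈ Finset.univ.erase i := by simp [hl]
  rw [skipPoly, skipPoly, ← Finset.mul_prod_erase _ _ h1, ← Finset.mul_prod_erase _ _ h2,
    Finset.erase_right_comm]
  simp only [derivative_mul, derivative_X_sub_C, one_mul, eval_add, eval_mul, eval_sub, eval_X,
    eval_C, sub_self, zero_mul, add_zero]
  field_simp

open Polynomial in
-- Differentiate the interpolation formula once more and evaluate at x_i. This expresses the
-- elementary functions of degree s + 1 through those of degree s, each term with a single pole.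
theorem recipElem_succ {x : Fin N → ℂ} (hx : Function.Injective x) (s : ℕ) (i : Fin N) :
    (s + 2 : ℂ) * recipElem (s + 1) i x =
      ∑ l ∈ Finset.univ.erase i, (recipElem s i x + recipElem s l x) * (x i - x l)⁻¹ := by
  have h1 := congrArg (fun p => (derivative p).eval (x i)) (hasseDeriv_prod_eq_sum hx s)
  have h2 : derivative (hasseDeriv (s + 1) (∏ l, (X - C (x l)))) =
      (s + 2) • hasseDeriv (s + 2) (∏ l, (X - C (x l))) := by
    have h3 := LinearMap.congr_fun (hasseDeriv_comp (R := ℂ) 1 (s + 1)) (∏ l, (X - C (x l)))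
    rw [LinearMap.comp_apply, hasseDeriv_one] at h3
    rw [h3, LinearMap.smul_apply, add_comm 1 (s + 1), Nat.choose_one_right]
  have h4 := eval_skipPoly_ne_zero hx i
  have h6 : ∀ l ∈ Finset.univ.erase i, recipElem s l x * (derivative (skipPoly l x)).eval (x i) =
      recipElem s l x * ((skipPoly i x).eval (x i) * (x i - x l)⁻¹) := fun l hl => by
    rw [eval_derivative_skipPoly_of_ne hx (Finset.mem_erase.1 hl).1]
  simp only [h2, eval_smul, eval_hasseDeriv_succ_prod, derivative_sum, derivative_mul,
    derivative_C, zero_mul, zero_add, eval_finsetSum, eval_mul, eval_C] at h1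
  rw [← Finset.add_sum_erase _ _ (Finset.mem_univ i), eval_derivative_skipPoly_self hx,
    Finset.sum_congr rfl h6] at h1
  have h5 : (hasseDeriv (s + 1) (skipPoly i x)).eval (x i) =
      recipElem (s + 1) i x * (skipPoly i x).eval (x i) := by
    rw [recipElem, div_mul_cancel₀ _ h4]
  rw [h5, nsmul_eq_mul] at h1
  apply mul_right_cancel₀ h4
  simp only [add_mul, Finset.sum_add_distrib, ← Finset.mul_sum, Finset.sum_mul]
  push_cast at h1
  calc _ = _ := by ring
    _ = _ := h1
    _ = _ := by
      rw [Finset.mul_sum, Finset.mul_sum, Finset.mul_sum, Finset.sum_mul]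
      congr 1
      · exact Finset.sum_congr rfl fun l _ => by ring
      · exact Finset.sum_congr rfl fun l _ => by ring

/-! ### Weighted sums of Vandermonde derivatives as polynomials in the power sums -/

/-- The power sum `p_b` of the variables `x_i - 1` as an element of the ring of symmetric
functions, the variable `X a` standing for `p_{a+1}`. -/
noncomputable def pw (N : ℕ) : ℕ → MvPolynomial ℕ ℂ
  | 0 => MvPolynomial.C (N : ℂ)
  | b + 1 => MvPolynomial.X b

/-- The values of symmetric functions in the variables `x_i - 1`. -/
noncomputable def psEval (x : Fin N → ℂ) : MvPolynomial ℕ ℂ →+* ℂ :=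
  MvPolynomial.eval fun a => ∑ i, (x i - 1) ^ (a + 1)

theorem psEval_pw (x : Fin N → ℂ) (b : ℕ) : psEval x (pw N b) = ∑ i, (x i - 1) ^ b := by
  cases b <;> simp [psEval, pw]

/-- The symmetric functions `∑_i y_i^b ∂_i^s V / (s! V)`, with `V` the Vandermonde product. -/
noncomputable def vanderSym (N : ℕ) : ℕ → ℕ → MvPolynomial ℕ ℂ
  | 0, b => pw N b
  | _ + 1, 0 => 0
  | s + 1, b + 1 => MvPolynomial.C ((s + 2 : ℂ)⁻¹) *
      (∑ p ∈ Finset.HasAntidiagonal.antidiagonal b, pw N p.1 * vanderSym N s p.2 - (b + 1 : ℂ) • vanderSym N s b)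

/-- Insert the recursion and exchange the names i and l in the terms containing `recipElem s l x`.
The poles then combine into divided differences (y_i^b − y_l^b)/(y_i − y_l), which are polynomials.
Extending their sum to l = i produces the correction term in the recursion for `vanderSym`. -/
theorem sum_recipElem {x : Fin N → ℂ} (hx : Function.Injective x) (s : ℕ) :
    ∀ b, ∑ i, (x i - 1) ^ b * recipElem s i x = psEval x (vanderSym N s b) := by
  induction s with
  | zero => intro b; simp [recipElem_zero hx, vanderSym, psEval_pw]
  | succ s ih =>
    intro b
    have hs : (s + 2 : ℂ) ≠ 0 := by exact_mod_cast (Nat.succ_ne_zero (s + 1))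
    set y : Fin N → ℂ := fun i => x i - 1 with hy
    have hyd : ∀ i l, x i - x l = y i - y l := fun i l => by simp [hy]
    let E : Fin N → ℂ := fun i => recipElem s i x
    let Q : ℕ → Fin N → Fin N → ℂ := fun b i l =>
      if l = i then 0 else y i ^ b * (E i + E l) * (y i - y l)⁻¹
    have h1 : (s + 2 : ℂ) * ∑ i, y i ^ b * recipElem (s + 1) i x = ∑ i, ∑ l, Q b i l := by
      rw [Finset.mul_sum]
      refine Finset.sum_congr rfl fun i _ => ?_
      rw [mul_left_comm, recipElem_succ hx, Finset.mul_sum,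
        ← Finset.add_sum_erase (f := Q b i) _ (Finset.mem_univ i)]
      simp only [Q, if_true, zero_add]
      refine Finset.sum_congr rfl fun l hl => ?_
      rw [if_neg (Finset.mem_erase.1 hl).1, hyd]
      ring
    have h2 : ∑ i, ∑ l, Q b i l = ∑ i, E i * ∑ l ∈ Finset.univ.erase i,
        (y i ^ b - y l ^ b) * (y i - y l)⁻¹ := by
      have e1 : ∀ i l, Q b i l =
          (if l = i then 0 else y i ^ b * E i * (y i - y l)⁻¹) +
          (if l = i then 0 else y i ^ b * E l * (y i - y l)⁻¹) := by
        intro i l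
        simp only [Q]
        split_ifs <;> ring
      simp only [e1, Finset.sum_add_distrib]
      rw [Finset.sum_comm (f := fun i l => if l = i then 0 else y i ^ b * E l * (y i - y l)⁻¹),
        ← Finset.sum_add_distrib]
      refine Finset.sum_congr rfl fun i _ => ?_
      rw [← Finset.sum_add_distrib, ← Finset.add_sum_erase _ _ (Finset.mem_univ i), Finset.mul_sum]
      simp only [if_true, zero_add]
      refine Finset.sum_congr rfl fun l hl => ?_
      have hl' := (Finset.mem_erase.1 hl).1
      rw [if_neg hl', if_neg hl'.symm, ← neg_sub (y i) (y l), inv_neg]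
      ring
    apply mul_left_cancel₀ hs
    rw [h1, h2]
    rcases b with _ | b
    · simp [vanderSym]
    · have e3 : ∀ i, ∑ l ∈ Finset.univ.erase i, (y i ^ (b + 1) - y l ^ (b + 1)) * (y i - y l)⁻¹ =
          ∑ p ∈ Finset.HasAntidiagonal.antidiagonal b, (∑ l, y l ^ p.1) * y i ^ p.2 - (b + 1) * y i ^ b := by
        intro i
        have e4 : ∀ l ∈ Finset.univ.erase i, (y i ^ (b + 1) - y l ^ (b + 1)) * (y i - y l)⁻¹ =
            ∑ p ∈ Finset.HasAntidiagonal.antidiagonal b, y l ^ p.1 * y i ^ p.2 := by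
          intro l hl
          have h : y i - y l ≠ 0 := by
            rw [← hyd]
            exact sub_ne_zero.2 fun h => (Finset.mem_erase.1 hl).1 (hx h).symm
          rw [mul_inv_eq_iff_eq_mul₀ h, ← (Commute.all (y i) (y l)).geom_sum₂_mul (b + 1),
            Finset.Nat.sum_antidiagonal_eq_sum_range_succ (fun a c => y l ^ a * y i ^ c),
            ← Finset.sum_range_reflect]
          congr 1
          refine Finset.sum_congr rfl fun a ha => ?_
          have := Finset.mem_range.1 ha
          rw [mul_comm]
          congr 2; omega
        rw [Finset.sum_congr rfl e4, Finset.sum_comm]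
        have e5 : ∀ p ∈ Finset.HasAntidiagonal.antidiagonal b, ∑ l ∈ Finset.univ.erase i, y l ^ p.1 * y i ^ p.2 =
            (∑ l, y l ^ p.1) * y i ^ p.2 - y i ^ b := by
          intro p hp
          rw [← Finset.sum_mul, ← Finset.add_sum_erase _ _ (Finset.mem_univ i), add_mul, ← pow_add,
            Finset.HasAntidiagonal.mem_antidiagonal.1 hp]
          ring
        rw [Finset.sum_congr rfl e5, Finset.sum_sub_distrib, Finset.sum_const,
          Finset.Nat.card_antidiagonal, nsmul_eq_mul]
        push_cast
        ring
      simp only [e3, vanderSym, map_mul, map_sub, map_sum, psEval_pw, ← ih]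
      have e6 : ∀ (c : ℂ) (f : MvPolynomial ℕ ℂ), psEval x (c • f) = c * psEval x f := fun c f => by
        simp [psEval, MvPolynomial.smul_eval]
      have e7 : psEval x (MvPolynomial.C (s + 2 : ℂ)⁻¹) = (s + 2 : ℂ)⁻¹ := by simp [psEval]
      rw [e6, e7, mul_inv_cancel_left₀ hs, ← ih]
      simp only [mul_sub, Finset.sum_sub_distrib, Finset.mul_sum]
      congr 1
      · rw [Finset.sum_comm]
        refine Finset.sum_congr rfl fun p _ => ?_
        refine Finset.sum_congr rfl fun i _ => ?_
        rw [Finset.sum_mul, Finset.sum_mul, Finset.mul_sum]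
        exact Finset.sum_congr rfl fun l _ => by simp only [hy, E]; ring
      · exact Finset.sum_congr rfl fun i _ => by simp only [hy, E]; ring

theorem dense_injective : Dense {x : Fin N → ℂ | Function.Injective x} := by
  intro x
  set γ : ℂ → Fin N → ℂ := fun t i => x i + t * (i : ℕ) with hγ
  have hγc : Continuous γ := by fun_prop
  have hγ0 : γ 0 = x := by funext i; simp [hγ]
  have hγt : Tendsto γ (𝓝[≠] 0) (𝓝 x) := by
    have := hγc.tendsto 0
    rw [hγ0] at this
    exact this.mono_left nhdsWithin_le_nhds
  refine mem_closure_of_tendsto hγt ?_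
  have h1 : ∀ p : Fin N × Fin N, ∀ᶠ t in 𝓝[≠] (0 : ℂ), γ t p.1 = γ t p.2 → p.1 = p.2 := by
    intro p
    by_cases hp : x p.1 = x p.2
    · filter_upwards [self_mem_nhdsWithin] with t ht h
      have ht : t ≠ 0 := ht
      simp only [hγ, hp, add_right_inj, mul_eq_mul_left_iff, ht, or_false, Nat.cast_inj] at h
      exact Fin.ext h
    · have h2 : ∀ᶠ t in 𝓝 (0 : ℂ), γ t p.1 ≠ γ t p.2 := by
        have h3 : ContinuousAt (fun t => γ t p.1 - γ t p.2) 0 := by fun_prop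
        have h4 : γ 0 p.1 - γ 0 p.2 ≠ 0 := by rw [hγ0]; exact sub_ne_zero.2 hp
        filter_upwards [h3.eventually_ne h4] with t ht
        exact sub_ne_zero.1 ht
      filter_upwards [h2.filter_mono nhdsWithin_le_nhds] with t ht h
      exact absurd h ht
  filter_upwards [eventually_all.2 h1] with t ht i j hij
  exact ht (i, j) hij

theorem continuous_psEval (f : MvPolynomial ℕ ℂ) : Continuous fun x : Fin N → ℂ => psEval x f := by
  exact (MvPolynomial.continuous_eval f).comp (by fun_prop)

/-- For distinct coordinates this is `sum_recipElem`. Both sides are continuous and such points are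
dense, so it holds at 1^N and near it, where the quotients by V make no sense. -/
theorem sum_pow_mul_iterate_partialDeriv_vander (x : Fin N → ℂ) (s b : ℕ) :
    ∑ i : Fin N, (x i - 1) ^ b * (partialDeriv i)^[s] vander x =
      s.factorial * vander x * psEval x (vanderSym N s b) := by
  have h1 : Continuous fun x : Fin N → ℂ =>
      ∑ i : Fin N, (x i - 1) ^ b * (partialDeriv i)^[s] vander x :=
    continuous_finsetSum _ fun i _ => Continuous.mul (by fun_prop)
      (contDiff_iterate_partialDeriv_vander _ s).continuous
  have h2 : Continuous fun x : Fin N → ℂ =>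
      s.factorial * vander x * psEval x (vanderSym N s b) :=
    (continuous_const.mul (contDiff_iterate_partialDeriv_vander 0 0).continuous).mul
      (continuous_psEval _)
  refine congrFun (h1.ext_on dense_injective h2 fun x hx => ?_) x
  have hx : Function.Injective x := hx
  simp only [← sum_recipElem hx, iterate_partialDeriv_vander_eq hx, Finset.mul_sum]
  exact Finset.sum_congr rfl fun i _ => by ring

/-! ### Differential operators on symmetric functions -/

/-- Polynomials in the power sums; the variable `X a` stands for `p_{a+1}`. -/
abbrev SymRing : Type := MvPolynomial ℕ ℂ

/-- The operator `∂/∂p_{a+1}` conjugated by `exp L`. -/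
noncomputable def twDeriv (L : SymRing) (a : ℕ) : SymRing →ₗ[ℂ] SymRing :=
  (MvPolynomial.pderiv a).toLinearMap + LinearMap.mulLeft ℂ (MvPolynomial.pderiv a L)

theorem twDeriv_apply (L : SymRing) (a : ℕ) (h : SymRing) :
    twDeriv L a h = MvPolynomial.pderiv a h + MvPolynomial.pderiv a L * h := rfl

/-- The coefficient of `y_i ^ m` in the operator `∂_i ^ n` conjugated by `exp L`. -/
noncomputable def derivCoeff (L : SymRing) : ℕ → ℕ → SymRing →ₗ[ℂ] SymRing
  | 0, m => if m = 0 then LinearMap.id else 0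
  | n + 1, m => (m + 1 : ℂ) • derivCoeff L n (m + 1) +
      ∑ p ∈ Finset.HasAntidiagonal.antidiagonal m,
        (p.1 + 1 : ℂ) • (twDeriv L p.1 ∘ₗ derivCoeff L n p.2)

theorem smooth_psEval (f : SymRing) : Smooth fun x : Fin N → ℂ => psEval x f := by
  induction f using MvPolynomial.induction_on with
  | C a => simpa [psEval] using contDiffAt_const
  | add f g hf hg => simpa using hf.add hg
  | mul_X f a hf =>
    simp only [map_mul]
    refine hf.mul ?_
    simp only [psEval, MvPolynomial.eval_X]
    exact ContDiffAt.sum fun i _ => ((smooth_coord i).sub contDiffAt_const).pow _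

theorem differentiable_psEval (f : SymRing) : Differentiable ℂ fun x : Fin N → ℂ => psEval x f := by
  induction f using MvPolynomial.induction_on with
  | C a => simp [psEval]
  | add f g hf hg =>
    simp only [map_add]
    exact hf.fun_add hg
  | mul_X f a hf =>
    simp only [map_mul]
    refine hf.mul ?_
    simp only [psEval, MvPolynomial.eval_X]
    fun_prop

theorem partialDeriv_powerSum (i : Fin N) (a : ℕ) (x : Fin N → ℂ) :
    partialDeriv i (fun x : Fin N → ℂ => ∑ l, (x l - 1) ^ (a + 1)) x = (a + 1) * (x i - 1) ^ a := by
  have h1 : ∀ l : Fin N, HasFDerivAt (fun x : Fin N → ℂ => (x l - 1) ^ (a + 1))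
      (((a + 1 : ℕ) * (x l - 1) ^ a) •
        ContinuousLinearMap.proj (R := ℂ) (φ := fun _ : Fin N => ℂ) l) x := fun l => by
    have := ((hasFDerivAt_apply (𝕜 := ℂ) (F' := fun _ : Fin N => ℂ) l x).sub_const 1).pow (a + 1)
    simpa [mul_smul] using this
  rw [partialDeriv, (HasFDerivAt.fun_sum fun l _ => h1 l).fderiv]
  simp [coordVec_apply]

/-- The chain rule with ∂_i p_(a+1) = (a + 1) y_i^a. Only finitely many power sums occur in f, so
any long enough range gives the same sum. -/
theorem exists_partialDeriv_psEval (f : SymRing) : ∃ A₀ : ℕ, ∀ A, A₀ ≤ A → ∀ (i : Fin N)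
    (x : Fin N → ℂ), partialDeriv i (fun x => psEval x f) x =
      ∑ a ∈ Finset.range A, (a + 1) * (x i - 1) ^ a * psEval x (MvPolynomial.pderiv a f) := by
  induction f using MvPolynomial.induction_on with
  | C c =>
    refine ⟨0, fun A _ i x => ?_⟩
    simp [psEval, partialDeriv]
  | add f g hf hg =>
    obtain ⟨A, hA⟩ := hf
    obtain ⟨B, hB⟩ := hg
    refine ⟨max A B, fun D hD i x => ?_⟩
    have h1 : partialDeriv i (fun x => psEval x (f + g)) x =
        partialDeriv i (fun x => psEval x f) x + partialDeriv i (fun x => psEval x g) x := by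
      simp only [map_add, partialDeriv]
      rw [fderiv_fun_add (differentiable_psEval f x) (differentiable_psEval g x)]
      rfl
    rw [h1, hA D ((le_max_left _ _).trans hD), hB D ((le_max_right _ _).trans hD),
      ← Finset.sum_add_distrib]
    simp only [map_add, mul_add]
  | mul_X f n hf =>
    obtain ⟨A, hA⟩ := hf
    refine ⟨max A (n + 1), fun D hD i x => ?_⟩
    have h1 : partialDeriv i (fun x => psEval x (f * MvPolynomial.X n)) x =
        psEval x (MvPolynomial.X n) * partialDeriv i (fun x => psEval x f) x +
        psEval x f * ((n + 1) * (x i - 1) ^ n) := by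
      rw [← partialDeriv_powerSum]
      simp only [map_mul, partialDeriv]
      rw [fderiv_fun_mul (differentiable_psEval f x) (differentiable_psEval _ x)]
      simp [psEval, add_comm]
    rw [h1, hA D ((le_max_left _ _).trans hD), Finset.mul_sum]
    have hn : n ∈ Finset.range D := Finset.mem_range.2 ((le_max_right _ _).trans hD)
    simp only [MvPolynomial.pderiv_mul, MvPolynomial.pderiv_X, map_add, map_mul, mul_add,
      Finset.sum_add_distrib, Pi.single_apply]
    congr 1
    · exact Finset.sum_congr rfl fun a _ => by ring
    · rw [Finset.sum_eq_single n]
      · simp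
        ring
      · intro b _ hb
        simp [hb.symm]
      · exact fun h => absurd hn h

section jets

variable (i : Fin N) {K : ℕ}

theorem smooth_pow (a : ℕ) : Smooth fun x : Fin N → ℂ => (x i - 1) ^ a :=
  ((smooth_coord i).sub contDiffAt_const).pow a

theorem vanishTo_pow (a : ℕ) : VanishTo a fun x : Fin N → ℂ => (x i - 1) ^ a := by
  induction a with
  | zero => trivial
  | succ a ih =>
    simp only [pow_succ]
    exact ih.mul (b := 1) (smooth_pow i a) ((smooth_coord i).sub contDiffAt_const)
      ⟨by simp, fun _ => trivial⟩

theorem jetEq_pow_mul_zero {a : ℕ} (ha : K ≤ a) {c : (Fin N → ℂ) → ℂ} (hc : Smooth c) :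
    JetEq K (fun x => (x i - 1) ^ a * c x) fun _ => 0 := by
  refine ⟨(smooth_pow i a).mul hc, contDiffAt_const, ?_⟩
  simpa using ((vanishTo_pow i a).mul_right (smooth_pow i a) hc).mono ha

/-- Since y_i^a vanishes to order a, the terms with a ≥ K do not affect the jet. Ranges can thus be
made independent of the polynomial, which later is essential because the polynomials vary with N. -/
theorem jetEq_truncate {A : ℕ} (hA : K ≤ A) {c : ℕ → (Fin N → ℂ) → ℂ} (hc : ∀ a, Smooth (c a)) :
    JetEq K (fun x => ∑ a ∈ Finset.range A, (x i - 1) ^ a * c a x)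
      fun x => ∑ a ∈ Finset.range K, (x i - 1) ^ a * c a x := by
  have h1 : JetEq K (fun x => ∑ a ∈ Finset.range A, (x i - 1) ^ a * c a x)
      fun x => ∑ a ∈ Finset.range A, if a < K then (x i - 1) ^ a * c a x else 0 := by
    refine JetEq.sum _ fun a _ => ?_
    by_cases h : a < K
    · simp only [h, if_true]
      exact JetEq.refl ((smooth_pow i a).mul (hc a))
    · simp only [h, if_false]
      exact jetEq_pow_mul_zero i (not_lt.1 h) (hc a)
  convert h1 using 2 with x
  rw [← Finset.sum_filter]
  refine Finset.sum_congr ?_ fun _ _ => rfl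
  ext a
  simp only [Finset.mem_filter, Finset.mem_range]
  omega

theorem sum_range_sum_range_ite {A B K : ℕ} (hA : K ≤ A) (hB : K ≤ B) (g : ℕ → ℕ → ℂ) :
    ∑ m ∈ Finset.range A, ∑ a ∈ Finset.range B, (if m + a < K then g a m else 0) =
      ∑ M ∈ Finset.range K, ∑ p ∈ Finset.HasAntidiagonal.antidiagonal M, g p.1 p.2 := by
  rw [← Finset.sum_product' (f := fun m a => if m + a < K then g a m else 0), ← Finset.sum_filter,
    ← Finset.sum_fiberwise_of_maps_to (t := Finset.range K) (g := fun p : ℕ × ℕ => p.1 + p.2)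
      (fun p hp => Finset.mem_range.2 (Finset.mem_filter.1 hp).2)]
  refine Finset.sum_congr rfl fun M hM => ?_
  have hM := Finset.mem_range.1 hM
  refine Finset.sum_nbij' (fun p => (p.2, p.1)) (fun p => (p.2, p.1)) ?_ ?_ ?_ ?_ ?_
  · intro p hp
    simp only [Finset.mem_filter] at hp
    rw [Finset.HasAntidiagonal.mem_antidiagonal, ← hp.2, add_comm]
  · intro p hp
    have := Finset.HasAntidiagonal.mem_antidiagonal.1 hp
    simp only [Finset.mem_filter, Finset.mem_product, Finset.mem_range]
    omega
  · exact fun _ _ => rfl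
  · exact fun _ _ => rfl
  · exact fun _ _ => rfl

/-- Collect a product of two expansions in y_i by total degree, dropping the degrees that are
invisible to the jet. -/
theorem jetEq_regroup {A B : ℕ} (hA : K ≤ A) (hB : K ≤ B) {c : ℕ → ℕ → (Fin N → ℂ) → ℂ}
    (hc : ∀ a m, Smooth (c a m)) :
    JetEq K (fun x => ∑ m ∈ Finset.range A, ∑ a ∈ Finset.range B, (x i - 1) ^ (m + a) * c a m x)
      fun x => ∑ M ∈ Finset.range K, (x i - 1) ^ M *
        ∑ p ∈ Finset.HasAntidiagonal.antidiagonal M, c p.1 p.2 x := by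
  have h1 : JetEq K
      (fun x => ∑ m ∈ Finset.range A, ∑ a ∈ Finset.range B, (x i - 1) ^ (m + a) * c a m x)
      fun x => ∑ m ∈ Finset.range A, ∑ a ∈ Finset.range B,
        if m + a < K then (x i - 1) ^ (m + a) * c a m x else 0 := by
    refine JetEq.sum _ fun m _ => JetEq.sum _ fun a _ => ?_
    by_cases h : m + a < K
    · simp only [h, if_true]
      exact JetEq.refl ((smooth_pow i _).mul (hc a m))
    · simp only [h, if_false]
      exact jetEq_pow_mul_zero i (not_lt.1 h) (hc a m)
  convert h1 using 2 with x
  rw [sum_range_sum_range_ite hA hB fun a m => (x i - 1) ^ (m + a) * c a m x]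
  refine Finset.sum_congr rfl fun M _ => ?_
  rw [Finset.mul_sum]
  refine Finset.sum_congr rfl fun p hp => ?_
  rw [← Finset.HasAntidiagonal.mem_antidiagonal.1 hp, add_comm]

theorem jetEq_partialDeriv_psEval (f : SymRing) :
    JetEq K (partialDeriv i fun x => psEval x f) fun x => ∑ a ∈ Finset.range K,
      (x i - 1) ^ a * ((a + 1) * psEval x (MvPolynomial.pderiv a f)) := by
  obtain ⟨A, hA⟩ := exists_partialDeriv_psEval (N := N) f
  have h1 := jetEq_truncate (K := K) i (le_max_right A K)
    (c := fun a x => (a + 1) * psEval x (MvPolynomial.pderiv a f))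
    fun a => contDiffAt_const.mul (smooth_psEval _)
  convert h1 using 1
  funext x
  rw [hA _ (le_max_left A K)]
  exact Finset.sum_congr rfl fun a _ => by ring

theorem smooth_expWeight (L h : SymRing) :
    Smooth fun x : Fin N → ℂ => psEval x h * Complex.exp (psEval x L) :=
  (smooth_psEval h).mul (smooth_psEval L).cexp

theorem jetEq_partialDeriv_expWeight (L h : SymRing) :
    JetEq K (partialDeriv i fun x => psEval x h * Complex.exp (psEval x L))
      fun x => ∑ a ∈ Finset.range K, (x i - 1) ^ a *
        ((a + 1) * (psEval x (twDeriv L a h) * Complex.exp (psEval x L))) := by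
  have h1 : partialDeriv i (fun x : Fin N → ℂ => psEval x h * Complex.exp (psEval x L)) =ᶠ[𝓝 1]
      fun x => Complex.exp (psEval x L) * (psEval x h * partialDeriv i (fun x => psEval x L) x +
        partialDeriv i (fun x => psEval x h) x) := by
    filter_upwards [partialDeriv_mul (smooth_psEval h) (smooth_psEval L).cexp i,
      partialDeriv_exp (smooth_psEval L) i] with x e1 e2
    rw [e1, e2]
    ring
  refine (JetEq.of_eventuallyEq ((smooth_expWeight L h).partialDeriv i) h1).trans ?_
  have h2 := (JetEq.refl (K := K) (smooth_psEval (N := N) L).cexp).mul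
    (((JetEq.refl (smooth_psEval h)).mul (jetEq_partialDeriv_psEval (K := K) i L)).add
      (jetEq_partialDeriv_psEval (K := K) i h))
  convert h2 using 1
  funext x
  rw [Finset.mul_sum, ← Finset.sum_add_distrib, Finset.mul_sum]
  refine Finset.sum_congr rfl fun a _ => ?_
  rw [twDeriv_apply, map_add, map_mul]
  ring

theorem partialDeriv_sum {ι : Type*} (s : Finset ι) {f : ι → (Fin N → ℂ) → ℂ}
    (hf : ∀ j, Smooth (f j)) (k : ℕ) :
    partialDeriv k (fun x => ∑ j ∈ s, f j x) =ᶠ[𝓝 1] fun x => ∑ j ∈ s, partialDeriv k (f j) x := by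
  have h1 : ∀ᶠ x in 𝓝 (1 : Fin N → ℂ), ∀ j ∈ s, DifferentiableAt ℂ (f j) x :=
    (Finset.eventually_all s).2 fun j _ => (hf j).eventually_differentiableAt
  filter_upwards [h1] with x hx
  rw [partialDeriv, fderiv_fun_sum hx]
  simp [partialDeriv]

theorem partialDeriv_pow (m : ℕ) (x : Fin N → ℂ) :
    partialDeriv i (fun x : Fin N → ℂ => (x i - 1) ^ m) x = m * (x i - 1) ^ (m - 1) := by
  have := ((hasFDerivAt_apply (𝕜 := ℂ) (F' := fun _ : Fin N => ℂ) i x).sub_const 1).pow m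
  rw [partialDeriv, this.fderiv]
  simp [coordVec_apply]

/-- A derivative of an expansion in y_i either lowers the power y_i^m or hits the symmetric
coefficient; these are the two terms in the recursion for `derivCoeff`. Each derivative costs one
order of the jet, so the induction hypothesis is used at K + 1. -/
theorem jetEq_iterate_partialDeriv_expWeight (L h : SymRing) (n : ℕ) : ∀ K,
    JetEq K ((partialDeriv i)^[n] fun x => psEval x h * Complex.exp (psEval x L))
      fun x => ∑ m ∈ Finset.range K, (x i - 1) ^ m *
        (psEval x (derivCoeff L n m h) * Complex.exp (psEval x L)) := by
  induction n with
  | zero =>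
    intro K
    rcases K with _ | K
    · exact ⟨smooth_expWeight L h, by simpa using contDiffAt_const, trivial⟩
    · have h1 : (fun x : Fin N → ℂ => ∑ m ∈ Finset.range (K + 1), (x i - 1) ^ m *
          (psEval x (derivCoeff L 0 m h) * Complex.exp (psEval x L))) =
          fun x => psEval x h * Complex.exp (psEval x L) := by
        funext x
        rw [Finset.sum_range_succ', Finset.sum_eq_zero]
        · simp [derivCoeff]
        · intro m _
          simp [derivCoeff]
      rw [h1]
      exact JetEq.refl (smooth_expWeight L h)
  | succ n ih =>
    intro K
    rw [Function.iterate_succ_apply']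
    refine ((ih (K + 1)).partialDeriv i).trans ?_
    have hs : ∀ m, Smooth fun x : Fin N → ℂ =>
      psEval x (derivCoeff L n m h) * Complex.exp (psEval x L) := fun m => smooth_expWeight _ _
    have h1 : partialDeriv i (fun x : Fin N → ℂ => ∑ m ∈ Finset.range (K + 1), (x i - 1) ^ m *
        (psEval x (derivCoeff L n m h) * Complex.exp (psEval x L))) =ᶠ[𝓝 1]
        fun x => ∑ m ∈ Finset.range K, (x i - 1) ^ m *
          ((m + 1) * (psEval x (derivCoeff L n (m + 1) h) * Complex.exp (psEval x L))) +
        ∑ m ∈ Finset.range (K + 1), (x i - 1) ^ m * partialDeriv i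
          (fun x => psEval x (derivCoeff L n m h) * Complex.exp (psEval x L)) x := by
      have e1 : ∀ᶠ x in 𝓝 (1 : Fin N → ℂ), ∀ m ∈ Finset.range (K + 1), _ :=
        (Finset.eventually_all _).2 fun m _ => partialDeriv_mul (smooth_pow i m) (hs m) i
      filter_upwards [partialDeriv_sum (Finset.range (K + 1)) (fun m => (smooth_pow i m).mul (hs m))
        i, e1] with x h2 h3
      rw [h2, Finset.sum_congr rfl h3, Finset.sum_add_distrib, add_comm]
      congr 1
      rw [Finset.sum_range_succ']
      simp only [partialDeriv_pow, Nat.cast_zero, zero_mul, mul_zero, add_zero,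
        Nat.add_sub_cancel]
      refine Finset.sum_congr rfl fun m _ => ?_
      push_cast
      ring
    refine (JetEq.of_eventuallyEq (ContDiffAt.fderiv_right
      (ContDiffAt.sum fun m _ => (smooth_pow i m).mul (hs m)) (by simp) |>.clm_apply
        contDiffAt_const) h1).trans ?_
    have h4 : JetEq K (fun x => ∑ m ∈ Finset.range (K + 1), (x i - 1) ^ m * partialDeriv i
          (fun x => psEval x (derivCoeff L n m h) * Complex.exp (psEval x L)) x)
        fun x => ∑ m ∈ Finset.range (K + 1), (x i - 1) ^ m * ∑ a ∈ Finset.range K, (x i - 1) ^ a *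
        ((a + 1) * (psEval x (twDeriv L a (derivCoeff L n m h)) * Complex.exp (psEval x L))) :=
      JetEq.sum _ fun m _ => (JetEq.refl (smooth_pow i m)).mul
        (jetEq_partialDeriv_expWeight i L _)
    have h5 := jetEq_regroup (K := K) i (Nat.le_succ K) le_rfl (c := fun a m x =>
      (a + 1) * (psEval x (twDeriv L a (derivCoeff L n m h)) * Complex.exp (psEval x L)))
      fun a m => contDiffAt_const.mul (smooth_expWeight _ _)
    simp only [Finset.mul_sum, ← mul_assoc, ← pow_add] at h4 h5
    have h6 : Smooth fun x : Fin N → ℂ => ∑ m ∈ Finset.range K, (x i - 1) ^ m *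
          ((m + 1) * (psEval x (derivCoeff L n (m + 1) h) * Complex.exp (psEval x L))) :=
      ContDiffAt.sum fun m _ => (smooth_pow i m).mul (contDiffAt_const.mul (hs (m + 1)))
    have h7 := (JetEq.refl (K := K) h6).add (h4.trans h5)
    convert h7 using 1
    · funext x
      rw [← Finset.sum_add_distrib]
      refine Finset.sum_congr rfl fun m _ => ?_
      rw [derivCoeff, LinearMap.add_apply, LinearMap.smul_apply, map_add, LinearMap.sum_apply,
        map_sum]
      have e6 : ∀ (c : ℂ) (f : SymRing), psEval x (c • f) = c * psEval x f := fun c f => by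
        simp [psEval, MvPolynomial.smul_eval]
      simp only [LinearMap.smul_apply, e6, LinearMap.comp_apply]
      rw [add_mul, mul_add, Finset.sum_mul, Finset.mul_sum]
      congr 1
      · ring
      · exact Finset.sum_congr rfl fun p _ => by ring

end jets

/-! ### The operators acting on generating functions -/

theorem psEval_smul (x : Fin N → ℂ) (c : ℂ) (f : SymRing) : psEval x (c • f) = c * psEval x f := by
  simp [psEval, MvPolynomial.smul_eval]

theorem smooth_iterate_partialDeriv {f : (Fin N → ℂ) → ℂ} (hf : Smooth f) (i n : ℕ) :
    Smooth ((partialDeriv i)^[n] f) := by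
  induction n with
  | zero => exact hf
  | succ n ih =>
    rw [Function.iterate_succ_apply']
    exact ih.partialDeriv i

theorem VanishTo.iterate_partialDeriv {f : (Fin N → ℂ) → ℂ} {a : ℕ} (h : VanishTo a f) (i : Fin N)
    (n : ℕ) : VanishTo (a - n) ((partialDeriv i)^[n] f) := by
  induction n with
  | zero => exact h
  | succ n ih =>
    rw [Function.iterate_succ_apply']
    rcases Nat.eq_zero_or_pos (a - n) with h0 | h0
    · rw [show a - (n + 1) = 0 by omega]
      trivial
    · obtain ⟨b, hb⟩ := Nat.exists_eq_succ_of_ne_zero h0.ne'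
      rw [hb] at ih
      rw [show a - (n + 1) = b by omega]
      exact ih.2 i

theorem iterate_partialDeriv_mul {f g : (Fin N → ℂ) → ℂ} (hf : Smooth f) (hg : Smooth g)
    (i j : ℕ) :
    (partialDeriv i)^[j] (fun x => f x * g x) =ᶠ[𝓝 1] fun x =>
      ∑ p ∈ Finset.HasAntidiagonal.antidiagonal j,
        (j.choose p.1 : ℂ) * ((partialDeriv i)^[p.1] f x * (partialDeriv i)^[p.2] g x) := by
  induction j with
  | zero => simp
  | succ j ih =>
    have hs := fun a b => (smooth_iterate_partialDeriv hf i a).mul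
      (smooth_iterate_partialDeriv hg i b)
    have e1 : ∀ᶠ x in 𝓝 (1 : Fin N → ℂ), ∀ p ∈ Finset.HasAntidiagonal.antidiagonal j, _ :=
      (Finset.eventually_all _).2 fun p _ => partialDeriv_mul
        (f := fun _ => (j.choose p.1 : ℂ)) contDiffAt_const (hs p.1 p.2) i
    have e2 : ∀ᶠ x in 𝓝 (1 : Fin N → ℂ), ∀ p ∈ Finset.HasAntidiagonal.antidiagonal j, _ :=
      (Finset.eventually_all _).2 fun p _ => partialDeriv_mul
        (smooth_iterate_partialDeriv hf i p.1) (smooth_iterate_partialDeriv hg i p.2) i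
    rw [Function.iterate_succ_apply']
    filter_upwards [partialDeriv_congr ih i, partialDeriv_sum
      (Finset.HasAntidiagonal.antidiagonal j) (f := fun p x => (j.choose p.1 : ℂ) *
        ((partialDeriv i)^[p.1] f x * (partialDeriv i)^[p.2] g x))
      (fun p => contDiffAt_const.mul (hs p.1 p.2)) i, e1, e2] with x h1 h2 h3 h4
    rw [h1, h2, Finset.sum_congr rfl h3, Finset.sum_antidiagonal_choose_succ_mul
      (fun a b => (partialDeriv i)^[a] f x * (partialDeriv i)^[b] g x), ← Finset.sum_add_distrib]
    refine Finset.sum_congr rfl fun p hp => ?_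
    rw [h4 p hp, ← Finset.HasAntidiagonal.mem_antidiagonal.1 hp, Nat.choose_symm_add,
      Function.iterate_succ_apply', Function.iterate_succ_apply']
    simp [partialDeriv]
    ring

theorem vanishTo_iterate_vander (i : Fin N) (s : ℕ) :
    VanishTo (vanderDeg N - s) ((partialDeriv i)^[s] (vander (N := N))) :=
  vanishTo_vander.iterate_partialDeriv i s

/-- The operator on symmetric functions corresponding to `∑_i y_i^b ∂_i^j`, up to terms of high
order. -/
noncomputable def diffOp (N : ℕ) (L : SymRing) (M j b : ℕ) : SymRing →ₗ[ℂ] SymRing :=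
  ∑ p ∈ Finset.HasAntidiagonal.antidiagonal j, ((j.choose p.1 : ℂ) * p.1.factorial) •
    ∑ m ∈ Finset.range M, LinearMap.mulLeft ℂ (vanderSym N p.1 (b + m)) ∘ₗ derivCoeff L p.2 m

/-- By Leibniz' rule ∂_i^j is shared between V and the symmetric factor. An s-th derivative of V
still vanishes to order deg V − s, so cutting the expansion of the other factor at M ≥ K + j leaves
agreement to order deg V + K. The sum over i then turns y_i^(b+m) ∂_i^s V into V times a symmetric
polynomial. -/
theorem jetEq_diffOp (L h : SymRing) {K M j : ℕ} (hM : K + j ≤ M) (b : ℕ) :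
    JetEq (vanderDeg N + K)
      (fun x : Fin N → ℂ => ∑ i : Fin N, (x i - 1) ^ b * (partialDeriv i)^[j]
        (fun x => vander x * (psEval x h * Complex.exp (psEval x L))) x)
      fun x => vander x * (psEval x (diffOp N L M j b h) * Complex.exp (psEval x L)) := by
  have hH : Smooth fun x : Fin N → ℂ => psEval x h * Complex.exp (psEval x L) :=
    smooth_expWeight L h
  have h1 : ∀ i : Fin N, JetEq (vanderDeg N + K) ((partialDeriv i)^[j]
        (fun x : Fin N → ℂ => vander x * (psEval x h * Complex.exp (psEval x L))))
      fun x => ∑ p ∈ Finset.HasAntidiagonal.antidiagonal j, (j.choose p.1 : ℂ) *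
        ((partialDeriv i)^[p.1] vander x * ∑ m ∈ Finset.range M, (x i - 1) ^ m *
          (psEval x (derivCoeff L p.2 m h) * Complex.exp (psEval x L))) := fun i => by
    refine (JetEq.of_eventuallyEq (smooth_iterate_partialDeriv (smooth_vander.mul hH) i j)
      (iterate_partialDeriv_mul smooth_vander hH i j)).trans ?_
    refine JetEq.sum _ fun p hp => (JetEq.refl contDiffAt_const).mul ?_
    refine JetEq.mono ((jetEq_iterate_partialDeriv_expWeight i L h p.2 M).vanish_mul
      (smooth_iterate_partialDeriv smooth_vander i p.1) (vanishTo_iterate_vander i p.1)) ?_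
    have := Finset.HasAntidiagonal.mem_antidiagonal.1 hp
    omega
  have h2 := JetEq.sum (K := vanderDeg N + K) Finset.univ fun (i : Fin N) _ =>
    (JetEq.refl (K := vanderDeg N + K) (smooth_pow i b)).mul (h1 i)
  convert h2 using 1
  funext x
  simp only [diffOp, LinearMap.sum_apply, LinearMap.smul_apply, LinearMap.comp_apply,
    LinearMap.mulLeft_apply, map_sum, psEval_smul, map_mul, Finset.mul_sum, Finset.sum_mul]
  symm
  rw [Finset.sum_comm]
  refine Finset.sum_congr rfl fun p _ => ?_
  rw [Finset.sum_comm]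
  refine Finset.sum_congr rfl fun m _ => ?_
  have h3 := sum_pow_mul_iterate_partialDeriv_vander x p.1 (b + m)
  calc _ = (j.choose p.1 : ℂ) * (p.1.factorial * vander x * psEval x (vanderSym N p.1 (b + m))) *
          (psEval x (derivCoeff L p.2 m h) * Complex.exp (psEval x L)) := by
        rw [← h3, Finset.mul_sum, Finset.sum_mul]
        exact Finset.sum_congr rfl fun i _ => by rw [pow_add]; ring
    _ = _ := by ring

theorem eulerOp_pow_mul {f : (Fin N → ℂ) → ℂ} (hf : Smooth f) (i : Fin N) (j : ℕ) :
    eulerOp i (fun x => x i ^ j * (partialDeriv i)^[j] f x) =ᶠ[𝓝 1] fun x =>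
      j * (x i ^ j * (partialDeriv i)^[j] f x) + x i ^ (j + 1) * (partialDeriv i)^[j + 1] f x := by
  filter_upwards [partialDeriv_mul ((smooth_coord i).pow j) (smooth_iterate_partialDeriv hf i j) i]
    with x hx
  have h1 : partialDeriv i (fun x : Fin N → ℂ => x i ^ j) x = j * x i ^ (j - 1) := by
    have := (hasFDerivAt_apply (𝕜 := ℂ) (F' := fun _ : Fin N => ℂ) i x).pow j
    rw [partialDeriv, this.fderiv]
    simp [coordVec_apply]
  rw [eulerOp, hx, h1, Function.iterate_succ_apply']
  rcases j with _ | j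
  · simp
  · simp only [Nat.add_sub_cancel]
    ring

/-- Normal ordering of (x ∂)^k; the coefficients are the Stirling numbers of the second kind. -/
theorem iterate_eulerOp_eq_sum {f : (Fin N → ℂ) → ℂ} (hf : Smooth f) (i : Fin N) (k : ℕ) :
    (eulerOp i)^[k] f =ᶠ[𝓝 1] fun x => ∑ j ∈ Finset.range (k + 1),
      (Nat.stirlingSecond k j : ℂ) * (x i ^ j * (partialDeriv i)^[j] f x) := by
  induction k with
  | zero => simp
  | succ k ih =>
    have hs : ∀ j, Smooth fun x => x i ^ j * (partialDeriv i)^[j] f x := fun j =>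
      ((smooth_coord i).pow j).mul (smooth_iterate_partialDeriv hf i j)
    have e1 : ∀ᶠ x in 𝓝 (1 : Fin N → ℂ), ∀ j ∈ Finset.range (k + 1), _ :=
      (Finset.eventually_all _).2 fun j _ => partialDeriv_mul
        (f := fun _ => (Nat.stirlingSecond k j : ℂ)) contDiffAt_const (hs j) i
    have e2 : ∀ᶠ x in 𝓝 (1 : Fin N → ℂ), ∀ j ∈ Finset.range (k + 1), _ :=
      (Finset.eventually_all _).2 fun j _ => eulerOp_pow_mul hf i j
    rw [Function.iterate_succ_apply']
    filter_upwards [eulerOp_congr ih i, partialDeriv_sum (Finset.range (k + 1))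
      (f := fun j x => (Nat.stirlingSecond k j : ℂ) * (x i ^ j * (partialDeriv i)^[j] f x))
      (fun j => contDiffAt_const.mul (hs j)) i, e1, e2] with x h1 h2 h3 h4
    rw [h1, eulerOp, h2, Finset.sum_congr rfl h3, Finset.mul_sum]
    have h5 : ∀ j ∈ Finset.range (k + 1), x i * ((Nat.stirlingSecond k j : ℂ) *
        partialDeriv i (fun x => x i ^ j * (partialDeriv i)^[j] f x) x +
        (x i ^ j * (partialDeriv i)^[j] f x) *
          partialDeriv i (fun _ => (Nat.stirlingSecond k j : ℂ)) x) =
        j * Nat.stirlingSecond k j * (x i ^ j * (partialDeriv i)^[j] f x) +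
        Nat.stirlingSecond k j * (x i ^ (j + 1) * (partialDeriv i)^[j + 1] f x) := by
      intro j hj
      have h6 := h4 j hj
      have h7 : partialDeriv i (fun _ : Fin N → ℂ => (Nat.stirlingSecond k j : ℂ)) x = 0 := by
        simp [partialDeriv]
      rw [h7, mul_zero, add_zero, mul_left_comm]
      rw [eulerOp] at h6
      rw [h6]
      ring
    rw [Finset.sum_congr rfl h5, Finset.sum_add_distrib, Finset.sum_range_succ' _ (k + 1),
      Finset.sum_range_succ']
    simp only [Nat.stirlingSecond_succ_succ, Nat.stirlingSecond_succ_zero, Nat.cast_zero, zero_mul,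
      add_zero, Nat.cast_add, Nat.cast_mul, Nat.cast_one, add_mul, Finset.sum_add_distrib]
    congr 1
    simp only [Finset.sum_range_succ _ k, Nat.stirlingSecond_eq_zero_of_lt (Nat.lt_succ_self k),
      Nat.cast_zero, mul_zero, zero_mul, add_zero]

/-- The operator on symmetric functions corresponding to `∑_i (x_i ∂_i)^k`, up to terms of high
order. -/
noncomputable def powOp (N : ℕ) (L : SymRing) (M k : ℕ) : SymRing →ₗ[ℂ] SymRing :=
  ∑ j ∈ Finset.range (k + 1), (Nat.stirlingSecond k j : ℂ) •
    ∑ b ∈ Finset.range (j + 1), (j.choose b : ℂ) • diffOp N L M j b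

/-- Write (x_i ∂_i)^k in normal order and expand x_i^j = (1 + y_i)^j. -/
theorem jetEq_powOp (L h : SymRing) {K M k : ℕ} (hM : K + k ≤ M) :
    JetEq (vanderDeg N + K)
      (fun x : Fin N → ℂ => ∑ i : Fin N, (eulerOp i)^[k]
        (fun x => vander x * (psEval x h * Complex.exp (psEval x L))) x)
      fun x => vander x * (psEval x (powOp N L M k h) * Complex.exp (psEval x L)) := by
  set F : (Fin N → ℂ) → ℂ := fun x => vander x * (psEval x h * Complex.exp (psEval x L)) with hF
  have hs : Smooth F := smooth_vander.mul (smooth_expWeight L h)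
  have h1 : (fun x : Fin N → ℂ => ∑ i : Fin N, (eulerOp i)^[k] F x) =ᶠ[𝓝 1] fun x =>
      ∑ j ∈ Finset.range (k + 1), (Nat.stirlingSecond k j : ℂ) * ∑ b ∈ Finset.range (j + 1),
        (j.choose b : ℂ) * ∑ i : Fin N, (x i - 1) ^ b * (partialDeriv i)^[j] F x := by
    filter_upwards [eventually_all.2 fun i => iterate_eulerOp_eq_sum hs i k] with x hx
    simp only [hx]
    rw [Finset.sum_comm]
    refine Finset.sum_congr rfl fun j _ => ?_
    rw [← Finset.mul_sum]
    congr 1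
    simp only [Finset.mul_sum]
    rw [Finset.sum_comm]
    refine Finset.sum_congr rfl fun i _ => ?_
    have h2 : x i ^ j = ∑ b ∈ Finset.range (j + 1), (x i - 1) ^ b * (j.choose b : ℂ) := by
      have := add_pow (x i - 1) 1 j
      simpa using this
    rw [h2, Finset.sum_mul]
    exact Finset.sum_congr rfl fun b _ => by ring
  have h3 : JetEq (vanderDeg N + K) (fun x => ∑ j ∈ Finset.range (k + 1),
      (Nat.stirlingSecond k j : ℂ) * ∑ b ∈ Finset.range (j + 1),
        (j.choose b : ℂ) * ∑ i : Fin N, (x i - 1) ^ b * (partialDeriv i)^[j] F x) _ :=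
    JetEq.sum _ fun j hj => (JetEq.refl contDiffAt_const).mul (JetEq.sum _ fun b _ =>
      (JetEq.refl contDiffAt_const).mul (jetEq_diffOp L h (M := M) (by
        have := Finset.mem_range.1 hj
        omega) b))
  have h4 := JetEq.of_eventuallyEq (K := vanderDeg N + K) h3.left h1.symm
  convert h4.symm.trans h3 using 1
  funext x
  simp only [powOp, LinearMap.sum_apply, LinearMap.smul_apply, map_sum, psEval_smul,
    Finset.mul_sum, Finset.sum_mul]
  exact Finset.sum_congr rfl fun j _ => Finset.sum_congr rfl fun b _ => by ring

theorem smooth_vander_mul_genFn {w : Signature N → ℂ} (hw : ExpSummable w) :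
    Smooth fun x => vander x * genFn w x :=
  contDiffAt_infty.2 fun k => contDiffAt_vander_mul_genFn hw k

/-- Inserting a factor p_k − e costs k orders of the jet, the order of the differential operator. -/
theorem jetEq_genFn_sigPower {w : Signature N → ℂ} (hw : ExpSummable w) {L h : SymRing}
    {K M k : ℕ} (hM : K + k ≤ M) (e : ℂ)
    (hj : JetEq (vanderDeg N + (K + k)) (fun x => vander x * genFn w x)
      fun x => vander x * (psEval x h * Complex.exp (psEval x L))) :
    JetEq (vanderDeg N + K) (fun x => vander x * genFn (fun u => ((sigPower k u : ℂ) - e) * w u) x)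
      fun x => vander x * (psEval x (powOp N L M k h - e • h) * Complex.exp (psEval x L)) := by
  have hw' : ExpSummable fun u => ((sigPower k u : ℂ) - e) * w u :=
    hw.mul ((polyBdd_sigPower k).sub (polyBdd_const e))
  refine (JetEq.of_eventuallyEq (smooth_vander_mul_genFn hw')
    (vander_mul_genFn_sigPower hw k e)).trans ?_
  have h1 := JetEq.sum (K := vanderDeg N + K) Finset.univ fun (i : Fin N) _ =>
    JetEq.iterate_eulerOp (n := k) i (K := vanderDeg N + K) (by rwa [add_assoc])
  have h2 := (h1.trans (jetEq_powOp L h hM)).sub ((JetEq.refl (contDiffAt_const (c := e))).mul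
    (hj.mono (by omega)))
  convert h2 using 1
  funext x
  rw [map_sub, psEval_smul]
  ring

/-- The composition of the operators `powOp - e` for the pairs `(k, e)` in a list. -/
noncomputable def levelOp (N : ℕ) (L : SymRing) (M : ℕ) (ls : List (ℕ × ℂ)) (h : SymRing) :
    SymRing :=
  ls.foldr (fun a h => powOp N L M a.1 h - a.2 • h) h

/-- The product of the functions `p_k - e` for the pairs `(k, e)` in a list. -/
noncomputable def levelFn (ls : List (ℕ × ℂ)) (u : Signature N) : ℂ :=
  (ls.map fun a => (sigPower a.1 u : ℂ) - a.2).prod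

theorem polyBdd_levelFn (ls : List (ℕ × ℂ)) : PolyBdd (levelFn (N := N) ls) := by
  unfold levelFn
  induction ls with
  | nil => simpa using polyBdd_const 1
  | cons a ls ih =>
    simp only [List.map_cons, List.prod_cons]
    exact ((polyBdd_sigPower a.1).sub (polyBdd_const a.2)).mul ih

theorem jetEq_levelOp {w : Signature N → ℂ} (hw : ExpSummable w) {L h : SymRing} {M : ℕ}
    (ls : List (ℕ × ℂ)) : ∀ {K : ℕ}, K + (ls.map Prod.fst).sum ≤ M →
    JetEq (vanderDeg N + (K + (ls.map Prod.fst).sum)) (fun x => vander x * genFn w x)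
      (fun x => vander x * (psEval x h * Complex.exp (psEval x L))) →
    JetEq (vanderDeg N + K) (fun x => vander x * genFn (fun u => levelFn ls u * w u) x)
      fun x => vander x * (psEval x (levelOp N L M ls h) * Complex.exp (psEval x L)) := by
  induction ls with
  | nil => intro K _ h; simpa [levelFn, levelOp] using h
  | cons a ls ih =>
    intro K hM hj
    simp only [List.map_cons, List.sum_cons] at hM hj
    have h1 := ih (K := K + a.1) (by omega) (by rwa [add_assoc])
    have h2 := jetEq_genFn_sigPower (hw.mul (polyBdd_levelFn ls)) (M := M) (by omega) a.2 h1
    have h3 : (fun u => levelFn (N := N) (a :: ls) u * w u) =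
        fun u => ((sigPower a.1 u : ℂ) - a.2) * (levelFn ls u * w u) := by
      funext u
      simp [levelFn, mul_assoc]
    rw [h3]
    exact h2

/-- The composition of the operators on all levels, applied to `1`. -/
noncomputable def chainOp (N M : ℕ) : ∀ {m : ℕ}, (Fin (m + 1) → SymRing) →
    (Fin (m + 1) → List (ℕ × ℂ)) → SymRing
  | 0, L, ls => levelOp N (L 0) M (ls 0) 1
  | _ + 1, L, ls => levelOp N (L 0) M (ls 0) (chainOp N M (fun s => L s.succ) fun s => ls s.succ)

/-- Within a level the operators act on h with L fixed. Between levels the multiplication by g turns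
exp(L (s + 1)) into exp(L s) and leaves h unchanged. M has to exceed the total order of all
operators, because the jets of the generating functions are known only to order M. -/
theorem jetEq_chainOp {ρ : PMF (Signature N)} (hρ : ExpSummable (massFn ρ)) {M : ℕ} : ∀ {m : ℕ}
    {σ : Fin m → PMF (Signature N)}, (∀ r, ExpSummable (massFn (σ r))) →
    ∀ {L : Fin (m + 1) → SymRing},
    JetEq M (schurGF ρ) (fun x => Complex.exp (psEval x (L (Fin.last m)))) →
    (∀ r : Fin m, JetEq M (schurGF (σ r)) fun x =>
      Complex.exp (psEval x (L r.castSucc) - psEval x (L r.succ))) →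
    ∀ (ls : Fin (m + 1) → List (ℕ × ℂ)) {K : ℕ}, K + ∑ s, ((ls s).map Prod.fst).sum ≤ M →
    JetEq (vanderDeg N + K) (fun x => vander x * genFn (chainMarg ρ σ fun s => levelFn (ls s)) x)
      fun x => vander x * (psEval x (chainOp N M L ls) * Complex.exp (psEval x (L 0))) := by
  intro m
  induction m with
  | zero =>
    intro σ hσ L h1 _ ls K hK
    rw [Fin.sum_univ_one] at hK
    refine jetEq_levelOp hρ (ls 0) (K := K) hK ?_
    simp only [map_one, one_mul]
    exact (h1.vanish_mul smooth_vander vanishTo_vander).mono (by omega)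
  | succ m ih =>
    intro σ hσ L h1 h2 ls K hK
    rw [Fin.sum_univ_succ] at hK
    have h3 := ih (σ := fun r => σ r.succ) (fun r => hσ r.succ) (L := fun s => L s.succ)
      (by rwa [Fin.succ_last]) (fun r => by simpa only [Fin.succ_castSucc] using h2 r.succ)
      (fun s => ls s.succ) (K := K + ((ls 0).map Prod.fst).sum) (by omega)
    have hW := expSummable_chainMarg (φ := fun s => levelFn (ls s.succ)) hρ (fun r => hσ r.succ)
      fun s => polyBdd_levelFn _
    refine jetEq_levelOp (hW.push (hσ 0)) (ls 0) (K := K) (by omega) ?_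
    have h4 : (fun x => vander x * genFn (pushWeight (σ 0) (chainMarg ρ (fun r => σ r.succ)
        fun s => levelFn (ls s.succ))) x) =ᶠ[𝓝 1] fun x => schurGF (σ 0) x *
          (vander x * genFn (chainMarg ρ (fun r => σ r.succ) fun s => levelFn (ls s.succ)) x) := by
      filter_upwards [genFn_pushWeight hW (hσ 0)] with x hx
      rw [hx]
      ring
    refine (JetEq.of_eventuallyEq (smooth_vander_mul_genFn (hW.push (hσ 0))) h4).trans ?_
    have h5 := h3.vanish_mul (h2 0).left (a := 0) trivial
    rw [zero_add] at h5
    refine h5.trans ?_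
    have h6 := ((h2 0).mul (JetEq.refl ((smooth_psEval (chainOp N M (fun s => L s.succ)
      fun s => ls s.succ)).mul (smooth_psEval (L (Fin.succ 0))).cexp))).vanish_mul smooth_vander
      vanishTo_vander
    have h7 := h6.mono (L := vanderDeg N + (K + ((ls 0).map Prod.fst).sum)) (by omega)
    convert h7 using 1
    · funext x
      ring
    · funext x
      rw [Complex.exp_sub]
      have := Complex.exp_ne_zero (psEval x (L (Fin.succ 0)))
      simp only [Fin.castSucc_zero]
      field_simp

theorem psEval_one (f : SymRing) :
    psEval (1 : Fin N → ℂ) f = MvPolynomial.constantCoeff f := by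
  simp only [psEval, Pi.one_apply, sub_self, ne_eq, Nat.succ_ne_zero, not_false_eq_true, zero_pow,
    Finset.sum_const_zero]
  exact (DFunLike.congr_fun MvPolynomial.eval_zero f : _)

/-- At 1^N all power sums vanish, so h·exp(L) takes the value of the constant coefficient of h. This
converts joint moments at fixed N into algebra. -/
theorem integral_chainMeasure_levelFn {m : ℕ} {ρ : PMF (Signature N)}
    {σ : Fin m → PMF (Signature N)} (hρ : ExpSummable (massFn ρ))
    (hσ : ∀ r, ExpSummable (massFn (σ r))) {M : ℕ} {L : Fin (m + 1) → SymRing}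
    (h0 : MvPolynomial.constantCoeff (L 0) = 0)
    (h1 : JetEq M (schurGF ρ) fun x => Complex.exp (psEval x (L (Fin.last m))))
    (h2 : ∀ r : Fin m, JetEq M (schurGF (σ r)) fun x =>
      Complex.exp (psEval x (L r.castSucc) - psEval x (L r.succ)))
    (ls : Fin (m + 1) → List (ℕ × ℂ)) (hM : 1 + ∑ s, ((ls s).map Prod.fst).sum ≤ M) :
    ∫ l, ∏ s, levelFn (ls s) (l s) ∂(chainMeasure ρ σ) =
      MvPolynomial.constantCoeff (chainOp N M L ls) := by
  rw [integral_chain_prod hρ hσ fun s => polyBdd_levelFn (ls s)]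
  have hW := expSummable_chainMarg hρ hσ fun s => polyBdd_levelFn (ls s)
  rw [eq_of_jetEq_vander_mul (continuousAt_genFn hW)
    (smooth_expWeight (L 0) (chainOp N M L ls)).continuousAt (jetEq_chainOp hρ hσ h1 h2 ls hM)]
  simp only [psEval_one, h0, Complex.exp_zero, mul_one]

/-! ### Jets of symmetric functions -/

theorem mixedPartial_cons (i : ℕ) (I : List ℕ) (f : (Fin N → ℂ) → ℂ) :
    mixedPartial (i :: I) f = partialDeriv i (mixedPartial I f) := rfl

theorem mixedPartial_congr {f g : (Fin N → ℂ) → ℂ} (h : f =ᶠ[𝓝 1] g) (I : List ℕ) :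
    mixedPartial I f =ᶠ[𝓝 1] mixedPartial I g := by
  induction I with
  | nil => exact h
  | cons i I ih => exact partialDeriv_congr ih i

theorem Smooth.mixedPartial {f : (Fin N → ℂ) → ℂ} (hf : Smooth f) (I : List ℕ) :
    Smooth (mixedPartial I f) := by
  induction I with
  | nil => exact hf
  | cons i I ih => exact ih.partialDeriv i

theorem partialDeriv_comm {f : (Fin N → ℂ) → ℂ} (hf : Smooth f) (i j : ℕ) :
    partialDeriv i (partialDeriv j f) =ᶠ[𝓝 1] partialDeriv j (partialDeriv i f) := by
  have h1 : ContDiffAt ℂ 2 f 1 := by exact_mod_cast contDiffAt_infty.1 hf 2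
  filter_upwards [h1.eventually (by simp)] with x hx
  have h2 : IsSymmSndFDerivAt ℂ f x := hx.isSymmSndFDerivAt (by simp)
  have h3 : DifferentiableAt ℂ (fderiv ℂ f) x :=
    (hx.fderiv_right (m := 1) (by norm_num)).differentiableAt one_ne_zero
  have h4 : ∀ v w : Fin N → ℂ, fderiv ℂ (fun y => fderiv ℂ f y v) x w =
      fderiv ℂ (fderiv ℂ f) x w v := by
    intro v w
    rw [fderiv_clm_apply h3 (differentiableAt_const v)]
    simp
  change fderiv ℂ (fun y => fderiv ℂ f y _) x _ = fderiv ℂ (fun y => fderiv ℂ f y _) x _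
  rw [h4, h4]
  exact h2 _ _

theorem mixedPartial_perm {f : (Fin N → ℂ) → ℂ} (hf : Smooth f) {I J : List ℕ}
    (h : I.Perm J) : mixedPartial I f =ᶠ[𝓝 1] mixedPartial J f := by
  induction h with
  | nil => rfl
  | cons i _ ih => exact partialDeriv_congr ih i
  | swap i j I => exact partialDeriv_comm (hf.mixedPartial I) j i
  | trans _ _ h1 h2 => exact h1.trans h2

theorem mixedPartial_sub {f g : (Fin N → ℂ) → ℂ} (hf : Smooth f) (hg : Smooth g) (I : List ℕ) :
    mixedPartial I (fun x => f x - g x) =ᶠ[𝓝 1]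
      fun x => mixedPartial I f x - mixedPartial I g x := by
  induction I with
  | nil => rfl
  | cons i I ih =>
    exact (partialDeriv_congr ih i).trans
      (partialDeriv_sub (hf.mixedPartial I) (hg.mixedPartial I) i)

theorem mixedPartial_add {f g : (Fin N → ℂ) → ℂ} (hf : Smooth f) (hg : Smooth g) (I : List ℕ) :
    mixedPartial I (fun x => f x + g x) =ᶠ[𝓝 1]
      fun x => mixedPartial I f x + mixedPartial I g x := by
  induction I with
  | nil => rfl
  | cons i I ih =>
    exact (partialDeriv_congr ih i).trans
      (partialDeriv_add (hf.mixedPartial I) (hg.mixedPartial I) i)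

theorem mixedPartial_sum {ι : Type*} (s : Finset ι) {f : ι → (Fin N → ℂ) → ℂ}
    (hf : ∀ j, Smooth (f j)) (I : List ℕ) :
    mixedPartial I (fun x => ∑ j ∈ s, f j x) =ᶠ[𝓝 1] fun x => ∑ j ∈ s, mixedPartial I (f j) x := by
  induction I with
  | nil => rfl
  | cons i I ih =>
    exact (partialDeriv_congr ih i).trans (partialDeriv_sum s (fun j => (hf j).mixedPartial I) i)

theorem mixedPartial_const_mul {f : (Fin N → ℂ) → ℂ} (c : ℂ) (I : List ℕ) :
    mixedPartial I (fun x => c * f x) = fun x => c * mixedPartial I f x := by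
  induction I with
  | nil => rfl
  | cons i I ih =>
    rw [mixedPartial_cons, ih]
    funext x
    change fderiv ℂ (c • mixedPartial I f) x _ = _
    rw [fderiv_const_smul_field]
    rfl

theorem mixedPartial_comp_perm {f : (Fin N → ℂ) → ℂ} (τ : Equiv.Perm (Fin N))
    (I : List (Fin N)) (x : Fin N → ℂ) :
    mixedPartial ((I.map τ).map Fin.val) (fun x => f (x ∘ τ)) x =
      mixedPartial (I.map Fin.val) f (x ∘ τ) := by
  induction I generalizing x with
  | nil => rfl
  | cons i I ih =>
    simp only [List.map_cons, mixedPartial_cons]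
    rw [show mixedPartial ((I.map τ).map Fin.val) (fun x => f (x ∘ τ)) =
      fun x => mixedPartial (I.map Fin.val) f (x ∘ τ) from funext ih]
    let e : (Fin N → ℂ) ≃L[ℂ] (Fin N → ℂ) :=
      (LinearEquiv.funCongrLeft ℂ ℂ τ).toContinuousLinearEquiv
    have he : ∀ x, e x = x ∘ τ := fun x => rfl
    have h1 : (fun x => mixedPartial (I.map Fin.val) f (x ∘ τ)) =
        mixedPartial (I.map Fin.val) f ∘ e := by
      funext x
      simp [he]
    simp only [partialDeriv]
    rw [h1, e.comp_right_fderiv]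
    simp only [ContinuousLinearMap.comp_apply, ContinuousLinearEquiv.coe_coe, he]
    congr 1
    funext j
    simp [coordVec_apply]

/-! ### Monomial symmetric functions and their derivatives -/

/-- The list containing each `i j` exactly `κ j + 1` times. -/
def placeList {α : Type*} {d : ℕ} (κ : Fin d → ℕ) (i : Fin d → α) : List α :=
  (List.ofFn fun j => List.replicate (κ j + 1) (i j)).flatten

theorem map_placeList {α β : Type*} {d : ℕ} (κ : Fin d → ℕ) (i : Fin d → α) (f : α → β) :
    (placeList κ i).map f = placeList κ fun j => f (i j) := by
  simp [placeList, List.map_flatten, List.map_ofFn, Function.comp_def]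

theorem count_placeList {α : Type*} [DecidableEq α] {d : ℕ} (κ : Fin d → ℕ) (i : Fin d → α)
    (a : α) : (placeList κ i).count a = ∑ j, if i j = a then κ j + 1 else 0 := by
  rw [placeList, List.count_flatten, List.map_ofFn, List.sum_ofFn]
  refine Finset.sum_congr rfl fun j _ => ?_
  simp [List.count_replicate]

/-- The monomial symmetric function with exponents `κ j + 1`, summed over all injective
placements of the exponents. -/
noncomputable def monoSym : ∀ {d : ℕ}, (Fin d → ℕ) → SymRing
  | 0, _ => 1
  | d + 1, κ => MvPolynomial.X (κ 0) * monoSym (fun j : Fin d => κ j.succ) -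
      ∑ l : Fin d, monoSym (Function.update (fun j : Fin d => κ j.succ) l (κ l.succ + κ 0 + 1))

-- Multiply a sum over placements of the last d exponents by a power sum: the new index is either
-- different from the others or equal to one of them. In the latter case the exponents κ 0 + 1 and κ
-- (l + 1) + 1 merge, which is why the update has an additional 1.
open Classical in
theorem psEval_monoSym (x : Fin N → ℂ) : ∀ {d : ℕ} (κ : Fin d → ℕ),
    psEval x (monoSym κ) = ∑ i : Fin d → Fin N,
      if Function.Injective i then ∏ j, (x (i j) - 1) ^ (κ j + 1) else 0
  | 0, κ => by
    simp [monoSym, Function.injective_of_subsingleton]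
  | d + 1, κ => by
    rw [monoSym, map_sub, map_mul, map_sum]
    simp only [psEval_monoSym x]
    have hX : psEval x (MvPolynomial.X (κ 0)) = ∑ l, (x l - 1) ^ (κ 0 + 1) := by simp [psEval]
    rw [hX, ← (Fin.consEquiv fun _ : Fin (d + 1) => Fin N).sum_comp, Fintype.sum_prod_type_right,
      Finset.mul_sum, Finset.sum_comm, ← Finset.sum_sub_distrib]
    refine Finset.sum_congr rfl fun e _ => ?_
    have h0 : ∀ l, (Fin.consEquiv fun _ : Fin (d + 1) => Fin N) (l, e) =
      (Fin.cons l e : Fin (d + 1) → Fin N) := fun l => rfl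
    simp only [h0, Fin.cons_injective_iff]
    by_cases he : Function.Injective e
    · simp only [he, if_true, and_true, Fin.prod_univ_succ, Fin.cons_zero, Fin.cons_succ]
      have h1 : ∀ l : Fin d, ∏ j, (x (e j) - 1) ^
          (Function.update (fun j : Fin d => κ j.succ) l (κ l.succ + κ 0 + 1) j + 1) =
          (x (e l) - 1) ^ (κ 0 + 1) * ∏ j, (x (e j) - 1) ^ (κ j.succ + 1) := by
        intro l
        rw [← Finset.mul_prod_erase _ _ (Finset.mem_univ l),
          ← Finset.mul_prod_erase _ (fun j => (x (e j) - 1) ^ (κ j.succ + 1)) (Finset.mem_univ l),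
          Function.update_self, ← mul_assoc, ← pow_add]
        congr 1
        · congr 1
          ring
        · refine Finset.prod_congr rfl fun j hj => ?_
          rw [Function.update_of_ne (Finset.mem_erase.1 hj).1]
      simp only [h1]
      rw [← Finset.sum_mul, ← sub_mul]
      have h2 : ∀ l, (if l ∉ Set.range e then (x l - 1) ^ (κ 0 + 1) *
          ∏ j, (x (e j) - 1) ^ (κ j.succ + 1) else 0) =
          (if l ∉ Set.range e then (x l - 1) ^ (κ 0 + 1) else 0) *
          ∏ j, (x (e j) - 1) ^ (κ j.succ + 1) := fun l => by split_ifs <;> simp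
      simp only [h2]
      rw [← Finset.sum_mul]
      congr 1
      rw [sub_eq_iff_eq_add]
      have h3 : ∑ j, (x (e j) - 1) ^ (κ 0 + 1) =
          ∑ l, if l ∈ Set.range e then (x l - 1) ^ (κ 0 + 1) else 0 := by
        rw [← Finset.sum_filter, ← Finset.sum_image (f := fun l => (x l - 1) ^ (κ 0 + 1))
          (g := e) he.injOn]
        refine Finset.sum_congr ?_ fun _ _ => rfl
        ext l
        simp
      rw [h3, ← Finset.sum_add_distrib]
      refine Finset.sum_congr rfl fun l _ => ?_
      by_cases hl : l ∈ Set.range e <;> simp only [hl, not_true_eq_false, not_false_eq_true,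
        if_true, if_false, zero_add, add_zero]
    · simp [he]

theorem partialDeriv_monomial (β : Fin N → ℕ) (i : Fin N) (x : Fin N → ℂ) :
    partialDeriv i (fun x : Fin N → ℂ => ∏ l, (x l - 1) ^ β l) x =
      β i * ∏ l, (x l - 1) ^ (β l - if l = i then 1 else 0) := by
  have h1 : ∀ l : Fin N, HasFDerivAt (fun x : Fin N → ℂ => (x l - 1) ^ β l)
      ((β l * (x l - 1) ^ (β l - 1)) •
        ContinuousLinearMap.proj (R := ℂ) (φ := fun _ : Fin N => ℂ) l) x := fun l => by
    have := ((hasFDerivAt_apply (𝕜 := ℂ) (F' := fun _ : Fin N => ℂ) l x).sub_const 1).pow (β l)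
    simpa [mul_smul] using this
  rw [partialDeriv, (HasFDerivAt.finsetProd (u := Finset.univ) fun l _ => h1 l).fderiv]
  simp only [sum_apply, smul_apply, ContinuousLinearMap.proj_apply, coordVec_apply, smul_eq_mul,
    mul_ite, mul_one, mul_zero, Finset.sum_ite_eq', Finset.mem_univ, if_true]
  have h2 : ∏ l ∈ Finset.univ.erase i, (x l - 1) ^ (β l - if l = i then 1 else 0) =
      ∏ l ∈ Finset.univ.erase i, (x l - 1) ^ β l :=
    Finset.prod_congr rfl fun l hl => by rw [if_neg (Finset.mem_erase.1 hl).1, Nat.sub_zero]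
  rw [← Finset.mul_prod_erase Finset.univ
    (fun l => (x l - 1) ^ (β l - if l = i then 1 else 0)) (Finset.mem_univ i), if_pos rfl, h2]
  ring

theorem mixedPartial_monomial (β : Fin N → ℕ) (I : List (Fin N)) (x : Fin N → ℂ) :
    mixedPartial (I.map Fin.val) (fun x : Fin N → ℂ => ∏ l, (x l - 1) ^ β l) x =
      ∏ l, ((β l).descFactorial (I.count l) : ℂ) * (x l - 1) ^ (β l - I.count l) := by
  induction I generalizing x with
  | nil => simp [mixedPartial]
  | cons i I ih =>
    rw [List.map_cons, mixedPartial_cons, show mixedPartial (I.map Fin.val)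
      (fun x : Fin N → ℂ => ∏ l, (x l - 1) ^ β l) = fun x =>
        (∏ l, ((β l).descFactorial (I.count l) : ℂ)) * ∏ l, (x l - 1) ^ (β l - I.count l) from
      funext fun x => by rw [ih, Finset.prod_mul_distrib]]
    have h1 := congrFun (mixedPartial_const_mul (∏ l, ((β l).descFactorial (I.count l) : ℂ))
      [(i : ℕ)] (f := fun x : Fin N → ℂ => ∏ l, (x l - 1) ^ (β l - I.count l))) x
    simp only [mixedPartial, List.foldr_cons, List.foldr_nil] at h1
    rw [h1, partialDeriv_monomial, Finset.prod_mul_distrib]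
    have h2 : ∀ l, (i :: I).count l = I.count l + if l = i then 1 else 0 := fun l => by
      rw [List.count_cons]
      by_cases h : l = i
      · simp [h]
      · simp [h, Ne.symm h]
    simp only [h2, Nat.sub_sub]
    rw [← mul_assoc]
    congr 1
    have h3 : ∏ l ∈ Finset.univ.erase i,
        ((β l).descFactorial (I.count l + if l = i then 1 else 0) : ℂ) =
        ∏ l ∈ Finset.univ.erase i, ((β l).descFactorial (I.count l) : ℂ) :=
      Finset.prod_congr rfl fun l hl => by rw [if_neg (Finset.mem_erase.1 hl).1, add_zero]
    rw [← Finset.prod_erase_mul _ _ (Finset.mem_univ i), ← Finset.prod_erase_mul Finset.univ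
      (fun l => ((β l).descFactorial (I.count l + if l = i then 1 else 0) : ℂ)) (Finset.mem_univ i),
      if_pos rfl, Nat.descFactorial_succ, h3]
    push_cast
    ring

theorem mixedPartial_monomial_one (β : Fin N → ℕ) (I : List (Fin N)) :
    mixedPartial (I.map Fin.val) (fun x : Fin N → ℂ => ∏ l, (x l - 1) ^ β l) 1 =
      if ∀ l, I.count l = β l then ∏ l, ((β l).factorial : ℂ) else 0 := by
  rw [mixedPartial_monomial]
  split_ifs with h
  · refine Finset.prod_congr rfl fun l _ => ?_
    rw [h l, Nat.descFactorial_self]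
    simp
  · push Not at h
    obtain ⟨l, hl⟩ := h
    refine Finset.prod_eq_zero (Finset.mem_univ l) ?_
    rcases hl.lt_or_gt with h | h
    · rw [Pi.one_apply, sub_self, zero_pow (by omega), mul_zero]
    · rw [Nat.descFactorial_of_lt h, Nat.cast_zero, zero_mul]

/-- The coefficient of the monomial symmetric function with exponents `κ j + 1` in the jet of a
symmetric function with derivatives `t`. -/
noncomputable def jetCoeff (t : List ℕ → ℂ) {d : ℕ} (κ : Fin d → ℕ) : ℂ :=
  t (placeList κ fun j => (j : ℕ)) / (d.factorial * ∏ j, ((κ j + 1).factorial : ℂ))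

/-- The symmetric function with derivatives `t` at `(1, …, 1)` of order less than `M`. -/
noncomputable def jetSym (M : ℕ) (t : List ℕ → ℂ) : SymRing :=
  ∑ d ∈ Finset.range M, ∑ κ : Fin d → Fin M,
    jetCoeff t (fun j => (κ j : ℕ)) • monoSym fun j => (κ j : ℕ)

theorem mixedPartial_symmetric {f : (Fin N → ℂ) → ℂ} (hs : ∀ (τ : Equiv.Perm (Fin N)) x,
    f (x ∘ τ) = f x) (τ : Equiv.Perm (Fin N)) (I : List (Fin N)) :
    mixedPartial ((I.map τ).map Fin.val) f 1 = mixedPartial (I.map Fin.val) f 1 := by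
  have := mixedPartial_comp_perm (f := f) τ I 1
  simp only [hs] at this
  exact this

/-- A derivative of a symmetric function at 1^N depends only on the multiplicities of the indices;
move the d distinct indices to the first d variables by a permutation. -/
theorem mixedPartial_placeList {f : (Fin N → ℂ) → ℂ} (hf : Smooth f)
    (hs : ∀ (τ : Equiv.Perm (Fin N)) x, f (x ∘ τ) = f x) {d : ℕ} (κ : Fin d → ℕ)
    {i : Fin d → Fin N} (hi : Function.Injective i) {I : List (Fin N)}
    (hI : ∀ l, I.count l = ∑ j, if i j = l then κ j + 1 else 0) :
    mixedPartial (placeList κ fun j => (j : ℕ)) f 1 = mixedPartial (I.map Fin.val) f 1 := by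
  have hd : d ≤ N := by simpa using Fintype.card_le_of_injective i hi
  obtain ⟨τ, hτ⟩ := Equiv.Perm.exists_extending_pair (Fin.castLE hd) i
    (Fin.castLE_injective hd) hi
  have h1 : I.Perm ((placeList κ (Fin.castLE hd)).map τ) := by
    rw [List.perm_iff_count]
    intro l
    rw [hI, map_placeList, count_placeList]
    simp only [hτ]
  have h2 := (mixedPartial_perm hf (h1.map Fin.val)).self_of_nhds
  rw [h2, mixedPartial_symmetric hs, map_placeList]
  rfl

open Classical in
theorem mixedPartial_psEval_monoSym {d : ℕ} (κ : Fin d → ℕ) (I : List (Fin N)) :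
    mixedPartial (I.map Fin.val) (fun x : Fin N → ℂ => psEval x (monoSym κ)) 1 =
      ∑ i : Fin d → Fin N, if Function.Injective i ∧
        ∀ l, I.count l = ∑ j, if i j = l then κ j + 1 else 0 then
          ∏ j, ((κ j + 1).factorial : ℂ) else 0 := by
  let g : (Fin d → Fin N) → (Fin N → ℂ) → ℂ := fun i x =>
    (if Function.Injective i then 1 else 0) * ∏ l, (x l - 1) ^ ∑ j, if i j = l then κ j + 1 else 0
  have hg : ∀ i, Smooth (g i) := fun i =>
    contDiffAt_const.mul (contDiffAt_prod fun l _ => smooth_pow l _)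
  have h1 : (fun x : Fin N → ℂ => psEval x (monoSym κ)) = fun x => ∑ i, g i x := by
    funext x
    rw [psEval_monoSym]
    refine Finset.sum_congr rfl fun i _ => ?_
    simp only [g]
    split_ifs with hi
    · simp only [← Finset.prod_pow_eq_pow_sum, one_mul]
      rw [Finset.prod_comm]
      refine Finset.prod_congr rfl fun j _ => ?_
      rw [Finset.prod_eq_single (i j)]
      · simp
      · intro l _ hl
        simp [hl.symm]
      · simp
    · simp
  rw [h1, (mixedPartial_sum Finset.univ hg _).self_of_nhds]
  refine Finset.sum_congr rfl fun i _ => ?_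
  rw [show mixedPartial (I.map Fin.val) (g i) 1 = _ from
    congrFun (mixedPartial_const_mul _ (I.map Fin.val)) 1, mixedPartial_monomial_one]
  by_cases hi : Function.Injective i
  · simp only [hi, if_true, one_mul, true_and]
    split_ifs with h
    · have h2 : ∀ l, ((∑ j, if i j = l then κ j + 1 else 0).factorial : ℂ) =
          ∏ j, if i j = l then ((κ j + 1).factorial : ℂ) else 1 := by
        intro l
        by_cases hl : ∃ j, i j = l
        · obtain ⟨j, rfl⟩ := hl
          rw [Finset.sum_eq_single j, Finset.prod_eq_single j]
          · simp
          · intro b _ hb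
            rw [if_neg fun h => hb (hi h)]
          · simp
          · intro b _ hb
            rw [if_neg fun h => hb (hi h)]
          · simp
        · push Not at hl
          simp [hl]
      simp only [h2]
      rw [Finset.prod_comm]
      exact Finset.prod_congr rfl fun j _ => by simp
    · rfl
  · simp [hi]

-- A placement of exponents reproducing the multiplicities in I is an enumeration of the distinct
-- entries of I, and the exponents are then forced. The number d! of enumerations is the
-- normalisation in `jetCoeff`.
open Classical in
theorem card_placements (M : ℕ) (I : List (Fin N)) (hI : I.length < M) (d : ℕ) :
    ((Finset.univ : Finset ((Fin d → Fin M) × (Fin d → Fin N))).filter fun p =>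
      Function.Injective p.2 ∧
        ∀ l, I.count l = ∑ j, if p.2 j = l then (p.1 j : ℕ) + 1 else 0).card =
      if d = I.toFinset.card then d.factorial else 0 := by
  have hmem : ∀ {p : (Fin d → Fin M) × (Fin d → Fin N)}, Function.Injective p.2 →
      (∀ l, I.count l = ∑ j, if p.2 j = l then (p.1 j : ℕ) + 1 else 0) →
      (∀ j, I.count (p.2 j) = p.1 j + 1) ∧ ∀ l, l ∈ I.toFinset ↔ ∃ j, p.2 j = l := by
    intro p hp h
    have h1 : ∀ j, I.count (p.2 j) = p.1 j + 1 := by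
      intro j
      rw [h, Finset.sum_eq_single j]
      · simp
      · intro b _ hb
        rw [if_neg fun h => hb (hp h)]
      · simp
    refine ⟨h1, fun l => ?_⟩
    rw [List.mem_toFinset, ← List.count_pos_iff]
    constructor
    · intro hl
      by_contra! hne
      rw [h, Finset.sum_eq_zero fun j _ => if_neg (hne j)] at hl
      exact lt_irrefl _ hl
    · rintro ⟨j, rfl⟩
      rw [h1]
      exact Nat.succ_pos _
  split_ifs with hd
  · have hcard : Fintype.card (Fin d) = Fintype.card I.toFinset := by
      rw [Fintype.card_fin, Fintype.card_coe, hd]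
    have h0 : (Finset.univ : Finset (Fin d ≃ I.toFinset)).card = d.factorial := by
      rw [Finset.card_univ, Fintype.card_equiv (Fintype.equivOfCardEq hcard), Fintype.card_fin]
    rw [← h0]
    symm
    refine Finset.card_bij (fun e _ => (fun j => ⟨I.count (e j).1 - 1, ?_⟩, fun j => (e j).1))
      ?_ ?_ ?_
    · have := List.count_le_length (a := (e j).1) (l := I)
      omega
    · intro e _
      simp only [Finset.mem_filter, Finset.mem_univ, true_and]
      refine ⟨fun a b hab => e.injective (Subtype.ext hab), fun l => ?_⟩
      by_cases hl : l ∈ I.toFinset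
      · obtain ⟨j, hj⟩ := e.surjective ⟨l, hl⟩
        have hj' : (e j : Fin N) = l := by rw [hj]
        rw [Finset.sum_eq_single j]
        · have := List.count_pos_iff.2 (List.mem_toFinset.1 hl)
          simp only [hj', if_true]
          omega
        · intro b _ hb
          rw [if_neg]
          exact fun h => hb (e.injective (Subtype.ext (h.trans hj'.symm)))
        · simp
      · rw [Finset.sum_eq_zero, List.count_eq_zero]
        · exact fun h => hl (List.mem_toFinset.2 h)
        · intro j _
          rw [if_neg]
          rintro rfl
          exact hl (e j).2
    · intro e _ e' _ h
      ext j
      have := congrFun (congrArg Prod.snd h) j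
      exact congrArg Fin.val this
    · rintro ⟨κ, i⟩ hp
      simp only [Finset.mem_filter, Finset.mem_univ, true_and] at hp
      obtain ⟨h1, h2⟩ := hmem (p := (κ, i)) hp.1 hp.2
      refine ⟨Equiv.ofBijective (fun j => ⟨i j, (h2 _).2 ⟨j, rfl⟩⟩) ⟨fun a b hab =>
        hp.1 (congrArg Subtype.val hab), fun l => ?_⟩, Finset.mem_univ _, ?_⟩
      · obtain ⟨j, hj⟩ := (h2 l).1 l.2
        exact ⟨j, Subtype.ext hj⟩
      · refine Prod.ext ?_ rfl
        funext j
        apply Fin.ext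
        have h3 : I.count (i j) = κ j + 1 := h1 j
        change I.count (i j) - 1 = (κ j : ℕ)
        omega
  · rw [Finset.card_eq_zero, Finset.filter_eq_empty_iff]
    rintro p - ⟨hp, h⟩
    apply hd
    have h2 := (hmem hp h).2
    have h3 : I.toFinset = Finset.univ.image p.2 := by
      ext l
      simp [h2]
    rw [h3, Finset.card_image_of_injective _ hp]
    simp

/-- For a given list of derivatives only one number of variables contributes, and there all
admissible placements give the same value, so `jetSym` has the prescribed derivatives of order less
than M. -/
theorem jetEq_jetSym {f : (Fin N → ℂ) → ℂ} (hf : Smooth f)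
    (hs : ∀ (τ : Equiv.Perm (Fin N)) x, f (x ∘ τ) = f x) (M : ℕ) :
    JetEq M f fun x => psEval x (jetSym M fun I => mixedPartial I f 1) := by
  classical
  refine ⟨hf, smooth_psEval _, VanishTo.of_mixedPartial fun I hI => ?_⟩
  rw [(mixedPartial_sub hf (smooth_psEval _) _).self_of_nhds, sub_eq_zero]
  set t : List ℕ → ℂ := fun I => mixedPartial I f 1 with ht
  set τ := mixedPartial (I.map Fin.val) f 1 with hτ
  have h1 : (fun x : Fin N → ℂ => psEval x (jetSym M t)) = fun x => ∑ d ∈ Finset.range M,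
      ∑ κ : Fin d → Fin M, jetCoeff t (fun j => (κ j : ℕ)) *
        psEval x (monoSym fun j => (κ j : ℕ)) := by
    funext x
    simp only [jetSym, map_sum, psEval_smul]
  have hsm : ∀ {d : ℕ} (κ : Fin d → Fin M), Smooth fun x : Fin N → ℂ =>
      jetCoeff t (fun j => (κ j : ℕ)) * psEval x (monoSym fun j => (κ j : ℕ)) := fun κ =>
    contDiffAt_const.mul (smooth_psEval _)
  rw [h1, (mixedPartial_sum _ (fun d => ContDiffAt.sum fun κ _ => hsm κ) _).self_of_nhds]
  have h2 : ∀ d ∈ Finset.range M, mixedPartial (I.map Fin.val) (fun x : Fin N → ℂ =>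
      ∑ κ : Fin d → Fin M, jetCoeff t (fun j => (κ j : ℕ)) *
        psEval x (monoSym fun j => (κ j : ℕ))) 1 =
      if d = I.toFinset.card then τ else 0 := by
    intro d _
    rw [(mixedPartial_sum _ (fun κ => hsm κ) _).self_of_nhds]
    have h3 : ∀ κ : Fin d → Fin M, mixedPartial (I.map Fin.val) (fun x : Fin N → ℂ =>
        jetCoeff t (fun j => (κ j : ℕ)) * psEval x (monoSym fun j => (κ j : ℕ))) 1 =
        ∑ i : Fin d → Fin N, if Function.Injective i ∧
          ∀ l, I.count l = ∑ j, if i j = l then (κ j : ℕ) + 1 else 0 then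
            τ / d.factorial else 0 := by
      intro κ
      rw [congrFun (mixedPartial_const_mul _ (I.map Fin.val)) 1, mixedPartial_psEval_monoSym,
        Finset.mul_sum]
      refine Finset.sum_congr rfl fun i _ => ?_
      split_ifs with h
      · have h4 : t (placeList (fun j => (κ j : ℕ)) fun j => (j : ℕ)) = τ :=
          mixedPartial_placeList hf hs _ h.1 h.2
        rw [jetCoeff, h4]
        have h5 : ∏ j, (((κ j : ℕ) + 1).factorial : ℂ) ≠ 0 :=
          Finset.prod_ne_zero_iff.2 fun j _ => Nat.cast_ne_zero.2 (Nat.factorial_ne_zero _)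
        have h6 : (d.factorial : ℂ) ≠ 0 := Nat.cast_ne_zero.2 (Nat.factorial_ne_zero _)
        field_simp
      · rw [mul_zero]
    simp only [h3]
    rw [← Fintype.sum_prod_type' (f := fun (κ : Fin d → Fin M) (i : Fin d → Fin N) =>
      if Function.Injective i ∧ ∀ l, I.count l = ∑ j, if i j = l then (κ j : ℕ) + 1 else 0 then
        τ / d.factorial else 0), ← Finset.sum_filter, Finset.sum_const, card_placements M I hI]
    split_ifs with hd
    · rw [nsmul_eq_mul, mul_div_cancel₀ _ (Nat.cast_ne_zero.2 (Nat.factorial_ne_zero _))]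
    · simp
  refine Eq.trans ?_ (Finset.sum_congr rfl h2).symm
  rw [Finset.sum_ite_eq', if_pos]
  rw [Finset.mem_range]
  exact (List.toFinset_card_le I).trans_lt hI

end SchurCLT

namespace SchurCLT

/-! ### Convergence of operators on symmetric functions -/

/-- Coefficientwise convergence of polynomials. -/
def CoeffTendsto (h : ℕ → SymRing) (g : SymRing) : Prop :=
  ∀ m, Tendsto (fun N => (h N).coeff m) atTop (𝓝 (g.coeff m))

namespace CoeffTendsto

variable {h h' : ℕ → SymRing} {g g' : SymRing}

theorem const (g : SymRing) : CoeffTendsto (fun _ => g) g := fun _ => tendsto_const_nhds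

theorem add (H : CoeffTendsto h g) (H' : CoeffTendsto h' g') :
    CoeffTendsto (fun N => h N + h' N) (g + g') := fun m => by
  simpa only [MvPolynomial.coeff_add] using (H m).add (H' m)

theorem smul {c : ℕ → ℂ} {c' : ℂ} (hc : Tendsto c atTop (𝓝 c')) (H : CoeffTendsto h g) :
    CoeffTendsto (fun N => c N • h N) (c' • g) := fun m => by
  simpa only [MvPolynomial.coeff_smul, smul_eq_mul] using hc.mul (H m)

theorem sub (H : CoeffTendsto h g) (H' : CoeffTendsto h' g') :
    CoeffTendsto (fun N => h N - h' N) (g - g') := fun m => by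
  simpa only [MvPolynomial.coeff_sub] using (H m).sub (H' m)

theorem sum {ι : Type*} (s : Finset ι) {h : ι → ℕ → SymRing} {g : ι → SymRing}
    (H : ∀ i ∈ s, CoeffTendsto (h i) (g i)) :
    CoeffTendsto (fun N => ∑ i ∈ s, h i N) (∑ i ∈ s, g i) := fun m => by
  simpa only [MvPolynomial.coeff_sum] using tendsto_finsetSum s fun i hi => H i hi m

/-- A coefficient of a product is a sum over a finite set depending only on the exponent, so no
control of degrees or of the number of variables is needed. -/
theorem mul (H : CoeffTendsto h g) (H' : CoeffTendsto h' g') :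
    CoeffTendsto (fun N => h N * h' N) (g * g') := fun m => by
  simpa only [MvPolynomial.coeff_mul] using
    tendsto_finsetSum _ fun p _ => (H p.1).mul (H' p.2)

theorem pderiv (H : CoeffTendsto h g) (a : ℕ) :
    CoeffTendsto (fun N => MvPolynomial.pderiv a (h N)) (MvPolynomial.pderiv a g) := fun m => by
  have h1 : ∀ f : SymRing, (MvPolynomial.pderiv a f).coeff m =
      f.coeff (m + Finsupp.single a 1) * (m a + 1) := fun f => by
    induction f using MvPolynomial.induction_on' with
    | monomial u c =>
      rw [MvPolynomial.pderiv_monomial, MvPolynomial.coeff_monomial, MvPolynomial.coeff_monomial]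
      by_cases hu : u = m + Finsupp.single a 1
      · subst hu
        simp
      · rw [if_neg hu, zero_mul]
        split_ifs with h2
        · by_cases h3 : u a = 0
          · simp [h3]
          · exfalso
            apply hu
            rw [← h2, tsub_add_cancel_of_le]
            rw [Finsupp.single_le_iff]
            omega
        · rfl
    | add p q hp hq => simp only [map_add, MvPolynomial.coeff_add, hp, hq, add_mul]
  simpa only [h1] using (H _).mul_const _

end CoeffTendsto

/-- Convergence of operators: they map convergent sequences to convergent sequences. -/
def OpTendsto (T : ℕ → Module.End ℂ SymRing) (S : Module.End ℂ SymRing) : Prop :=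
  ∀ h g, CoeffTendsto h g → CoeffTendsto (fun N => T N (h N)) (S g)

namespace OpTendsto

variable {T T' : ℕ → Module.End ℂ SymRing} {S S' : Module.End ℂ SymRing}

theorem add (H : OpTendsto T S) (H' : OpTendsto T' S') :
    OpTendsto (fun N => T N + T' N) (S + S') := fun h g hg => (H h g hg).add (H' h g hg)

theorem smul {c : ℕ → ℂ} {c' : ℂ} (hc : Tendsto c atTop (𝓝 c')) (H : OpTendsto T S) :
    OpTendsto (fun N => c N • T N) (c' • S) := fun h g hg => (H h g hg).smul hc

theorem mul (H : OpTendsto T S) (H' : OpTendsto T' S') :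
    OpTendsto (fun N => T N * T' N) (S * S') := fun h g hg => H _ _ (H' h g hg)

theorem mulLeft {h : ℕ → SymRing} {g : SymRing} (H : CoeffTendsto h g) :
    OpTendsto (fun N => LinearMap.mulLeft ℂ (h N)) (LinearMap.mulLeft ℂ g) :=
  fun _ _ hg => H.mul hg

theorem zero : OpTendsto (fun _ => 0) 0 := fun _ _ _ => CoeffTendsto.const 0

end OpTendsto

/-- The operators `T N` are of the form `N ^ r (y_N + Ξ_N / N)` where the numbers `y_N` tend
to `y` and the operators `Ξ_N` tend to `Ξ`. -/
def DualTendsto (r : ℕ) (T : ℕ → Module.End ℂ SymRing) (y : ℂ) (Ξ : Module.End ℂ SymRing) : Prop :=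
  ∃ (yN : ℕ → ℂ) (ΞN : ℕ → Module.End ℂ SymRing),
    (∀ N : ℕ, 1 ≤ N → T N = (N : ℂ) ^ r • (yN N • 1 + (N : ℂ)⁻¹ • ΞN N)) ∧
    Tendsto yN atTop (𝓝 y) ∧ OpTendsto ΞN Ξ

namespace DualTendsto

variable {r r' : ℕ} {T T' : ℕ → Module.End ℂ SymRing} {y y' : ℂ} {Ξ Ξ' : Module.End ℂ SymRing}

theorem tendsto_inv : Tendsto (fun N : ℕ => (N : ℂ)⁻¹) atTop (𝓝 0) :=
  tendsto_inv_atTop_nhds_zero_nat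

theorem add (H : DualTendsto r T y Ξ) (H' : DualTendsto r T' y' Ξ') :
    DualTendsto r (fun N => T N + T' N) (y + y') (Ξ + Ξ') := by
  obtain ⟨a, b, h1, h2, h3⟩ := H
  obtain ⟨a', b', h1', h2', h3'⟩ := H'
  refine ⟨_, _, fun N hN => ?_, h2.add h2', h3.add h3'⟩
  change T N + T' N = _
  rw [h1 N hN, h1' N hN]
  module

theorem smul (c : ℂ) (H : DualTendsto r T y Ξ) :
    DualTendsto r (fun N => c • T N) (c * y) (c • Ξ) := by
  obtain ⟨a, b, h1, h2, h3⟩ := H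
  refine ⟨_, _, fun N hN => ?_, h2.const_mul c, h3.smul tendsto_const_nhds⟩
  change c • T N = _
  rw [h1 N hN]
  module

theorem zero : DualTendsto r (fun _ => 0) 0 0 :=
  ⟨fun _ => 0, fun _ => 0, fun N _ => by simp, tendsto_const_nhds, OpTendsto.zero⟩

theorem sum {ι : Type*} (s : Finset ι) {T : ι → ℕ → Module.End ℂ SymRing} {y : ι → ℂ}
    {Ξ : ι → Module.End ℂ SymRing} (H : ∀ i ∈ s, DualTendsto r (T i) (y i) (Ξ i)) :
    DualTendsto r (fun N => ∑ i ∈ s, T i N) (∑ i ∈ s, y i) (∑ i ∈ s, Ξ i) := by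
  classical
  induction s using Finset.induction_on with
  | empty => simpa using zero
  | insert i s hi ih =>
    simp only [Finset.sum_insert hi]
    exact (H i (Finset.mem_insert_self _ _)).add
      (ih fun j hj => H j (Finset.mem_insert_of_mem hj))

/-- Arithmetic of dual numbers with 1/N as the infinitesimal: the leading parts are scalars, so the
first order part obeys Leibniz' rule although the operators do not commute. -/
theorem mul (H : DualTendsto r T y Ξ) (H' : DualTendsto r' T' y' Ξ') :
    DualTendsto (r + r') (fun N => T N * T' N) (y * y') (y • Ξ' + y' • Ξ) := by
  obtain ⟨a, b, h1, h2, h3⟩ := H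
  obtain ⟨a', b', h1', h2', h3'⟩ := H'
  refine ⟨_, fun N => (a N • b' N + a' N • b N) + (N : ℂ)⁻¹ • (b N * b' N), fun N hN => ?_,
    h2.mul h2', ?_⟩
  · change T N * T' N = _
    rw [h1 N hN, h1' N hN]
    refine LinearMap.ext fun h => ?_
    simp only [Module.End.mul_apply, LinearMap.smul_apply, LinearMap.add_apply, map_smul, map_add,
      Module.End.one_apply]
    module
  · have := ((h3'.smul h2).add (h3.smul h2')).add ((h3.mul h3').smul tendsto_inv)
    simpa using this

/-- A lower power of N is negligible in the leading and in the first order part alike. The scalar a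
N / N is put into y_N, for which convergence without a rate suffices, because centring will remove
scalars altogether. -/
theorem raise (H : DualTendsto r T y Ξ) : DualTendsto (r + 1) T 0 0 := by
  obtain ⟨a, b, h1, h2, h3⟩ := H
  refine ⟨fun N => a N * (N : ℂ)⁻¹, fun N => (N : ℂ)⁻¹ • b N, fun N hN => ?_, ?_, ?_⟩
  · have hN0 : (N : ℂ) ≠ 0 := Nat.cast_ne_zero.2 (by omega)
    rw [h1 N hN, show (N : ℂ) ^ (r + 1) = (N : ℂ) ^ r * N from pow_succ _ _]
    simp only [smul_add, smul_smul]
    congr 2 <;> field_simp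
  · simpa using h2.mul tendsto_inv
  · simpa using h3.smul tendsto_inv

theorem raise_lt (H : DualTendsto r T y Ξ) {k : ℕ} (hk : r < k) : DualTendsto k T 0 0 := by
  induction k with
  | zero => omega
  | succ k ih =>
    rcases Nat.lt_succ_iff_lt_or_eq.1 hk with h | rfl
    · exact (ih h).raise
    · exact H.raise

end DualTendsto

/-! ### Expansion of conjugated derivatives in powers of N -/

/-- Asymptotics of the logarithms of generating functions. -/
structure LogAsymp (L : ℕ → SymRing) (f : PowerSeries ℂ) (G : ℕ → SymRing) : Prop where
  lead : ∀ a : ℕ, Tendsto (fun N : ℕ => (a + 1 : ℂ) *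
    MvPolynomial.constantCoeff (MvPolynomial.pderiv a (L N)) / N) atTop (𝓝 (PowerSeries.coeff a f))
  next : ∀ a : ℕ, CoeffTendsto (fun N => (a + 1 : ℂ) • (MvPolynomial.pderiv a (L N) -
    MvPolynomial.C (MvPolynomial.constantCoeff (MvPolynomial.pderiv a (L N))))) (G a)

/-- The operator `(a + 1) ∂_a + G_a`. -/
noncomputable def fluctOp (G : ℕ → SymRing) (a : ℕ) : Module.End ℂ SymRing :=
  (a + 1 : ℂ) • (MvPolynomial.pderiv a).toLinearMap + LinearMap.mulLeft ℂ (G a)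

/-- The constant term of ∂_a L is of order N and acts as a scalar; the rest of ∂_a L and the
derivation itself are of order 1. -/
theorem dualTendsto_twDeriv {L : ℕ → SymRing} {f : PowerSeries ℂ} {G : ℕ → SymRing}
    (hL : LogAsymp L f G) (a : ℕ) :
    DualTendsto 1 (fun N => (a + 1 : ℂ) • twDeriv (L N) a) (PowerSeries.coeff a f)
      (fluctOp G a) := by
  refine ⟨_, fun N => (a + 1 : ℂ) • (MvPolynomial.pderiv a).toLinearMap +
    LinearMap.mulLeft ℂ ((a + 1 : ℂ) • (MvPolynomial.pderiv a (L N) -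
      MvPolynomial.C (MvPolynomial.constantCoeff (MvPolynomial.pderiv a (L N))))), fun N hN => ?_,
    hL.lead a, ?_⟩
  · have hN0 : (N : ℂ) ≠ 0 := Nat.cast_ne_zero.2 (by omega)
    refine LinearMap.ext fun h => ?_
    simp only [LinearMap.smul_apply, LinearMap.add_apply, LinearMap.mulLeft_apply,
      twDeriv_apply, Derivation.coeFn_coe, Module.End.one_apply, pow_one, smul_add, smul_smul]
    rw [mul_inv_cancel₀ hN0, mul_div_cancel₀ _ hN0]
    simp only [smul_mul_assoc, sub_mul, smul_sub, ← MvPolynomial.smul_eq_C_mul, one_mul,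
      smul_smul]
    match_scalars
    · field_simp
    all_goals (field_simp; try ring)
  · refine OpTendsto.add (OpTendsto.smul tendsto_const_nhds fun h g hg => hg.pderiv a)
      (OpTendsto.mulLeft (hL.next a))

/-- The first order term in the expansion of `derivCoeff`. -/
noncomputable def derivFluct (f : PowerSeries ℂ) (G : ℕ → SymRing) (n m : ℕ) :
    Module.End ℂ SymRing :=
  (n : ℂ) • ∑ p ∈ Finset.HasAntidiagonal.antidiagonal m,
    PowerSeries.coeff p.1 (f ^ (n - 1)) • fluctOp G p.2

/-- View f as a power series F with coefficients among the scalar operators, which commute with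
everything. The claim is the coefficient of F · n F^(n−1) A + F^n A = (n + 1) F^n A, with A the
generating series of the fluctuation operators. -/
theorem derivFluct_succ (f : PowerSeries ℂ) (G : ℕ → SymRing) (n m : ℕ) :
    derivFluct f G (n + 1) m = ∑ p ∈ Finset.HasAntidiagonal.antidiagonal m,
      (PowerSeries.coeff p.1 f • derivFluct f G n p.2 +
        PowerSeries.coeff p.2 (f ^ n) • fluctOp G p.1) := by
  let A : PowerSeries (Module.End ℂ SymRing) := PowerSeries.mk (fluctOp G)
  let F : PowerSeries (Module.End ℂ SymRing) := PowerSeries.map (algebraMap ℂ _) f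
  have hF : ∀ n m, PowerSeries.coeff m (F ^ n) = algebraMap ℂ (Module.End ℂ SymRing)
      (PowerSeries.coeff m (f ^ n)) := fun n m => by
    simp only [F]
    rw [← map_pow, PowerSeries.coeff_map]
  have h1 : ∀ n m, derivFluct f G n m = PowerSeries.coeff m ((n : PowerSeries _) * (F ^ (n - 1) * A)) := by
    intro n m
    rw [← nsmul_eq_mul, map_nsmul, PowerSeries.coeff_mul, derivFluct, Nat.cast_smul_eq_nsmul]
    congr 1
    refine Finset.sum_congr rfl fun p _ => ?_
    rw [hF, PowerSeries.coeff_mk, Algebra.smul_def]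
  have h2 : PowerSeries.coeff m (F * ((n : PowerSeries _) * (F ^ (n - 1) * A)) + F ^ n * A) =
      ∑ p ∈ Finset.HasAntidiagonal.antidiagonal m,
      (PowerSeries.coeff p.1 f • derivFluct f G n p.2 +
        PowerSeries.coeff p.2 (f ^ n) • fluctOp G p.1) := by
    rw [map_add, PowerSeries.coeff_mul, PowerSeries.coeff_mul, Finset.sum_add_distrib]
    congr 1
    · refine Finset.sum_congr rfl fun p _ => ?_
      rw [h1, ← pow_one F, hF, pow_one, Algebra.smul_def]
    · rw [← Finset.Nat.sum_antidiagonal_swap]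
      refine Finset.sum_congr rfl fun p _ => ?_
      rw [hF, PowerSeries.coeff_mk, Algebra.smul_def]
      rfl
  rw [← h2, h1]
  congr 1
  rw [Nat.add_sub_cancel, ← mul_assoc, ← mul_assoc, ← mul_assoc, ← add_mul]
  congr 1
  rcases n with _ | n
  · simp
  · rw [Nat.add_sub_cancel, (Nat.cast_commute (n + 1) F).eq.symm, mul_assoc, ← pow_succ']
    push_cast
    noncomm_ring

/-- In the recursion the term that differentiates y_i^m carries no new factor N, so it drops out by
`DualTendsto.raise`. What is left is a convolution with the coefficients of f. -/
theorem dualTendsto_derivCoeff {L : ℕ → SymRing} {f : PowerSeries ℂ} {G : ℕ → SymRing}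
    (hL : LogAsymp L f G) (n : ℕ) : ∀ m, DualTendsto n (fun N => derivCoeff (L N) n m)
      (PowerSeries.coeff m (f ^ n)) (derivFluct f G n m) := by
  induction n with
  | zero =>
    intro m
    refine ⟨fun _ => if m = 0 then 1 else 0, fun _ => 0, fun N _ => ?_, ?_, ?_⟩
    · change (if m = 0 then LinearMap.id else 0) = _
      split_ifs
      · simp; rfl
      · simp
    · rw [pow_zero, PowerSeries.coeff_one]
      exact tendsto_const_nhds
    · simpa [derivFluct] using OpTendsto.zero
  | succ n ih =>
    intro m
    have h1 := ((ih (m + 1)).smul (m + 1 : ℂ)).raise.add (DualTendsto.sum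
      (Finset.HasAntidiagonal.antidiagonal m) fun p _ => (add_comm n 1) ▸
        (dualTendsto_twDeriv hL p.1).mul (ih p.2))
    have h2 : 0 + ∑ p ∈ Finset.HasAntidiagonal.antidiagonal m,
        PowerSeries.coeff p.1 f * PowerSeries.coeff p.2 (f ^ n) =
        PowerSeries.coeff m (f ^ (n + 1)) := by
      rw [zero_add, pow_succ', PowerSeries.coeff_mul]
    rw [h2, zero_add, ← derivFluct_succ] at h1
    exact h1

end SchurCLT

/-! ### Expansion of the Vandermonde factors and of the power operators in powers of N -/

namespace SchurCLT

/-- The first order term in the expansion of `vanderSym`. -/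
noncomputable def vanderLim (s b : ℕ) : SymRing :=
  if s < b then (s.factorial : ℂ)⁻¹ • MvPolynomial.X (b - s - 1) else 0

theorem DualTendsto.congr_lim {r : ℕ} {T : ℕ → Module.End ℂ SymRing} {y y' : ℂ}
    {Ξ Ξ' : Module.End ℂ SymRing} (H : DualTendsto r T y Ξ) (hy : y = y') (hΞ : Ξ = Ξ') :
    DualTendsto r T y' Ξ' := hy ▸ hΞ ▸ H

theorem DualTendsto.congr_seq {r : ℕ} {T T' : ℕ → Module.End ℂ SymRing} {y : ℂ}
    {Ξ : Module.End ℂ SymRing} (H : DualTendsto r T y Ξ) (hT : ∀ N, T' N = T N) :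
    DualTendsto r T' y Ξ := by
  rwa [show T' = T from funext hT]

/-- Only p_0 = N has order N. The other power sums are independent of N and contribute to the first
order term. -/
theorem dualTendsto_pw (b : ℕ) :
    DualTendsto 1 (fun N => LinearMap.mulLeft ℂ (pw N b)) (if b = 0 then 1 else 0)
      (LinearMap.mulLeft ℂ (vanderLim 0 b)) := by
  rcases b with _ | b
  · refine ⟨fun _ => 1, fun _ => 0, fun N hN => ?_, tendsto_const_nhds, ?_⟩
    · refine LinearMap.ext fun h => ?_
      simp [pw, MvPolynomial.smul_eq_C_mul]
    · simpa [vanderLim] using OpTendsto.zero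
  · refine ⟨fun _ => 0, fun _ => LinearMap.mulLeft ℂ (MvPolynomial.X b), fun N hN => ?_,
      tendsto_const_nhds, ?_⟩
    · have hN0 : (N : ℂ) ≠ 0 := Nat.cast_ne_zero.2 (by omega)
      refine LinearMap.ext fun h => ?_
      simp [pw, smul_smul, hN0]
    · simpa [vanderLim] using OpTendsto.mulLeft (CoeffTendsto.const _)

/-- In the recursion the leading part comes from p_0, and each step contributes the factor 1/(s +
2). The first order part of step s + 1 has two sources: p_0 times the first order term gives 1/s!,
and p_(b−s) times the leading term gives 1/(s + 1)!. Their sum divided by s + 2 is 1/(s + 1)!. The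
correction term in the recursion has one power of N less. -/
theorem dualTendsto_vanderSym (s : ℕ) : ∀ b,
    DualTendsto (s + 1) (fun N => LinearMap.mulLeft ℂ (vanderSym N s b))
      (if b = s then ((s + 1).factorial : ℂ)⁻¹ else 0) (LinearMap.mulLeft ℂ (vanderLim s b)) := by
  induction s with
  | zero =>
    intro b
    simpa [vanderSym] using dualTendsto_pw b
  | succ s ih =>
    rintro (_ | b)
    · simpa [vanderSym, vanderLim] using DualTendsto.zero
    · have h1 := ((DualTendsto.sum (Finset.HasAntidiagonal.antidiagonal b) fun p _ =>
        (add_comm 1 (s + 1)) ▸ (dualTendsto_pw p.1).mul (ih p.2)).add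
          (((ih b).smul (-(b + 1 : ℂ))).raise)).smul ((s : ℂ) + 2)⁻¹
      refine (h1.congr_seq fun N => ?_).congr_lim ?_ ?_
      · refine LinearMap.ext fun h => ?_
        simp only [vanderSym, LinearMap.smul_apply, LinearMap.add_apply, LinearMap.sum_apply,
          LinearMap.mulLeft_apply, Module.End.mul_apply, ← MvPolynomial.smul_eq_C_mul]
        rw [smul_mul_assoc, sub_mul, Finset.sum_mul, smul_mul_assoc, sub_eq_add_neg, neg_smul]
        simp only [mul_assoc]
      · rw [add_zero, Finset.sum_eq_single (0, b)]
        · simp only [if_true, one_mul, add_left_inj, mul_ite, mul_zero]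
          split_ifs
          · rw [Nat.factorial_succ (s + 1), ← mul_inv]
            push_cast
            ring
          · rfl
        · rintro ⟨p, q⟩ hp hne
          rw [Finset.HasAntidiagonal.mem_antidiagonal] at hp
          dsimp only at hp ⊢
          rw [if_neg, zero_mul]
          rintro rfl
          exact hne (by rw [← hp, zero_add])
        · intro h
          exact absurd (Finset.HasAntidiagonal.mem_antidiagonal.2 (zero_add b)) h
      · rw [add_zero, Finset.sum_add_distrib, Finset.sum_eq_single (0, b)]
        rotate_left
        · rintro ⟨p, q⟩ hp hne
          rw [Finset.HasAntidiagonal.mem_antidiagonal] at hp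
          dsimp only at hp ⊢
          rw [if_neg, zero_smul]
          rintro rfl
          exact hne (by rw [← hp, zero_add])
        · intro h
          exact absurd (Finset.HasAntidiagonal.mem_antidiagonal.2 (zero_add b)) h
        by_cases hs : s < b
        · rw [Finset.sum_eq_single (b - s, s)]
          rotate_left
          · rintro ⟨p, q⟩ hp hne
            rw [Finset.HasAntidiagonal.mem_antidiagonal] at hp
            dsimp only at hp ⊢
            rw [if_neg, zero_smul]
            rintro rfl
            exact hne (by rw [← hp, Nat.add_sub_cancel])
          · intro h
            exact absurd (Finset.HasAntidiagonal.mem_antidiagonal.2 (Nat.sub_add_cancel hs.le)) h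
          have hs1 : (s : ℂ) + 1 ≠ 0 := by exact_mod_cast s.succ_ne_zero
          have hs2 : (s : ℂ) + 2 ≠ 0 := by exact_mod_cast (s + 1).succ_ne_zero
          have hs3 : (s.factorial : ℂ) ≠ 0 := by exact_mod_cast s.factorial_ne_zero
          refine LinearMap.ext fun h => ?_
          simp only [vanderLim, if_true, one_smul, if_pos hs, if_pos (Nat.sub_pos_of_lt hs),
            if_pos (Nat.succ_lt_succ hs), LinearMap.smul_apply, LinearMap.add_apply,
            LinearMap.mulLeft_apply, Nat.sub_zero, Nat.factorial_zero, Nat.cast_one, inv_one,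
            Nat.factorial_succ, Nat.add_sub_add_right, smul_mul_assoc]
          push_cast
          match_scalars
          field_simp
          ring
        · rw [Finset.sum_eq_zero]
          · simp [vanderLim, hs]
          · rintro ⟨p, q⟩ hp
            rw [Finset.HasAntidiagonal.mem_antidiagonal] at hp
            dsimp only at hp ⊢
            by_cases hq : q = s
            · have : p = 0 := by omega
              subst this
              simp [vanderLim]
            · rw [if_neg hq, zero_smul]

/-- The power series `((1 + u) (1 + u f(u)))^k`. -/
noncomputable def wickSeries (f : PowerSeries ℂ) (k : ℕ) : PowerSeries ℂ :=
  ((1 + PowerSeries.X) * (1 + PowerSeries.X * f)) ^ k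

theorem coeff_wickSeries (f : PowerSeries ℂ) (k n : ℕ) :
    PowerSeries.coeff n (wickSeries f k) =
      ∑ b ∈ Finset.range (k + 1), ∑ i ∈ Finset.range (k + 1),
        (k.choose b : ℂ) * (k.choose i : ℂ) *
          if b + (k - i) ≤ n then PowerSeries.coeff (n - (b + (k - i))) (f ^ (k - i)) else 0 := by
  rw [wickSeries, mul_pow, add_comm 1 PowerSeries.X, add_pow, add_pow, Finset.sum_mul_sum, map_sum]
  refine Finset.sum_congr rfl fun b _ => ?_
  rw [map_sum]
  refine Finset.sum_congr rfl fun i _ => ?_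
  have : PowerSeries.X ^ b * 1 ^ (k - b) * (k.choose b : PowerSeries ℂ) *
      (1 ^ i * (PowerSeries.X * f) ^ (k - i) * (k.choose i : PowerSeries ℂ)) =
      ((k.choose b : ℂ) * (k.choose i : ℂ)) • (PowerSeries.X ^ (b + (k - i)) * f ^ (k - i)) := by
    rw [one_pow, one_pow, mul_pow, pow_add, PowerSeries.smul_eq_C_mul, map_mul, map_natCast,
      map_natCast]
    ring
  rw [this, PowerSeries.coeff_smul, PowerSeries.coeff_X_pow_mul', smul_eq_mul]

/-- The multiplication part of the first order term in the expansion of `powOp`. -/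
noncomputable def limPoly (f : PowerSeries ℂ) (M k : ℕ) : SymRing :=
  ∑ b ∈ Finset.range (k + 1), (k.choose b : ℂ) • ∑ p ∈ Finset.HasAntidiagonal.antidiagonal k,
    (k.choose p.1 : ℂ) • ∑ m ∈ Finset.range M, PowerSeries.coeff m (f ^ p.2) •
      (if p.1 < b + m then (MvPolynomial.X (b + m - p.1 - 1) : SymRing) else 0)

/-- The first order term in the expansion of `powOp`. -/
noncomputable def limOp (f : PowerSeries ℂ) (G : ℕ → SymRing) (M k : ℕ) : Module.End ℂ SymRing :=
  ∑ j ∈ Finset.range k, PowerSeries.coeff (k - 1 - j) (wickSeries f k) • fluctOp G j +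
    LinearMap.mulLeft ℂ (limPoly f M k)

/-- After ordering by the index j of the fluctuation operators, the identity binom(k, i)·(k − i)/(i
+ 1) = binom(k, i + 1) turns the coefficient into the expansion of `coeff_wickSeries` with i shifted
by one. -/
theorem sum_derivFluct (f : PowerSeries ℂ) (G : ℕ → SymRing) (k : ℕ) :
    ∑ b ∈ Finset.range (k + 1), (k.choose b : ℂ) •
      ∑ p ∈ Finset.HasAntidiagonal.antidiagonal k, ((k.choose p.1 : ℂ) / (p.1 + 1)) •
        (if b ≤ p.1 then derivFluct f G p.2 (p.1 - b) else 0) =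
    ∑ j ∈ Finset.range k, PowerSeries.coeff (k - 1 - j) (wickSeries f k) • fluctOp G j := by
  have h1 : ∀ b i, (if b ≤ i then derivFluct f G (k - i) (i - b) else 0) =
      ∑ j ∈ Finset.range k, (((k - i : ℕ) : ℂ) * if b + j ≤ i then
        PowerSeries.coeff (i - (b + j)) (f ^ (k - i - 1)) else 0) • fluctOp G j := by
    intro b i
    by_cases hik : k ≤ i
    · simp [Nat.sub_eq_zero_of_le hik, derivFluct]
    split_ifs with hb
    · rw [derivFluct, ← Finset.Nat.sum_antidiagonal_swap,
        Finset.Nat.sum_antidiagonal_eq_sum_range_succ_mk, Finset.smul_sum]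
      rw [← Finset.sum_subset (s₁ := Finset.range (i - b).succ) (s₂ := Finset.range k)]
      · refine Finset.sum_congr rfl fun j hj => ?_
        have hj' := Finset.mem_range.1 hj
        rw [if_pos (by omega), smul_smul]
        simp only [Prod.swap_prod_mk]
        rw [Nat.sub_sub]
      · intro j hj
        rw [Finset.mem_range] at hj ⊢
        omega
      · intro j _ hj
        rw [Finset.mem_range] at hj
        rw [if_neg (by omega), mul_zero, zero_smul]
    · refine (Finset.sum_eq_zero fun j _ => ?_).symm
      rw [if_neg (by omega), mul_zero, zero_smul]
  simp only [Finset.Nat.sum_antidiagonal_eq_sum_range_succ_mk, h1, Finset.smul_sum, smul_smul]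
  simp only [Finset.sum_comm (s := Finset.range (k + 1)) (t := Finset.range k)]
  refine Finset.sum_congr rfl fun j hj => ?_
  rw [Finset.mem_range] at hj
  simp only [← Finset.sum_smul]
  congr 1
  rw [coeff_wickSeries]
  refine Finset.sum_congr rfl fun b _ => ?_
  rw [Finset.sum_range_succ, Finset.sum_range_succ' _ k]
  rw [Nat.sub_self, if_neg (by omega : ¬ b + (k - 0) ≤ k - 1 - j)]
  simp only [Nat.cast_zero, zero_mul, mul_zero, add_zero]
  refine Finset.sum_congr rfl fun i hi => ?_
  rw [Finset.mem_range] at hi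
  have h2 : (k.choose i : ℂ) / (i + 1) * ((k - i : ℕ) : ℂ) = (k.choose (i + 1) : ℂ) := by
    have h3 : (i : ℂ) + 1 ≠ 0 := by exact_mod_cast i.succ_ne_zero
    have := Nat.choose_succ_right_eq k i
    field_simp
    rw [mul_comm ((i : ℂ) + 1)]
    exact_mod_cast this.symm
  rw [← h2]
  by_cases hb : b + j ≤ i
  · rw [if_pos hb, if_pos (by omega), show k - 1 - j - (b + (k - (i + 1))) = i - (b + j) by omega,
      Nat.sub_sub]
    ring
  · rw [if_neg hb, if_neg (by omega)]
    ring

/-- The term with s derivatives on V contributes N^(s+1)·N^(j−s) = N^(j+1), the same for every s. In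
the first order part either the remaining derivatives fluctuate, which requires b + m = s, or the
Vandermonde factor does, which gives multiplication by a power sum. The leading scalar need not be
known. -/
theorem dualTendsto_diffOp {L : ℕ → SymRing} {f : PowerSeries ℂ} {G : ℕ → SymRing}
    (hL : LogAsymp L f G) {M j : ℕ} (hM : j < M) (b : ℕ) :
    ∃ y, DualTendsto (j + 1) (fun N => diffOp N (L N) M j b) y
      (∑ p ∈ Finset.HasAntidiagonal.antidiagonal j, ((j.choose p.1 : ℂ) / (p.1 + 1)) •
        (if b ≤ p.1 then derivFluct f G p.2 (p.1 - b) else 0) +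
      ∑ p ∈ Finset.HasAntidiagonal.antidiagonal j, (j.choose p.1 : ℂ) • ∑ m ∈ Finset.range M,
        PowerSeries.coeff m (f ^ p.2) • LinearMap.mulLeft ℂ
          (if p.1 < b + m then (MvPolynomial.X (b + m - p.1 - 1) : SymRing) else 0)) := by
  have h1 := DualTendsto.sum (Finset.HasAntidiagonal.antidiagonal j) fun p hp =>
    (DualTendsto.sum (Finset.range M) fun m _ =>
      (show p.1 + 1 + p.2 = j + 1 by
        rw [Finset.HasAntidiagonal.mem_antidiagonal] at hp; omega) ▸
      (dualTendsto_vanderSym p.1 (b + m)).mul (dualTendsto_derivCoeff hL p.2 m)).smul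
        ((j.choose p.1 : ℂ) * p.1.factorial)
  refine ⟨_, (h1.congr_seq fun N => rfl).congr_lim rfl ?_⟩
  rw [← Finset.sum_add_distrib]
  refine Finset.sum_congr rfl fun p hp => ?_
  rw [Finset.HasAntidiagonal.mem_antidiagonal] at hp
  have hf : (p.1.factorial : ℂ) ≠ 0 := by exact_mod_cast p.1.factorial_ne_zero
  rw [Finset.sum_add_distrib, smul_add]
  congr 1
  · split_ifs with hb
    · rw [Finset.sum_eq_single (p.1 - b)]
      · rw [if_pos (by omega), smul_smul, Nat.factorial_succ]
        congr 1
        push_cast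
        have h3 : (p.1 : ℂ) + 1 ≠ 0 := by exact_mod_cast p.1.succ_ne_zero
        field_simp
      · intro m _ hm
        rw [if_neg (by omega), zero_smul]
      · intro h
        rw [Finset.mem_range] at h
        omega
    · rw [Finset.sum_eq_zero, smul_zero, smul_zero]
      intro m _
      rw [if_neg (by omega), zero_smul]
  · rw [mul_smul]
    congr 1
    rw [Finset.smul_sum]
    refine Finset.sum_congr rfl fun m _ => ?_
    rw [smul_comm]
    congr 1
    rw [vanderLim]
    split_ifs
    · refine LinearMap.ext fun h => ?_
      simp [hf, smul_smul]
    · refine LinearMap.ext fun h => ?_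
      simp

/-- Terms with j < k have order N^(j+1) and disappear; for j = k the Stirling number is 1. -/
theorem dualTendsto_powOp {L : ℕ → SymRing} {f : PowerSeries ℂ} {G : ℕ → SymRing}
    (hL : LogAsymp L f G) {M k : ℕ} (hM : k < M) :
    ∃ y, DualTendsto (k + 1) (fun N => powOp N (L N) M k) y (limOp f G M k) := by
  have h0 : ∀ j ∈ Finset.range (k + 1), ∀ b, ∃ y Ξ,
      DualTendsto (j + 1) (fun N => diffOp N (L N) M j b) y Ξ := fun j hj b => by
    rw [Finset.mem_range] at hj
    obtain ⟨y, hy⟩ := dualTendsto_diffOp hL (show j < M by omega) b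
    exact ⟨y, _, hy⟩
  choose y hy using fun b => dualTendsto_diffOp hL hM b
  have h1 : ∀ j ∈ Finset.range k, DualTendsto (k + 1) (fun N => (k.stirlingSecond j : ℂ) •
      ∑ b ∈ Finset.range (j + 1), (j.choose b : ℂ) • diffOp N (L N) M j b) 0 0 := by
    intro j hj
    rw [Finset.mem_range] at hj
    choose y' Ξ' hy' using h0 j (Finset.mem_range.2 (by omega))
    exact ((DualTendsto.sum _ fun b _ => (hy' b).smul (j.choose b : ℂ)).smul _).raise_lt
      (show j + 1 < k + 1 by omega)
  have h2 := (DualTendsto.sum _ h1).add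
    (DualTendsto.sum (Finset.range (k + 1)) fun b _ => (hy b).smul (k.choose b : ℂ))
  refine ⟨_, (h2.congr_seq fun N => ?_).congr_lim rfl ?_⟩
  · rw [powOp, Finset.sum_range_succ, Nat.stirlingSecond_self, Nat.cast_one, one_smul]
  · rw [Finset.sum_const_zero, zero_add, limOp, ← sum_derivFluct]
    simp only [smul_add, Finset.sum_add_distrib]
    congr 1
    refine LinearMap.ext fun h => ?_
    simp only [limPoly, LinearMap.sum_apply, LinearMap.smul_apply, LinearMap.mulLeft_apply,
      Finset.sum_mul, smul_mul_assoc]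

end SchurCLT

namespace SchurCLT

/-! ### Wick's formula -/

/-- The sum over all pairings of the entries of a list of the products of the covariances. -/
def wick {ι R : Type*} [CommRing R] (C : ι → ι → R) : List ι → R
  | [] => 1
  | a :: l => ∑ i : Fin l.length, C a l[i] * wick C (l.eraseIdx i)
termination_by l => l.length
decreasing_by
  have := i.2
  simp only [List.length_cons]
  have := List.length_eraseIdx_le l i
  omega

section Abstract

variable {ι R A : Type*} [CommRing R] [AddCommGroup A] [Module R A]

/-- Commute D to the right through all factors T b until it annihilates e. Every passage leaves a
scalar and removes one factor. -/
theorem apply_foldr_eq_sum (D : A →ₗ[R] A) (T : ι → A →ₗ[R] A) (e : A) (c : ι → R)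
    (hD : ∀ b h, D (T b h) = c b • h + T b (D h)) (he : D e = 0) (l : List ι) :
    D (l.foldr (fun b h => T b h) e) =
      ∑ i : Fin l.length, c l[i] • (l.eraseIdx i).foldr (fun b h => T b h) e := by
  induction l with
  | nil => simpa using he
  | cons b l ih =>
    rw [List.foldr_cons, hD, ih, map_sum]
    simp only [map_smul]
    exact (Fin.sum_univ_succ (n := l.length) (fun i : Fin (l.length + 1) =>
      c (b :: l)[i] • ((b :: l).eraseIdx i).foldr (fun b h => T b h) e)).symm

/-- Wick's formula for a functional `E` with `E (T a h) = E (D a h)`, where the commutators of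
`D a` and `T b` are the scalars `C a b`. -/
theorem apply_foldr_eq_wick (E : A →ₗ[R] R) (D T : ι → A →ₗ[R] A) (e : A) (C : ι → ι → R)
    (hD : ∀ a b h, D a (T b h) = C a b • h + T b (D a h)) (he : ∀ a, D a e = 0)
    (hE : ∀ a h, E (T a h) = E (D a h)) (h1 : E e = 1) (l : List ι) :
    E (l.foldr (fun b h => T b h) e) = wick C l := by
  induction hn : l.length using Nat.strong_induction_on generalizing l with
  | _ n ih =>
    rcases l with _ | ⟨a, l⟩
    · simpa [wick] using h1
    · rw [List.foldr_cons, hE, apply_foldr_eq_sum (D a) T e (C a) (hD a) (he a), map_sum, wick]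
      refine Finset.sum_congr rfl fun i _ => ?_
      rw [map_smul, smul_eq_mul, ih (l.eraseIdx i).length _ _ rfl]
      rw [← hn, List.length_cons]
      have := List.length_eraseIdx_le l i
      omega

/-- Only pairs in the order of the list enter. This matters because the covariance formula available
here is asymmetric and correct only for ordered levels. -/
theorem wick_congr {C C' : ι → ι → R} {l : List ι} (h : l.Pairwise fun a b => C a b = C' a b) :
    wick C l = wick C' l := by
  induction hn : l.length using Nat.strong_induction_on generalizing l with
  | _ n ih =>
    rcases l with _ | ⟨a, l⟩
    · simp [wick]
    · rw [wick, wick]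
      rw [List.pairwise_cons] at h
      refine Finset.sum_congr rfl fun i _ => ?_
      rw [show C a l[i] = C' a l[i] from h.1 _ (List.getElem_mem _), ih (l.eraseIdx i).length _
        (h.2.sublist (List.eraseIdx_sublist _ _)) rfl]
      rw [← hn, List.length_cons]
      have := List.length_eraseIdx_le l i
      omega

end Abstract

theorem wick_map {ι κ R : Type*} [CommRing R] (C : κ → κ → R) (f : ι → κ) (l : List ι) :
    wick C (l.map f) = wick (fun a b => C (f a) (f b)) l := by
  induction hn : l.length using Nat.strong_induction_on generalizing l with
  | _ n ih =>
    rcases l with _ | ⟨a, l⟩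
    · simp [wick]
    · rw [List.map_cons, wick, wick, ← (finCongr (List.length_map (as := l) f)).sum_comp]
      refine Finset.sum_congr rfl fun i _ => ?_
      have h1 : (l.eraseIdx i).length < n := by
        rw [← hn, List.length_cons]
        have := List.length_eraseIdx_le l i
        omega
      have h2 := ih _ h1 _ rfl
      simp only [finCongr_apply, Fin.val_cast, List.eraseIdx_map, h2]
      simp

theorem map_wick {ι R S : Type*} [CommRing R] [CommRing S] (φ : R →+* S) (C : ι → ι → R)
    (l : List ι) : φ (wick C l) = wick (fun a b => φ (C a b)) l := by
  induction hn : l.length using Nat.strong_induction_on generalizing l with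
  | _ n ih =>
    rcases l with _ | ⟨a, l⟩
    · simp [wick]
    · rw [wick, wick, map_sum]
      refine Finset.sum_congr rfl fun i _ => ?_
      rw [map_mul, ih (l.eraseIdx i).length _ _ rfl]
      rw [← hn, List.length_cons]
      have := List.length_eraseIdx_le l i
      omega

/-! ### Moments of Gaussian vectors -/

theorem integrable_pow_gaussianReal (n : ℕ) : Integrable (fun x : ℝ => x ^ n) (gaussianReal 0 1) := by
  rcases n with _ | n
  · simp
  · have h := (memLp_id_gaussianReal' (μ := 0) (v := 1) ((n + 1 : ℕ) : ENNReal)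
      (ENNReal.natCast_ne_top _)).integrable_norm_pow n.succ_ne_zero
    refine h.mono (continuous_pow _).aestronglyMeasurable (Eventually.of_forall fun x => ?_)
    simp

theorem integrable_pow_mul_gaussianPDFReal (n : ℕ) :
    Integrable fun x : ℝ => x ^ n * gaussianPDFReal 0 1 x := by
  have h := integrable_pow_gaussianReal n
  rw [gaussianReal_of_var_ne_zero _ one_ne_zero, gaussianPDF_def,
    integrable_withDensity_iff_integrable_smul₀'] at h
  · refine h.congr (Eventually.of_forall fun x => ?_)
    simp only
    rw [ENNReal.toReal_ofReal (gaussianPDFReal_nonneg _ _ _), smul_eq_mul, mul_comm]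
  · exact (measurable_gaussianPDFReal 0 1).ennreal_ofReal.aemeasurable
  · exact Eventually.of_forall fun x => ENNReal.ofReal_lt_top

theorem hasDerivAt_gaussianPDFReal (x : ℝ) :
    HasDerivAt (gaussianPDFReal 0 1) (-(x * gaussianPDFReal 0 1 x)) x := by
  rw [gaussianPDFReal_def]
  have h : HasDerivAt (fun x : ℝ => -(x - 0) ^ 2 / (2 * (1 : NNReal))) (-x) x := by
    have := (((hasDerivAt_id x).sub_const 0).pow 2).neg.div_const (2 * ((1 : NNReal) : ℝ))
    refine this.congr_deriv ?_
    simp only [id_eq, sub_zero, NNReal.coe_one]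
    norm_num
    ring
  refine ((h.exp).const_mul (√(2 * Real.pi * (1 : NNReal)))⁻¹).congr_deriv ?_
  ring

/-- Integration by parts, as the density has derivative −x times itself. For n = 0 the truncated
exponent n − 1 is harmless because of the factor n. -/
theorem integral_pow_gaussianReal (n : ℕ) :
    ∫ x : ℝ, x ^ (n + 1) ∂(gaussianReal 0 1) = n * ∫ x : ℝ, x ^ (n - 1) ∂(gaussianReal 0 1) := by
  rw [integral_gaussianReal_eq_integral_smul one_ne_zero,
    integral_gaussianReal_eq_integral_smul one_ne_zero]
  have h := integral_mul_deriv_eq_deriv_mul_of_integrable (u := fun x : ℝ => x ^ n)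
    (v := gaussianPDFReal 0 1) (fun x _ => hasDerivAt_pow n x)
    (fun x _ => hasDerivAt_gaussianPDFReal x) ?_ ?_ (integrable_pow_mul_gaussianPDFReal n)
  · rw [← integral_const_mul, ← neg_inj, ← integral_neg]
    have h2 : ∀ x : ℝ, -(gaussianPDFReal 0 1 x • x ^ (n + 1)) =
      x ^ n * -(x * gaussianPDFReal 0 1 x) := fun x => by rw [smul_eq_mul]; ring
    simp only [h2]
    rw [h]
    congr 2
    funext x
    rw [smul_eq_mul]
    ring
  · refine (integrable_pow_mul_gaussianPDFReal (n + 1)).neg.congr (Eventually.of_forall fun x => ?_)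
    simp only [Pi.neg_apply, Pi.mul_apply]
    ring
  · refine ((integrable_pow_mul_gaussianPDFReal (n - 1)).const_mul (n : ℝ)).congr
      (Eventually.of_forall fun x => ?_)
    simp only [Pi.mul_apply]
    ring

/-- The standard Gaussian measure on `ℝ^n`. -/
noncomputable def stdGauss (n : ℕ) : Measure (Fin n → ℝ) := Measure.pi fun _ => gaussianReal 0 1

instance isProbabilityMeasure_stdGauss (n : ℕ) : IsProbabilityMeasure (stdGauss n) := by
  unfold stdGauss; infer_instance

instance isGaussian_stdGauss (n : ℕ) : IsGaussian (stdGauss n) := by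
  have h : (stdGaussian (EuclideanSpace ℝ (Fin n))).map
      (EuclideanSpace.equiv (Fin n) ℝ).toContinuousLinearMap = stdGauss n := by
    rw [← map_pi_eq_stdGaussian, Measure.map_map]
    · exact Measure.map_id
    · fun_prop
    · fun_prop
  rw [← h]
  infer_instance

section MvPolynomial

open MvPolynomial

variable {n : ℕ}

theorem integrable_eval_stdGauss (h : MvPolynomial (Fin n) ℝ) :
    Integrable (fun z => eval z h) (stdGauss n) := by
  induction h using MvPolynomial.induction_on' with
  | monomial u a =>
    simp only [eval_monomial, Finsupp.prod_fintype _ _ fun i => pow_zero _]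
    exact (Integrable.fintype_prod fun i => integrable_pow_gaussianReal (u i)).const_mul a
  | add p q hp hq =>
    simp only [map_add]
    exact hp.add hq

/-- Stein's identity for polynomials; on monomials it reduces to one coordinate. -/
theorem integral_mul_eval_stdGauss (i : Fin n) (h : MvPolynomial (Fin n) ℝ) :
    ∫ z, eval z (X i * h) ∂(stdGauss n) = ∫ z, eval z (pderiv i h) ∂(stdGauss n) := by
  induction h using MvPolynomial.induction_on' with
  | monomial u a =>
    rw [pderiv_monomial, mul_comm, X, monomial_mul, mul_one]
    simp only [eval_monomial, Finsupp.prod_fintype _ _ fun i => pow_zero _]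
    rw [integral_const_mul, integral_const_mul, mul_assoc]
    congr 1
    rw [stdGauss, integral_fintype_prod_eq_prod (fun j (x : ℝ) => x ^ ((u + Finsupp.single i 1 : Fin n →₀ ℕ) j)),
      integral_fintype_prod_eq_prod (fun j (x : ℝ) => x ^ ((u - Finsupp.single i 1 : Fin n →₀ ℕ) j)),
      ← Finset.mul_prod_erase _ _ (Finset.mem_univ i),
      ← Finset.mul_prod_erase _ _ (Finset.mem_univ i), ← mul_assoc]
    congr 1
    · have h1 : (u + Finsupp.single i 1 : Fin n →₀ ℕ) i = u i + 1 := by simp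
      have h2 : (u - Finsupp.single i 1 : Fin n →₀ ℕ) i = u i - 1 := by simp
      simp only [h1, h2]
      exact integral_pow_gaussianReal (u i)
    · refine Finset.prod_congr rfl fun j hj => ?_
      simp [Finsupp.single_eq_of_ne (Finset.ne_of_mem_erase hj)]
  | add p q hp hq =>
    rw [mul_add, map_add]
    simp only [map_add (MvPolynomial.eval _)]
    rw [integral_add (integrable_eval_stdGauss _) (integrable_eval_stdGauss _), hp, hq,
      integral_add (integrable_eval_stdGauss _) (integrable_eval_stdGauss _)]

end MvPolynomial

/-- A positive semidefinite matrix is the covariance matrix of a centered Gaussian measure, whose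
moments are given by Wick's formula. -/
theorem exists_gaussian_wick {ι : Type*} [Fintype ι] {C : ι → ι → ℝ}
    (hC : (Matrix.of C).PosSemidef) :
    ∃ γ : Measure (ι → ℝ), IsGaussian γ ∧
      ∀ l : List ι, ∫ y, (l.map y).prod ∂γ = wick C l := by
  classical
  -- Writing C as a Gram matrix exhibits the measure as a linear image of a standard Gaussian.
  obtain ⟨n, v, hv⟩ := Matrix.posSemidef_iff_eq_sum_vecMulVec.1 hC
  have hCv : ∀ a b, C a b = ∑ i, v i a * v i b := fun a b => by
    have := congrFun (congrFun hv a) b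
    rw [Matrix.of_apply] at this
    rw [this, Matrix.sum_apply]
    rfl
  let A : (Fin n → ℝ) →L[ℝ] (ι → ℝ) :=
    ContinuousLinearMap.pi fun a => ∑ i, v i a • ContinuousLinearMap.proj i
  refine ⟨(stdGauss n).map A, inferInstance, fun l => ?_⟩
  let V : ι → MvPolynomial (Fin n) ℝ := fun a => ∑ i, v i a • MvPolynomial.X i
  have hAV : ∀ z a, A z a = MvPolynomial.eval z (V a) := fun z a => by
    simp [A, V, MvPolynomial.smul_eval]
  have h1 : ∀ z, (l.map (A z)).prod =
      MvPolynomial.eval z (l.foldr (fun b h => LinearMap.mulLeft ℝ (V b) h) 1) := by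
    intro z
    induction l with
    | nil => simp
    | cons a l ih => simp only [List.map_cons, List.prod_cons, List.foldr_cons,
        LinearMap.mulLeft_apply, map_mul, ih, hAV]
  rw [integral_map A.continuous.aemeasurable]
  · simp only [h1]
    let E : MvPolynomial (Fin n) ℝ →ₗ[ℝ] ℝ :=
      { toFun := fun h => ∫ z, MvPolynomial.eval z h ∂(stdGauss n)
        map_add' := fun p q => by
          simp only [map_add]
          exact integral_add (integrable_eval_stdGauss _) (integrable_eval_stdGauss _)
        map_smul' := fun c p => by
          simp only [MvPolynomial.smul_eval, RingHom.id_apply, smul_eq_mul]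
          exact integral_const_mul _ _ }
    let D : ι → MvPolynomial (Fin n) ℝ →ₗ[ℝ] MvPolynomial (Fin n) ℝ := fun a =>
      ∑ i, v i a • (MvPolynomial.pderiv i).toLinearMap
    have hDa : ∀ a h, D a h = ∑ i, v i a • MvPolynomial.pderiv i h := fun a h => by
      simp only [D, LinearMap.sum_apply, LinearMap.smul_apply]
      rfl
    -- The linear form V a is dual to the directional derivative D a by Stein's identity, and D a (V
    -- b) is the scalar product C a b.
    refine apply_foldr_eq_wick E D (fun b => LinearMap.mulLeft ℝ (V b)) 1 C ?_ ?_ ?_ ?_ l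
    · intro a b h
      have h2 : ∀ i, MvPolynomial.pderiv i (V b) = MvPolynomial.C (v i b) := fun i => by
        have h3 : ∀ j, MvPolynomial.pderiv i (v j b • MvPolynomial.X j : MvPolynomial (Fin n) ℝ) =
            MvPolynomial.C (v j b) * (Pi.single j 1 : Fin n → _) i := fun j => by
          rw [Derivation.map_smul, MvPolynomial.pderiv_X, MvPolynomial.smul_eq_C_mul,
            Pi.single_apply, Pi.single_apply]
          simp only [eq_comm]
        simp only [V, map_sum, h3]
        rw [Finset.sum_eq_single i]
        · simp
        · intro j _ hj
          rw [Pi.single_eq_of_ne hj.symm, mul_zero]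
        · simp
      simp only [hDa, LinearMap.mulLeft_apply, Derivation.leibniz, h2, hCv, smul_eq_mul,
        Finset.mul_sum, smul_add, Finset.sum_add_distrib, Finset.sum_smul, mul_comm h,
        ← MvPolynomial.smul_eq_C_mul, smul_smul, mul_smul_comm]
      rw [add_comm]
    · intro a
      rw [hDa]
      simp
    · intro a h
      change ∫ z, MvPolynomial.eval z (V a * h) ∂(stdGauss n) = E (D a h)
      rw [hDa, map_sum]
      simp only [V, Finset.sum_mul, smul_mul_assoc, map_sum, map_smul]
      simp only [MvPolynomial.smul_eval]
      rw [integral_finsetSum _ fun i _ => (integrable_eval_stdGauss _).const_mul _]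
      refine Finset.sum_congr rfl fun i _ => ?_
      rw [integral_const_mul, integral_mul_eval_stdGauss]
      rfl
    · change ∫ z, MvPolynomial.eval z 1 ∂(stdGauss n) = 1
      simp
  · refine Continuous.aestronglyMeasurable ?_
    exact continuous_list_prod l fun a _ => continuous_apply a

end SchurCLT

namespace SchurCLT

open MvPolynomial (pderiv constantCoeff X)

/-! ### Asymptotics of logarithms of appropriate generating functions -/

/-- Linear combinations of the variables. -/
structure IsLin (v : SymRing) : Prop where
  zero : constantCoeff v = 0
  pderiv_eq : ∀ b, pderiv b v = MvPolynomial.C (constantCoeff (pderiv b v))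

namespace IsLin

theorem add {v w : SymRing} (hv : IsLin v) (hw : IsLin w) : IsLin (v + w) :=
  ⟨by rw [map_add, hv.zero, hw.zero, add_zero], fun b => by
    rw [map_add, map_add, map_add, ← hv.pderiv_eq, ← hw.pderiv_eq]⟩

theorem smul (c : ℂ) {v : SymRing} (hv : IsLin v) : IsLin (c • v) :=
  ⟨by rw [MvPolynomial.smul_eq_C_mul, map_mul, hv.zero, mul_zero], fun b => by
    rw [Derivation.map_smul, hv.pderiv_eq, MvPolynomial.smul_eq_C_mul, map_mul, map_mul,
      MvPolynomial.constantCoeff_C, MvPolynomial.constantCoeff_C]⟩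

theorem of_zero : IsLin 0 := ⟨map_zero _, fun b => by simp⟩

theorem sum {ι : Type*} (s : Finset ι) {v : ι → SymRing} (hv : ∀ i ∈ s, IsLin (v i)) :
    IsLin (∑ i ∈ s, v i) := by
  classical
  induction s using Finset.induction_on with
  | empty => simpa using of_zero
  | insert i s hi ih =>
    rw [Finset.sum_insert hi]
    exact (hv i (Finset.mem_insert_self _ _)).add
      (ih fun j hj => hv j (Finset.mem_insert_of_mem hj))

theorem of_X (a : ℕ) : IsLin (X a) :=
  ⟨by simp, fun b => by
    rw [MvPolynomial.pderiv_X, Pi.single_apply]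
    split_ifs <;> simp⟩

end IsLin

theorem pderiv_X_eq (a b : ℕ) : pderiv b (X a : SymRing) = MvPolynomial.C (if a = b then 1 else 0) := by
  rw [MvPolynomial.pderiv_X, Pi.single_apply]
  by_cases h : a = b
  · simp [h]
  · simp [h]

theorem placeList_one (κ : Fin 1 → ℕ) :
    placeList κ (fun j => (j : ℕ)) = List.replicate (κ 0 + 1) 0 := by
  simp [placeList]

theorem placeList_two (κ : Fin 2 → ℕ) :
    placeList κ (fun j => (j : ℕ)) = List.replicate (κ 0 + 1) 0 ++ List.replicate (κ 1 + 1) 1 := by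
  simp [placeList]

theorem card_toFinset_placeList {d : ℕ} (κ : Fin d → ℕ) :
    d ≤ (placeList κ (fun j => (j : ℕ))).toFinset.card := by
  have h : Finset.univ.image (fun j : Fin d => (j : ℕ)) ⊆
      (placeList κ (fun j => (j : ℕ))).toFinset := by
    intro a ha
    obtain ⟨j, -, rfl⟩ := Finset.mem_image.1 ha
    rw [List.mem_toFinset, ← List.count_pos_iff, count_placeList]
    exact Finset.sum_pos' (fun _ _ => Nat.zero_le _) ⟨j, Finset.mem_univ _, by simp⟩
  have h2 := Finset.card_le_card h
  rwa [Finset.card_image_of_injective _ Fin.val_injective, Finset.card_univ, Fintype.card_fin]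
    at h2

theorem tendsto_jetCoeff_two {F : ∀ N : ℕ, (Fin N → ℂ) → ℂ} {c : ℕ → ℝ} {d : ℕ → ℕ → ℝ}
    (hF : IsAppropriateWith F c d) (κ : Fin 2 → ℕ) :
    Tendsto (fun N => jetCoeff (fun I => logCoeff F I N) κ) atTop
      (𝓝 ((d (κ 0 + 1) (κ 1 + 1) : ℂ) / (2 * ((κ 0 + 1).factorial * (κ 1 + 1).factorial)))) := by
  have h := (hF.tendsto_two 0 1 (κ 0 + 1) (κ 1 + 1) zero_ne_one (by omega) (by omega)).div_const
    (2 * ((κ 0 + 1).factorial * (κ 1 + 1).factorial))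
  refine h.congr fun N => ?_
  rw [jetCoeff, placeList_two, Fin.prod_univ_two]
  rfl

theorem tendsto_jetCoeff_three {F : ∀ N : ℕ, (Fin N → ℂ) → ℂ} {c : ℕ → ℝ} {d : ℕ → ℕ → ℝ}
    (hF : IsAppropriateWith F c d) {r : ℕ} (κ : Fin (r + 3) → ℕ) :
    Tendsto (fun N => jetCoeff (fun I => logCoeff F I N) κ) atTop (𝓝 0) := by
  have h := (hF.tendsto_three _ (le_trans (by omega) (card_toFinset_placeList κ))).div_const
    ((r + 3).factorial * ∏ j, ((κ j + 1).factorial : ℂ))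
  rw [zero_div] at h
  exact h

/-- Both numbers are limits of the same mixed derivative, taken in two orders. -/
theorem IsAppropriateWith.d_symm {F : ∀ N : ℕ, (Fin N → ℂ) → ℂ} {c : ℕ → ℝ} {d : ℕ → ℕ → ℝ}
    (hF : IsAppropriateWith F c d) {k l : ℕ} (hk : 1 ≤ k) (hl : 1 ≤ l) : d k l = d l k := by
  have h1 := hF.tendsto_two 0 1 k l zero_ne_one hk hl
  have h2 := hF.tendsto_two 1 0 l k one_ne_zero hl hk
  have h3 : (d k l : ℂ) = d l k := by
    refine tendsto_nhds_unique (h1.congr' ?_) h2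
    filter_upwards [eventually_ge_atTop 1] with N hN
    exact (mixedPartial_perm (hF.log_holomorphic N hN).contDiffAt
      List.perm_append_comm).self_of_nhds
  exact_mod_cast h3

/-- The limit of the part of `jetSym` of degree at least two. -/
noncomputable def quadSym (M : ℕ) (d : ℕ → ℕ → ℝ) : SymRing :=
  ∑ κ : Fin 2 → Fin M, ((d (κ 0 + 1) (κ 1 + 1) : ℂ) /
    (2 * (((κ 0 : ℕ) + 1).factorial * ((κ 1 : ℕ) + 1).factorial))) • monoSym fun j => (κ j : ℕ)

/-- The limit of the non-constant part of the derivative of `jetSym`. -/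
noncomputable def gradSym (M : ℕ) (d : ℕ → ℕ → ℝ) (a : ℕ) : SymRing :=
  (a + 1 : ℂ) • (pderiv a (quadSym M d) -
    MvPolynomial.C (constantCoeff (pderiv a (quadSym M d))))

/-- The truncation of the power series `F(1 + u)`. -/
noncomputable def truncF (M : ℕ) (c : ℕ → ℝ) : PowerSeries ℂ :=
  PowerSeries.mk fun a => if a < M then (c (a + 1) : ℂ) / a.factorial else 0

theorem monoSym_two (κ : Fin 2 → ℕ) : monoSym κ = X (κ 0) * X (κ 1) - X (κ 1 + κ 0 + 1) := by
  simp [monoSym]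

theorem pderiv_monoSym_two (κ : Fin 2 → ℕ) (a b : ℕ) : pderiv b (pderiv a (monoSym κ)) =
    MvPolynomial.C ((if κ 0 = a then 1 else 0) * (if κ 1 = b then 1 else 0) +
      (if κ 0 = b then 1 else 0) * (if κ 1 = a then 1 else 0)) := by
  rw [monoSym_two]
  simp only [map_sub, map_add, Derivation.leibniz, pderiv_X_eq, smul_eq_mul, MvPolynomial.pderiv_C,
    mul_zero, zero_add, sub_zero, ← map_mul]
  ring_nf

theorem pderiv_quadSym (M : ℕ) (d : ℕ → ℕ → ℝ) (a b : ℕ) :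
    ∃ z, pderiv b (pderiv a (quadSym M d)) = MvPolynomial.C z ∧
    ((∀ k l, 1 ≤ k → 1 ≤ l → d k l = d l k) → a < M → b < M →
      z = (d (a + 1) (b + 1) : ℂ) / ((a + 1).factorial * (b + 1).factorial)) := by
  refine ⟨∑ κ : Fin 2 → Fin M, ((d (κ 0 + 1) (κ 1 + 1) : ℂ) /
    (2 * (((κ 0 : ℕ) + 1).factorial * ((κ 1 : ℕ) + 1).factorial))) *
      ((if (κ 0 : ℕ) = a then 1 else 0) * (if (κ 1 : ℕ) = b then 1 else 0) +
      (if (κ 0 : ℕ) = b then 1 else 0) * (if (κ 1 : ℕ) = a then 1 else 0)), ?_, ?_⟩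
  · rw [quadSym, map_sum, map_sum, map_sum]
    refine Finset.sum_congr rfl fun κ _ => ?_
    rw [Derivation.map_smul, Derivation.map_smul, pderiv_monoSym_two, map_mul,
      MvPolynomial.smul_eq_C_mul]
  · intro hd ha hb
    rw [Fintype.sum_equiv (finTwoArrowEquiv (Fin M)) _ (fun p : Fin M × Fin M =>
      ((d (p.1 + 1) (p.2 + 1) : ℂ) / (2 * (((p.1 : ℕ) + 1).factorial * ((p.2 : ℕ) + 1).factorial))) *
      ((if p.1 = ⟨a, ha⟩ then 1 else 0) * (if p.2 = ⟨b, hb⟩ then 1 else 0) +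
      (if p.1 = ⟨b, hb⟩ then 1 else 0) * (if p.2 = ⟨a, ha⟩ then 1 else 0)))
      fun κ => by simp [finTwoArrowEquiv, Fin.ext_iff]]
    rw [Fintype.sum_prod_type]
    simp only [mul_add, Finset.sum_add_distrib, mul_ite, mul_one, mul_zero, Finset.sum_ite_eq',
      Finset.mem_univ, if_true]
    rw [hd (b + 1) (a + 1) (by omega) (by omega)]
    have h1 : (((a + 1).factorial : ℕ) : ℂ) ≠ 0 := by exact_mod_cast (a + 1).factorial_ne_zero
    have h2 : (((b + 1).factorial : ℕ) : ℂ) ≠ 0 := by exact_mod_cast (b + 1).factorial_ne_zero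
    field_simp
    ring

/-- The monomial functions of two exponents are quadratic in the power sums plus a linear term, so
their derivatives are affine; the constant is subtracted. -/
theorem isLin_gradSym (M : ℕ) (d : ℕ → ℕ → ℝ) (a : ℕ) : IsLin (gradSym M d a) := by
  refine IsLin.smul _ ⟨?_, fun b => ?_⟩
  · rw [map_sub, MvPolynomial.constantCoeff_C, sub_self]
  · obtain ⟨z, hz, -⟩ := pderiv_quadSym M d a b
    rw [map_sub, MvPolynomial.pderiv_C, sub_zero, hz, MvPolynomial.constantCoeff_C]

theorem pderiv_gradSym {M : ℕ} {d : ℕ → ℕ → ℝ} (hd : ∀ k l, 1 ≤ k → 1 ≤ l → d k l = d l k)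
    {a b : ℕ} (ha : a < M) (hb : b < M) : constantCoeff (pderiv b (gradSym M d a)) =
      (d (a + 1) (b + 1) : ℂ) / (a.factorial * (b + 1).factorial) := by
  obtain ⟨z, hz, h2⟩ := pderiv_quadSym M d a b
  rw [gradSym, Derivation.map_smul, map_sub, MvPolynomial.pderiv_C, sub_zero, hz,
    MvPolynomial.smul_eq_C_mul, map_mul, MvPolynomial.constantCoeff_C,
    MvPolynomial.constantCoeff_C, h2 hd ha hb, Nat.factorial_succ a]
  have h1 : (a : ℂ) + 1 ≠ 0 := by exact_mod_cast a.succ_ne_zero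
  push_cast
  have h3 : (a.factorial : ℂ) ≠ 0 := by exact_mod_cast a.factorial_ne_zero
  have h4 : (((b + 1).factorial : ℕ) : ℂ) ≠ 0 := by exact_mod_cast (b + 1).factorial_ne_zero
  field_simp

/-- Sort the jet of log F_N by the number of distinct indices. None: a constant, killed by
derivatives. One: a linear form in the power sums with coefficients of order N, which produces the
leading term. Two: a limit, whose nonconstant derivative is `gradSym`. Three or more: tends to zero.
The last two classes also contain linear terms, but these are of order 1 and negligible beside N. -/
theorem logAsymp_jetSym {F : ∀ N : ℕ, (Fin N → ℂ) → ℂ} {c : ℕ → ℝ} {d : ℕ → ℕ → ℝ}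
    (hF : IsAppropriateWith F c d) {M : ℕ} (hM : 3 ≤ M) :
    LogAsymp (fun N => jetSym M fun I => logCoeff F I N) (truncF M c) (gradSym M d) := by
  obtain ⟨r, rfl⟩ : ∃ r, M = r + 3 := ⟨M - 3, by omega⟩
  let t : ℕ → List ℕ → ℂ := fun N I => logCoeff F I N
  change LogAsymp (fun N => jetSym (r + 3) (t N)) _ _
  let g : ℕ → ℕ → SymRing := fun N e => ∑ κ : Fin e → Fin (r + 3),
    jetCoeff (t N) (fun j => (κ j : ℕ)) • monoSym fun j => (κ j : ℕ)
  let rest : ℕ → SymRing := fun N => ∑ e ∈ Finset.range r, g N (e + 3) + g N 2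
  have hsplit : ∀ N, jetSym (r + 3) (t N) = rest N + g N 1 + g N 0 := fun N => by
    rw [jetSym, Finset.sum_range_succ', Finset.sum_range_succ', Finset.sum_range_succ']
  have hrest : CoeffTendsto rest (quadSym (r + 3) d) := by
    have h1 : CoeffTendsto (fun N => ∑ e ∈ Finset.range r, g N (e + 3)) 0 := by
      have := CoeffTendsto.sum (Finset.range r) (h := fun e N => g N (e + 3)) (g := fun _ => 0)
        fun e _ => by
          have h2 := CoeffTendsto.sum Finset.univ fun (κ : Fin (e + 3) → Fin (r + 3)) _ =>
            (CoeffTendsto.const (monoSym fun j => (κ j : ℕ))).smul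
              (tendsto_jetCoeff_three hF fun j => (κ j : ℕ))
          simpa only [zero_smul, Finset.sum_const_zero] using h2
      simpa only [Finset.sum_const_zero] using this
    have h2 : CoeffTendsto (fun N => g N 2) (quadSym (r + 3) d) :=
      CoeffTendsto.sum Finset.univ fun κ _ => (CoeffTendsto.const _).smul
        (tendsto_jetCoeff_two hF fun j => (κ j : ℕ))
    have h3 := h1.add h2
    rwa [zero_add] at h3
  have hg0 : ∀ N a, pderiv a (g N 0) = 0 := fun N a => by
    simp [g, monoSym]
  have hg1 : ∀ N a, pderiv a (g N 1) = MvPolynomial.C (if a < r + 3 then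
      t N (List.replicate (a + 1) 0) / (a + 1).factorial else 0) := fun N a => by
    simp only [g, map_sum, Derivation.map_smul]
    have h1 : ∀ κ : Fin 1 → Fin (r + 3), jetCoeff (t N) (fun j => (κ j : ℕ)) •
        pderiv a (monoSym fun j => (κ j : ℕ)) = if (κ 0 : ℕ) = a then
          MvPolynomial.C (t N (List.replicate (a + 1) 0) / (a + 1).factorial) else 0 := by
      intro κ
      have h2 : (monoSym fun j => (κ j : ℕ)) = (X (κ 0 : ℕ) : SymRing) := by simp [monoSym]
      rw [h2, pderiv_X_eq]
      split_ifs with h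
      · rw [jetCoeff, placeList_one, h]
        simp [MvPolynomial.smul_eq_C_mul, h]
      · simp
    rw [Finset.sum_congr rfl fun κ _ => h1 κ]
    rw [Fintype.sum_equiv (Equiv.funUnique (Fin 1) (Fin (r + 3))) (fun κ => if (κ 0 : ℕ) = a then
      MvPolynomial.C (t N (List.replicate (a + 1) 0) / (a + 1).factorial) else 0)
      (fun b : Fin (r + 3) => if (b : ℕ) = a then MvPolynomial.C (t N (List.replicate (a + 1) 0) / (a + 1).factorial)
        else 0) fun κ => rfl]
    split_ifs with ha
    · rw [Finset.sum_eq_single ⟨a, ha⟩]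
      · rw [if_pos rfl]
      · intro b _ hb
        rw [if_neg]
        exact fun h => hb (Fin.ext h)
      · simp
    · rw [map_zero]
      refine Finset.sum_eq_zero fun b _ => ?_
      rw [if_neg]
      have := b.2
      omega
  have hpd : ∀ N a, pderiv a (jetSym (r + 3) (t N)) = pderiv a (rest N) +
      MvPolynomial.C (if a < r + 3 then
      t N (List.replicate (a + 1) 0) / (a + 1).factorial else 0) := fun N a => by
    rw [hsplit, map_add, map_add, hg0, hg1, add_zero]
  have hconst : ∀ a, Tendsto (fun N => constantCoeff (pderiv a (rest N))) atTop
      (𝓝 (constantCoeff (pderiv a (quadSym (r + 3) d)))) := fun a => (hrest.pderiv a) 0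
  refine ⟨fun a => ?_, fun a => ?_⟩
  · simp only [hpd, map_add, MvPolynomial.constantCoeff_C]
    have h1 := ((hconst a).const_mul (a + 1 : ℂ)).mul DualTendsto.tendsto_inv
    rw [mul_zero] at h1
    have h2 : Tendsto (fun N : ℕ => ((a : ℂ) + 1) * (if a < r + 3 then
        t N (List.replicate (a + 1) 0) / (a + 1).factorial else 0) / N) atTop
        (𝓝 (PowerSeries.coeff a (truncF (r + 3) c))) := by
      rw [truncF, PowerSeries.coeff_mk]
      split_ifs
      · have h3 := (hF.tendsto_one 0 (a + 1) (by omega)).div_const (a.factorial : ℂ)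
        refine h3.congr fun N => ?_
        rw [Nat.factorial_succ]
        have h4 : (a : ℂ) + 1 ≠ 0 := by exact_mod_cast a.succ_ne_zero
        have h5 : (a.factorial : ℂ) ≠ 0 := by exact_mod_cast a.factorial_ne_zero
        push_cast
        simp only [t]
        field_simp
      · simp
    have h3 := h1.add h2
    rw [zero_add] at h3
    refine h3.congr fun N => ?_
    ring
  · have h1 : ∀ N, pderiv a (jetSym (r + 3) (t N)) - MvPolynomial.C (constantCoeff
        (pderiv a (jetSym (r + 3) (t N)))) = pderiv a (rest N) -
          MvPolynomial.C (constantCoeff (pderiv a (rest N))) := fun N => by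
      rw [hpd, map_add constantCoeff, MvPolynomial.constantCoeff_C, map_add MvPolynomial.C]
      ring
    simp only [h1]
    refine CoeffTendsto.smul tendsto_const_nhds ((hrest.pderiv a).sub fun m => ?_)
    simp only [MvPolynomial.coeff_C]
    split_ifs
    · exact hconst a
    · exact tendsto_const_nhds

theorem constantCoeff_monoSym_succ : ∀ {e : ℕ} (κ : Fin (e + 1) → ℕ), constantCoeff (monoSym κ) = 0
  | 0, κ => by simp [monoSym]
  | e + 1, κ => by
    rw [monoSym, map_sub, map_mul, MvPolynomial.constantCoeff_X, zero_mul, zero_sub, map_sum,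
      Finset.sum_eq_zero fun l _ => constantCoeff_monoSym_succ _, neg_zero]

theorem constantCoeff_jetSym {M : ℕ} {t : List ℕ → ℂ} (ht : t [] = 0) :
    constantCoeff (jetSym M t) = 0 := by
  rw [jetSym, map_sum]
  refine Finset.sum_eq_zero fun e _ => ?_
  rw [map_sum]
  refine Finset.sum_eq_zero fun κ _ => ?_
  rw [MvPolynomial.smul_eq_C_mul, map_mul, MvPolynomial.constantCoeff_C]
  rcases e with _ | e
  · simp [jetCoeff, placeList, ht]
  · rw [constantCoeff_monoSym_succ, mul_zero]

end SchurCLT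

namespace SchurCLT

/-! ### Products of appropriate sequences -/

/-- Near x both factors have argument below π/2 in absolute value, so the principal branches add. -/
theorem eventually_log_mul {X : Type*} [TopologicalSpace X] {x : X} {f g : X → ℂ}
    (hf : ContinuousAt f x) (hg : ContinuousAt g x) (hf1 : f x = 1) (hg1 : g x = 1) :
    ∀ᶠ y in 𝓝 x, Complex.log (f y * g y) = Complex.log (f y) + Complex.log (g y) := by
  have h1 : ∀ {f : X → ℂ}, ContinuousAt f x → f x = 1 →
      ∀ᶠ y in 𝓝 x, f y ≠ 0 ∧ |(f y).arg| < Real.pi / 2 := by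
    intro f hf hf1
    have h2 : ContinuousAt (fun y => |(f y).arg|) x :=
      (ContinuousAt.comp (f := f) (g := Complex.arg) (Complex.continuousAt_arg (by
        rw [hf1]; exact Complex.one_mem_slitPlane)) hf).abs
    refine (hf.eventually_ne (by rw [hf1]; exact one_ne_zero)).and (h2.eventually_lt_const ?_)
    change |(f x).arg| < _
    rw [hf1, Complex.arg_one, abs_zero]
    positivity
  filter_upwards [h1 hf hf1, h1 hg hg1] with y hy1 hy2
  rw [Complex.log_mul_eq_add_log_iff hy1.1 hy2.1]
  have := abs_lt.1 hy1.2
  have := abs_lt.1 hy2.2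
  constructor <;> linarith

theorem eventually_log_prod {X ι : Type*} [TopologicalSpace X] {x : X} (s : Finset ι)
    {f : ι → X → ℂ} (hf : ∀ i, ContinuousAt (f i) x) (hf1 : ∀ i, f i x = 1) :
    ∀ᶠ y in 𝓝 x, Complex.log (∏ i ∈ s, f i y) = ∑ i ∈ s, Complex.log (f i y) := by
  classical
  induction s using Finset.induction_on with
  | empty => simp
  | insert i s hi ih =>
    have h1 := eventually_log_mul (hf i) (tendsto_finsetProd s fun j _ => hf j : ContinuousAt
      (fun y => ∏ j ∈ s, f j y) x) (hf1 i) (Finset.prod_eq_one fun j _ => hf1 j)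
    filter_upwards [h1, ih] with y hy1 hy2
    rw [Finset.prod_insert hi, Finset.sum_insert hi, hy1, hy2]

section SchurGF

variable {N : ℕ}

theorem schurGF_one (ρ : PMF (Signature N)) : schurGF ρ 1 = 1 := by
  rw [schurGF_eq_genFn, genFn_one]
  have h := (ENNReal.tsum_toReal_eq fun l => ρ.apply_ne_top l).symm
  rw [ρ.tsum_coe, ENNReal.toReal_one] at h
  rw [← Complex.ofReal_one, ← h, Complex.ofReal_tsum]
  rfl

theorem IsAppropriate.continuousAt {ρ : ∀ N : ℕ, PMF (Signature N)} (h : IsAppropriate ρ)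
    (hN : 1 ≤ N) : ContinuousAt (schurGF (ρ N)) 1 :=
  continuousAt_genFn (h.expSummable hN)

end SchurGF

variable {m : ℕ} {ρ : ∀ N : ℕ, PMF (Signature N)} {σ : Fin m → ∀ N : ℕ, PMF (Signature N)}

theorem levelGF_one (s : Fin (m + 1)) (N : ℕ) : levelGF ρ σ s N 1 = 1 := by
  rw [levelGF, schurGF_one, one_mul]
  exact Finset.prod_eq_one fun r _ => schurGF_one _

theorem continuousAt_levelGF (hρ : IsAppropriate ρ) (hσ : ∀ r, IsAppropriate (σ r))
    (s : Fin (m + 1)) {N : ℕ} (hN : 1 ≤ N) : ContinuousAt (levelGF ρ σ s N) 1 :=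
  (hρ.continuousAt hN).mul (tendsto_finsetProd _ fun r _ => (hσ r).continuousAt hN)

theorem log_levelGF (hρ : IsAppropriate ρ) (hσ : ∀ r, IsAppropriate (σ r))
    (s : Fin (m + 1)) {N : ℕ} (hN : 1 ≤ N) :
    (fun x => Complex.log (levelGF ρ σ s N x)) =ᶠ[𝓝 1] fun x => Complex.log (schurGF (ρ N) x) +
      ∑ r : Fin m with s ≤ r.castSucc, Complex.log (schurGF (σ r N) x) := by
  filter_upwards [eventually_log_mul (hρ.continuousAt hN) (tendsto_finsetProd
    (Finset.univ.filter fun r : Fin m => s ≤ r.castSucc) fun r _ => (hσ r).continuousAt hN :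
      ContinuousAt (fun x => ∏ r : Fin m with s ≤ r.castSucc, schurGF (σ r N) x) 1)
      (schurGF_one _) (Finset.prod_eq_one fun r _ => schurGF_one _),
    eventually_log_prod (Finset.univ.filter fun r : Fin m => s ≤ r.castSucc)
      (fun r => (hσ r).continuousAt hN) (fun r => schurGF_one _)] with x h1 h2
  rw [levelGF, h1, h2]

/-- The sequences `H_s` are appropriate. -/
theorem isAppropriateWith_levelGF (hρ : IsAppropriate ρ) (hσ : ∀ r, IsAppropriate (σ r))
    (s : Fin (m + 1)) : ∃ c d, IsAppropriateWith (levelGF ρ σ s) c d := by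
  obtain ⟨c, d, h⟩ := hρ.2
  choose c' d' h' using fun r => (hσ r).2
  let S : Finset (Fin m) := Finset.univ.filter fun r : Fin m => s ≤ r.castSucc
  have hlog : ∀ N, 1 ≤ N → ∀ I, logCoeff (levelGF ρ σ s) I N =
      logCoeff (fun N => schurGF (ρ N)) I N +
        ∑ r ∈ S, logCoeff (fun N => schurGF (σ r N)) I N := by
    intro N hN I
    have h1 : Smooth fun x => Complex.log (schurGF (ρ N) x) :=
      (h.log_holomorphic N hN).contDiffAt
    have h2 : ∀ r, Smooth fun x => Complex.log (schurGF (σ r N) x) := fun r =>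
      ((h' r).log_holomorphic N hN).contDiffAt
    rw [logCoeff, (mixedPartial_congr (log_levelGF hρ hσ s hN) I).self_of_nhds,
      (mixedPartial_add h1 (ContDiffAt.sum fun r _ => h2 r) I).self_of_nhds]
    exact congrArg _ (mixedPartial_sum S h2 I).self_of_nhds
  have hlog' : ∀ I, (fun N => logCoeff (fun N => schurGF (ρ N)) I N +
      ∑ r ∈ S, logCoeff (fun N => schurGF (σ r N)) I N) =ᶠ[atTop]
        fun N => logCoeff (levelGF ρ σ s) I N := fun I => by
    filter_upwards [eventually_ge_atTop 1] with N hN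
    exact (hlog N hN I).symm
  refine ⟨fun k => c k + ∑ r ∈ S, c' r k, fun k l => d k l + ∑ r ∈ S, d' r k l,
    ?_, ?_, ?_, ?_, ?_, ?_, ?_⟩
  · intro N hN τ x
    rw [levelGF, levelGF, h.symmetric N hN]
    congr 1
    exact Finset.prod_congr rfl fun r _ => (h' r).symmetric N hN τ x
  · intro N hN
    refine AnalyticAt.congr ?_ (log_levelGF hρ hσ s hN).symm
    exact (h.log_holomorphic N hN).fun_add
      (Finset.analyticAt_fun_sum _ fun r _ => (h' r).log_holomorphic N hN)
  · intro i k hk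
    have h1 := (h.tendsto_one i k hk).add
      (tendsto_finsetSum S fun r _ => (h' r).tendsto_one i k hk)
    push_cast
    refine h1.congr' ?_
    filter_upwards [hlog' (List.replicate k i)] with N hN
    rw [← hN, add_div, Finset.sum_div]
  · intro i j k l hij hk hl
    have h1 := (h.tendsto_two i j k l hij hk hl).add
      (tendsto_finsetSum S fun r _ => (h' r).tendsto_two i j k l hij hk hl)
    push_cast
    exact h1.congr' (hlog' _)
  · intro I hI
    have h1 := (h.tendsto_three I hI).add
      (tendsto_finsetSum S fun r _ => (h' r).tendsto_three I hI)
    rw [Finset.sum_const_zero, add_zero] at h1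
    exact h1.congr' (hlog' _)
  · filter_upwards [h.summable_one, (Finset.eventually_all S).2 fun r _ => (h' r).summable_one]
      with x h1 h2
    refine (h1.add (summable_sum fun r hr => h2 r hr)).congr fun k => ?_
    push_cast
    rw [add_div, add_mul, Finset.sum_div, Finset.sum_mul]
  · filter_upwards [h.summable_two, (Finset.eventually_all S).2 fun r _ => (h' r).summable_two]
      with x h1 h2
    refine (h1.add (summable_sum fun r hr => h2 r hr)).congr fun k => ?_
    push_cast
    rw [add_div, add_mul, add_mul, Finset.sum_div, Finset.sum_mul, Finset.sum_mul]

/-! ### Jets of the generating functions -/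

/-- The jet of `log H_s`. -/
noncomputable def levelSym (M : ℕ) (ρ : ∀ N : ℕ, PMF (Signature N))
    (σ : Fin m → ∀ N : ℕ, PMF (Signature N)) (N : ℕ) (s : Fin (m + 1)) : SymRing :=
  jetSym M fun I => logCoeff (levelGF ρ σ s) I N

theorem constantCoeff_levelSym (M N : ℕ) (s : Fin (m + 1)) :
    MvPolynomial.constantCoeff (levelSym M ρ σ N s) = 0 := by
  refine constantCoeff_jetSym ?_
  change Complex.log (levelGF ρ σ s N 1) = 0
  rw [levelGF_one, Complex.log_one]

theorem jetEq_levelSym {s : Fin (m + 1)} {c : ℕ → ℝ} {d : ℕ → ℕ → ℝ}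
    (hc : IsAppropriateWith (levelGF ρ σ s) c d) {N : ℕ} (hN : 1 ≤ N) (M : ℕ) :
    JetEq M (fun x => Complex.log (levelGF ρ σ s N x)) fun x => psEval x (levelSym M ρ σ N s) :=
  jetEq_jetSym (hc.log_holomorphic N hN).contDiffAt
    (fun τ x => by rw [hc.symmetric N hN]) M

theorem jetEq_schurGF_last (hρ : IsAppropriate ρ)
    {c : ℕ → ℝ} {d : ℕ → ℕ → ℝ} (hc : IsAppropriateWith (levelGF ρ σ (Fin.last m)) c d) {N : ℕ}
    (hN : 1 ≤ N) (M : ℕ) : JetEq M (schurGF (ρ N)) fun x =>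
      Complex.exp (psEval x (levelSym M ρ σ N (Fin.last m))) := by
  have h1 := (jetEq_levelSym hc hN M).exp
  refine (JetEq.of_eventuallyEq h1.left ?_).symm.trans h1
  filter_upwards [(hρ.continuousAt hN).eventually_ne (by rw [schurGF_one]; exact one_ne_zero)]
    with x hx
  have h2 : levelGF ρ σ (Fin.last m) N x = schurGF (ρ N) x := by
    rw [levelGF, Finset.filter_false_of_mem, Finset.prod_empty, mul_one]
    intro r _
    exact not_le.2 (Fin.castSucc_lt_last r)
  rw [h2, Complex.exp_log hx]

theorem levelGF_castSucc (r : Fin m) (N : ℕ) (x : Fin N → ℂ) :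
    levelGF ρ σ r.castSucc N x = levelGF ρ σ r.succ N x * schurGF (σ r N) x := by
  rw [levelGF, levelGF, mul_assoc]
  congr 1
  have : (Finset.univ.filter fun q : Fin m => r.castSucc ≤ q.castSucc) =
      insert r (Finset.univ.filter fun q : Fin m => r.succ ≤ q.castSucc) := by
    ext q
    simp only [Finset.mem_filter, Finset.mem_univ, true_and, Finset.mem_insert,
      Fin.castSucc_le_castSucc_iff, Fin.succ_le_castSucc_iff]
    exact le_iff_eq_or_lt.trans (or_congr_left eq_comm)
  rw [this, Finset.prod_insert, mul_comm]
  simp [Fin.succ_le_castSucc_iff]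

/-- The logarithm of g is the difference of the logarithms of the generating functions of two
neighbouring levels, so only the level functions need symmetric representatives. -/
theorem jetEq_schurGF_step (hρ : IsAppropriate ρ) (hσ : ∀ r, IsAppropriate (σ r))
    {c : Fin (m + 1) → ℕ → ℝ} {d : Fin (m + 1) → ℕ → ℕ → ℝ}
    (hc : ∀ s, IsAppropriateWith (levelGF ρ σ s) (c s) (d s)) {N : ℕ} (hN : 1 ≤ N) (M : ℕ)
    (r : Fin m) : JetEq M (schurGF (σ r N)) fun x => Complex.exp
      (psEval x (levelSym M ρ σ N r.castSucc) - psEval x (levelSym M ρ σ N r.succ)) := by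
  have h1 := ((jetEq_levelSym (hc r.castSucc) hN M).sub (jetEq_levelSym (hc r.succ) hN M)).exp
  refine (JetEq.of_eventuallyEq h1.left ?_).symm.trans h1
  filter_upwards [((hσ r).continuousAt hN).eventually_ne (by rw [schurGF_one]; exact one_ne_zero),
    eventually_log_mul (continuousAt_levelGF hρ hσ r.succ hN) ((hσ r).continuousAt hN)
      (levelGF_one _ _) (schurGF_one _)] with x hx h2
  rw [levelGF_castSucc, h2, add_sub_cancel_left, Complex.exp_log hx]

end SchurCLT

namespace SchurCLT

open MvPolynomial (pderiv constantCoeff X)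

/-! ### The limiting fluctuation operators -/

/-- The multiplication part of `limOp`. -/
noncomputable def limMul (f : PowerSeries ℂ) (G : ℕ → SymRing) (M k : ℕ) : SymRing :=
  limPoly f M k + ∑ j ∈ Finset.range k, PowerSeries.coeff (k - 1 - j) (wickSeries f k) • G j

/-- The derivation part of `limOp`. -/
noncomputable def limDeriv (f : PowerSeries ℂ) (k : ℕ) : SymRing →ₗ[ℂ] SymRing :=
  ∑ j ∈ Finset.range k, (PowerSeries.coeff (k - 1 - j) (wickSeries f k) * (j + 1)) •
    (pderiv j).toLinearMap

theorem limDeriv_apply (f : PowerSeries ℂ) (k : ℕ) (h : SymRing) : limDeriv f k h =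
    ∑ j ∈ Finset.range k, (PowerSeries.coeff (k - 1 - j) (wickSeries f k) * (j + 1)) •
      pderiv j h := by
  simp only [limDeriv, LinearMap.sum_apply, LinearMap.smul_apply]
  rfl

/-- Annihilation and creation parts: a derivation with constant coefficients and multiplication by a
linear form. -/
theorem limOp_apply (f : PowerSeries ℂ) (G : ℕ → SymRing) (M k : ℕ) (h : SymRing) :
    limOp f G M k h = limMul f G M k * h + limDeriv f k h := by
  rw [limDeriv_apply]
  simp only [limOp, limMul, fluctOp, LinearMap.add_apply, LinearMap.sum_apply,
    LinearMap.smul_apply, LinearMap.mulLeft_apply, add_mul, Finset.sum_mul, smul_add, smul_smul,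
    Finset.sum_add_distrib, smul_mul_assoc]
  have h1 : ∀ j, ((pderiv j : Derivation ℂ SymRing SymRing) : SymRing →ₗ[ℂ] SymRing) h =
    pderiv j h := fun _ => rfl
  simp only [h1]
  abel

theorem isLin_limPoly (f : PowerSeries ℂ) (M k : ℕ) : IsLin (limPoly f M k) :=
  IsLin.sum _ fun b _ => (IsLin.sum _ fun p _ => (IsLin.sum _ fun m _ => IsLin.smul _ (by
    split_ifs
    · exact IsLin.of_X _
    · exact IsLin.of_zero)).smul _).smul _

theorem isLin_limMul {f : PowerSeries ℂ} {G : ℕ → SymRing} (hG : ∀ j, IsLin (G j)) (M k : ℕ) :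
    IsLin (limMul f G M k) :=
  (isLin_limPoly f M k).add (IsLin.sum _ fun j _ => (hG j).smul _)

/-- The derivatives of a linear form are constants, so its commutator with the derivation is a
scalar. -/
theorem limDeriv_mul {v : SymRing} (hv : IsLin v) (f : PowerSeries ℂ) (k : ℕ) (h : SymRing) :
    limDeriv f k (v * h) = constantCoeff (limDeriv f k v) • h + v * limDeriv f k h := by
  simp only [limDeriv_apply, Derivation.leibniz, smul_eq_mul, smul_add, Finset.sum_add_distrib,
    map_sum, Finset.sum_smul, Finset.mul_sum, mul_smul_comm]
  rw [add_comm]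
  congr 1
  refine Finset.sum_congr rfl fun j _ => ?_
  rw [hv.pderiv_eq j, MvPolynomial.smul_eq_C_mul, MvPolynomial.smul_eq_C_mul,
    MvPolynomial.smul_eq_C_mul]
  simp only [map_mul, MvPolynomial.constantCoeff_C]
  ring

theorem pderiv_comm (i j : ℕ) (h : SymRing) : pderiv i (pderiv j h) = pderiv j (pderiv i h) := by
  have h1 : ⁅(pderiv i : Derivation ℂ SymRing SymRing), pderiv j⁆ = 0 :=
    MvPolynomial.derivation_ext fun l => by
      rw [Derivation.commutator_apply, pderiv_X_eq, pderiv_X_eq, MvPolynomial.pderiv_C,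
        MvPolynomial.pderiv_C, sub_zero, Derivation.zero_apply]
  have h2 := DFunLike.congr_fun h1 h
  rwa [Derivation.commutator_apply, Derivation.zero_apply, sub_eq_zero] at h2

theorem limDeriv_comm (f f' : PowerSeries ℂ) (k k' : ℕ) (h : SymRing) :
    limDeriv f k (limDeriv f' k' h) = limDeriv f' k' (limDeriv f k h) := by
  simp only [limDeriv_apply, map_sum, Derivation.map_smul]
  rw [Finset.sum_comm]
  refine Finset.sum_congr rfl fun i _ => Finset.sum_congr rfl fun j _ => ?_
  rw [smul_comm, pderiv_comm]

theorem limDeriv_one (f : PowerSeries ℂ) (k : ℕ) : limDeriv f k 1 = 0 := by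
  rw [limDeriv_apply]
  simp

/-- The constant coefficient of a product of fluctuation operators is given by Wick's formula. -/
theorem constantCoeff_foldr_limOp {ι : Type*} (f : ι → PowerSeries ℂ) (G : ι → ℕ → SymRing)
    (hG : ∀ a j, IsLin (G a j)) (M : ℕ) (k : ι → ℕ) (l : List ι) :
    constantCoeff (l.foldr (fun a h => limOp (f a) (G a) M (k a) h) 1) =
      wick (fun a b => constantCoeff (limDeriv (f a) (k a) (limMul (f b) (G b) M (k b)))) l := by
  let E : SymRing →ₗ[ℂ] ℂ :=
    { toFun := constantCoeff
      map_add' := map_add _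
      map_smul' := fun c p => by
        rw [MvPolynomial.smul_eq_C_mul, map_mul, MvPolynomial.constantCoeff_C]
        rfl }
  refine apply_foldr_eq_wick E (fun a => limDeriv (f a) (k a))
    (fun a => limOp (f a) (G a) M (k a)) 1 _ (fun a b h => ?_) (fun a => limDeriv_one _ _)
    (fun a h => ?_) (map_one constantCoeff) l
  · rw [limOp_apply, limOp_apply, map_add, limDeriv_mul (isLin_limMul (hG b) M (k b)),
      limDeriv_comm, add_assoc]
  · change constantCoeff (limOp (f a) (G a) M (k a) h) = constantCoeff (limDeriv (f a) (k a) h)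
    rw [limOp_apply, map_add, map_mul, (isLin_limMul (hG a) M (k a)).zero, zero_mul, zero_add]

/-- The variable indexed by t occurs when b + q = i + t + 1, and then the factor u^b · u^(k−i) · u^q
in the expansion of the series has degree k + 1 + t. The condition on M keeps all these q within the
range. -/
theorem pderiv_limPoly (f : PowerSeries ℂ) {M k t : ℕ} (hM : k + t + 1 < M) :
    constantCoeff (pderiv t (limPoly f M k)) =
      PowerSeries.coeff (k + 1 + t) (wickSeries f k) := by
  rw [coeff_wickSeries, limPoly, map_sum, map_sum]
  refine Finset.sum_congr rfl fun b hb => ?_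
  rw [Finset.Nat.sum_antidiagonal_eq_sum_range_succ_mk, Derivation.map_smul, map_sum,
    MvPolynomial.smul_eq_C_mul, map_mul, MvPolynomial.constantCoeff_C, map_sum, Finset.mul_sum]
  refine Finset.sum_congr rfl fun i hi => ?_
  rw [Finset.mem_range] at hb hi
  rw [Derivation.map_smul, MvPolynomial.smul_eq_C_mul, map_mul, MvPolynomial.constantCoeff_C,
    map_sum, map_sum, mul_assoc]
  congr 2
  have h1 : ∀ q, constantCoeff (pderiv t (PowerSeries.coeff q (f ^ (k - i)) •
      if i < b + q then (X (b + q - i - 1) : SymRing) else 0)) =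
      if b + q = i + t + 1 then PowerSeries.coeff q (f ^ (k - i)) else 0 := by
    intro q
    rw [Derivation.map_smul, MvPolynomial.smul_eq_C_mul, map_mul, MvPolynomial.constantCoeff_C]
    split_ifs with h1 h2 h2
    · rw [pderiv_X_eq, if_pos (by omega), MvPolynomial.constantCoeff_C, mul_one]
    · rw [pderiv_X_eq, if_neg (by omega), MvPolynomial.constantCoeff_C, mul_zero]
    · omega
    · rw [map_zero, map_zero, mul_zero]
  rw [Finset.sum_congr rfl fun q _ => h1 q]
  split_ifs with h2
  · rw [Finset.sum_eq_single (k + 1 + t - (b + (k - i)))]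
    · rw [if_pos (by omega)]
    · intro q _ hq
      rw [if_neg (by omega)]
    · intro hq
      rw [Finset.mem_range] at hq
      omega
  · refine Finset.sum_eq_zero fun q _ => ?_
    rw [if_neg (by omega)]

/-- The power series `F(1 + u)`. -/
noncomputable def fullF (c : ℕ → ℝ) : PowerSeries ℂ :=
  PowerSeries.mk fun a => (c (a + 1) : ℂ) / a.factorial

/-- F enters multiplied by u, so cutting it at degree M changes nothing up to and including degree
M. -/
theorem coeff_wickSeries_truncF (c : ℕ → ℝ) {M n : ℕ} (hn : n ≤ M) (k : ℕ) :
    PowerSeries.coeff n (wickSeries (truncF M c) k) =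
      PowerSeries.coeff n (wickSeries (fullF c) k) := by
  have h1 : PowerSeries.X ^ M ∣ fullF c - truncF M c := by
    rw [PowerSeries.X_pow_dvd_iff]
    intro a ha
    rw [map_sub, fullF, truncF, PowerSeries.coeff_mk, PowerSeries.coeff_mk, if_pos ha, sub_self]
  have h2 : PowerSeries.X ^ (M + 1) ∣ (1 + PowerSeries.X) * (1 + PowerSeries.X * fullF c) -
      (1 + PowerSeries.X) * (1 + PowerSeries.X * truncF M c) := by
    rw [show (1 + PowerSeries.X) * (1 + PowerSeries.X * fullF c) -
      (1 + PowerSeries.X) * (1 + PowerSeries.X * truncF M c) =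
        PowerSeries.X * (fullF c - truncF M c) * (1 + PowerSeries.X) by ring, pow_succ']
    exact (mul_dvd_mul_left _ h1).mul_right _
  have h3 := h2.trans (sub_dvd_pow_sub_pow _ _ k)
  have h4 := PowerSeries.X_pow_dvd_iff.1 h3 n (by omega)
  rw [map_sub, sub_eq_zero] at h4
  exact h4.symm

/-- The limit of the covariances, in terms of Laurent coefficients. -/
noncomputable def covCoeff (c₁ c₂ : ℕ → ℝ) (d : ℕ → ℕ → ℝ) (k₁ k₂ : ℕ) : ℂ :=
  ∑ j ∈ Finset.range k₁, PowerSeries.coeff (k₁ - 1 - j) (wickSeries (fullF c₁) k₁) *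
    ((j + 1) * PowerSeries.coeff (k₂ + 1 + j) (wickSeries (fullF c₂) k₂) +
      ∑ i ∈ Finset.range k₂, PowerSeries.coeff (k₂ - 1 - i) (wickSeries (fullF c₂) k₂) *
        ((d (j + 1) (i + 1) : ℂ) / (j.factorial * i.factorial)))

/-- The derivation carries the coefficients of u^(−1−j) in (1/u + 1 + (1 + u) F₁)^k₁. It meets those
of u^(1+j) for F₂ through the multiplication part of the Vandermonde terms, and the singular
coefficients for F₂ through G. -/
theorem constantCoeff_limDeriv_limMul (c₁ c₂ : ℕ → ℝ) {d : ℕ → ℕ → ℝ}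
    (hd : ∀ k l, 1 ≤ k → 1 ≤ l → d k l = d l k) {M k₁ k₂ : ℕ} (hM : k₁ + k₂ < M) :
    constantCoeff (limDeriv (truncF M c₁) k₁ (limMul (truncF M c₂) (gradSym M d) M k₂)) =
      covCoeff c₁ c₂ d k₁ k₂ := by
  rw [limDeriv_apply, map_sum, covCoeff]
  refine Finset.sum_congr rfl fun j hj => ?_
  rw [Finset.mem_range] at hj
  rw [limMul, map_add, MvPolynomial.smul_eq_C_mul, map_mul, MvPolynomial.constantCoeff_C, map_add,
    pderiv_limPoly _ (by omega), coeff_wickSeries_truncF _ (by omega),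
    coeff_wickSeries_truncF _ (by omega), mul_assoc, mul_add, map_sum, map_sum, Finset.mul_sum]
  congr 2
  refine Finset.sum_congr rfl fun i hi => ?_
  rw [Finset.mem_range] at hi
  rw [Derivation.map_smul, MvPolynomial.smul_eq_C_mul, map_mul, MvPolynomial.constantCoeff_C,
    pderiv_gradSym hd (by omega) (by omega), coeff_wickSeries_truncF _ (by omega),
    hd (i + 1) (j + 1) (by omega) (by omega), Nat.factorial_succ]
  have h1 : (j : ℂ) + 1 ≠ 0 := by exact_mod_cast j.succ_ne_zero
  have h2 : (j.factorial : ℂ) ≠ 0 := by exact_mod_cast j.factorial_ne_zero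
  have h3 : (i.factorial : ℂ) ≠ 0 := by exact_mod_cast i.factorial_ne_zero
  push_cast
  field_simp

end SchurCLT

namespace SchurCLT

open MvPolynomial (pderiv constantCoeff X)

/-! ### Convergence of the centered moments -/

/-- The concatenation of the lists `ks s`, labelled by the levels. -/
def chainFlat {n : ℕ} (ks : Fin n → List ℕ) : List (ℕ × Fin n) :=
  (List.ofFn fun s => (ks s).map fun k => (k, s)).flatten

theorem chainFlat_succ {n : ℕ} (ks : Fin (n + 1) → List ℕ) : chainFlat ks =
    (ks 0).map (fun k => (k, 0)) ++
      (chainFlat fun s => ks s.succ).map fun a => (a.1, a.2.succ) := by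
  simp [chainFlat, List.ofFn_succ, List.map_flatten, List.map_ofFn, Function.comp_def]

theorem foldr_levelOp (N M : ℕ) (L : SymRing) (e : ℕ → ℂ) (ks : List ℕ) (h : SymRing) :
    levelOp N L M (ks.map fun k => (k, e k)) h =
      ks.foldr (fun k h => powOp N L M k h - e k • h) h := by
  rw [levelOp, List.foldr_map]

/-- The lowest level is the head of the flattened list, and its operators are applied last. -/
theorem chainOp_eq_foldr (N M : ℕ) : ∀ {m : ℕ} (L : Fin (m + 1) → SymRing)
    (e : ℕ → Fin (m + 1) → ℂ) (ks : Fin (m + 1) → List ℕ),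
    chainOp N M L (fun s => (ks s).map fun k => (k, e k s)) =
      (chainFlat ks).foldr (fun a h => powOp N (L a.2) M a.1 h - e a.1 a.2 • h) 1
  | 0, L, e, ks => by
    rw [chainOp, foldr_levelOp N M (L 0) (fun k => e k 0), chainFlat_succ, List.foldr_append,
      List.foldr_map]
    rfl
  | m + 1, L, e, ks => by
    rw [chainOp, foldr_levelOp N M (L 0) (fun k => e k 0), chainFlat_succ, List.foldr_append,
      List.foldr_map, List.foldr_map,
      chainOp_eq_foldr N M (fun s => L s.succ) (fun k s => e k s.succ) (fun s => ks s.succ)]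

theorem chainFlat_single : ∀ {n : ℕ} (k : ℕ) (s : Fin n),
    chainFlat (fun t => if t = s then [k] else []) = [(k, s)]
  | 0, _, s => s.elim0
  | n + 1, k, s => by
    have h0 : ∀ n, chainFlat (fun _ : Fin n => ([] : List ℕ)) = [] := fun n => by
      simp [chainFlat]
    rw [chainFlat_succ]
    induction s using Fin.cases with
    | zero => simp [h0]
    | succ s =>
      have := chainFlat_single k s
      simp [(Fin.succ_ne_zero s).symm, this]

theorem prod_chainFlat {n : ℕ} {A : Type*} [CommMonoid A] (ks : Fin n → List ℕ)
    (f : ℕ × Fin n → A) :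
    ((chainFlat ks).map f).prod = ∏ s, ((ks s).map fun k => f (k, s)).prod := by
  rw [chainFlat, List.map_flatten, List.prod_flatten, List.map_map, List.map_ofFn, List.prod_ofFn]
  simp [Function.comp_def]

theorem sum_chainFlat {n : ℕ} (ks : Fin n → List ℕ) :
    ((chainFlat ks).map Prod.fst).sum = ∑ s, (ks s).sum := by
  rw [chainFlat, List.map_flatten, List.sum_flatten, List.map_map, List.map_ofFn, List.sum_ofFn]
  simp [Function.comp_def]

/-- Subtraction of the expected values. -/
theorem DualTendsto.exists_center {k : ℕ} {T : ℕ → Module.End ℂ SymRing} {y : ℂ}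
    {Ξ : Module.End ℂ SymRing} (H : DualTendsto (k + 1) T y Ξ) (hΞ : constantCoeff (Ξ 1) = 0) :
    ∃ S : ℕ → Module.End ℂ SymRing,
      (∀ N : ℕ, 1 ≤ N → ∀ h, T N h - constantCoeff (T N 1) • h = (N : ℂ) ^ k • S N h) ∧
      OpTendsto S Ξ := by
  obtain ⟨y', b, h1, -, h3⟩ := H
  refine ⟨fun N => b N + (-constantCoeff (b N 1)) • 1, fun N hN h => ?_, ?_⟩
  · have hN0 : (N : ℂ) ≠ 0 := Nat.cast_ne_zero.2 (by omega)
    rw [h1 N hN]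
    simp only [LinearMap.smul_apply, LinearMap.add_apply, Module.End.one_apply,
      MvPolynomial.constantCoeff_smul, map_add, map_one, smul_eq_mul]
    match_scalars
    · field_simp
      ring
    · field_simp
      exact pow_succ' _ _
  · have h4 : Tendsto (fun N => -constantCoeff (b N 1)) atTop (𝓝 0) := by
      have := (h3 _ _ (CoeffTendsto.const 1) 0).neg
      rwa [show (Ξ 1).coeff 0 = 0 from hΞ, neg_zero] at this
    have h5 := h3.add (OpTendsto.smul (T := fun _ => 1) (S := 1) h4 fun _ _ hg => hg)
    rwa [zero_smul, add_zero] at h5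

/-- Convergence of operators is stable under composition by definition, so the powers of N can be
collected in front of a convergent sequence of polynomials. -/
theorem exists_foldr_tendsto {ι : Type*} (k : ι → ℕ) (T : ι → ℕ → SymRing → SymRing)
    (Ξ : ι → Module.End ℂ SymRing) (l : List ι)
    (H : ∀ a ∈ l, ∃ S : ℕ → Module.End ℂ SymRing,
      (∀ N : ℕ, 1 ≤ N → ∀ h, T a N h = (N : ℂ) ^ k a • S N h) ∧ OpTendsto S (Ξ a)) :
    ∃ h : ℕ → SymRing, (∀ N : ℕ, 1 ≤ N → l.foldr (fun a h => T a N h) 1 =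
      (l.map fun a => (N : ℂ) ^ k a).prod • h N) ∧
      CoeffTendsto h (l.foldr (fun a h => Ξ a h) 1) := by
  induction l with
  | nil => exact ⟨fun _ => 1, fun N _ => by simp, CoeffTendsto.const 1⟩
  | cons a l ih =>
    obtain ⟨h, h1, h2⟩ := ih fun b hb => H b (List.mem_cons_of_mem _ hb)
    obtain ⟨S, h3, h4⟩ := H a List.mem_cons_self
    refine ⟨fun N => S N (h N), fun N hN => ?_, h4 _ _ h2⟩
    rw [List.foldr_cons, h1 N hN, h3 N hN, map_smul, smul_smul, List.map_cons, List.prod_cons]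

variable {m : ℕ} {ρ : ∀ N : ℕ, PMF (Signature N)} {σ : Fin m → ∀ N : ℕ, PMF (Signature N)}

/-- The law of the chain for given `N`. -/
noncomputable def chainLaw (ρ : ∀ N : ℕ, PMF (Signature N)) (σ : Fin m → ∀ N : ℕ, PMF (Signature N))
    (N : ℕ) : Measure (Fin (m + 1) → Signature N) :=
  chainMeasure (ρ N) fun r => σ r N

/-- The centered moments of the chain, in terms of operators. -/
theorem integral_chainLaw_prod (hρ : IsAppropriate ρ) (hσ : ∀ r, IsAppropriate (σ r))
    {c : Fin (m + 1) → ℕ → ℝ} {d : Fin (m + 1) → ℕ → ℕ → ℝ}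
    (hc : ∀ s, IsAppropriateWith (levelGF ρ σ s) (c s) (d s)) {N M : ℕ} (hN : 1 ≤ N)
    (ks : Fin (m + 1) → List ℕ) (hM : 1 + ∑ s, (ks s).sum ≤ M) (e : ℕ → Fin (m + 1) → ℝ) :
    ((∫ l, ((chainFlat ks).map fun a => powerSum a.1 a.2 l - e a.1 a.2).prod ∂(chainLaw ρ σ N) :
      ℝ) : ℂ) = constantCoeff ((chainFlat ks).foldr
        (fun a h => powOp N (levelSym M ρ σ N a.2) M a.1 h - (e a.1 a.2 : ℂ) • h) 1) := by
  rw [← chainOp_eq_foldr N M (levelSym M ρ σ N) (fun k s => (e k s : ℂ)) ks,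
    ← integral_chainMeasure_levelFn (ρ := ρ N) (σ := fun r => σ r N) (hρ.expSummable hN)
      (fun r => (hσ r).expSummable hN) (constantCoeff_levelSym M N 0)
      (jetEq_schurGF_last hρ (hc _) hN M) (fun r => jetEq_schurGF_step hρ hσ hc hN M r) _
      (by simpa [List.map_map, Function.comp_def] using hM), ← integral_complex_ofReal, chainLaw]
  refine integral_congr_ae (Eventually.of_forall fun l => ?_)
  simp only [prod_chainFlat, Complex.ofReal_prod, levelFn, List.map_map, Function.comp_def,
    powerSum_eq]
  refine Finset.prod_congr rfl fun s _ => ?_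
  have := map_list_prod Complex.ofRealHom ((ks s).map fun k => sigPower k (l s) - e k s)
  rw [List.map_map] at this
  refine this.trans ?_
  simp [Function.comp_def]

theorem integral_powerSum (hρ : IsAppropriate ρ) (hσ : ∀ r, IsAppropriate (σ r))
    {c : Fin (m + 1) → ℕ → ℝ} {d : Fin (m + 1) → ℕ → ℕ → ℝ}
    (hc : ∀ s, IsAppropriateWith (levelGF ρ σ s) (c s) (d s)) {N M k : ℕ} (hN : 1 ≤ N)
    (hM : 1 + k ≤ M) (s : Fin (m + 1)) :
    ((∫ l, powerSum k s l ∂(chainLaw ρ σ N) : ℝ) : ℂ) =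
      constantCoeff (powOp N (levelSym M ρ σ N s) M k 1) := by
  have h1 := integral_chainLaw_prod hρ hσ hc hN (M := M) (fun t => if t = s then [k] else [])
    (by
      have : ∀ t, (if t = s then [k] else []).sum = if t = s then k else 0 := fun t => by
        split_ifs <;> simp
      simpa [this] using hM) fun _ _ => 0
  rw [chainFlat_single] at h1
  simpa using h1

/-- The normalized covariance functional. -/
noncomputable def covLim (c : Fin (m + 1) → ℕ → ℝ) (d : Fin (m + 1) → ℕ → ℕ → ℝ)
    (a b : ℕ × Fin (m + 1)) : ℂ := covCoeff (c a.2) (c b.2) (d b.2) a.1 b.1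

/-- Centring by the expectation is centring each operator by its own constant coefficient on 1, so
the normalized product converges to the product of the limiting operators. -/
theorem tendsto_integral_prod (hρ : IsAppropriate ρ) (hσ : ∀ r, IsAppropriate (σ r))
    {c : Fin (m + 1) → ℕ → ℝ} {d : Fin (m + 1) → ℕ → ℕ → ℝ}
    (hc : ∀ s, IsAppropriateWith (levelGF ρ σ s) (c s) (d s)) (ks : Fin (m + 1) → List ℕ) :
    Tendsto (fun N : ℕ => ((∫ l, ((chainFlat ks).map fun a => (powerSum a.1 a.2 l -
      ∫ l', powerSum a.1 a.2 l' ∂(chainLaw ρ σ N)) / (N : ℝ) ^ a.1).prod ∂(chainLaw ρ σ N) : ℝ) : ℂ))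
      atTop (𝓝 (wick (covLim c d) (chainFlat ks))) := by
  -- Large enough for the exact moment formula, for `logAsymp_jetSym` (at least 3), and to exceed
  -- the sum of any two exponents in the covariances.
  set M : ℕ := 4 + 2 * ∑ s, (ks s).sum with hMdef
  have hk : ∀ a ∈ chainFlat ks, a.1 ≤ ∑ s, (ks s).sum := fun a ha => by
    rw [← sum_chainFlat]
    exact List.single_le_sum (fun _ _ => Nat.zero_le _) _ (List.mem_map_of_mem ha)
  let f : ℕ × Fin (m + 1) → PowerSeries ℂ := fun a => truncF M (c a.2)
  let G : ℕ × Fin (m + 1) → ℕ → SymRing := fun a => gradSym M (d a.2)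
  have hG : ∀ a j, IsLin (G a j) := fun a j => isLin_gradSym _ _ _
  have hL : ∀ a : ℕ × Fin (m + 1), LogAsymp (fun N => levelSym M ρ σ N a.2) (f a) (G a) :=
    fun a => logAsymp_jetSym (hc a.2) (by omega)
  obtain ⟨h, h1, h2⟩ := exists_foldr_tendsto (fun a : ℕ × Fin (m + 1) => a.1)
    (fun a N h => powOp N (levelSym M ρ σ N a.2) M a.1 h -
      constantCoeff (powOp N (levelSym M ρ σ N a.2) M a.1 1) • h)
    (fun a => limOp (f a) (G a) M a.1) (chainFlat ks) fun a ha => by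
      obtain ⟨y, hy⟩ := dualTendsto_powOp (hL a) (M := M) (k := a.1) (by have := hk a ha; omega)
      refine hy.exists_center ?_
      rw [limOp_apply, limDeriv_one, mul_one, add_zero, (isLin_limMul (hG a) M a.1).zero]
  have h3 : wick (covLim c d) (chainFlat ks) = constantCoeff ((chainFlat ks).foldr
      (fun a h => limOp (f a) (G a) M a.1 h) 1) := by
    rw [constantCoeff_foldr_limOp f G hG M (fun a => a.1)]
    refine wick_congr (List.pairwise_of_forall_mem_list fun a ha b hb => ?_)
    refine (constantCoeff_limDeriv_limMul _ _ (fun k l hk hl => (hc b.2).d_symm hk hl) ?_).symm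
    have := hk a ha
    have := hk b hb
    omega
  rw [h3]
  refine (h2 0).congr' ?_
  filter_upwards [eventually_ge_atTop 1] with N hN
  have hN0 : (N : ℂ) ≠ 0 := Nat.cast_ne_zero.2 (by omega)
  have h4 : ((chainFlat ks).map fun a => (N : ℂ) ^ a.1).prod ≠ 0 := by
    refine List.prod_ne_zero fun h0 => ?_
    obtain ⟨a, -, ha⟩ := List.mem_map.1 h0
    exact pow_ne_zero _ hN0 ha
  have h5 := integral_chainLaw_prod hρ hσ hc hN (M := M) ks (by omega)
    fun k s => ∫ l', powerSum k s l' ∂(chainLaw ρ σ N)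
  have h6 : (chainFlat ks).foldr (fun a h => powOp N (levelSym M ρ σ N a.2) M a.1 h -
      ((∫ l', powerSum a.1 a.2 l' ∂(chainLaw ρ σ N) : ℝ) : ℂ) • h) 1 =
      (chainFlat ks).foldr (fun a h => powOp N (levelSym M ρ σ N a.2) M a.1 h -
      constantCoeff (powOp N (levelSym M ρ σ N a.2) M a.1 1) • h) 1 := by
    refine List.foldr_ext _ _ _ fun a ha h => ?_
    rw [integral_powerSum hρ hσ hc hN (M := M) (by have := hk a ha; omega)]
  rw [h6, h1 N hN, MvPolynomial.constantCoeff_smul, smul_eq_mul] at h5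
  have h7 : ∀ l : Fin (m + 1) → Signature N, ((chainFlat ks).map fun a => (powerSum a.1 a.2 l -
      ∫ l', powerSum a.1 a.2 l' ∂(chainLaw ρ σ N)) / (N : ℝ) ^ a.1).prod =
      ((chainFlat ks).map fun a => powerSum a.1 a.2 l -
        ∫ l', powerSum a.1 a.2 l' ∂(chainLaw ρ σ N)).prod /
        ((chainFlat ks).map fun a => (N : ℝ) ^ a.1).prod := fun l => by
    generalize chainFlat ks = L
    induction L with
    | nil => simp
    | cons a L ih => simp only [List.map_cons, List.prod_cons, ih, mul_div_mul_comm]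
  simp only [h7]
  rw [integral_div, Complex.ofReal_div, h5]
  have h8 : ((((chainFlat ks).map fun a => (N : ℝ) ^ a.1).prod : ℝ) : ℂ) =
      ((chainFlat ks).map fun a => (N : ℂ) ^ a.1).prod := by
    have := map_list_prod Complex.ofRealHom ((chainFlat ks).map fun a => (N : ℝ) ^ a.1)
    rw [List.map_map] at this
    refine this.trans ?_
    simp [Function.comp_def]
  rw [h8, mul_div_cancel_left₀ _ h4]
  rfl

end SchurCLT

namespace SchurCLT

/-! ### Gaussian limits -/

/-- Convergence of moments to sums over pairings implies convergence to a Gaussian vector in the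
sense of moments. -/
theorem exists_tendstoGaussianInMoments {T : Type*} {Ω : ℕ → Type*} [∀ N, MeasurableSpace (Ω N)]
    (P : ∀ N, Measure (Ω N)) (ξ : ∀ N, T → Ω N → ℝ) (r : T → T → Prop) [DecidableRel r]
    [Std.Total r] [IsTrans T r] (K : T → T → ℂ)
    (hmem : ∀ N, 1 ≤ N → ∀ a, MemLp (ξ N a) 2 (P N))
    (H : ∀ L : List T, L.Pairwise r → Tendsto (fun N =>
      ((∫ ω, (L.map fun a => ξ N a ω).prod ∂(P N) : ℝ) : ℂ)) atTop (𝓝 (wick K L))) :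
    ∃ C : T → T → ℝ, TendstoGaussianInMoments P ξ C ∧
      (∀ a b, Tendsto (fun N => ∫ ω, ξ N a ω * ξ N b ω ∂(P N)) atTop (𝓝 (C a b))) ∧
      ∀ a b, r a b → (C a b : ℂ) = K a b := by
  have hpair : ∀ a b, r a b → Tendsto (fun N => ((∫ ω, ξ N a ω * ξ N b ω ∂(P N) : ℝ) : ℂ)) atTop
      (𝓝 (K a b)) := fun a b hab => by
    have h := H [a, b] (List.pairwise_pair.2 hab)
    simpa [wick] using h
  have hreal : ∀ a b, r a b → ((K a b).re : ℂ) = K a b := fun a b hab => by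
    have h1 := (Complex.continuous_im.tendsto _).comp (hpair a b hab)
    have h2 : (K a b).im = 0 := by
      refine tendsto_nhds_unique h1 ?_
      simp only [Function.comp_def, Complex.ofReal_im]
      exact tendsto_const_nhds
    exact Complex.ext (by simp) (by simp [h2])
  -- K is meaningful on ordered pairs only; as r is total, its real part extends to a symmetric
  -- function.
  let C : T → T → ℝ := fun a b => if r a b then (K a b).re else (K b a).re
  have hpair' : ∀ a b, r a b → Tendsto (fun N => ∫ ω, ξ N a ω * ξ N b ω ∂(P N)) atTop
      (𝓝 (K a b).re) := fun a b hab => (Complex.continuous_re.tendsto _).comp (hpair a b hab)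
  have hC : ∀ a b, Tendsto (fun N => ∫ ω, ξ N a ω * ξ N b ω ∂(P N)) atTop (𝓝 (C a b)) := by
    intro a b
    simp only [C]
    split_ifs with hab
    · exact hpair' a b hab
    · simpa only [mul_comm] using hpair' b a ((total_of r a b).resolve_left hab)
  have hCK : ∀ a b, r a b → (C a b : ℂ) = K a b := fun a b hab => by
    simp only [C, if_pos hab]
    exact hreal a b hab
  have hsymm : ∀ a b, C a b = C b a := fun a b => by
    refine tendsto_nhds_unique (hC a b) ?_
    simpa only [mul_comm] using hC b a
  refine ⟨C, fun J => ?_, hC, hCK⟩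
  -- The quadratic form of C at x is the limit of the second moments of the linear combinations with
  -- coefficients x.
  have hpsd : (Matrix.of fun a b : J => C a b).PosSemidef := by
    refine Matrix.PosSemidef.of_dotProduct_mulVec_nonneg ?_ fun x => ?_
    · ext a b
      simp [hsymm b a]
    · have h1 : Tendsto (fun N => ∑ a : J, ∑ b : J, x a * x b *
          ∫ ω, ξ N a ω * ξ N b ω ∂(P N)) atTop (𝓝 (∑ a : J, ∑ b : J, x a * x b * C a b)) :=
        tendsto_finsetSum _ fun a _ => tendsto_finsetSum _ fun b _ => (hC a b).const_mul _
      have h2 : star x ⬝ᵥ (Matrix.of fun a b : J => C a b).mulVec x =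
          ∑ a : J, ∑ b : J, x a * x b * C a b := by
        simp only [dotProduct, Matrix.mulVec, Matrix.of_apply, star_trivial, Finset.mul_sum]
        exact Finset.sum_congr rfl fun a _ => Finset.sum_congr rfl fun b _ => by ring
      rw [h2]
      refine ge_of_tendsto h1 ?_
      filter_upwards [eventually_ge_atTop 1] with N hN
      have h3 : ∑ a : J, ∑ b : J, x a * x b * ∫ ω, ξ N a ω * ξ N b ω ∂(P N) =
          ∫ ω, (∑ a : J, x a * ξ N a ω) ^ 2 ∂(P N) := by
        have h4 : ∀ ω, (∑ a : J, x a * ξ N a ω) ^ 2 =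
            ∑ a : J, ∑ b : J, x a * x b * (ξ N a ω * ξ N b ω) := fun ω => by
          rw [sq, Finset.sum_mul_sum]
          exact Finset.sum_congr rfl fun a _ => Finset.sum_congr rfl fun b _ => by ring
        have h5 : ∀ a b : J, Integrable (fun ω => x a * x b * (ξ N a ω * ξ N b ω)) (P N) :=
          fun a b => ((hmem N hN a).integrable_mul (hmem N hN b)).const_mul _
        simp only [h4]
        rw [integral_finsetSum _ fun a _ => integrable_finsetSum _ fun b _ => h5 a b]
        refine Finset.sum_congr rfl fun a _ => ?_
        rw [integral_finsetSum _ fun b _ => h5 a b]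
        exact Finset.sum_congr rfl fun b _ => (integral_const_mul _ _).symm
      rw [h3]
      exact integral_nonneg fun ω => sq_nonneg _
  obtain ⟨γ, hγ, hw⟩ := exists_gaussian_wick (C := fun a b : J => C a b) hpsd
  have hmean : ∀ a : J, ∫ y, y a ∂γ = 0 := fun a => by
    have := hw [a]
    simpa [wick] using this
  refine ⟨γ, hγ, hmean, fun a b => ?_, fun α => ?_⟩
  · rw [covariance]
    simp only [hmean, sub_zero]
    have := hw [a, b]
    simpa [wick] using this
  · let L0 : List J := (Finset.univ : Finset J).toList.flatMap fun a => List.replicate (α a) a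
    let rJ : J → J → Prop := fun a b => r a b
    have : Std.Total rJ := ⟨fun a b => total_of r a.1 b.1⟩
    have : IsTrans J rJ := ⟨fun a b c => trans_of r⟩
    -- The factors of a moment commute, so they may be sorted; the hypothesis speaks about sorted
    -- lists only.
    let L : List J := L0.insertionSort rJ
    have hL : L.Pairwise rJ := List.pairwise_insertionSort rJ L0
    have hprod : ∀ f : J → ℝ, ∏ a, f a ^ α a = (L.map f).prod := fun f => by
      rw [((List.perm_insertionSort rJ L0).map f).prod_eq, List.map_flatMap, List.flatMap,
        List.prod_flatten, List.map_map]
      simp only [Function.comp_def, List.map_replicate, List.prod_replicate]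
      exact (Finset.prod_map_toList _ _).symm
    simp only [hprod]
    rw [hw]
    have h1 := H (L.map Subtype.val) (List.pairwise_map.2 hL)
    have h2 : wick K (L.map Subtype.val) = ((wick (fun a b : J => C a b) L : ℝ) : ℂ) := by
      rw [wick_map, ← Complex.ofRealHom_eq_coe, map_wick]
      exact (wick_congr (hL.imp fun hab => hCK _ _ hab)).symm
    rw [h2] at h1
    have h3 := (Complex.continuous_re.tendsto _).comp h1
    simpa only [Function.comp_def, Complex.ofReal_re, List.map_map] using h3

theorem chainFlat_update : ∀ {n : ℕ} (ks : Fin n → List ℕ) (k : ℕ) (s : Fin n),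
    (∀ t < s, ks t = []) → chainFlat (Function.update ks s (k :: ks s)) = (k, s) :: chainFlat ks
  | 0, _, _, s, _ => s.elim0
  | n + 1, ks, k, s, h => by
    rw [chainFlat_succ, chainFlat_succ ks]
    induction s using Fin.cases with
    | zero => simp [Fin.succ_ne_zero]
    | succ s =>
      have h1 := chainFlat_update (fun t => ks t.succ) k s fun t ht => h t.succ
        (Fin.succ_lt_succ_iff.2 ht)
      have h2 : (fun t : Fin n => Function.update ks s.succ (k :: ks s.succ) t.succ) =
          Function.update (fun t => ks t.succ) s (k :: ks s.succ) := by
        funext t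
        by_cases ht : t = s
        · subst ht; simp
        · rw [Function.update_of_ne ht, Function.update_of_ne (fun h' => ht (Fin.succ_injective _ h'))]
      rw [h2, h1, Function.update_of_ne (Fin.succ_ne_zero s).symm, h 0 (Fin.succ_pos s)]
      simp

/-- The lists sorted by level are those obtained by concatenating the levels, that is, the ones
accessible to the operator calculus. -/
theorem exists_chainFlat_eq {n : ℕ} (L : List (ℕ × Fin n)) (hL : L.Pairwise fun a b => a.2 ≤ b.2) :
    ∃ ks, chainFlat ks = L := by
  induction L with
  | nil => exact ⟨fun _ => [], by simp [chainFlat]⟩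
  | cons a L ih =>
    rw [List.pairwise_cons] at hL
    obtain ⟨ks, hks⟩ := ih hL.2
    refine ⟨Function.update ks a.2 (a.1 :: ks a.2), ?_⟩
    rw [chainFlat_update ks a.1 a.2, hks]
    intro t ht
    rw [List.eq_nil_iff_forall_not_mem]
    intro k hk
    have : (k, t) ∈ L := by
      rw [← hks, chainFlat, List.mem_flatten]
      exact ⟨_, List.mem_ofFn.2 ⟨t, rfl⟩, List.mem_map_of_mem hk⟩
    exact absurd (hL.1 _ this) (not_le.2 ht)

variable {m : ℕ} {ρ : ∀ N : ℕ, PMF (Signature N)} {σ : Fin m → ∀ N : ℕ, PMF (Signature N)}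

theorem memLp_fluctuation (hρ : IsAppropriate ρ) (hσ : ∀ r, IsAppropriate (σ r)) {N : ℕ}
    (hN : 1 ≤ N) (a : ℕ+ × Fin (m + 1)) :
    MemLp (fluctuation (chainLaw ρ σ N) a) 2 (chainLaw ρ σ N) := by
  have : IsProbabilityMeasure (chainLaw ρ σ N) :=
    isProbabilityMeasure_chainMeasure (hρ.expSummable hN) fun r => (hσ r).expSummable hN
  have h1 : MemLp (powerSum a.1 a.2) 2 (chainLaw ρ σ N) := by
    have h := memLp_powerSum (ρ := ρ N) (σ := fun r => σ r N) (hρ.expSummable hN)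
      (fun r => (hσ r).expSummable hN) a.1 a.2 2
    rwa [Nat.cast_ofNat] at h
  have h2 := (h1.sub (memLp_const (∫ l', powerSum a.1 a.2 l' ∂(chainLaw ρ σ N)))).const_mul
    ((N : ℝ) ^ (a.1 : ℕ))⁻¹
  refine h2.ae_eq (Eventually.of_forall fun l => ?_)
  simp only [fluctuation, Pi.sub_apply]
  rw [div_eq_inv_mul]

/-- The central limit theorem, with the covariance in terms of Laurent coefficients. -/
theorem exists_tendstoGaussian_fluctuation (hρ : IsAppropriate ρ) (hσ : ∀ r, IsAppropriate (σ r))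
    {c : Fin (m + 1) → ℕ → ℝ} {d : Fin (m + 1) → ℕ → ℕ → ℝ}
    (hc : ∀ s, IsAppropriateWith (levelGF ρ σ s) (c s) (d s)) :
    ∃ C : ℕ+ × Fin (m + 1) → ℕ+ × Fin (m + 1) → ℝ,
      TendstoGaussianInMoments (chainLaw ρ σ) (fun N => fluctuation (chainLaw ρ σ N)) C ∧
      (∀ (k₁ k₂ : ℕ+) (s₁ s₂ : Fin (m + 1)), Tendsto (fun N : ℕ =>
        cov[powerSum k₁ s₁, powerSum k₂ s₂; chainLaw ρ σ N] / (N : ℝ) ^ ((k₁ : ℕ) + (k₂ : ℕ)))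
          atTop (𝓝 (C (k₁, s₁) (k₂, s₂)))) ∧
      ∀ (k₁ k₂ : ℕ+) (s₁ s₂ : Fin (m + 1)), s₁ ≤ s₂ → (C (k₁, s₁) (k₂, s₂) : ℂ) =
        covCoeff (c s₁) (c s₂) (d s₂) k₁ k₂ := by
  let r : ℕ+ × Fin (m + 1) → ℕ+ × Fin (m + 1) → Prop := fun a b => a.2 ≤ b.2
  have : Std.Total r := ⟨fun a b => le_total a.2 b.2⟩
  have : IsTrans _ r := ⟨fun a b c => le_trans⟩
  let φ : ℕ+ × Fin (m + 1) → ℕ × Fin (m + 1) := fun a => (a.1, a.2)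
  obtain ⟨C, h1, h2, h3⟩ := exists_tendstoGaussianInMoments (chainLaw ρ σ)
    (fun N => fluctuation (chainLaw ρ σ N)) r (fun a b => covLim c d (φ a) (φ b))
    (fun N hN a => memLp_fluctuation hρ hσ hN a) fun L hL => by
      obtain ⟨ks, hks⟩ := exists_chainFlat_eq (L.map φ) (List.pairwise_map.2 hL)
      have h := tendsto_integral_prod hρ hσ hc ks
      rw [hks, wick_map] at h
      simp only [List.map_map] at h
      exact h
  refine ⟨C, h1, fun k₁ k₂ s₁ s₂ => ?_, fun k₁ k₂ s₁ s₂ hs => h3 (k₁, s₁) (k₂, s₂) hs⟩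
  refine (h2 (k₁, s₁) (k₂, s₂)).congr fun N => ?_
  rw [covariance, ← integral_div]
  refine integral_congr_ae (Eventually.of_forall fun l => ?_)
  simp only [fluctuation]
  rw [div_mul_div_comm, pow_add]

end SchurCLT

namespace SchurCLT

/-! ### Double contour integrals of Laurent series -/

theorem hasSum_circleIntegral {ι : Type*} [Countable ι] {R : ℝ} (hR : 0 ≤ R) {f : ι → ℂ → ℂ}
    {g : ℂ → ℂ} {B : ι → ℝ} (hf : ∀ i, ContinuousOn (f i) (Metric.sphere 0 R))
    (hB : ∀ i, ∀ z ∈ Metric.sphere (0 : ℂ) R, ‖f i z‖ ≤ B i) (hs : Summable B)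
    (hg : ∀ z ∈ Metric.sphere (0 : ℂ) R, HasSum (fun i => f i z) (g z)) :
    HasSum (fun i => ∮ z in C(0, R), f i z) (∮ z in C(0, R), g z) := by
  have hmem : ∀ θ, circleMap 0 R θ ∈ Metric.sphere (0 : ℂ) R := circleMap_mem_sphere _ hR
  refine intervalIntegral.hasSum_integral_of_dominated_convergence (fun i _ => R * B i)
    (fun i => ?_) (fun i => ?_) ?_ ?_ ?_
  · refine Continuous.aestronglyMeasurable ?_
    simp only [deriv_circleMap]
    exact ((continuous_circleMap 0 R).mul continuous_const).smul
      ((hf i).comp_continuous (continuous_circleMap 0 R) hmem)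
  · refine Eventually.of_forall fun θ _ => ?_
    rw [norm_smul, deriv_circleMap, norm_mul, norm_circleMap_zero, Complex.norm_I, mul_one,
      abs_of_nonneg hR]
    exact mul_le_mul_of_nonneg_left (hB i _ (hmem θ)) hR
  · exact Eventually.of_forall fun _ _ => hs.mul_left R
  · exact intervalIntegrable_const
  · exact Eventually.of_forall fun θ _ => (hg _ (hmem θ)).const_smul _

theorem circleIntegral_zpow {R : ℝ} (hR : 0 < R) (n : ℤ) :
    (∮ z in C(0, R), z ^ n) = if n = -1 then 2 * Real.pi * Complex.I else 0 := by
  split_ifs with h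
  · subst h
    simpa using circleIntegral.integral_sub_center_inv (0 : ℂ) hR.ne'
  · simpa using circleIntegral.integral_sub_zpow_of_ne h (0 : ℂ) 0 R

/-- The double contour integral of an absolutely convergent double Laurent series. -/
theorem hasSum_double_circleIntegral {ι : Type*} [Countable ι] {R S : ℝ} (hR : 0 < R) (hS : 0 < S)
    {a : ι → ℂ} {m n : ι → ℤ} {h : ℂ → ℂ → ℂ}
    (hs : Summable fun i => ‖a i‖ * R ^ m i * S ^ n i)
    (hh : ∀ z ∈ Metric.sphere (0 : ℂ) R, ∀ w ∈ Metric.sphere (0 : ℂ) S,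
      HasSum (fun i => a i * z ^ m i * w ^ n i) (h z w)) :
    HasSum (fun i => if m i = -1 ∧ n i = -1 then a i else 0)
      (1 / (2 * Real.pi * Complex.I) ^ 2 * ∮ z in C(0, R), ∮ w in C(0, S), h z w) := by
  have hz : ∀ {T : ℝ}, 0 < T → ∀ z ∈ Metric.sphere (0 : ℂ) T, z ≠ 0 ∧ ‖z‖ = T :=
    fun hT z hz => by
      rw [mem_sphere_zero_iff_norm] at hz
      exact ⟨fun h => by rw [h, norm_zero] at hz; exact hT.ne hz, hz⟩
  have hc : ∀ {T : ℝ}, 0 < T → ∀ k : ℤ, ContinuousOn (fun z : ℂ => z ^ k) (Metric.sphere 0 T) :=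
    fun hT k z hz' => (continuousAt_zpow₀ z k (Or.inl (hz hT z hz').1)).continuousWithinAt
  have hpi : (2 * Real.pi * Complex.I : ℂ) ≠ 0 := Complex.two_pi_I_ne_zero
  have h1 : ∀ z ∈ Metric.sphere (0 : ℂ) R, HasSum (fun i => a i * z ^ m i *
      if n i = -1 then 2 * Real.pi * Complex.I else 0) (∮ w in C(0, S), h z w) := by
    intro z hz'
    have h2 := hasSum_circleIntegral hS.le (f := fun i w => a i * z ^ m i * w ^ n i)
      (fun i => continuousOn_const.mul (hc hS (n i))) (B := fun i => ‖a i‖ * R ^ m i * S ^ n i)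
      (fun i w hw => by
        rw [norm_mul, norm_mul, norm_zpow, norm_zpow, (hz hR z hz').2, (hz hS w hw).2]) hs
      (fun w hw => hh z hz' w hw)
    refine h2.congr_fun ?_ 
    intro i
    rw [circleIntegral.integral_const_mul, circleIntegral_zpow hS]
  have h3 := hasSum_circleIntegral hR.le (f := fun i z => a i * z ^ m i *
      if n i = -1 then 2 * Real.pi * Complex.I else 0)
    (fun i => (continuousOn_const.mul (hc hR (m i))).mul continuousOn_const)
    (B := fun i => ‖a i‖ * R ^ m i * S ^ n i * (2 * Real.pi * S)) (fun i z hz' => by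
      rw [norm_mul, norm_mul, norm_zpow, (hz hR z hz').2, mul_assoc _ (S ^ n i)]
      refine mul_le_mul_of_nonneg_left ?_ (by positivity)
      split_ifs with hn
      · rw [hn, zpow_neg_one, norm_mul, norm_mul, Complex.norm_I, mul_one, Complex.norm_real,
          Complex.norm_two, Real.norm_of_nonneg Real.pi_pos.le]
        field_simp
        exact le_rfl
      · rw [norm_zero]
        positivity) (hs.mul_right _) h1
  have h4 := h3.mul_left (1 / (2 * Real.pi * Complex.I : ℂ) ^ 2)
  refine h4.congr_fun fun i => ?_
  have h5 : (∮ z in C(0, R), a i * z ^ m i * if n i = -1 then 2 * Real.pi * Complex.I else 0) =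
      a i * (if m i = -1 then 2 * Real.pi * Complex.I else 0) *
        if n i = -1 then 2 * Real.pi * Complex.I else 0 := by
    have : ∀ z : ℂ, (a i * z ^ m i * if n i = -1 then 2 * Real.pi * Complex.I else 0) =
        (a i * if n i = -1 then 2 * Real.pi * Complex.I else 0) * z ^ m i := fun z => by ring
    simp only [this]
    rw [circleIntegral.integral_const_mul, circleIntegral_zpow hR]
    ring
  rw [h5]
  by_cases hm : m i = -1 <;> by_cases hn : n i = -1
  · simp only [hm, hn, and_self, if_true]
    field_simp
  · simp [hn]
  · simp [hm]
  · simp [hm]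

/-! ### Absolutely convergent power series -/

/-- Absolute convergence of a power series at radius `r`. -/
def AbsConv (r : ℝ) (f : PowerSeries ℂ) : Prop := Summable fun n => ‖PowerSeries.coeff n f‖ * r ^ n

namespace AbsConv

variable {r : ℝ} {f g : PowerSeries ℂ} {z : ℂ}

theorem summable_norm (hf : AbsConv r f) (hz : ‖z‖ ≤ r) :
    Summable fun n => ‖PowerSeries.coeff n f * z ^ n‖ := by
  refine Summable.of_nonneg_of_le (fun n => norm_nonneg _) (fun n => ?_) hf
  rw [norm_mul, norm_pow]
  gcongr

theorem of_complex (hr : 0 ≤ r) (h : Summable fun n => ‖PowerSeries.coeff n f * (r : ℂ) ^ n‖) :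
    AbsConv r f := by
  refine h.congr fun n => ?_
  rw [norm_mul, norm_pow, Complex.norm_real, Real.norm_of_nonneg hr]

theorem mul (hr : 0 ≤ r) (hf : AbsConv r f) (hg : AbsConv r g) : AbsConv r (f * g) ∧
    ∀ z : ℂ, ‖z‖ ≤ r → ∑' n, PowerSeries.coeff n (f * g) * z ^ n =
      (∑' n, PowerSeries.coeff n f * z ^ n) * ∑' n, PowerSeries.coeff n g * z ^ n := by
  have h1 : ∀ (z : ℂ) n, PowerSeries.coeff n (f * g) * z ^ n =
      ∑ p ∈ Finset.HasAntidiagonal.antidiagonal n,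
        PowerSeries.coeff p.1 f * z ^ p.1 * (PowerSeries.coeff p.2 g * z ^ p.2) := fun z n => by
    rw [PowerSeries.coeff_mul, Finset.sum_mul]
    refine Finset.sum_congr rfl fun p hp => ?_
    rw [← Finset.HasAntidiagonal.mem_antidiagonal.1 hp, pow_add]
    ring
  have hrr : ‖(r : ℂ)‖ ≤ r := by rw [Complex.norm_real, Real.norm_of_nonneg hr]
  refine ⟨of_complex hr ?_, fun z hz => ?_⟩
  · simp only [h1]
    exact summable_norm_sum_mul_antidiagonal_of_summable_norm
      (f := fun n => PowerSeries.coeff n f * (r : ℂ) ^ n)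
      (g := fun n => PowerSeries.coeff n g * (r : ℂ) ^ n) (hf.summable_norm hrr)
      (hg.summable_norm hrr)
  · simp only [h1]
    exact (tsum_mul_tsum_eq_tsum_sum_antidiagonal_of_summable_norm
      (f := fun n => PowerSeries.coeff n f * z ^ n)
      (g := fun n => PowerSeries.coeff n g * z ^ n) (hf.summable_norm hz)
      (hg.summable_norm hz)).symm

theorem add (hf : AbsConv r f) (hr : 0 ≤ r) (hg : AbsConv r g) : AbsConv r (f + g) ∧
    ∀ z : ℂ, ‖z‖ ≤ r → ∑' n, PowerSeries.coeff n (f + g) * z ^ n =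
      (∑' n, PowerSeries.coeff n f * z ^ n) + ∑' n, PowerSeries.coeff n g * z ^ n := by
  refine ⟨Summable.of_nonneg_of_le (fun n => by positivity) (fun n => ?_) (Summable.add hf hg),
    fun z hz => ?_⟩
  · rw [map_add, ← add_mul]
    gcongr
    exact norm_add_le _ _
  · rw [← (hf.summable_norm hz).of_norm.tsum_add (hg.summable_norm hz).of_norm]
    simp only [map_add, add_mul]

theorem one : AbsConv r 1 ∧ ∀ z : ℂ, ∑' n, PowerSeries.coeff n (1 : PowerSeries ℂ) * z ^ n = 1 := by
  refine ⟨summable_of_ne_finset_zero (s := {0}) fun n hn => ?_, fun z => ?_⟩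
  · rw [PowerSeries.coeff_one, if_neg (by simpa using hn)]
    simp
  · rw [tsum_eq_single 0 fun n hn => by rw [PowerSeries.coeff_one, if_neg hn, zero_mul]]
    simp

theorem X : AbsConv r PowerSeries.X ∧
    ∀ z : ℂ, ∑' n, PowerSeries.coeff n (PowerSeries.X : PowerSeries ℂ) * z ^ n = z := by
  refine ⟨summable_of_ne_finset_zero (s := {1}) fun n hn => ?_, fun z => ?_⟩
  · rw [PowerSeries.coeff_X, if_neg (by simpa using hn)]
    simp
  · rw [tsum_eq_single 1 fun n hn => by rw [PowerSeries.coeff_X, if_neg hn, zero_mul]]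
    simp

theorem pow (hr : 0 ≤ r) (hf : AbsConv r f) (k : ℕ) : AbsConv r (f ^ k) ∧
    ∀ z : ℂ, ‖z‖ ≤ r → ∑' n, PowerSeries.coeff n (f ^ k) * z ^ n =
      (∑' n, PowerSeries.coeff n f * z ^ n) ^ k := by
  induction k with
  | zero => exact ⟨by simpa using one.1, fun z _ => by simp⟩
  | succ k ih =>
    rw [pow_succ]
    refine ⟨(mul hr ih.1 hf).1, fun z hz => ?_⟩
    rw [(mul hr ih.1 hf).2 z hz, ih.2 z hz, pow_succ]

theorem wickSeries (hr : 0 ≤ r) (hf : AbsConv r f) (k : ℕ) : AbsConv r (wickSeries f k) ∧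
    ∀ z : ℂ, ‖z‖ ≤ r → ∑' n, PowerSeries.coeff n (SchurCLT.wickSeries f k) * z ^ n =
      ((1 + z) * (1 + z * ∑' n, PowerSeries.coeff n f * z ^ n)) ^ k := by
  have h1 := add (r := r) one.1 hr X.1
  have h2 := mul hr X.1 hf
  have h3 := add one.1 hr h2.1
  have h4 := mul hr h1.1 h3.1
  have h5 := pow hr h4.1 k
  refine ⟨h5.1, fun z hz => ?_⟩
  rw [SchurCLT.wickSeries, h5.2 z hz, h4.2 z hz, h1.2 z hz, h3.2 z hz, h2.2 z hz, (one (r := r)).2,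
    (X (r := r)).2]

end AbsConv

/-- The derivative of the geometric series in z/w. The choice |z| = ε < |w| = 2ε of the contours
enters here. -/
theorem hasSum_inv_sub_sq {z w : ℂ} (hzw : ‖z‖ < ‖w‖) :
    HasSum (fun j : ℕ => ((j : ℂ) + 1) * z ^ (j : ℤ) * w ^ (-(j : ℤ) - 2)) (1 / (z - w) ^ 2) := by
  have hw : w ≠ 0 := norm_pos_iff.1 ((norm_nonneg z).trans_lt hzw)
  have h1 : ‖z / w‖ < 1 := by
    rw [norm_div]
    exact (div_lt_one (norm_pos_iff.2 hw)).2 hzw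
  have h2 := (hasSum_choose_mul_geometric_of_norm_lt_one 1 h1).mul_left ((w ^ 2)⁻¹)
  have h3 : (w ^ 2)⁻¹ * (1 / (1 - z / w) ^ (1 + 1)) = 1 / (z - w) ^ 2 := by
    have h4 : z - w ≠ 0 := fun h => by rw [sub_eq_zero.1 h] at hzw; exact lt_irrefl _ hzw
    have h5 : w - z ≠ 0 := fun h => h4 (by rw [← neg_sub, h, neg_zero])
    have h6 : 1 - z / w = (w - z) / w := by field_simp
    rw [h6, div_pow, show (z - w) ^ 2 = (w - z) ^ 2 by ring]
    field_simp
    ring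
  rw [h3] at h2
  refine h2.congr_fun fun j => ?_
  rw [Nat.choose_one_right, div_pow, zpow_natCast, zpow_sub₀ hw, zpow_neg, zpow_natCast]
  have := zpow_ne_zero 2 hw
  push_cast
  field_simp

end SchurCLT

namespace SchurCLT

/-! ### The covariance as a double contour integral -/

theorem limitF_eq (c : ℕ → ℝ) (z : ℂ) :
    limitF c (1 + z) = ∑' n, PowerSeries.coeff n (fullF c) * z ^ n := by
  simp only [limitF, fullF, PowerSeries.coeff_mk, add_sub_cancel_left]

theorem hasSum_sumElim {α β : Type*} {f : α → ℂ} {g : β → ℂ} {a b : ℂ}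
    (hf : Summable fun i => ‖f i‖) (hg : Summable fun i => ‖g i‖) (ha : HasSum f a)
    (hb : HasSum g b) :
    (Summable fun i => ‖Sum.elim f g i‖) ∧ HasSum (Sum.elim f g) (a + b) :=
  ⟨(HasSum.sum (f := fun i => ‖Sum.elim f g i‖) hf.hasSum hg.hasSum).summable,
    HasSum.sum (f := Sum.elim f g) ha hb⟩

theorem hasSum_mul_mul {α β γ : Type*} {f : α → ℂ} {g : β → ℂ} {h : γ → ℂ} {a b c : ℂ}
    (hf : Summable fun i => ‖f i‖) (hg : Summable fun i => ‖g i‖) (hh : Summable fun i => ‖h i‖)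
    (ha : HasSum f a) (hb : HasSum g b) (hc : HasSum h c) :
    (Summable fun i : (α × β) × γ => ‖f i.1.1 * g i.1.2 * h i.2‖) ∧
      HasSum (fun i : (α × β) × γ => f i.1.1 * g i.1.2 * h i.2) (a * b * c) := by
  have h1 := ha.mul hb (summable_mul_of_summable_norm hf hg)
  have h2 : Summable fun i : α × β => ‖f i.1 * g i.2‖ := hf.mul_norm hg
  have h3 := Summable.mul_norm (f := fun i : α × β => f i.1 * g i.2) h2 hh
  exact ⟨h3, HasSum.mul (f := fun i : α × β => f i.1 * g i.2) h1 hc h3.of_norm⟩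

/-- The index set of the Laurent expansion of the covariance integrand. -/
abbrev CovIndex : Type := (ℕ × ℕ) × ((ℕ × ℕ) ⊕ ℕ)

/-- Taylor coefficients of `G(1 + z, 1 + w)`. -/
noncomputable def gCoeff (d : ℕ → ℕ → ℝ) (q : ℕ × ℕ) : ℂ :=
  (d (q.1 + 1) (q.2 + 1) : ℂ) / ((q.1.factorial : ℂ) * (q.2.factorial : ℂ))

/-- The coefficient of a monomial of the covariance integrand. -/
noncomputable def covLaurent (p₁ p₂ : PowerSeries ℂ) (d : ℕ → ℕ → ℝ) (i : CovIndex) : ℂ :=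
  PowerSeries.coeff i.1.1 p₁ * PowerSeries.coeff i.1.2 p₂ *
    Sum.elim (gCoeff d) (fun j : ℕ => (j : ℂ) + 1) i.2

/-- The exponent of `z` in a monomial of the covariance integrand. -/
def covExpFst (k : ℕ) (i : CovIndex) : ℤ :=
  (i.1.1 : ℤ) - k + Sum.elim (fun q : ℕ × ℕ => (q.1 : ℤ)) (fun j : ℕ => (j : ℤ)) i.2

/-- The exponent of `w` in a monomial of the covariance integrand. -/
def covExpSnd (k : ℕ) (i : CovIndex) : ℤ :=
  (i.1.2 : ℤ) - k + Sum.elim (fun q : ℕ × ℕ => (q.2 : ℤ)) (fun j : ℕ => -(j : ℤ) - 2) i.2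

theorem covLaurent_mul_zpow (p₁ p₂ : PowerSeries ℂ) (d : ℕ → ℕ → ℝ) (k₁ k₂ : ℕ) {z w : ℂ}
    (hz : z ≠ 0) (hw : w ≠ 0) (i : CovIndex) :
    covLaurent p₁ p₂ d i * z ^ covExpFst k₁ i * w ^ covExpSnd k₂ i =
      PowerSeries.coeff i.1.1 p₁ * z ^ i.1.1 * (PowerSeries.coeff i.1.2 p₂ * w ^ i.1.2) *
        Sum.elim (fun q : ℕ × ℕ => gCoeff d q * z ^ q.1 * w ^ q.2)
          (fun j : ℕ => ((j : ℂ) + 1) * z ^ (j : ℤ) * w ^ (-(j : ℤ) - 2)) i.2 *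
        (z ^ (-(k₁ : ℤ)) * w ^ (-(k₂ : ℤ))) := by
  obtain ⟨⟨n₁, n₂⟩, q | j⟩ := i
  · simp only [covLaurent, covExpFst, covExpSnd, Sum.elim_inl, sub_eq_add_neg, zpow_add₀ hz,
      zpow_add₀ hw, zpow_natCast]
    ring
  · simp only [covLaurent, covExpFst, covExpSnd, Sum.elim_inr, sub_eq_add_neg, zpow_add₀ hz,
      zpow_add₀ hw, zpow_natCast]
    ring

theorem summable_norm_gCoeff {d : ℕ → ℕ → ℝ} {r : ℝ} (hr : 0 ≤ r)
    (hd : Summable fun q : ℕ × ℕ => gCoeff d q * (r : ℂ) ^ q.1 * (r : ℂ) ^ q.2) {z w : ℂ}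
    (hz : ‖z‖ ≤ r) (hw : ‖w‖ ≤ r) :
    Summable fun q : ℕ × ℕ => ‖gCoeff d q * z ^ q.1 * w ^ q.2‖ := by
  refine Summable.of_nonneg_of_le (fun q => norm_nonneg _) (fun q => ?_) hd.norm
  rw [norm_mul, norm_mul, norm_mul, norm_mul, norm_pow, norm_pow, norm_pow, norm_pow,
    Complex.norm_real, Real.norm_of_nonneg hr]
  gcongr

/-- Each base equals (1 + u)(1 + u F)/u, so the integrand is a product of three absolutely
convergent series times z^(−k₁) w^(−k₂). The index set has the two alternatives for the summands of
Q. -/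
theorem hasSum_covIntegrand {c₁ c₂ : ℕ → ℝ} {d : ℕ → ℕ → ℝ} {r : ℝ} (hr : 0 ≤ r)
    (h₁ : AbsConv r (fullF c₁)) (h₂ : AbsConv r (fullF c₂))
    (hd : Summable fun q : ℕ × ℕ => gCoeff d q * (r : ℂ) ^ q.1 * (r : ℂ) ^ q.2)
    (k₁ k₂ : ℕ) {z w : ℂ} (hz0 : z ≠ 0) (hzw : ‖z‖ < ‖w‖) (hw : ‖w‖ ≤ r) :
    (Summable fun i => ‖covLaurent (wickSeries (fullF c₁) k₁) (wickSeries (fullF c₂) k₂) d i *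
      z ^ covExpFst k₁ i * w ^ covExpSnd k₂ i‖) ∧
    HasSum (fun i => covLaurent (wickSeries (fullF c₁) k₁) (wickSeries (fullF c₂) k₂) d i *
      z ^ covExpFst k₁ i * w ^ covExpSnd k₂ i)
      ((1 / z + 1 + (1 + z) * limitF c₁ (1 + z)) ^ k₁ *
        (1 / w + 1 + (1 + w) * limitF c₂ (1 + w)) ^ k₂ * limitQ d z w) := by
  have hw0 : w ≠ 0 := norm_pos_iff.1 ((norm_nonneg z).trans_lt hzw)
  have hz : ‖z‖ ≤ r := hzw.le.trans hw
  obtain ⟨hp₁, hv₁⟩ := h₁.wickSeries hr k₁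
  obtain ⟨hp₂, hv₂⟩ := h₂.wickSeries hr k₂
  have hs₁ := hp₁.summable_norm hz
  have hs₂ := hp₂.summable_norm hw
  have hsD := summable_norm_gCoeff hr hd hz hw
  have hpole := hasSum_inv_sub_sq hzw
  obtain ⟨hsT, hT⟩ := hasSum_sumElim hsD hpole.summable.norm hsD.of_norm.hasSum hpole
  obtain ⟨hsA, hA⟩ := hasSum_mul_mul hs₁ hs₂ hsT hs₁.of_norm.hasSum hs₂.of_norm.hasSum hT
  have hfac : ∀ {u : ℂ}, u ≠ 0 → ∀ (F : ℂ) (k : ℕ), (1 / u + 1 + (1 + u) * F) ^ k =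
      ((1 + u) * (1 + u * F)) ^ k * u ^ (-(k : ℤ)) := by
    intro u hu F k
    rw [zpow_neg, zpow_natCast, ← inv_pow, ← mul_pow]
    congr 1
    field_simp
  have hG : limitQ d z w = (∑' q, gCoeff d q * z ^ q.1 * w ^ q.2) + 1 / (z - w) ^ 2 := by
    simp only [limitQ, limitG, add_sub_cancel_left, gCoeff]
  have hval : (1 / z + 1 + (1 + z) * limitF c₁ (1 + z)) ^ k₁ *
      (1 / w + 1 + (1 + w) * limitF c₂ (1 + w)) ^ k₂ * limitQ d z w =
      (∑' n, PowerSeries.coeff n (wickSeries (fullF c₁) k₁) * z ^ n) *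
        (∑' n, PowerSeries.coeff n (wickSeries (fullF c₂) k₂) * w ^ n) *
        ((∑' q, gCoeff d q * z ^ q.1 * w ^ q.2) + 1 / (z - w) ^ 2) *
        (z ^ (-(k₁ : ℤ)) * w ^ (-(k₂ : ℤ))) := by
    rw [hfac hz0, hfac hw0, limitF_eq, limitF_eq, ← hv₁ z hz, ← hv₂ w hw, hG]
    ring
  rw [hval]
  simp only [covLaurent_mul_zpow _ _ d k₁ k₂ hz0 hw0]
  refine ⟨?_, hA.mul_right _⟩
  simp only [norm_mul _ (z ^ (-(k₁ : ℤ)) * w ^ (-(k₂ : ℤ)))]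
  exact hsA.mul_right _

/-- Both exponents being −1 determines the power series indices from the index of the Q-term: k₁ − 1
− q₁ and k₂ − 1 − q₂ for a term of G, k₁ − 1 − j and k₂ + 1 + j for a term of the double pole.
Nonnegativity leaves finitely many, which are the summands of `covCoeff`. -/
theorem hasSum_covCoeff (c₁ c₂ : ℕ → ℝ) (d : ℕ → ℕ → ℝ) (k₁ k₂ : ℕ) :
    HasSum (fun i => if covExpFst k₁ i = -1 ∧ covExpSnd k₂ i = -1 then
      covLaurent (wickSeries (fullF c₁) k₁) (wickSeries (fullF c₂) k₂) d i else 0)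
      (covCoeff c₁ c₂ d k₁ k₂) := by
  let e : (ℕ × ℕ) ⊕ ℕ → CovIndex := fun t =>
    (Sum.elim (fun q : ℕ × ℕ => (k₁ - 1 - q.1, k₂ - 1 - q.2))
      (fun j : ℕ => (k₁ - 1 - j, k₂ + 1 + j)) t, t)
  have he : Function.Injective e := fun s t h => congrArg Prod.snd h
  let S : Finset ((ℕ × ℕ) ⊕ ℕ) :=
    (Finset.range k₁ ×ˢ Finset.range k₂).disjSum (Finset.range k₁)
  have hfin : HasSum (fun i => if covExpFst k₁ i = -1 ∧ covExpSnd k₂ i = -1 then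
      covLaurent (wickSeries (fullF c₁) k₁) (wickSeries (fullF c₂) k₂) d i else 0) _ :=
    hasSum_sum_of_ne_finset_zero (s := S.image e) (by
      rintro ⟨⟨n₁, n₂⟩, q | j⟩ hi
      · refine if_neg fun h => hi (Finset.mem_image.2 ⟨Sum.inl q, ?_, ?_⟩)
        · simp only [covExpFst, covExpSnd, Sum.elim_inl] at h
          simp only [S, Finset.inl_mem_disjSum, Finset.mem_product, Finset.mem_range]
          omega
        · simp only [covExpFst, covExpSnd, Sum.elim_inl] at h
          simp only [e, Sum.elim_inl, Prod.mk.injEq, and_true]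
          omega
      · refine if_neg fun h => hi (Finset.mem_image.2 ⟨Sum.inr j, ?_, ?_⟩)
        · simp only [covExpFst, covExpSnd, Sum.elim_inr] at h
          simp only [S, Finset.inr_mem_disjSum, Finset.mem_range]
          omega
        · simp only [covExpFst, covExpSnd, Sum.elim_inr] at h
          simp only [e, Sum.elim_inr, Prod.mk.injEq, and_true]
          omega)
  convert! hfin using 1
  rw [Finset.sum_image fun _ _ _ _ h => he h, Finset.sum_disjSum, Finset.sum_product, covCoeff,
    ← Finset.sum_add_distrib]
  refine Finset.sum_congr rfl fun j hj => ?_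
  rw [Finset.mem_range] at hj
  rw [mul_add, Finset.mul_sum, add_comm]
  congr 1
  · refine Finset.sum_congr rfl fun i hi => ?_
    rw [Finset.mem_range] at hi
    rw [if_pos]
    · simp only [covLaurent, gCoeff, e, Sum.elim_inl]
      ring
    · simp only [covExpFst, covExpSnd, e, Sum.elim_inl]
      omega
  · rw [if_pos]
    · simp only [covLaurent, e, Sum.elim_inr]
      ring
    · simp only [covExpFst, covExpSnd, e, Sum.elim_inr]
      omega

theorem covCoeff_eq_contourCov {c₁ c₂ : ℕ → ℝ} {d : ℕ → ℕ → ℝ} {ε : ℝ} (hε : 0 < ε)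
    (h₁ : AbsConv (2 * ε) (fullF c₁)) (h₂ : AbsConv (2 * ε) (fullF c₂))
    (hd : Summable fun q : ℕ × ℕ =>
      gCoeff d q * ((2 * ε : ℝ) : ℂ) ^ q.1 * ((2 * ε : ℝ) : ℂ) ^ q.2) (k₁ k₂ : ℕ) :
    covCoeff c₁ c₂ d k₁ k₂ = contourCov (limitF c₁) (limitF c₂) (limitQ d) k₁ k₂ ε := by
  have hε2 : 0 < 2 * ε := by positivity
  have key := fun (z : ℂ) (hz : ‖z‖ = ε) (w : ℂ) (hw : ‖w‖ = 2 * ε) =>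
    hasSum_covIntegrand hε2.le h₁ h₂ hd k₁ k₂ (norm_pos_iff.1 (hz ▸ hε))
      (by rw [hz, hw]; linarith : ‖z‖ < ‖w‖) hw.le
  have hs : Summable fun i =>
      ‖covLaurent (wickSeries (fullF c₁) k₁) (wickSeries (fullF c₂) k₂) d i‖ *
        ε ^ covExpFst k₁ i * (2 * ε) ^ covExpSnd k₂ i := by
    have h3 := (key ε (by rw [Complex.norm_real, Real.norm_of_nonneg hε.le]) ((2 * ε : ℝ) : ℂ)
      (by rw [Complex.norm_real, Real.norm_of_nonneg hε2.le])).1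
    refine h3.congr fun i => ?_
    rw [norm_mul, norm_mul, norm_zpow, norm_zpow, Complex.norm_real, Complex.norm_real,
      Real.norm_of_nonneg hε.le, Real.norm_of_nonneg hε2.le]
  exact (hasSum_covCoeff c₁ c₂ d k₁ k₂).unique (hasSum_double_circleIntegral hε hε2 hs
    fun z hz w hw => (key z (mem_sphere_zero_iff_norm.1 hz) w (mem_sphere_zero_iff_norm.1 hw)).2)

/-- Convergence at the single points 1 + 2ε and (1 + 2ε, 1 + 2ε) is absolute, and therefore controls
the whole polydisc of radius 2ε. -/
theorem eventually_covCoeff_eq_contourCov {ι : Type*} [Finite ι] {c : ι → ℕ → ℝ}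
    {d : ι → ℕ → ℕ → ℝ}
    (hc : ∀ s, ∀ᶠ x in 𝓝 (1 : ℂ), Summable fun k : ℕ =>
      (c s (k + 1) : ℂ) / (k.factorial : ℂ) * (x - 1) ^ k)
    (hd : ∀ s, ∀ᶠ p in 𝓝 ((1, 1) : ℂ × ℂ), Summable fun q : ℕ × ℕ =>
      (d s (q.1 + 1) (q.2 + 1) : ℂ) / ((q.1.factorial : ℂ) * (q.2.factorial : ℂ)) *
        (p.1 - 1) ^ q.1 * (p.2 - 1) ^ q.2) :
    ∀ᶠ ε in 𝓝[>] (0 : ℝ), ∀ (k₁ k₂ : ℕ) (s₁ s₂ : ι), covCoeff (c s₁) (c s₂) (d s₂) k₁ k₂ =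
      contourCov (limitF (c s₁)) (limitF (c s₂)) (limitQ (d s₂)) k₁ k₂ ε := by
  have h1 : Tendsto (fun ε : ℝ => 1 + 2 * (ε : ℂ)) (𝓝[>] 0) (𝓝 1) := by
    have : Continuous fun ε : ℝ => 1 + 2 * (ε : ℂ) := by fun_prop
    have h := this.tendsto 0
    simp only [Complex.ofReal_zero, mul_zero, add_zero] at h
    exact h.mono_left nhdsWithin_le_nhds
  have h2 := eventually_all.2 fun s => h1.eventually (hc s)
  have h3 := eventually_all.2 fun s => (h1.prodMk_nhds h1).eventually (hd s)
  filter_upwards [h2, h3, self_mem_nhdsWithin] with ε hε2 hε3 hε k₁ k₂ s₁ s₂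
  have hε : 0 < ε := hε
  have hconv : ∀ s, AbsConv (2 * ε) (fullF (c s)) := fun s => by
    refine AbsConv.of_complex (by positivity) ((hε2 s).norm.congr fun k => ?_)
    simp [fullF]
  refine covCoeff_eq_contourCov hε (hconv s₁) (hconv s₂) ?_ k₁ k₂
  simpa [gCoeff] using hε3 s₂

end SchurCLT

/-! ### The central limit theorem -/

theorem theorem2p5 (m : ℕ) (ρ : ∀ N : ℕ, PMF (Signature N))
    (σ : Fin m → ∀ N : ℕ, PMF (Signature N))
    (hρ : IsAppropriate ρ) (hσ : ∀ r, IsAppropriate (σ r)) :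
    -- the chain is well defined: the transition coefficients exist and are nonnegative, the
    -- weights form a probability measure, and the power sums have moments of all orders
    (∀ N : ℕ, 1 ≤ N → ∀ (r : Fin m) (l : Signature N),
      IsTransition (σ r N) l (transition (σ r N) l) ∧ ∀ u, 0 ≤ transition (σ r N) l u) ∧
    (∀ N : ℕ, 1 ≤ N → IsProbabilityMeasure (chainMeasure (ρ N) (fun r => σ r N))) ∧
    (∀ N : ℕ, 1 ≤ N → ∀ (k : ℕ) (s : Fin (m + 1)) (q : ℕ),
      MemLp (powerSum k s) q (chainMeasure (ρ N) (fun r => σ r N))) ∧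
    -- the products `H_s` are appropriate
    (∀ s, ∃ c d, IsAppropriateWith (levelGF ρ σ s) c d) ∧
    -- central limit theorem, in terms of the limiting coefficients `c s`, `d s` of `H_s`
    ∀ (c : Fin (m + 1) → ℕ → ℝ) (d : Fin (m + 1) → ℕ → ℕ → ℝ),
      (∀ s, IsAppropriateWith (levelGF ρ σ s) (c s) (d s)) →
      ∃ C : ℕ+ × Fin (m + 1) → ℕ+ × Fin (m + 1) → ℝ,
        TendstoGaussianInMoments (fun N => chainMeasure (ρ N) (fun r => σ r N))
          (fun N => fluctuation (chainMeasure (ρ N) (fun r => σ r N))) C ∧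
        (∀ (k₁ k₂ : ℕ+) (s₁ s₂ : Fin (m + 1)),
          Tendsto (fun N : ℕ =>
            cov[powerSum k₁ s₁, powerSum k₂ s₂; chainMeasure (ρ N) (fun r => σ r N)] /
              (N : ℝ) ^ ((k₁ : ℕ) + (k₂ : ℕ))) atTop (𝓝 (C (k₁, s₁) (k₂, s₂)))) ∧
        ∀ᶠ ε in 𝓝[>] (0 : ℝ), ∀ (k₁ k₂ : ℕ+) (s₁ s₂ : Fin (m + 1)), s₁ ≤ s₂ →
          (C (k₁, s₁) (k₂, s₂) : ℂ) =
            contourCov (limitF (c s₁)) (limitF (c s₂)) (limitQ (d s₂)) k₁ k₂ ε := by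
  refine ⟨fun N hN r l => ⟨isTransition_transition _ _, fun u => transition_nonneg _ _ _⟩,
    fun N hN => isProbabilityMeasure_chainMeasure (hρ.expSummable hN)
      fun r => (hσ r).expSummable hN,
    fun N hN k s q => memLp_powerSum (hρ.expSummable hN)
      (fun r => (hσ r).expSummable hN) k s q,
    isAppropriateWith_levelGF hρ hσ, fun c d hc => ?_⟩
  obtain ⟨C, h1, h2, h3⟩ := exists_tendstoGaussian_fluctuation hρ hσ hc
  refine ⟨C, h1, h2, ?_⟩
  filter_upwards [eventually_covCoeff_eq_contourCov (fun s => (hc s).summable_one)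
    (fun s => (hc s).summable_two)] with ε hε k₁ k₂ s₁ s₂ hs
  rw [h3 k₁ k₂ s₁ s₂ hs, hε]
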